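/- Let $n\ge 2$ and let $\Lambda=\mathbb Z^n=\bigoplus_i\mathbb Z\epsilon_i$ with the standard scalar product $\langle\cdot,\cdot\rangle$. Let $\Sigma$ be the root system of type $C_n$ with positive roots $\Sigma^+=\{\epsilon_i\pm\epsilon_j\ (i<j),\ 2\epsilon_i\}$, $\Sigma^-=-\Sigma^+$, simple roots $a_i=\epsilon_i-\epsilon_{i+1}$ $(1\le i<n)$, $a_n=2\epsilon_n$, co-roots $\alpha^\vee=2\alpha/\langle\alpha,\alpha\rangle$, and Weyl group $W$ (signed permutations) with simple reflections $s_1,\dots,s_n$ and length $l$. Let $\Lambda^+=\{\lambda\in\Lambda:\langle\lambda,a_i^\vee\rangle\ge0\ \forall i\}$, $\kappa=\sum_i(n+1-i)\epsilon_i$, $\Lambda^{++}=\kappa+\Lambda^+$ (regular dominant weights). Write $\lambda\le\mu$ if $\mu-\lambda\in\sum_i\mathbb Z_{\ge0}a_i^\vee$, let $\lambda^+$ be the dominant weight in $W\lambda$, and write $\lambda\preceq\mu$ if $\lambda^+<\mu^+$, or $\lambda^+=\mu^+$ and $\lambda\le\mu$. Let $q^{1/2},t_0,t_0^\vee,t,t_n,t_n^\vee\in\mathbb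 C\setminus\{0\}$ be generic, precisely: with $q=(q^{1/2})^2$, $q$ is not a root of unity; $t^{2j}\ne q^k$ for $1\le j\le n-1$, $k\in\mathbb Z$; $(t_0t_n)^2t^{2j}\neq q^k$ for $0\le j\le 2n-2$, $k\in\mathbb Z$; and $t^2\ne-1$, $t_n^2\neq-1$. Put $t_i=t$ for $1\le i<n$. Let $\mathcal A=\mathbb C[x_1^{\pm1},\dots,x_n^{\pm1}]$, $x^\mu=\prod_i x_i^{\mu_i}$. Let $W$ act by $w(x^\mu)=x^{w\mu}$, let $(s_0f)(x)=f(qx_1^{-1},x_2,\dots,x_n)$ and $\tau(\nu)x^\mu=q^{\langle\nu,\mu\rangle}x^\mu$, all extended to $\mathbb C(x)$. Consider the difference-reflection operators $$T_i=t_i+t_i^{-1}v_{a_i}(x)(s_i-1)\quad(0\le i\le n),$$ $$v_{a_0}=\frac{(1-t_0t_0^\vee q^{1/2}x_1^{-1})(1+t_0(t_0^\vee)^{-1}q^{1/2}x_1^{-1})}{1-qx_1^{-2}},\qquad v_{a_i}=\frac{1-t^2x^{a_i}}{1-x^{a_i}}\ (0<i<n),\qquad v_{a_n}=\frac{(1-t_nt_n^\vee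 x_n)(1+t_n(t_n^\vee)^{-1}x_n)}{1-x_n^2},$$ and $Y_i=T_i\cdots T_{n-1}T_nT_{n-1}\cdots T_1T_0T_1^{-1}\cdots T_{i-1}^{-1}$, $Y^\lambda=Y_1^{\lambda_1}\cdots Y_n^{\lambda_n}$, $f(Y)=\sum_\lambda c_\lambda Y^\lambda$ for $f=\sum_\lambda c_\lambda x^\lambda\in\mathcal A$. For $\lambda\in\Lambda$ let $\gamma_\lambda\in(\mathbb C\setminus\{0\})^n$ have coordinates $(\gamma_\lambda)_i=(t_0t_n)^{\rho_l(\lambda)_i}t^{\rho_m(\lambda)_i}q^{\lambda_i}$, where $\rho_l(\lambda)$ (resp. $\rho_m(\lambda)$) is the sum of $\epsilon(\langle\lambda,\alpha\rangle)\alpha^\vee$ over the positive roots $\alpha=2\epsilon_i$ (resp. $\alpha=\epsilon_i\pm\epsilon_j$, $i<j$), with $\epsilon(k)=1$ for $k\ge0$ and $\epsilon(k)=-1$ for $k<0$. There is a unique basis $\{P_\lambda\}_{\lambda\in\Lambda}$ of $\mathcal A$ (the monic non-symmetric Koornwinder polynomials) with $P_\lambda\in x^\lambda+\sum_{\mu\prec\lambda}\mathbb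 Cx^\mu$ and $f(Y)P_\lambda=f(\gamma_\lambda)P_\lambda$ for all $f\in\mathcal A$. With $m_\lambda=\sum_{\mu\in W\lambda}x^\mu$, there is a unique basis $\{P_\lambda^+\}_{\lambda\in\Lambda^+}$ of $\mathcal A^W$ (the monic symmetric Koornwinder polynomials) with $P_\lambda^+\in m_\lambda+\sum_{\mu\in\Lambda^+,\,\mu<\lambda}\mathbb Cm_\mu$ and $f(Y)_{sym}P^+_\lambda=f(\gamma_\lambda)P_\lambda^+$ for all $f\in\mathcal A^W$; here $D_{sym}=\sum_{w\in W}D(x,w)$ if $D=\sum_{w\in W}D(x,w)w$ with $q$-difference operators $D(x,w)\in\bigoplus_{\nu\in\Lambda}\mathbb C(x)\tau(\nu)$. Put $\mathcal A(\lambda)=\mathrm{span}\{P_\mu:\mu\in W\lambda\}$ and $\mathcal A_\pm(\lambda)=\{f\in\mathcal A(\lambda):(T_i\mp t_i^{\pm1})f=0,\ i=1,\dots,n\}$ for $\lambda\in\Lambda^+$. Then: (i) $\mathcal A_+(\lambda)$ is spanned by $P_\lambda^+$ for all $\lambda\in\Lambda^+$. (ii) For $\lambda\in\Lambda^+$, $\mathcal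 A_-(\lambda)$ is one-dimensional if $\lambda\in\Lambda^{++}$, and zero otherwise. For $\lambda\in\Lambda^{++}$ there is a unique $P_\lambda^-\in\mathcal A_-(\lambda)$ of the form $P_\lambda^-=x^\lambda+\sum_{\mu\prec\lambda}e_\mu x^\mu$ with $e_\mu\in\mathbb C$. (iii) For $P_\lambda^+$ ($\lambda\in\Lambda^+$) and $P_\lambda^-$ ($\lambda\in\Lambda^{++}$) one has $P_\lambda^\pm=\sum_{\mu\in W\lambda}c_{\lambda,\mu}^\pm P_\mu$ with $$c^\pm_{\lambda,\mu}=(\pm1)^{l(w_\mu)}\,\tilde t_{w_\mu}^{-2}\prod_{\alpha\in\Sigma^+,\ \langle\mu,\alpha\rangle<0}\tilde v_{\pm\alpha}(\gamma_\mu)=(\pm1)^{l(w_\mu)}\,\tilde t_{w_\mu}^{-2}\prod_{\alpha\in\Sigma^+\cap w_\mu^{-1}\Sigma^-}\tilde v_{\pm\alpha}(\gamma_\lambda^{-1}),$$ where $w_\mu\in W$ is the element of minimal length with $w_\mu\lambda=\mu$; $\tilde t_w=t_{i_1}\cdots t_{i_r}$ for a reduced expression $w=s_{i_1}\cdots s_{i_r}\in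 W$; $\gamma_\lambda^{-1}$ is the coordinatewise inverse; and $\tilde v_\alpha(x)=\frac{1-t^2x^\alpha}{1-x^\alpha}$ for $\alpha=\pm\epsilon_i\pm\epsilon_j$, $\tilde v_\alpha(x)=\frac{(1-t_nt_0x^{\alpha/2})(1+t_nt_0^{-1}x^{\alpha/2})}{1-x^\alpha}$ for $\alpha=\pm2\epsilon_i$. -/

import Mathlib

namespace Koornwinder

noncomputable section

open scoped Matrix

/-! ### Weights, roots and the Weyl group of type `C_n` -/

/-- The weight lattice `Λ = ⊕ ℤ ε_i`; the scalar product is the dot product `⬝ᵥ`. -/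
abbrev Wt (n : ℕ) : Type := Fin n → ℤ

/-- The basis vectors, indexed from `0`: `e 0 = ε_1`, `e 1 = ε_2`, and so on. -/
def e {n : ℕ} (j : ℕ) : Wt n := fun i => if (i : ℕ) = j then 1 else 0

/-- The positive roots `ε_i ± ε_j` (`i < j`) of squared length two. -/
def mediumPos (n : ℕ) : Finset (Wt n) :=
  (Finset.univ.filter fun ij : Fin n × Fin n => ij.1 < ij.2).image
      (fun ij => e (ij.1 : ℕ) - e (ij.2 : ℕ)) ∪
    (Finset.univ.filter fun ij : Fin n × Fin n => ij.1 < ij.2).image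
      (fun ij => e (ij.1 : ℕ) + e (ij.2 : ℕ))

/-- The positive roots `2ε_i` of squared length four. -/
def longPos (n : ℕ) : Finset (Wt n) := Finset.univ.image fun i : Fin n => 2 • e (i : ℕ)

/-- The vectors `ε_i`, the halves of the positive long roots. -/
def shortPos (n : ℕ) : Finset (Wt n) := Finset.univ.image fun i : Fin n => e (i : ℕ)

/-- The positive roots `Σ⁺`. -/
def posRoots (n : ℕ) : Finset (Wt n) := mediumPos n ∪ longPos n

/-- The co-root `α^∨ = 2α/⟨α, α⟩` of a root `α ∈ Σ` (the division is exact on roots). -/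
def coroot {n : ℕ} (α : Wt n) : Wt n := fun i => 2 * α i / (α ⬝ᵥ α)

/-- The simple roots, indexed from `0`: `ε_i - ε_{i+1}` for `i < n`, and `2ε_n`. -/
def simpleRoot {n : ℕ} (i : Fin n) : Wt n :=
  if (i : ℕ) + 1 < n then e (i : ℕ) - e ((i : ℕ) + 1) else 2 • e (i : ℕ)

/-- The signed permutation `λ ↦ (i ↦ s_i λ_{π⁻¹ i})` of the coordinates. -/
def signedPerm {n : ℕ} (π : Equiv.Perm (Fin n)) (s : Fin n → ℤˣ) : Wt n ≃ₗ[ℤ] Wt n where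
  toFun l := fun i => (s i : ℤ) * l (π⁻¹ i)
  invFun l := fun i => (s (π i) : ℤ) * l (π i)
  map_add' l m := by ext i; simp [mul_add]
  map_smul' c l := by ext i; simp [mul_left_comm]
  left_inv l := by ext i; simp [← mul_assoc, ← Units.val_mul]
  right_inv l := by ext i; simp [← mul_assoc, ← Units.val_mul]

/-- The sign change of the `j`-th coordinate (counted from `0`). -/
def signFlip {n : ℕ} (j : ℕ) : Wt n ≃ₗ[ℤ] Wt n :=
  signedPerm 1 fun i => if (i : ℕ) = j then -1 else 1

/-- The simple reflections, indexed as the simple roots: for `i < n` the transposition of the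
coordinates `i` and `i + 1`, and for `i = n` the sign change of the last coordinate. -/
def simpleRefl {n : ℕ} (i : Fin n) : Wt n ≃ₗ[ℤ] Wt n :=
  if h : (i : ℕ) + 1 < n then signedPerm (Equiv.swap i ⟨(i : ℕ) + 1, h⟩) 1 else signFlip (i : ℕ)

/-- The Weyl group `W` of type `C_n`, acting on `Λ`. -/
def weylGroup (n : ℕ) : Subgroup (Wt n ≃ₗ[ℤ] Wt n) :=
  Subgroup.closure (Set.range simpleRefl)

/-- `l` is a reduced expression of `w`. -/
def IsReducedWord {n : ℕ} (w : weylGroup n) (l : List (Fin n)) : Prop :=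
  (l.map simpleRefl).prod = (w : Wt n ≃ₗ[ℤ] Wt n) ∧
    ∀ l' : List (Fin n), (l'.map simpleRefl).prod = (w : Wt n ≃ₗ[ℤ] Wt n) →
      l.length ≤ l'.length

/-- A reduced expression of `w`. -/
def reducedWord {n : ℕ} (w : weylGroup n) : List (Fin n) := Classical.epsilon (IsReducedWord w)

/-- The length of `w ∈ W`. -/
def weylLength {n : ℕ} (w : weylGroup n) : ℕ := (reducedWord w).length

/-- `w` is the element of minimal length in `W` with `w λ = μ`. -/
def IsMinimalTo {n : ℕ} (l m : Wt n) (w : weylGroup n) : Prop :=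
  w • l = m ∧ ∀ w' : weylGroup n, w' • l = m → weylLength w ≤ weylLength w'

lemma sum_abs_signedPerm {n : ℕ} (π : Equiv.Perm (Fin n)) (s : Fin n → ℤˣ) (l : Wt n) :
    ∑ i, |signedPerm π s l i| = ∑ i, |l i| := by
  have h : ∀ i, |signedPerm π s l i| = |l (π⁻¹ i)| := by
    intro i
    change |(s i : ℤ) * l (π⁻¹ i)| = _
    rw [abs_mul, Int.isUnit_iff_abs_eq.mp (s i).isUnit, one_mul]
  simp_rw [h]
  exact Equiv.sum_comp π⁻¹ fun i => |l i|

lemma sum_abs_weyl {n : ℕ} (w : Wt n ≃ₗ[ℤ] Wt n) (hw : w ∈ weylGroup n) (l : Wt n) :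
    ∑ i, |w l i| = ∑ i, |l i| := by
  induction hw using Subgroup.closure_induction generalizing l with
  | mem w hw =>
    obtain ⟨i, rfl⟩ := hw
    unfold simpleRefl signFlip
    split_ifs <;> exact sum_abs_signedPerm _ _ _
  | one => rfl
  | mul x y _ _ hx hy => rw [LinearEquiv.mul_apply, hx, hy]
  | inv x _ hx =>
    have h := hx (x⁻¹ l)
    rw [← LinearEquiv.mul_apply, mul_inv_cancel] at h
    exact h.symm

lemma orbit_finite {n : ℕ} (l : Wt n) : (MulAction.orbit (weylGroup n) l).Finite := by
  refine (Set.finite_Icc (fun _ => -∑ i, |l i| : Wt n) (fun _ => ∑ i, |l i|)).subset ?_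
  rintro _ ⟨w, rfl⟩
  have h : ∀ i, |(w • l) i| ≤ ∑ i, |l i| := by
    intro i
    rw [← sum_abs_weyl w w.2 l]
    exact Finset.single_le_sum (f := fun i => |(w : Wt n ≃ₗ[ℤ] Wt n) l i|)
      (fun _ _ => abs_nonneg _) (Finset.mem_univ i)
  exact ⟨fun i => (abs_le.mp (h i)).1, fun i => (abs_le.mp (h i)).2⟩

/-- The orbit `Wλ`. -/
def weylOrbit {n : ℕ} (l : Wt n) : Finset (Wt n) := (orbit_finite l).toFinset

/-- `λ ∈ Λ⁺`: dominant weights. -/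
def IsDominant {n : ℕ} (l : Wt n) : Prop := ∀ i : Fin n, 0 ≤ l ⬝ᵥ coroot (simpleRoot i)

/-- The type of dominant weights. -/
abbrev DomWt (n : ℕ) : Type := {l : Wt n // IsDominant l}

/-- The fundamental weight `ω_i = ε_1 + ⋯ + ε_i`. -/
def fundWt {n : ℕ} (i : Fin n) : Wt n := ∑ j ∈ Finset.Iic i, e (j : ℕ)

/-- `λ ∈ Λ⁺⁺ = κ + Λ⁺` with `κ = ∑ ω_i`: regular dominant weights. -/
def IsRegularDominant {n : ℕ} (l : Wt n) : Prop := IsDominant (l - ∑ i : Fin n, fundWt i)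

/-- `λ ≤ μ`: the difference `μ - λ` is a sum of simple co-roots. -/
def DomLE {n : ℕ} (l m : Wt n) : Prop :=
  m - l ∈ AddSubmonoid.closure (Set.range fun i : Fin n => coroot (simpleRoot i))

/-- `λ < μ`. -/
def DomLT {n : ℕ} (l m : Wt n) : Prop := DomLE l m ∧ l ≠ m

/-- `λ ⪯ μ`: either `λ⁺ < μ⁺`, or `λ⁺ = μ⁺` and `λ ≤ μ`, where `λ⁺` and `μ⁺` are the
dominant weights in `Wλ` and `Wμ`. -/
def PrecLE {n : ℕ} (l m : Wt n) : Prop :=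
  ∃ l' m' : Wt n, IsDominant l' ∧ IsDominant m' ∧ l' ∈ weylOrbit l ∧ m' ∈ weylOrbit m ∧
    (DomLT l' m' ∨ (l' = m' ∧ DomLE l m))

/-- `λ ≺ μ`. -/
def PrecLT {n : ℕ} (l m : Wt n) : Prop := PrecLE l m ∧ l ≠ m

/-! ### Parameters -/

/-- The parameters: `qh = q^{1/2}`, and the five values of a multiplicity function on the affine
root system of type `C^∨C_n`: `t0`, `t0v`, `t`, `tn`, `tnv` are the values at
`a_0`, `a_0^∨ = a_0/2`, `a_i` (`0 < i < n`), `a_n`, `a_n^∨ = a_n/2`. -/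
structure Params where
  qh : ℂˣ
  t0 : ℂˣ
  t0v : ℂˣ
  t : ℂˣ
  tn : ℂˣ
  tnv : ℂˣ

/-- `q`. -/
def Params.q (p : Params) : ℂˣ := p.qh ^ 2

/-- The dual parameters: `t_0` and `t_n^∨` are interchanged. -/
def Params.dual (p : Params) : Params := { p with t0 := p.tnv, tnv := p.t0 }

/-- Genericity of the parameters, in explicit form. -/
structure Params.Generic (n : ℕ) (p : Params) : Prop where
  q_pow_ne_one : ∀ k : ℤ, k ≠ 0 → p.q ^ k ≠ 1
  t_pow_ne : ∀ j : ℕ, 1 ≤ j → j ≤ n - 1 → ∀ k : ℤ, p.t ^ (2 * j) ≠ p.q ^ k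
  t0_tn_pow_ne : ∀ j : ℕ, j ≤ 2 * n - 2 → ∀ k : ℤ,
    (p.t0 * p.tn) ^ 2 * p.t ^ (2 * j) ≠ p.q ^ k
  t_sq_ne : p.t ^ 2 ≠ -1
  tn_sq_ne : p.tn ^ 2 ≠ -1

/-- The value `t_β` of the multiplicity function at `β = α + (m/2)δ`, extended by `1` outside the
affine root system. The orbits are `2ℤδ + Σ_l ∋ a_n`, `(1+2ℤ)δ + Σ_l ∋ a_0`, `ℤδ + Σ_m ∋ a_i`,
`ℤδ + Σ_s ∋ a_n^∨` and `(1/2+ℤ)δ + Σ_s ∋ a_0^∨`. -/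
def Params.mult {n : ℕ} (p : Params) (α : Wt n) (m : ℤ) : ℂˣ :=
  if α ∈ longPos n ∨ -α ∈ longPos n then
    if 4 ∣ m then p.tn else if 2 ∣ m then p.t0 else 1
  else if α ∈ mediumPos n ∨ -α ∈ mediumPos n then
    if 2 ∣ m then p.t else 1
  else if α ∈ shortPos n ∨ -α ∈ shortPos n then
    if 2 ∣ m then p.tnv else p.t0v
  else 1

/-- The value at the simple root `a_i`, `i = 1, …, n`. -/
def Params.tSimple {n : ℕ} (p : Params) (i : Fin n) : ℂˣ := p.mult (simpleRoot i) 0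

/-- `t_w = t_{i_1} ⋯ t_{i_r}` for a reduced expression `w = s_{i_1} ⋯ s_{i_r}`. -/
def Params.tWeyl {n : ℕ} (p : Params) (w : weylGroup n) : ℂˣ :=
  ((reducedWord w).map p.tSimple).prod

/-- The function
`v_β = (1 - t_β t_{β/2} x^{β/2}) (1 + t_β t_{β/2}⁻¹ x^{β/2}) / (1 - x^β)` for `β = α + kδ`,
which reads `(1 - t_β² x^β) / (1 - x^β)` if `α/2` is not a weight. The argument `ev` supplies the
values of the monomials `x^μ`, `μ ∈ Λ`, while `x^{cδ} = q^c`. -/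
def vFun {n : ℕ} {F : Type*} [Field F] [Algebra ℂ F] (p : Params) (α : Wt n) (k : ℤ)
    (ev : Wt n → F) : F :=
  let tβ : F := algebraMap ℂ F (p.mult α (2 * k) : ℂˣ)
  let xβ : F := algebraMap ℂ F (p.q ^ k : ℂˣ) * ev α
  if ∀ i, Even (α i) then
    let α' : Wt n := fun i => α i / 2
    let tβ' : F := algebraMap ℂ F (p.mult α' k : ℂˣ)
    let xβ' : F := algebraMap ℂ F (p.qh ^ k : ℂˣ) * ev α'
    (1 - tβ * tβ' * xβ') * (1 + tβ * tβ'⁻¹ * xβ') / (1 - xβ)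
  else (1 - tβ ^ 2 * xβ) / (1 - xβ)

/-! ### Laurent polynomials and rational functions -/

/-- The group algebra `𝒜` of `Λ`, i.e. Laurent polynomials in `x_1, …, x_n`. -/
abbrev Laurent (n : ℕ) : Type := AddMonoidAlgebra ℂ (Wt n)

/-- The quotient field `ℂ(x)` of `𝒜`. -/
abbrev RatFn (n : ℕ) : Type := FractionRing (Laurent n)

/-- The operators on `ℂ(x)`. -/
abbrev Op (n : ℕ) : Type := Module.End ℂ (RatFn n)

/-- The monomial `x^μ`. -/
def mono {n : ℕ} (m : Wt n) : Laurent n := AddMonoidAlgebra.single m 1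

/-- The inclusion `𝒜 ⊂ ℂ(x)`. -/
def toRat {n : ℕ} : Laurent n →ₐ[ℂ] RatFn n := IsScalarTower.toAlgHom ℂ (Laurent n) (RatFn n)

/-- The monomial `x^μ` as a rational function. -/
def monoR {n : ℕ} (m : Wt n) : RatFn n := toRat (mono m)

/-- The action of a linear automorphism `w` of `Λ` on `𝒜`: `x^μ ↦ x^{wμ}`. -/
def weylAct {n : ℕ} (w : Wt n ≃ₗ[ℤ] Wt n) : Laurent n ≃ₐ[ℂ] Laurent n :=
  AddMonoidAlgebra.domCongr ℂ ℂ w.toAddEquiv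

/-- The algebra endomorphism `x^μ ↦ q^{⟨ν, μ⟩} x^μ` of `𝒜`. -/
def shiftHom {n : ℕ} (q : ℂˣ) (ν : Wt n) : Laurent n →ₐ[ℂ] Laurent n :=
  AddMonoidAlgebra.lift ℂ (Laurent n) (Wt n)
    { toFun := fun m =>
        AddMonoidAlgebra.single m.toAdd ((q ^ (ν ⬝ᵥ m.toAdd) : ℂˣ) : ℂ)
      map_one' := by simp [AddMonoidAlgebra.one_def]
      map_mul' := fun a b => by
        simp [AddMonoidAlgebra.single_mul_single, dotProduct_add, zpow_add] }

lemma shiftHom_comp {n : ℕ} (q : ℂˣ) (ν : Wt n) :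
    (shiftHom q ν).comp (shiftHom q (-ν)) = AlgHom.id ℂ (Laurent n) := by
  refine AddMonoidAlgebra.algHom_ext (fun m => ?_) (by ext)
  have h : ((q ^ (ν ⬝ᵥ m) : ℂˣ) : ℂ) ≠ 0 := Units.ne_zero _
  rw [Units.val_zpow_eq_zpow_val] at h
  simp [shiftHom, h]

/-- The translation `τ(ν)` acting on `𝒜`: `x^μ ↦ q^{⟨ν, μ⟩} x^μ`. -/
def shiftAct {n : ℕ} (q : ℂˣ) (ν : Wt n) : Laurent n ≃ₐ[ℂ] Laurent n :=
  AlgEquiv.ofAlgHom (shiftHom q ν) (shiftHom q (-ν)) (shiftHom_comp q ν)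
    (by simpa using shiftHom_comp q (-ν))

/-- The affine simple reflection `s_0` acting on `𝒜`: `f(x) ↦ f(q x_1⁻¹, x_2, …, x_n)`, that is,
`x^μ ↦ q^{μ_1} x^{(-μ_1, μ_2, …, μ_n)}`. -/
def affineReflAct {n : ℕ} (q : ℂˣ) : Laurent n ≃ₐ[ℂ] Laurent n :=
  (shiftAct q (e 0)).trans (weylAct (signFlip 0))

/-- The extension of an automorphism of `𝒜` to `ℂ(x)`, as an operator. -/
def extOp {n : ℕ} (σ : Laurent n ≃ₐ[ℂ] Laurent n) : Op n :=
  (IsFractionRing.algEquivOfAlgEquiv (K := RatFn n) (L := RatFn n) σ).toLinearMap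

/-- Multiplication by a rational function. -/
def mulOp {n : ℕ} (g : RatFn n) : Op n := LinearMap.mulLeft ℂ g

/-! ### Difference-reflection operators and `Y`-operators -/

/-- `T_0 = t_0 + t_0⁻¹ v_{a_0}(x) (s_0 - 1)`, where `a_0 = δ - 2ε_1`. -/
def T0 (n : ℕ) (p : Params) : Op n :=
  (p.t0 : ℂ) • 1 + ((p.t0⁻¹ : ℂˣ) : ℂ) •
    (mulOp (vFun p (-(2 • e 0)) 1 monoR) * (extOp (affineReflAct p.q) - 1))

/-- `T_i = t_i + t_i⁻¹ v_{a_i}(x) (s_i - 1)`, `i = 1, …, n`. -/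
def T {n : ℕ} (p : Params) (i : Fin n) : Op n :=
  (p.tSimple i : ℂ) • 1 + (((p.tSimple i)⁻¹ : ℂˣ) : ℂ) •
    (mulOp (vFun p (simpleRoot i) 0 monoR) * (extOp (weylAct (simpleRefl i)) - 1))

/-- `Y_i = T_i ⋯ T_{n-1} T_n T_{n-1} ⋯ T_1 T_0 T_1⁻¹ ⋯ T_{i-1}⁻¹`, `i = 1, …, n`. -/
def Y {n : ℕ} (p : Params) (i : Fin n) : Op n :=
  (((List.finRange n).drop i).map (T p)).prod *
    (((List.finRange n).dropLast.reverse).map (T p)).prod *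
    T0 n p *
    (((List.finRange n).take i).map fun j => Ring.inverse (T p j)).prod

/-- Integer powers of an invertible operator. -/
def opZPow {n : ℕ} (A : Op n) (k : ℤ) : Op n :=
  if 0 ≤ k then A ^ k.toNat else Ring.inverse A ^ (-k).toNat

/-- `Y^λ = Y_1^{λ_1} ⋯ Y_n^{λ_n}`. -/
def Ymono {n : ℕ} (p : Params) (l : Wt n) : Op n :=
  ((List.finRange n).map fun i => opZPow (Y p i) (l i)).prod

/-- `f(Y) = ∑ c_λ Y^λ` for `f = ∑ c_λ x^λ ∈ 𝒜`. -/
def evalY {n : ℕ} (p : Params) (f : Laurent n) : Op n := f.coeff.sum fun l c => c • Ymono p l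

/-- The value of the monomial `x^μ` at `y ∈ (ℂ ∖ {0})^n`. -/
def monoVal {n : ℕ} (y : Fin n → ℂˣ) (m : Wt n) : ℂ := ((∏ i, y i ^ m i : ℂˣ) : ℂ)

/-- The value `f(y)` of `f ∈ 𝒜` at `y ∈ (ℂ ∖ {0})^n`. -/
def evalAt {n : ℕ} (y : Fin n → ℂˣ) (f : Laurent n) : ℂ :=
  f.coeff.sum fun l c => c * monoVal y l

/-! ### The spectrum -/

/-- The sign function with the value `1` at `0`. -/
def sgn (k : ℤ) : ℤ := if 0 ≤ k then 1 else -1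

/-- `ρ_m(λ)`. -/
def rhoM {n : ℕ} (l : Wt n) : Wt n := ∑ α ∈ mediumPos n, sgn (l ⬝ᵥ α) • coroot α

/-- `ρ_l(λ)`. -/
def rhoL {n : ℕ} (l : Wt n) : Wt n := ∑ α ∈ longPos n, sgn (l ⬝ᵥ α) • coroot α

/-- `γ_λ = t_0^{ρ_l(λ)} t_n^{ρ_l(λ)} t^{ρ_m(λ)} q^λ`. -/
def gam {n : ℕ} (p : Params) (l : Wt n) : Fin n → ℂˣ := fun i =>
  p.t0 ^ rhoL l i * p.tn ^ rhoL l i * p.t ^ rhoM l i * p.q ^ l i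

/-! ### Non-symmetric Koornwinder polynomials -/

/-- `f = x^λ + ∑_{μ ≺ λ} c_μ x^μ`. -/
def IsMonicTriangular {n : ℕ} (l : Wt n) (f : Laurent n) : Prop :=
  f - mono l ∈ Submodule.span ℂ (mono '' {m : Wt n | PrecLT m l})

/-- The characterizing properties of the family of monic non-symmetric Koornwinder polynomials:
a basis of `𝒜` of monic triangular joint eigenfunctions of the `Y`-operators. -/
structure IsNonsymKoornwinder {n : ℕ} (p : Params) (P : Wt n → Laurent n) : Prop where
  linearIndependent : LinearIndependent ℂ P
  span_eq_top : Submodule.span ℂ (Set.range P) = ⊤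
  triangular : ∀ l, IsMonicTriangular l (P l)
  eigen : ∀ (l : Wt n) (f : Laurent n),
    evalY p f (toRat (P l)) = evalAt (gam p l) f • toRat (P l)

/-- The monic non-symmetric Koornwinder polynomials `P_λ`, `λ ∈ Λ`. -/
def nonsymK {n : ℕ} (p : Params) : Wt n → Laurent n :=
  Classical.epsilon (IsNonsymKoornwinder p)

/-! ### Symmetric Koornwinder polynomials -/

/-- The `W`-invariant Laurent polynomials `𝒜^W`. -/
def invariants (n : ℕ) : Submodule ℂ (Laurent n) where
  carrier := {f | ∀ w ∈ weylGroup n, weylAct w f = f}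
  add_mem' hf hg w hw := by rw [map_add, hf w hw, hg w hw]
  zero_mem' _ _ := map_zero _
  smul_mem' c f hf w hw := by rw [map_smul, hf w hw]

/-- The orbit sum `m_λ = ∑_{μ ∈ Wλ} x^μ`. -/
def orbitSum {n : ℕ} (l : Wt n) : Laurent n := ∑ m ∈ weylOrbit l, mono m

/-- The `q`-difference operators with coefficients in `ℂ(x)`: sums of `g(x) τ(ν)`. -/
def qDiffOps (n : ℕ) (p : Params) : Submodule ℂ (Op n) :=
  Submodule.span ℂ {D | ∃ (g : RatFn n) (ν : Wt n), D = mulOp g * extOp (shiftAct p.q ν)}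

/-- `E = D_sym`: if `D = ∑_{w ∈ W} D(x, w) w` with `q`-difference operators `D(x, w)`,
then `D_sym = ∑_{w ∈ W} D(x, w)`. -/
def IsSymOf {n : ℕ} (p : Params) (D E : Op n) : Prop :=
  ∃ d : weylGroup n →₀ Op n, (∀ w, d w ∈ qDiffOps n p) ∧
    D = d.sum (fun w A => A * extOp (weylAct (w : Wt n ≃ₗ[ℤ] Wt n))) ∧
    E = d.sum (fun _ A => A)

/-- The characterizing properties of the family of monic symmetric Koornwinder polynomials: a
basis of `𝒜^W`, triangular with respect to the orbit sums, of joint eigenfunctions of the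
operators `f(Y)_sym`, `f ∈ 𝒜^W`. -/
structure IsSymKoornwinder {n : ℕ} (p : Params) (Q : DomWt n → Laurent n) : Prop where
  linearIndependent : LinearIndependent ℂ Q
  span_eq : Submodule.span ℂ (Set.range Q) = invariants n
  triangular : ∀ l : DomWt n, Q l - orbitSum l.1 ∈
    Submodule.span ℂ (orbitSum '' {m : Wt n | IsDominant m ∧ DomLT m l.1})
  eigen : ∀ (l : DomWt n) (f : Laurent n), f ∈ invariants n →
    ∃ E : Op n, IsSymOf p (evalY p f) E ∧
      E (toRat (Q l)) = evalAt (gam p l.1) f • toRat (Q l)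

/-- The monic symmetric Koornwinder polynomials `P_λ⁺`, `λ ∈ Λ⁺`. -/
def symK {n : ℕ} (p : Params) : DomWt n → Laurent n :=
  Classical.epsilon (IsSymKoornwinder p)

/-! ### The spaces `𝒜(λ)`, `𝒜_±(λ)` and the expansion coefficients -/

/-- `𝒜(λ) = span {P_μ | μ ∈ Wλ}`. -/
def orbitSpace {n : ℕ} (p : Params) (l : Wt n) : Submodule ℂ (Laurent n) :=
  Submodule.span ℂ (nonsymK p '' (weylOrbit l : Set (Wt n)))

/-- `𝒜_±(λ) = {f ∈ 𝒜(λ) | (T_i ∓ t_i^{±1}) f = 0 for i = 1, …, n}`; the sign is `ε`. -/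
def signPart {n : ℕ} (p : Params) (ε : ℤˣ) (l : Wt n) : Submodule ℂ (Laurent n) where
  carrier := {f | f ∈ orbitSpace p l ∧ ∀ i : Fin n,
    T p i (toRat f) =
      (((ε : ℤ) : ℂ) * ((p.tSimple i ^ (ε : ℤ) : ℂˣ) : ℂ)) • toRat f}
  add_mem' hf hg := ⟨add_mem hf.1 hg.1, fun i => by
    rw [map_add, map_add, hf.2 i, hg.2 i, smul_add]⟩
  zero_mem' := ⟨zero_mem _, fun i => by simp⟩
  smul_mem' c f hf := ⟨Submodule.smul_mem _ c hf.1, fun i => by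
    rw [map_smul, map_smul, hf.2 i, smul_comm]⟩

/-- `(±1)^{l(w)} \tilde t_w^{-2} ∏ \tilde v_{±α}(γ_μ)`, the product over the positive roots `α`
with `⟨μ, α⟩ < 0`. -/
def coeffA {n : ℕ} (p : Params) (ε : ℤˣ) (w : weylGroup n) (m : Wt n) : ℂ :=
  ((ε : ℤ) : ℂ) ^ weylLength w * ((p.dual.tWeyl w : ℂˣ) : ℂ) ^ (-2 : ℤ) *
    ∏ α ∈ (posRoots n).filter (fun α => m ⬝ᵥ α < 0),
      vFun p.dual ((ε : ℤ) • α) 0 (monoVal (gam p m))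

/-- `(±1)^{l(w)} \tilde t_w^{-2} ∏ \tilde v_{±α}(γ_λ⁻¹)`, the product over the positive roots `α`
for which `wα` is a negative root. -/
def coeffB {n : ℕ} (p : Params) (ε : ℤˣ) (w : weylGroup n) (l : Wt n) : ℂ :=
  ((ε : ℤ) : ℂ) ^ weylLength w * ((p.dual.tWeyl w : ℂˣ) : ℂ) ^ (-2 : ℤ) *
    ∏ α ∈ (posRoots n).filter (fun α => -(w • α) ∈ posRoots n),
      vFun p.dual ((ε : ℤ) • α) 0 (monoVal (gam p l)⁻¹)

/-- `f = ∑_{μ ∈ Wλ} c_μ P_μ`, where `c_μ` is given by both formulas, `w_μ` being the element of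
minimal length in `W` with `w_μ λ = μ`. -/
def HasExpansion {n : ℕ} (p : Params) (ε : ℤˣ) (l : Wt n) (f : Laurent n) : Prop :=
  ∃ c : Wt n → ℂ, f = ∑ m ∈ weylOrbit l, c m • nonsymK p m ∧
    ∀ m ∈ weylOrbit l, ∀ w : weylGroup n, IsMinimalTo l m w →
      c m = coeffA p ε w m ∧ c m = coeffB p ε w l

end

end Koornwinder

open Koornwinder

namespace Koornwinder
noncomputable section
open scoped Matrix

/-! ### Coordinates of the simple reflections -/

variable {n : ℕ}

/-! The argument is representation theory of the affine Hecke algebra of type C_n: it acts on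
Laurent polynomials by Demazure–Lusztig operators, and its commuting elements Y_i are diagonalized.

Relations. Since s_i v = 1 + t_i² - v for v = v_{a_i}, each T_i satisfies a quadratic relation
(`dl_quadratic`); the nontrivial braid relations reduce to two rank-two identities of rational
functions (`dl_braid_medium`, `dl_braid_long`). Braid relations alone force the Y_i to commute
(`BraidRel.commute_yElt`), and together with the quadratic relations they prescribe how T_i passes
the Y_j (`Y_eq_T_Y_T`, `T_commute_Y`, `Y_last_quadratic`).

Diagonalization. T_i sends x^l to a combination of x^l, x^{s_i l} and monomials strictly inside the
segment joining them; by convexity the latter lie in lower orbits (`domPart_lt_of_inside`).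
Following the word for Y_i and undoing the reflections on the way shows that Y_i is triangular with
diagonal entry (γ_l)_i (`upperTri_YL`). Genericity makes l ↦ γ_l injective (`gam_injective`), so
Lagrange projectors in the Y_i produce the basis P_l, with simple joint spectrum.

Intertwiners. For a suitable scalar c, the vector T_i P_l - c P_l is a joint eigenvector at the
point s_i γ_l (`isEigen_TL_sub`). If s_i l ≠ l, this point is γ_{s_i l}, the vector is a multiple of
P_{s_i l}, and leading coefficients together with the quadratic relation give the matrix of T_i on
the pair. If s_i l = l, the point is not in the spectrum, the vector vanishes, and T_i P_l = t_i P_l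
(`IsNonsymKoornwinder.TL_apply`, `cT_of_orthogonal`).

Consequently T_i f = ±t_i^{±1} f is a two-term recursion between the coefficients of f at m and s_i
m, together with, for the minus sign, vanishing at the weights fixed by s_i
(`IsNonsymKoornwinder.TL_eq_signVal_iff`). On an orbit the recursion determines everything from the
coefficient at the dominant weight. The product formula solves it, because s_i carries the roots
negative on m to those negative on s_i m other than a_i, and γ_{s_i m} = s_i γ_m
(`expCoeff_simpleRefl`). The extra vanishing condition is void on the orbit of a regular weight and
kills everything on the other orbits.

Finally, T_i f = t_i f for all i means W-invariance, since v_{a_i} ≠ 0 (`mem_invariants_iff_TL`),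
and on invariants f(Y)_sym acts as f(Y) (`IsSymOf.apply_eq`). The invariants separate the spectral
points of different orbits, so the symmetric polynomials are the solutions with the plus sign
(`IsSymKoornwinder.eq_signPoly`). The two product formulas agree because α ↦ -w_μ α maps the
inversions of w_μ onto the positive roots negative on μ (`IsMinimalTo.image_inversions`). -/

lemma e_apply (j : ℕ) (k : Fin n) : (e j : Wt n) k = if (k : ℕ) = j then 1 else 0 := rfl

lemma dot_e (l : Wt n) (i : Fin n) : l ⬝ᵥ e (i : ℕ) = l i := by
  simp [dotProduct, e_apply, Fin.val_inj]

lemma signedPerm_apply (π : Equiv.Perm (Fin n)) (s : Fin n → ℤˣ) (l : Wt n) (i : Fin n) :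
    signedPerm π s l i = (s i : ℤ) * l (π⁻¹ i) := rfl

lemma signedPerm_mul (π π' : Equiv.Perm (Fin n)) (s s' : Fin n → ℤˣ) :
    signedPerm π s * signedPerm π' s' = signedPerm (π * π') (fun i => s i * s' (π⁻¹ i)) := by
  ext l i
  simp [LinearEquiv.mul_apply, signedPerm_apply, mul_assoc]

lemma signedPerm_one : signedPerm (1 : Equiv.Perm (Fin n)) 1 = 1 := by
  ext l i
  simp [signedPerm_apply]

lemma simpleRefl_of_lt {i : Fin n} (h : (i : ℕ) + 1 < n) (l : Wt n) (k : Fin n) :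
    simpleRefl i l k = l (Equiv.swap i ⟨i + 1, h⟩ k) := by
  simp [simpleRefl, h, signedPerm_apply]

lemma simpleRefl_of_last {i : Fin n} (h : ¬ (i : ℕ) + 1 < n) (l : Wt n) (k : Fin n) :
    simpleRefl i l k = if k = i then - l k else l k := by
  simp only [simpleRefl, h, dif_neg, not_false_eq_true, signFlip, signedPerm_apply, Fin.val_inj]
  split_ifs <;> simp

lemma signFlip_apply (j : ℕ) (l : Wt n) (k : Fin n) :
    signFlip j l k = if (k : ℕ) = j then - l k else l k := by
  simp only [signFlip, signedPerm_apply]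
  split_ifs <;> simp

lemma simpleRoot_of_lt {i : Fin n} (h : (i : ℕ) + 1 < n) :
    simpleRoot i = e (i : ℕ) - e ((i : ℕ) + 1) := by simp [simpleRoot, h]

lemma simpleRoot_of_last {i : Fin n} (h : ¬ (i : ℕ) + 1 < n) :
    simpleRoot i = 2 • e (i : ℕ) := by simp [simpleRoot, h]

lemma e_dot_e (i j : Fin n) : (e (i : ℕ) : Wt n) ⬝ᵥ e (j : ℕ) = if i = j then 1 else 0 := by
  rw [dot_e, e_apply]
  simp [Fin.val_inj, eq_comm]

lemma coroot_of_dot_two {α : Wt n} (h : α ⬝ᵥ α = 2) : coroot α = α := by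
  ext i; simp [coroot, h]

lemma coroot_two_smul {β : Wt n} (h : β ⬝ᵥ β = 1) : coroot (2 • β) = β := by
  have h4 : (2 • β) ⬝ᵥ (2 • β) = 4 := by rw [smul_dotProduct, dotProduct_smul, h]; rfl
  ext i
  change 2 * (2 • β i) / ((2 • β) ⬝ᵥ (2 • β)) = β i
  rw [h4, two_nsmul]
  omega

lemma e_sub_dot_self {i j : Fin n} (h : i ≠ j) :
    (e (i : ℕ) - e (j : ℕ) : Wt n) ⬝ᵥ (e (i : ℕ) - e (j : ℕ)) = 2 := by
  simp [sub_dotProduct, dotProduct_sub, e_dot_e, h, h.symm]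

lemma e_add_dot_self {i j : Fin n} (h : i ≠ j) :
    (e (i : ℕ) + e (j : ℕ) : Wt n) ⬝ᵥ (e (i : ℕ) + e (j : ℕ)) = 2 := by
  simp [add_dotProduct, dotProduct_add, e_dot_e, h, h.symm]

lemma coroot_e_sub {i j : Fin n} (h : i ≠ j) :
    coroot (e (i : ℕ) - e (j : ℕ) : Wt n) = e (i : ℕ) - e (j : ℕ) :=
  coroot_of_dot_two (e_sub_dot_self h)

lemma coroot_e_add {i j : Fin n} (h : i ≠ j) :
    coroot (e (i : ℕ) + e (j : ℕ) : Wt n) = e (i : ℕ) + e (j : ℕ) :=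
  coroot_of_dot_two (e_add_dot_self h)

lemma coroot_long (i : Fin n) : coroot (2 • e (i : ℕ) : Wt n) = e (i : ℕ) :=
  coroot_two_smul (by simp [e_dot_e])

lemma coroot_simple_of_lt {i : Fin n} (h : (i : ℕ) + 1 < n) :
    coroot (simpleRoot i) = e (i : ℕ) - e ((i : ℕ) + 1) := by
  rw [simpleRoot_of_lt h]
  exact coroot_e_sub (j := ⟨i + 1, h⟩) (by simp [Fin.ext_iff])

lemma coroot_simple_of_last {i : Fin n} (h : ¬ (i : ℕ) + 1 < n) :
    coroot (simpleRoot i) = e (i : ℕ) := by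
  rw [simpleRoot_of_last h, coroot_long]

lemma dot_coroot_simple_of_lt {i : Fin n} (h : (i : ℕ) + 1 < n) (l : Wt n) :
    l ⬝ᵥ coroot (simpleRoot i) = l i - l ⟨i + 1, h⟩ := by
  rw [coroot_simple_of_lt h, dotProduct_sub, dot_e]
  congr 1
  exact dot_e l ⟨i + 1, h⟩

lemma dot_coroot_simple_of_last {i : Fin n} (h : ¬ (i : ℕ) + 1 < n) (l : Wt n) :
    l ⬝ᵥ coroot (simpleRoot i) = l i := by
  rw [coroot_simple_of_last h, dot_e]

lemma dot_simple_of_lt {i : Fin n} (h : (i : ℕ) + 1 < n) (l : Wt n) :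
    l ⬝ᵥ simpleRoot i = l i - l ⟨i + 1, h⟩ := by
  rw [simpleRoot_of_lt h, dotProduct_sub, dot_e]
  congr 1
  exact dot_e l ⟨i + 1, h⟩

lemma dot_simple_of_last {i : Fin n} (h : ¬ (i : ℕ) + 1 < n) (l : Wt n) :
    l ⬝ᵥ simpleRoot i = 2 * l i := by
  rw [simpleRoot_of_last h, dotProduct_smul, dot_e]; simp

lemma simpleRefl_eq (i : Fin n) (l : Wt n) :
    simpleRefl i l = l - (l ⬝ᵥ coroot (simpleRoot i)) • simpleRoot i := by
  ext k
  by_cases h : (i : ℕ) + 1 < n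
  · rw [simpleRefl_of_lt h, dot_coroot_simple_of_lt h, simpleRoot_of_lt h]
    simp only [Pi.sub_apply, Pi.smul_apply, e_apply, smul_eq_mul]
    rcases eq_or_ne k i with rfl | hk
    · simp
    · rcases eq_or_ne k ⟨i + 1, h⟩ with rfl | hk'
      · simp
      · rw [Equiv.swap_apply_of_ne_of_ne hk hk']
        have h1 : (k : ℕ) ≠ i := fun h => hk (Fin.ext h)
        have h2 : (k : ℕ) ≠ i + 1 := fun h => hk' (Fin.ext h)
        simp [h1, h2]
  · rw [simpleRefl_of_last h, dot_coroot_simple_of_last h, simpleRoot_of_last h]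
    simp only [Pi.sub_apply, Pi.smul_apply, e_apply, smul_eq_mul, Fin.val_inj]
    split_ifs with hk
    · subst hk; simp; ring
    · simp

/-- `s_i l = l` if and only if `l` is orthogonal to `a_i`, in terms of the co-root. -/
lemma simpleRefl_eq_self {i : Fin n} {l : Wt n} (h : l ⬝ᵥ coroot (simpleRoot i) = 0) :
    simpleRefl i l = l := by rw [simpleRefl_eq, h]; simp

lemma simpleRefl_simpleRefl (i : Fin n) (l : Wt n) : simpleRefl i (simpleRefl i l) = l := by
  ext k
  by_cases h : (i : ℕ) + 1 < n
  · rw [simpleRefl_of_lt h, simpleRefl_of_lt h, Equiv.swap_apply_self]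
  · rw [simpleRefl_of_last h, simpleRefl_of_last h]; split_ifs <;> simp

lemma simpleRefl_mul_self (i : Fin n) : simpleRefl i * simpleRefl i = 1 :=
  LinearEquiv.ext (simpleRefl_simpleRefl i)

lemma simpleRefl_inv (i : Fin n) : (simpleRefl i)⁻¹ = simpleRefl i :=
  inv_eq_of_mul_eq_one_left (simpleRefl_mul_self i)

lemma simpleRefl_mem (i : Fin n) : simpleRefl i ∈ weylGroup n :=
  Subgroup.subset_closure ⟨i, rfl⟩

/-- The Weyl group consists of products of words in the simple reflections. -/
lemma exists_word {w : Wt n ≃ₗ[ℤ] Wt n} (hw : w ∈ weylGroup n) :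
    ∃ L : List (Fin n), (L.map simpleRefl).prod = w := by
  induction hw using Subgroup.closure_induction with
  | mem w hw => obtain ⟨i, rfl⟩ := hw; exact ⟨[i], by simp⟩
  | one => exact ⟨[], rfl⟩
  | mul x y _ _ hx hy =>
    obtain ⟨L, rfl⟩ := hx; obtain ⟨M, rfl⟩ := hy
    exact ⟨L ++ M, by simp⟩
  | inv x _ hx =>
    obtain ⟨L, rfl⟩ := hx
    refine ⟨L.reverse, ?_⟩
    rw [List.prod_inv_reverse, List.map_reverse, List.map_map]
    congr 2
    exact List.map_congr_left fun i _ => (simpleRefl_inv i).symm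

lemma word_mem (L : List (Fin n)) : (L.map simpleRefl).prod ∈ weylGroup n := by
  refine Subgroup.list_prod_mem _ fun x hx => ?_
  obtain ⟨i, -, rfl⟩ := List.mem_map.mp hx
  exact simpleRefl_mem i

lemma exists_signedPerm {w : Wt n ≃ₗ[ℤ] Wt n} (hw : w ∈ weylGroup n) :
    ∃ π s, w = signedPerm π s := by
  obtain ⟨L, rfl⟩ := exists_word hw
  induction L with
  | nil => exact ⟨1, 1, signedPerm_one.symm⟩
  | cons i L ih =>
    obtain ⟨π, s, h⟩ := ih (word_mem L)
    rw [List.map_cons, List.prod_cons, h]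
    unfold simpleRefl signFlip
    split_ifs <;> exact ⟨_, _, signedPerm_mul _ _ _ _⟩

lemma dot_signedPerm (π : Equiv.Perm (Fin n)) (s : Fin n → ℤˣ) (l m : Wt n) :
    signedPerm π s l ⬝ᵥ signedPerm π s m = l ⬝ᵥ m := by
  simp only [dotProduct, signedPerm_apply]
  rw [← Equiv.sum_comp π⁻¹ fun i => l i * m i]
  refine Finset.sum_congr rfl fun i _ => ?_
  have : ((s i : ℤ)) * (s i : ℤ) = 1 := by rw [← Units.val_mul, Int.units_mul_self]; rfl
  linear_combination (l (π⁻¹ i) * m (π⁻¹ i)) * this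

lemma dot_weyl {w : Wt n ≃ₗ[ℤ] Wt n} (hw : w ∈ weylGroup n) (l m : Wt n) :
    w l ⬝ᵥ w m = l ⬝ᵥ m := by
  obtain ⟨π, s, rfl⟩ := exists_signedPerm hw
  exact dot_signedPerm π s l m

lemma simpleRefl_dot (i : Fin n) (l m : Wt n) : simpleRefl i l ⬝ᵥ m = l ⬝ᵥ simpleRefl i m := by
  conv_lhs => rw [← simpleRefl_simpleRefl i m]
  exact dot_weyl (simpleRefl_mem i) _ _

/-- The simple reflections other than the last one are the adjacent transpositions, which generate
the symmetric group. -/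
lemma signedPerm_one_mem {m : ℕ} (π : Equiv.Perm (Fin (m + 1))) :
    signedPerm π 1 ∈ weylGroup (m + 1) := by
  have hπ : π ∈ Submonoid.closure (Set.range fun i : Fin m => Equiv.swap i.castSucc i.succ) := by
    rw [Equiv.Perm.mclosure_swap_castSucc_succ]; trivial
  induction hπ using Submonoid.closure_induction with
  | mem x hx =>
    obtain ⟨i, rfl⟩ := hx
    have h : ((i.castSucc : Fin (m + 1)) : ℕ) + 1 < m + 1 := by simp
    have := simpleRefl_mem (i.castSucc : Fin (m + 1))
    rw [simpleRefl, dif_pos h] at this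
    exact this
  | one => rw [signedPerm_one]; exact one_mem _
  | mul x y _ _ hx hy =>
    have := mul_mem hx hy
    rw [signedPerm_mul] at this
    simpa [Pi.one_def] using this

/-- Conjugating the last simple reflection by a transposition moves the sign change to any place.
The case of the first coordinate is the linear part of the affine reflection s_0. -/
lemma signFlip_mem (j : Fin n) : signFlip (j : ℕ) ∈ weylGroup n := by
  obtain ⟨m, rfl⟩ : ∃ m, n = m + 1 := ⟨n - 1, by have := j.2; omega⟩
  have h : signFlip (j : ℕ) = signedPerm (Equiv.swap j (Fin.last m)) 1 *
      simpleRefl (Fin.last m) * signedPerm (Equiv.swap j (Fin.last m)) 1 := by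
    ext l k
    rw [LinearEquiv.mul_apply, LinearEquiv.mul_apply, signFlip_apply, signedPerm_apply,
      simpleRefl_of_last (by simp), signedPerm_apply]
    simp only [Pi.one_apply, Units.val_one, one_mul, Equiv.swap_inv, Equiv.swap_apply_self,
      Fin.val_inj]
    congr 1
    rw [Equiv.swap_apply_eq_iff]
    simp
  rw [h]
  exact mul_mem (mul_mem (signedPerm_one_mem _) (simpleRefl_mem _)) (signedPerm_one_mem _)

lemma mem_weylOrbit {l m : Wt n} : m ∈ weylOrbit l ↔ ∃ w ∈ weylGroup n, w l = m := by
  simp only [weylOrbit, Set.Finite.mem_toFinset, MulAction.mem_orbit_iff]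
  constructor
  · rintro ⟨w, rfl⟩; exact ⟨w, w.2, rfl⟩
  · rintro ⟨w, hw, rfl⟩; exact ⟨⟨w, hw⟩, rfl⟩

lemma mem_weylOrbit_self (l : Wt n) : l ∈ weylOrbit l :=
  mem_weylOrbit.mpr ⟨1, one_mem _, rfl⟩

lemma weyl_mem_weylOrbit {w : Wt n ≃ₗ[ℤ] Wt n} (hw : w ∈ weylGroup n) (l : Wt n) :
    w l ∈ weylOrbit l := mem_weylOrbit.mpr ⟨w, hw, rfl⟩

lemma mem_weylOrbit_symm {l m : Wt n} (h : m ∈ weylOrbit l) : l ∈ weylOrbit m := by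
  obtain ⟨w, hw, rfl⟩ := mem_weylOrbit.mp h
  refine mem_weylOrbit.mpr ⟨w⁻¹, inv_mem hw, ?_⟩
  rw [← LinearEquiv.mul_apply, inv_mul_cancel]; rfl

lemma mem_weylOrbit_trans {l m k : Wt n} (h : m ∈ weylOrbit l) (h' : k ∈ weylOrbit m) :
    k ∈ weylOrbit l := by
  obtain ⟨w, hw, rfl⟩ := mem_weylOrbit.mp h
  obtain ⟨v, hv, rfl⟩ := mem_weylOrbit.mp h'
  exact mem_weylOrbit.mpr ⟨v * w, mul_mem hv hw, rfl⟩

/-! ### Partial sums and the dominance order -/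

/-- The partial sums `l_1 + ⋯ + l_k`. -/
def psum (l : Wt n) (k : Fin n) : ℤ := ∑ j ∈ Finset.Iic k, l j

lemma psum_add (l m : Wt n) (k : Fin n) : psum (l + m) k = psum l k + psum m k := by
  simp [psum, Finset.sum_add_distrib]

lemma psum_sub (l m : Wt n) (k : Fin n) : psum (l - m) k = psum l k - psum m k := by
  simp [psum, Finset.sum_sub_distrib]

lemma psum_zsmul (c : ℤ) (m : Wt n) (k : Fin n) : psum (c • m) k = c * psum m k := by
  simp [psum, Finset.mul_sum]

lemma psum_nsmul (c : ℕ) (m : Wt n) (k : Fin n) : psum (c • m) k = c * psum m k := by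
  simp [psum, Finset.mul_sum]

lemma psum_neg (m : Wt n) (k : Fin n) : psum (-m) k = - psum m k := by
  simp [psum]

lemma psum_sum {ι : Type*} (s : Finset ι) (f : ι → Wt n) (k : Fin n) :
    psum (∑ i ∈ s, f i) k = ∑ i ∈ s, psum (f i) k := by
  simp only [psum, Finset.sum_apply]
  exact Finset.sum_comm

lemma psum_e (i k : Fin n) : psum (e (i : ℕ)) k = if i ≤ k then 1 else 0 := by
  simp [psum, e_apply, Fin.val_inj]

lemma psum_e_nat (i : ℕ) (k : Fin n) : psum (e i) k = if i ≤ k then 1 else 0 := by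
  by_cases h : i < n
  · exact psum_e ⟨i, h⟩ k
  · rw [if_neg (by have := k.2; omega)]
    refine Finset.sum_eq_zero fun j _ => ?_
    rw [e_apply, if_neg (by have := j.2; omega)]

lemma psum_succ (l : Wt n) {k : Fin n} (h : (k : ℕ) + 1 < n) :
    psum l ⟨k + 1, h⟩ = psum l k + l ⟨k + 1, h⟩ := by
  have : Finset.Iic (⟨k + 1, h⟩ : Fin n) = insert ⟨k + 1, h⟩ (Finset.Iic k) := by
    ext j
    simp only [Finset.mem_Iic, Finset.mem_insert, Fin.le_def, Fin.ext_iff]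
    omega
  rw [psum, this, Finset.sum_insert (by simp [Fin.le_def]), add_comm]
  rfl

lemma psum_zero (l : Wt n) (h : 0 < n) : psum l ⟨0, h⟩ = l ⟨0, h⟩ := by
  have : Finset.Iic (⟨0, h⟩ : Fin n) = {⟨0, h⟩} := by
    ext j; simp [Fin.le_def, Fin.ext_iff]
  rw [psum, this, Finset.sum_singleton]

lemma psum_injective {l m : Wt n} (h : ∀ k, psum l k = psum m k) : l = m := by
  ext ⟨k, hk⟩
  cases k with
  | zero => rw [← psum_zero l hk, ← psum_zero m hk, h]
  | succ k =>
    have h1 := psum_succ l (k := ⟨k, by omega⟩) hk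
    have h2 := psum_succ m (k := ⟨k, by omega⟩) hk
    rw [h, h] at h1
    linarith

/-- Partial sums are the coordinates with respect to the basis of simple co-roots; this turns the
dominance order into a coordinatewise comparison of integers. -/
lemma psum_coroot_simple (i k : Fin n) :
    psum (coroot (simpleRoot i)) k = if i = k then 1 else 0 := by
  by_cases h : (i : ℕ) + 1 < n
  · rw [coroot_simple_of_lt h, psum_sub, psum_e_nat, psum_e_nat]
    simp only [Fin.ext_iff]
    split_ifs <;> omega
  · rw [coroot_simple_of_last h, psum_e_nat]
    simp only [Fin.ext_iff]
    have := k.2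
    split_ifs <;> omega

lemma domLE_iff {l m : Wt n} : DomLE l m ↔ ∀ k, psum l k ≤ psum m k := by
  have key : ∀ v : Wt n, v ∈ AddSubmonoid.closure
      (Set.range fun i : Fin n => coroot (simpleRoot i)) ↔ ∀ k, 0 ≤ psum v k := by
    intro v
    constructor
    · intro hv
      induction hv using AddSubmonoid.closure_induction with
      | mem x hx =>
        obtain ⟨i, rfl⟩ := hx
        intro k
        rw [psum_coroot_simple]; split_ifs <;> simp
      | zero => intro k; simp [psum]
      | add x y _ _ hx hy => intro k; rw [psum_add]; exact add_nonneg (hx k) (hy k)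
    · intro hv
      have : v = ∑ i, (psum v i).toNat • coroot (simpleRoot i) := by
        refine psum_injective fun k => ?_
        rw [psum_sum]
        simp_rw [psum_nsmul, psum_coroot_simple]
        simp [hv k]
      rw [this]
      exact AddSubmonoid.sum_mem _ fun i _ => AddSubmonoid.nsmul_mem _
        (AddSubmonoid.subset_closure (Set.mem_range_self i)) _
  rw [DomLE, key]
  simp_rw [psum_sub, sub_nonneg]

lemma DomLE.refl (l : Wt n) : DomLE l l := domLE_iff.mpr fun _ => le_rfl

lemma DomLE.trans {l m k : Wt n} (h : DomLE l m) (h' : DomLE m k) : DomLE l k :=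
  domLE_iff.mpr fun j => (domLE_iff.mp h j).trans (domLE_iff.mp h' j)

lemma DomLE.antisymm {l m : Wt n} (h : DomLE l m) (h' : DomLE m l) : l = m :=
  psum_injective fun j => (domLE_iff.mp h j).antisymm (domLE_iff.mp h' j)

lemma DomLT.trans_le {l m k : Wt n} (h : DomLT l m) (h' : DomLE m k) : DomLT l k :=
  ⟨h.1.trans h', by rintro rfl; exact h.2 (h.1.antisymm h')⟩

lemma isDominant_iff {l : Wt n} : IsDominant l ↔ Antitone l ∧ ∀ i, 0 ≤ l i := by
  constructor
  · intro h
    have h1 : ∀ (i : Fin n) (hi : (i : ℕ) + 1 < n), l ⟨i + 1, hi⟩ ≤ l i := fun i hi => by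
      have := h i
      rw [dot_coroot_simple_of_lt hi] at this; linarith
    have h2 : ∀ (d : ℕ) (i : Fin n) (hi : (i : ℕ) + d < n), l ⟨i + d, hi⟩ ≤ l i := by
      intro d
      induction d with
      | zero => intro i hi; exact le_rfl
      | succ d ih =>
        intro i hi
        exact (h1 ⟨i + d, by omega⟩ hi).trans (ih i (by omega))
    have h3 : Antitone l := by
      intro i j hij
      have := h2 (j - i) i (by have := j.2; rw [Fin.le_def] at hij; omega)
      rw [Fin.le_def] at hij
      have hj : (⟨i + (j - i), by have := j.2; omega⟩ : Fin n) = j :=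
        Fin.ext (by change (i : ℕ) + (j - i) = j; omega)
      rwa [hj] at this
    refine ⟨h3, fun i => ?_⟩
    have hl : ¬ (((⟨n - 1, by have := i.2; omega⟩ : Fin n) : ℕ) + 1 < n) := by simp; omega
    have h4 := h ⟨n - 1, by have := i.2; omega⟩
    rw [dot_coroot_simple_of_last hl] at h4
    exact h4.trans (h3 (by rw [Fin.le_def]; have := i.2; simp; omega))
  · rintro ⟨h1, h2⟩ i
    by_cases h : (i : ℕ) + 1 < n
    · rw [dot_coroot_simple_of_lt h]
      exact sub_nonneg.mpr (h1 (by rw [Fin.le_def]; simp))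
    · rw [dot_coroot_simple_of_last h]; exact h2 i

/-- Exchange argument: the two set differences have the same cardinality, the entries in one are at
most `l k` and those in the other at least `l k`. -/
lemma sum_le_psum {l : Wt n} (hl : Antitone l) (k : Fin n) (S : Finset (Fin n))
    (hS : S.card = (Finset.Iic k).card) : ∑ j ∈ S, l j ≤ psum l k := by
  have hc : (S \ Finset.Iic k).card = (Finset.Iic k \ S).card := Finset.card_sdiff_comm hS
  have h1 : ∑ j ∈ S \ Finset.Iic k, l j ≤ (S \ Finset.Iic k).card • l k :=
    Finset.sum_le_card_nsmul _ _ _ fun j hj => by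
      simp only [Finset.mem_sdiff, Finset.mem_Iic, not_le] at hj
      exact hl hj.2.le
  have h2 : (Finset.Iic k \ S).card • l k ≤ ∑ j ∈ Finset.Iic k \ S, l j :=
    Finset.card_nsmul_le_sum _ _ _ fun j hj => by
      simp only [Finset.mem_sdiff, Finset.mem_Iic] at hj
      exact hl hj.1
  rw [psum, ← Finset.sum_inter_add_sum_sdiff S (Finset.Iic k),
    ← Finset.sum_inter_add_sum_sdiff (Finset.Iic k) S, Finset.inter_comm]
  rw [hc] at h1
  linarith

/-- A dominant weight is the largest element of its orbit. -/
lemma weyl_domLE {l : Wt n} (hl : IsDominant l) {w : Wt n ≃ₗ[ℤ] Wt n} (hw : w ∈ weylGroup n) :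
    DomLE (w l) l := by
  obtain ⟨π, s, rfl⟩ := exists_signedPerm hw
  rw [isDominant_iff] at hl
  refine domLE_iff.mpr fun k => ?_
  -- Sign changes can only lower the entries, which are nonnegative; what remains is a sum over a
  -- permuted index set of the same size.
  calc psum (signedPerm π s l) k ≤ ∑ j ∈ Finset.Iic k, l (π⁻¹ j) := by
        refine Finset.sum_le_sum fun j _ => ?_
        rw [signedPerm_apply]
        have := hl.2 (π⁻¹ j)
        rcases Int.units_eq_one_or (s j) with h | h <;> simp [h]
        simpa using this
    _ = ∑ j ∈ (Finset.Iic k).map (π⁻¹).toEmbedding, l j := by simp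
    _ ≤ psum l k := sum_le_psum hl.1 k _ (Finset.card_map _)

lemma mem_orbit_domLE {l m : Wt n} (hl : IsDominant l) (hm : m ∈ weylOrbit l) : DomLE m l := by
  obtain ⟨w, hw, rfl⟩ := mem_weylOrbit.mp hm
  exact weyl_domLE hl hw

lemma dominant_unique {l m : Wt n} (hl : IsDominant l) (hm : IsDominant m)
    (h : m ∈ weylOrbit l) : m = l :=
  (mem_orbit_domLE hl h).antisymm (mem_orbit_domLE hm (mem_weylOrbit_symm h))

end
end Koornwinder

namespace Koornwinder
noncomputable section
open scoped Matrix
variable {n : ℕ}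

/-! ### Positive roots -/

lemma mem_mediumPos {α : Wt n} : α ∈ mediumPos n ↔
    ∃ i j : Fin n, i < j ∧ (α = e (i : ℕ) - e (j : ℕ) ∨ α = e (i : ℕ) + e (j : ℕ)) := by
  simp only [mediumPos, Finset.mem_union, Finset.mem_image, Finset.mem_filter, Finset.mem_univ,
    true_and, Prod.exists]
  constructor
  · rintro (⟨i, j, h, rfl⟩ | ⟨i, j, h, rfl⟩)
    · exact ⟨i, j, h, Or.inl rfl⟩
    · exact ⟨i, j, h, Or.inr rfl⟩
  · rintro ⟨i, j, h, rfl | rfl⟩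
    · exact Or.inl ⟨i, j, h, rfl⟩
    · exact Or.inr ⟨i, j, h, rfl⟩

lemma mem_longPos {α : Wt n} : α ∈ longPos n ↔ ∃ i : Fin n, α = 2 • e (i : ℕ) := by
  simp [longPos, eq_comm]

lemma mem_shortPos {α : Wt n} : α ∈ shortPos n ↔ ∃ i : Fin n, α = e (i : ℕ) := by
  simp [shortPos, eq_comm]

lemma dot_self_medium {α : Wt n} (h : α ∈ mediumPos n) : α ⬝ᵥ α = 2 := by
  obtain ⟨i, j, hij, rfl | rfl⟩ := mem_mediumPos.mp h
  · exact e_sub_dot_self hij.ne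
  · exact e_add_dot_self hij.ne

lemma dot_self_long {α : Wt n} (h : α ∈ longPos n) : α ⬝ᵥ α = 4 := by
  obtain ⟨i, rfl⟩ := mem_longPos.mp h
  simp only [smul_dotProduct, dotProduct_smul, e_dot_e, if_true]
  rfl

lemma medium_not_long {α : Wt n} (h : α ∈ mediumPos n) : α ∉ longPos n := fun h' => by
  have := dot_self_medium h; rw [dot_self_long h'] at this; norm_num at this

lemma posRoots_ne_zero {α : Wt n} (h : α ∈ posRoots n) : α ≠ 0 := by
  rintro rfl
  rcases Finset.mem_union.mp h with h | h
  · simpa using dot_self_medium h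
  · simpa using dot_self_long h

lemma psum_posRoots {α : Wt n} (h : α ∈ posRoots n) (k : Fin n) : 0 ≤ psum α k := by
  rcases Finset.mem_union.mp h with h | h
  · obtain ⟨i, j, hij, rfl | rfl⟩ := mem_mediumPos.mp h
    · rw [psum_sub, psum_e, psum_e]
      have : j ≤ k → i ≤ k := fun h => hij.le.trans h
      split_ifs <;> simp_all
    · rw [psum_add, psum_e, psum_e]; split_ifs <;> simp
  · obtain ⟨i, rfl⟩ := mem_longPos.mp h
    rw [psum_nsmul, psum_e]; split_ifs <;> simp

lemma neg_notMem_posRoots {α : Wt n} (h : α ∈ posRoots n) : -α ∉ posRoots n := fun h' => by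
  refine posRoots_ne_zero h (psum_injective fun k => ?_)
  have h1 := psum_posRoots h k
  have h2 := psum_posRoots h' k
  rw [psum_neg] at h2
  have h3 : psum (0 : Wt n) k = 0 := by simp [psum]
  rw [h3]; linarith

lemma simpleRoot_medium {i : Fin n} (h : (i : ℕ) + 1 < n) : simpleRoot i ∈ mediumPos n :=
  mem_mediumPos.mpr ⟨i, ⟨i + 1, h⟩, by simp [Fin.lt_def], Or.inl (simpleRoot_of_lt h)⟩

lemma simpleRoot_long {i : Fin n} (h : ¬ (i : ℕ) + 1 < n) : simpleRoot i ∈ longPos n :=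
  mem_longPos.mpr ⟨i, simpleRoot_of_last h⟩

lemma simpleRoot_mem (i : Fin n) : simpleRoot i ∈ posRoots n := by
  by_cases h : (i : ℕ) + 1 < n
  · exact Finset.mem_union_left _ (simpleRoot_medium h)
  · exact Finset.mem_union_right _ (simpleRoot_long h)

lemma simpleRefl_e_of_lt {i : Fin n} (h : (i : ℕ) + 1 < n) (k : Fin n) :
    simpleRefl i (e (k : ℕ)) = e (Equiv.swap i ⟨i + 1, h⟩ k : Fin n) := by
  ext j
  rw [simpleRefl_of_lt h, e_apply, e_apply]
  simp only [Fin.val_inj]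
  congr 1
  rw [Equiv.swap_apply_eq_iff]

lemma simpleRefl_e_of_last {i : Fin n} (h : ¬ (i : ℕ) + 1 < n) (k : Fin n) :
    simpleRefl i (e (k : ℕ)) = if k = i then - e (k : ℕ) else e (k : ℕ) := by
  ext j
  rw [simpleRefl_of_last h]
  by_cases hk : k = i
  · subst hk
    by_cases hj : j = k
    · simp [hj]
    · have : (j : ℕ) ≠ k := fun h => hj (Fin.ext h)
      simp [hj, e_apply, this]
  · by_cases hj : j = i
    · subst hj
      have : (j : ℕ) ≠ k := fun h => hk (Fin.ext h).symm
      simp [hk, e_apply, this]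
    · simp [hk, hj]

lemma simpleRefl_simpleRoot (i : Fin n) : simpleRefl i (simpleRoot i) = - simpleRoot i := by
  by_cases h : (i : ℕ) + 1 < n
  · have := simpleRefl_e_of_lt h ⟨i + 1, h⟩
    rw [simpleRoot_of_lt h, map_sub, simpleRefl_e_of_lt h, this]
    simp
  · rw [simpleRoot_of_last h, map_nsmul, simpleRefl_e_of_last h]
    simp

lemma simpleRefl_medium {i : Fin n} {α : Wt n} (h : α ∈ mediumPos n) (hne : α ≠ simpleRoot i) :
    simpleRefl i α ∈ mediumPos n := by
  obtain ⟨j, k, hjk, hα⟩ := mem_mediumPos.mp h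
  rw [mem_mediumPos]
  by_cases hi : (i : ℕ) + 1 < n
  · have hinj := (Equiv.swap i ⟨i + 1, hi⟩).injective.ne hjk.ne
    -- An adjacent transposition reverses the order of exactly one pair of indices, the pair that
    -- belongs to a_i itself.
    have hlt : ¬ (j = i ∧ k = ⟨i + 1, hi⟩) →
        Equiv.swap i ⟨i + 1, hi⟩ j < Equiv.swap i ⟨i + 1, hi⟩ k := by
      intro hc
      rw [Fin.lt_def] at hjk ⊢
      simp only [Equiv.swap_apply_def, Fin.ext_iff] at hc ⊢
      split_ifs <;> simp_all <;> omega
    rcases hα with rfl | rfl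
    · rw [map_sub, simpleRefl_e_of_lt hi, simpleRefl_e_of_lt hi]
      refine ⟨_, _, hlt ?_, Or.inl rfl⟩
      rintro ⟨rfl, rfl⟩
      exact hne (simpleRoot_of_lt hi).symm
    · rw [map_add, simpleRefl_e_of_lt hi, simpleRefl_e_of_lt hi]
      rcases lt_or_gt_of_ne hinj with h1 | h1
      · exact ⟨_, _, h1, Or.inr rfl⟩
      · exact ⟨_, _, h1, Or.inr (add_comm _ _)⟩
  · have hj : j ≠ i := by
      rintro rfl; rw [Fin.lt_def] at hjk; have := k.2; omega
    refine ⟨j, k, hjk, ?_⟩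
    rcases hα with rfl | rfl
    · rw [map_sub, simpleRefl_e_of_last hi, simpleRefl_e_of_last hi, if_neg hj]
      split_ifs <;> simp
    · rw [map_add, simpleRefl_e_of_last hi, simpleRefl_e_of_last hi, if_neg hj]
      split_ifs <;> simp [sub_eq_add_neg]

lemma simpleRefl_long {i : Fin n} {α : Wt n} (h : α ∈ longPos n) (hne : α ≠ simpleRoot i) :
    simpleRefl i α ∈ longPos n := by
  obtain ⟨j, rfl⟩ := mem_longPos.mp h
  rw [mem_longPos]
  by_cases hi : (i : ℕ) + 1 < n
  · exact ⟨_, by rw [map_nsmul, simpleRefl_e_of_lt hi]⟩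
  · refine ⟨j, ?_⟩
    rw [map_nsmul, simpleRefl_e_of_last hi, if_neg]
    rintro rfl
    exact hne (simpleRoot_of_last hi).symm

lemma simpleRefl_posRoots {i : Fin n} {α : Wt n} (h : α ∈ posRoots n) (hne : α ≠ simpleRoot i) :
    simpleRefl i α ∈ posRoots n := by
  rcases Finset.mem_union.mp h with h | h
  · exact Finset.mem_union_left _ (simpleRefl_medium h hne)
  · exact Finset.mem_union_right _ (simpleRefl_long h hne)

lemma simpleRefl_ne_simpleRoot {i : Fin n} {α : Wt n} (h : α ∈ posRoots n) :
    simpleRefl i α ≠ simpleRoot i := fun h' => by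
  have : α = - simpleRoot i := by
    rw [← simpleRefl_simpleRoot, ← h', simpleRefl_simpleRefl]
  rw [this] at h
  exact neg_notMem_posRoots (simpleRoot_mem i) h

/-- Induction on a word: a simple reflection permutes the positive roots other than its own root,
and negates the latter. -/
lemma isRoot_weyl {w : Wt n ≃ₗ[ℤ] Wt n} (hw : w ∈ weylGroup n) {α : Wt n}
    (h : α ∈ posRoots n) : w α ∈ posRoots n ∨ -(w α) ∈ posRoots n := by
  obtain ⟨L, rfl⟩ := exists_word hw
  clear hw
  induction L with
  | nil => exact Or.inl h
  | cons i L ih =>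
    rw [List.map_cons, List.prod_cons, LinearEquiv.mul_apply]
    set β := (L.map simpleRefl).prod α
    rcases ih with ih | ih
    · by_cases hβ : β = simpleRoot i
      · right; rw [hβ, simpleRefl_simpleRoot, neg_neg]; exact simpleRoot_mem i
      · exact Or.inl (simpleRefl_posRoots ih hβ)
    · by_cases hβ : -β = simpleRoot i
      · left
        rw [← neg_neg β, hβ, map_neg, simpleRefl_simpleRoot, neg_neg]; exact simpleRoot_mem i
      · right; rw [← map_neg]; exact simpleRefl_posRoots ih hβ

lemma dot_simple_eq (i : Fin n) (l : Wt n) : l ⬝ᵥ simpleRoot i =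
    (if (i : ℕ) + 1 < n then 1 else 2) * (l ⬝ᵥ coroot (simpleRoot i)) := by
  split_ifs with h
  · rw [dot_simple_of_lt h, dot_coroot_simple_of_lt h, one_mul]
  · rw [dot_simple_of_last h, dot_coroot_simple_of_last h]

lemma dot_simple_pos {i : Fin n} {l : Wt n} :
    0 < l ⬝ᵥ simpleRoot i ↔ 0 < l ⬝ᵥ coroot (simpleRoot i) := by
  rw [dot_simple_eq]; split_ifs <;> omega

lemma dot_simple_neg {i : Fin n} {l : Wt n} :
    l ⬝ᵥ simpleRoot i < 0 ↔ l ⬝ᵥ coroot (simpleRoot i) < 0 := by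
  rw [dot_simple_eq]; split_ifs <;> omega

lemma simpleRefl_eq_self_iff {i : Fin n} {l : Wt n} :
    simpleRefl i l = l ↔ l ⬝ᵥ simpleRoot i = 0 := by
  constructor
  · intro h
    have h1 : simpleRefl i l ⬝ᵥ simpleRoot i = - (l ⬝ᵥ simpleRoot i) := by
      rw [simpleRefl_dot, simpleRefl_simpleRoot, dotProduct_neg]
    rw [h] at h1; omega
  · intro h
    refine simpleRefl_eq_self ?_
    rw [dot_simple_eq] at h
    split_ifs at h <;> omega

lemma simpleRefl_dot_simple (i : Fin n) (l : Wt n) :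
    simpleRefl i l ⬝ᵥ simpleRoot i = - (l ⬝ᵥ simpleRoot i) := by
  rw [simpleRefl_dot, simpleRefl_simpleRoot, dotProduct_neg]

lemma dot_nonneg_of_dominant {l α : Wt n} (hl : IsDominant l) (h : α ∈ posRoots n) :
    0 ≤ l ⬝ᵥ α := by
  rw [isDominant_iff] at hl
  rcases Finset.mem_union.mp h with h | h
  · obtain ⟨i, j, hij, rfl | rfl⟩ := mem_mediumPos.mp h
    · rw [dotProduct_sub, dot_e, dot_e]; exact sub_nonneg.mpr (hl.1 hij.le)
    · rw [dotProduct_add, dot_e, dot_e]; exact add_nonneg (hl.2 _) (hl.2 _)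
  · obtain ⟨i, rfl⟩ := mem_longPos.mp h
    rw [dotProduct_smul, dot_e]; exact nsmul_nonneg (hl.2 _) _

/-! ### The positive roots on which a weight is negative -/

/-- The positive roots `α` with `⟨μ, α⟩ < 0`. -/
def negRoots (m : Wt n) : Finset (Wt n) := (posRoots n).filter fun α => m ⬝ᵥ α < 0

/-- The pairing is transported by s_i, which permutes the positive roots other than a_i, while a_i
itself becomes negative. Every recursion along an orbit, for lengths, for t_w and for the expansion
coefficients, rests on this. -/
lemma negRoots_simpleRefl {i : Fin n} {m : Wt n} (h : 0 < m ⬝ᵥ simpleRoot i) :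
    negRoots (simpleRefl i m) =
      insert (simpleRoot i) ((negRoots m).image (simpleRefl i)) := by
  ext α
  simp only [negRoots, Finset.mem_filter, Finset.mem_insert, Finset.mem_image]
  constructor
  · rintro ⟨h1, h2⟩
    by_cases hα : α = simpleRoot i
    · exact Or.inl hα
    · refine Or.inr ⟨simpleRefl i α, ⟨simpleRefl_posRoots h1 hα, ?_⟩, simpleRefl_simpleRefl i α⟩
      rwa [← simpleRefl_dot]
  · rintro (rfl | ⟨β, ⟨h1, h2⟩, rfl⟩)
    · refine ⟨simpleRoot_mem i, ?_⟩
      rw [simpleRefl_dot_simple]; omega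
    · refine ⟨simpleRefl_posRoots h1 ?_, ?_⟩
      · rintro rfl; omega
      · rwa [← simpleRefl_dot, simpleRefl_simpleRefl]

lemma prod_negRoots_simpleRefl {M : Type*} [CommMonoid M] {i : Fin n} {m : Wt n}
    (h : 0 < m ⬝ᵥ simpleRoot i) (F : Wt n → M) :
    ∏ α ∈ negRoots (simpleRefl i m), F α =
      F (simpleRoot i) * ∏ α ∈ negRoots m, F (simpleRefl i α) := by
  rw [negRoots_simpleRefl h, Finset.prod_insert, Finset.prod_image]
  · exact fun a _ b _ hab => (simpleRefl i).injective hab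
  · rw [Finset.mem_image]
    rintro ⟨α, hα, h'⟩
    exact simpleRefl_ne_simpleRoot (Finset.mem_filter.mp hα).1 h'

lemma card_negRoots_simpleRefl {i : Fin n} {m : Wt n} (h : 0 < m ⬝ᵥ simpleRoot i) :
    (negRoots (simpleRefl i m)).card = (negRoots m).card + 1 := by
  have := prod_negRoots_simpleRefl h (fun _ => Multiplicative.ofAdd (1 : ℕ))
  simp only [Finset.prod_const] at this
  have h2 := congrArg Multiplicative.toAdd this
  simp at h2
  omega

lemma negRoots_of_dominant {l : Wt n} (hl : IsDominant l) : negRoots l = ∅ := by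
  refine Finset.filter_eq_empty_iff.mpr fun α hα => ?_
  have := dot_nonneg_of_dominant hl hα
  omega

/-- Induction along ascending simple reflections: every weight is obtained from the dominant one
in its orbit by simple reflections that increase the number of negative roots. -/
lemma weight_induction {motive : Wt n → Prop} (dom : ∀ l, IsDominant l → motive l)
    (step : ∀ m i, 0 < m ⬝ᵥ simpleRoot i → motive m → motive (simpleRefl i m)) (m : Wt n) :
    motive m := by
  induction h : (negRoots m).card generalizing m with
  | zero =>
    refine dom m fun i => ?_
    by_contra hc
    have : simpleRoot i ∈ negRoots m := Finset.mem_filter.mpr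
      ⟨simpleRoot_mem i, dot_simple_neg.mpr (not_le.mp hc)⟩
    rw [Finset.card_eq_zero.mp h] at this
    simp at this
  | succ N ih =>
    by_cases hd : IsDominant m
    · exact dom m hd
    · obtain ⟨i, hi⟩ := not_forall.mp hd
      have h1 : 0 < simpleRefl i m ⬝ᵥ simpleRoot i := by
        rw [simpleRefl_dot_simple]
        have := dot_simple_neg.mpr (not_le.mp hi)
        omega
      have h2 := card_negRoots_simpleRefl h1
      rw [simpleRefl_simpleRefl] at h2
      have := step _ i h1 (ih (simpleRefl i m) (by omega))
      rwa [simpleRefl_simpleRefl] at this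

lemma simpleRefl_mem_weylOrbit {i : Fin n} {l m : Wt n} :
    simpleRefl i m ∈ weylOrbit l ↔ m ∈ weylOrbit l := by
  constructor
  · intro h
    have := mem_weylOrbit_trans h (weyl_mem_weylOrbit (simpleRefl_mem i) _)
    rwa [simpleRefl_simpleRefl] at this
  · intro h
    exact mem_weylOrbit_trans h (weyl_mem_weylOrbit (simpleRefl_mem i) _)

lemma exists_dominant_word (m : Wt n) : ∃ (L : List (Fin n)) (l : Wt n), IsDominant l ∧
    (L.map simpleRefl).prod l = m ∧ L.length = (negRoots m).card := by
  induction m using weight_induction with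
  | dom l hl => exact ⟨[], l, hl, rfl, by rw [negRoots_of_dominant hl]; rfl⟩
  | step m i h ih =>
    obtain ⟨L, l, hl, h1, h2⟩ := ih
    refine ⟨i :: L, l, hl, ?_, ?_⟩
    · rw [List.map_cons, List.prod_cons, LinearEquiv.mul_apply, h1]
    · rw [card_negRoots_simpleRefl h, ← h2]; rfl

lemma exists_dominant (m : Wt n) : ∃ l, IsDominant l ∧ l ∈ weylOrbit m := by
  obtain ⟨L, l, hl, h, -⟩ := exists_dominant_word m
  exact ⟨l, hl, mem_weylOrbit_symm (mem_weylOrbit.mpr ⟨_, word_mem L, h⟩)⟩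

/-- The dominant weight in the orbit of `m`. -/
def domPart (m : Wt n) : Wt n := (exists_dominant m).choose

lemma domPart_dominant (m : Wt n) : IsDominant (domPart m) := (exists_dominant m).choose_spec.1

lemma domPart_mem (m : Wt n) : domPart m ∈ weylOrbit m := (exists_dominant m).choose_spec.2

lemma eq_domPart {l m : Wt n} (hl : IsDominant l) (h : l ∈ weylOrbit m) : l = domPart m :=
  dominant_unique (domPart_dominant m) hl
    (mem_weylOrbit_trans (mem_weylOrbit_symm (domPart_mem m)) h)

lemma domPart_of_dominant {l : Wt n} (hl : IsDominant l) : domPart l = l :=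
  (eq_domPart hl (mem_weylOrbit_self l)).symm

lemma domPart_eq_of_mem {l m : Wt n} (h : m ∈ weylOrbit l) : domPart m = domPart l :=
  eq_domPart (domPart_dominant m) (mem_weylOrbit_trans h (domPart_mem m))

lemma domPart_weyl {w : Wt n ≃ₗ[ℤ] Wt n} (hw : w ∈ weylGroup n) (m : Wt n) :
    domPart (w m) = domPart m := domPart_eq_of_mem (weyl_mem_weylOrbit hw m)

lemma domLE_domPart (m : Wt n) : DomLE m (domPart m) :=
  mem_orbit_domLE (domPart_dominant m) (mem_weylOrbit_symm (domPart_mem m))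

/-! ### The order `≺` -/

lemma precLT_iff {l m : Wt n} : PrecLT l m ↔
    DomLT (domPart l) (domPart m) ∨ (domPart l = domPart m ∧ DomLT l m) := by
  constructor
  · rintro ⟨⟨l', m', hl', hm', hl, hm, h⟩, hne⟩
    rw [← eq_domPart hl' hl, ← eq_domPart hm' hm]
    exact h.imp id fun h => ⟨h.1, h.2, hne⟩
  · intro h
    refine ⟨⟨domPart l, domPart m, domPart_dominant l, domPart_dominant m, domPart_mem l,
      domPart_mem m, h.imp id fun h => ⟨h.1, h.2.1⟩⟩, ?_⟩
    rintro rfl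
    rcases h with h | h
    · exact h.2 rfl
    · exact h.2.2 rfl

lemma PrecLT.trans {l m k : Wt n} (h : PrecLT l m) (h' : PrecLT m k) : PrecLT l k := by
  rw [precLT_iff] at *
  rcases h with h | h
  · left
    rcases h' with h' | h'
    · exact h.trans_le h'.1
    · rwa [← h'.1]
  · rcases h' with h' | h'
    · left; rwa [h.1]
    · exact Or.inr ⟨h.1.trans h'.1, h.2.trans_le h'.2.1⟩

lemma PrecLT.irrefl (l : Wt n) : ¬ PrecLT l l := fun h => h.2 rfl

lemma abs_le_of_dominant {l m : Wt n} (hl : IsDominant l) (h : m ∈ weylOrbit l) (i : Fin n) :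
    |m i| ≤ psum l ⟨n - 1, by have := i.2; omega⟩ := by
  obtain ⟨w, hw, rfl⟩ := mem_weylOrbit.mp h
  have h1 : |w l i| ≤ ∑ i, |w l i| :=
    Finset.single_le_sum (f := fun i => |w l i|) (fun _ _ => abs_nonneg _) (Finset.mem_univ i)
  rw [sum_abs_weyl w hw] at h1
  refine h1.trans (le_of_eq ?_)
  have h2 : Finset.Iic (⟨n - 1, by have := i.2; omega⟩ : Fin n) = Finset.univ := by
    ext j; simp only [Finset.mem_Iic, Fin.le_def, Finset.mem_univ, iff_true]; have := j.2; omega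
  rw [psum, h2]
  exact Finset.sum_congr rfl fun j _ => abs_of_nonneg ((isDominant_iff.mp hl).2 j)

/-- The sum of the absolute values of the coordinates is constant on an orbit, and at a dominant
weight it is the last partial sum, which the order bounds. -/
lemma finite_domLE (l : Wt n) : {m : Wt n | DomLE (domPart m) l}.Finite := by
  rcases Nat.eq_zero_or_pos n with rfl | hn
  · exact Set.toFinite _
  · refine (Set.finite_Icc (fun _ => -psum l ⟨n - 1, by omega⟩ : Wt n)
      (fun _ => psum l ⟨n - 1, by omega⟩)).subset ?_
    intro m hm
    have h : ∀ i, |m i| ≤ psum l ⟨n - 1, by omega⟩ := fun i =>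
      (abs_le_of_dominant (domPart_dominant m) (mem_weylOrbit_symm (domPart_mem m)) i).trans
        (domLE_iff.mp hm _)
    exact ⟨fun i => (abs_le.mp (h i)).1, fun i => (abs_le.mp (h i)).2⟩

lemma PrecLT.domPart_le {l m : Wt n} (h : PrecLT l m) : DomLE (domPart l) (domPart m) := by
  rcases precLT_iff.mp h with h | h
  · exact h.1
  · rw [h.1]; exact DomLE.refl _

lemma finite_precLT (l : Wt n) : {m : Wt n | PrecLT m l}.Finite :=
  (finite_domLE (domPart l)).subset fun _ hm => PrecLT.domPart_le hm

/-- A weight below x has its dominant part below that of x, which leaves finitely many candidates; a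
minimal element is found among these. -/
lemma wellFounded_precLT : WellFounded (PrecLT : Wt n → Wt n → Prop) := by
  rw [WellFounded.wellFounded_iff_has_min]
  intro S ⟨x, hx⟩
  have hfin : (S ∩ {m | DomLE (domPart m) (domPart x)}).Finite :=
    (finite_domLE (domPart x)).subset Set.inter_subset_right
  have : IsStrictOrder (Wt n) PrecLT :=
    { irrefl := PrecLT.irrefl, trans := fun _ _ _ => PrecLT.trans }
  have hwf := Set.wellFoundedOn_iff.mp (hfin.wellFoundedOn (r := PrecLT))
  obtain ⟨m, hm, hmin⟩ := hwf.has_min (S ∩ {m | DomLE (domPart m) (domPart x)})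
    ⟨x, hx, DomLE.refl (domPart x)⟩
  have hy' : ∀ y ∈ S, PrecLT y m → y ∈ S ∩ {m | DomLE (domPart m) (domPart x)} :=
    fun y hy hlt => ⟨hy, (PrecLT.domPart_le hlt).trans hm.2⟩
  exact ⟨m, hm.1, fun y hy hlt => hmin y (hy' y hy hlt) ⟨hlt, hy' y hy hlt, hm⟩⟩

lemma simpleRefl_precLT {i : Fin n} {m : Wt n} (h : 0 < m ⬝ᵥ simpleRoot i) :
    PrecLT (simpleRefl i m) m := by
  refine precLT_iff.mpr (Or.inr ⟨domPart_weyl (simpleRefl_mem i) m, ?_, ?_⟩)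
  · refine domLE_iff.mpr fun k => ?_
    rw [simpleRefl_eq, psum_sub, psum_zsmul]
    have := mul_nonneg (dot_simple_pos.mp h).le (psum_posRoots (simpleRoot_mem i) k)
    linarith
  · intro h'
    rw [simpleRefl_eq_self_iff] at h'; omega

/-! ### Weights inside a root string -/

/-- A vector all whose images under the Weyl group are positive or negative. -/
def Signed (d : Wt n) : Prop :=
  ∀ w ∈ weylGroup n, (∀ k, 0 ≤ psum (w d) k) ∨ (∀ k, psum (w d) k ≤ 0)

lemma signed_of_posRoots {α : Wt n} (h : α ∈ posRoots n) : Signed α := fun w hw => by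
  rcases isRoot_weyl hw h with h | h
  · exact Or.inl (psum_posRoots h)
  · right; intro k
    have := psum_posRoots h k
    rw [psum_neg] at this; linarith

lemma signed_neg {d : Wt n} (h : Signed d) : Signed (-d) := fun w hw => by
  simp only [map_neg, psum_neg]
  rcases h w hw with h | h
  · right; intro k; have := h k; linarith
  · left; intro k; have := h k; linarith

lemma signed_e (i : Fin n) : Signed (e (i : ℕ) : Wt n) := fun w hw => by
  have h := signed_of_posRoots (Finset.mem_union_right _ (mem_longPos.mpr ⟨i, rfl⟩)) w hw
  simp only [map_nsmul, psum_nsmul] at h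
  rcases h with h | h
  · left; intro k; have := h k; push_cast at this; linarith
  · right; intro k; have := h k; push_cast at this; linarith

/-- Convexity of orbits: a weight strictly between l and l - K d, with both ends in one orbit,
belongs to a lower orbit. Let w make the inner weight dominant. As w d has a sign, the image under w
of one of the two ends lies strictly above the inner weight, and that image is still below the
dominant weight of the orbit. -/
lemma domPart_lt_of_inside {l d : Wt n} (hd : Signed d) (hne : d ≠ 0) {j K : ℤ} (hj : 0 < j)
    (hjK : j < K) (hK : l - K • d ∈ weylOrbit l) :
    DomLT (domPart (l - j • d)) (domPart l) := by
  obtain ⟨w, hw, hwm⟩ := mem_weylOrbit.mp (domPart_mem (l - j • d))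
  have hd0 : w d ≠ 0 := by simpa using hne
  rcases hd w hw with h | h
  · have h1 : DomLE (w l) (domPart l) := by
      rw [← domPart_weyl hw l]; exact domLE_domPart _
    refine DomLT.trans_le ⟨?_, ?_⟩ h1
    · rw [← hwm, domLE_iff]
      intro k
      rw [map_sub, map_zsmul, psum_sub, psum_zsmul]
      have := mul_nonneg hj.le (h k)
      linarith
    · rw [← hwm, map_sub, map_zsmul]
      intro h'
      rw [sub_eq_self, smul_eq_zero] at h'
      exact h'.elim hj.ne' hd0
  · have h1 : DomLE (w (l - K • d)) (domPart l) := by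
      rw [← domPart_eq_of_mem hK, ← domPart_weyl hw (l - K • d)]; exact domLE_domPart _
    have h2 : w (l - K • d) = domPart (l - j • d) - (K - j) • w d := by
      rw [← hwm]; simp only [map_sub, map_zsmul]; module
    refine DomLT.trans_le ⟨?_, ?_⟩ h1
    · rw [h2, domLE_iff]
      intro k
      rw [psum_sub, psum_zsmul]
      have := mul_nonpos_of_nonneg_of_nonpos (sub_nonneg.mpr hjK.le) (h k)
      linarith
    · rw [h2]
      intro h'
      rw [eq_comm, sub_eq_self, smul_eq_zero] at h'
      exact h'.elim (by omega) hd0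

end
end Koornwinder

namespace Koornwinder
noncomputable section
open scoped Matrix
variable {n : ℕ}

/-! ### The vectors `ρ_l(λ)` and `ρ_m(λ)` -/

lemma sgn_neg {k : ℤ} (h : k ≠ 0) : sgn (-k) = - sgn k := by
  unfold sgn; split_ifs <;> omega

lemma sgn_of_nonneg {k : ℤ} (h : 0 ≤ k) : sgn k = 1 := if_pos h

lemma sgn_two_mul (k : ℤ) : sgn (2 * k) = sgn k := by
  unfold sgn; split_ifs <;> omega

lemma coroot_medium {α : Wt n} (h : α ∈ mediumPos n) : coroot α = α :=
  coroot_of_dot_two (dot_self_medium h)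

lemma two_smul_coroot_long {α : Wt n} (h : α ∈ longPos n) : 2 • coroot α = α := by
  obtain ⟨i, rfl⟩ := mem_longPos.mp h
  rw [coroot_long]

lemma coroot_simpleRefl {i : Fin n} {α : Wt n} (h : α ∈ posRoots n) (hne : α ≠ simpleRoot i) :
    coroot (simpleRefl i α) = simpleRefl i (coroot α) := by
  rcases Finset.mem_union.mp h with h | h
  · rw [coroot_medium h, coroot_medium (simpleRefl_medium h hne)]
  · have h2 := two_smul_coroot_long (simpleRefl_long h hne)
    conv_rhs at h2 => rw [← two_smul_coroot_long h, map_nsmul]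
    exact nsmul_right_injective two_ne_zero h2

lemma simpleRefl_coroot (i : Fin n) :
    simpleRefl i (coroot (simpleRoot i)) = - coroot (simpleRoot i) := by
  by_cases h : (i : ℕ) + 1 < n
  · rw [coroot_medium (simpleRoot_medium h), simpleRefl_simpleRoot]
  · have h2 := congrArg (simpleRefl i) (two_smul_coroot_long (simpleRoot_long h))
    rw [map_nsmul, simpleRefl_simpleRoot] at h2
    conv_rhs at h2 => rw [← two_smul_coroot_long (simpleRoot_long h), ← smul_neg]
    exact nsmul_right_injective two_ne_zero h2

/-- The sum of `sgn ⟨l, α⟩ α^∨` over a set `S` of roots. -/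
def rhoOf (S : Finset (Wt n)) (l : Wt n) : Wt n := ∑ α ∈ S, sgn (l ⬝ᵥ α) • coroot α

lemma rhoOf_erase {S : Finset (Wt n)} {i : Fin n} (hp : S ⊆ posRoots n)
    (hS : ∀ α ∈ S, α ≠ simpleRoot i → simpleRefl i α ∈ S) (l : Wt n) :
    rhoOf (S.erase (simpleRoot i)) (simpleRefl i l) =
      simpleRefl i (rhoOf (S.erase (simpleRoot i)) l) := by
  have hmem : ∀ α ∈ S.erase (simpleRoot i), simpleRefl i α ∈ S.erase (simpleRoot i) := by
    intro α hα
    rw [Finset.mem_erase] at hα ⊢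
    exact ⟨simpleRefl_ne_simpleRoot (hp hα.2), hS α hα.2 hα.1⟩
  rw [rhoOf, rhoOf, map_sum]
  refine Finset.sum_nbij' (simpleRefl i) (simpleRefl i) hmem hmem
    (fun α _ => simpleRefl_simpleRefl i α) (fun α _ => simpleRefl_simpleRefl i α) fun α hα => ?_
  rw [Finset.mem_erase] at hα
  rw [coroot_simpleRefl (hp hα.2) hα.1, map_zsmul, simpleRefl_simpleRefl, simpleRefl_dot]

/-- All roots but a_i are permuted by s_i. The term of a_i is compatible with s_i because its sign
changes when the pairing is nonzero. -/
lemma rhoOf_simpleRefl {S : Finset (Wt n)} {i : Fin n} (hp : S ⊆ posRoots n)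
    (hS : ∀ α ∈ S, α ≠ simpleRoot i → simpleRefl i α ∈ S) {l : Wt n}
    (hl : l ⬝ᵥ simpleRoot i ≠ 0) :
    rhoOf S (simpleRefl i l) = simpleRefl i (rhoOf S l) := by
  have h := rhoOf_erase hp hS l
  by_cases ha : simpleRoot i ∈ S
  · simp only [rhoOf] at h ⊢
    rw [← Finset.sum_erase_add _ _ ha, h, ← Finset.sum_erase_add _ _ ha, map_add, map_zsmul,
      simpleRefl_coroot, simpleRefl_dot_simple, sgn_neg hl]
    simp
  · rwa [Finset.erase_eq_of_notMem ha] at h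

/-- At a weight fixed by s_i the convention that the sign of 0 is 1 leaves a defect of two co-roots.
It makes the coordinates of γ_l differ by a factor t² there, so that γ_l is not fixed by s_i. -/
lemma rhoOf_of_orthogonal {S : Finset (Wt n)} {i : Fin n} (hp : S ⊆ posRoots n)
    (hS : ∀ α ∈ S, α ≠ simpleRoot i → simpleRefl i α ∈ S) {l : Wt n}
    (hl : l ⬝ᵥ simpleRoot i = 0) :
    rhoOf S l = simpleRefl i (rhoOf S l) +
      if simpleRoot i ∈ S then 2 • coroot (simpleRoot i) else 0 := by
  have h := rhoOf_erase hp hS l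
  rw [simpleRefl_eq_self_iff.mpr hl] at h
  split_ifs with ha
  · simp only [rhoOf] at h ⊢
    rw [← Finset.sum_erase_add _ _ ha, map_add, ← h, map_zsmul,
      simpleRefl_coroot, hl, sgn_of_nonneg le_rfl]
    module
  · rw [Finset.erase_eq_of_notMem ha] at h
    rw [← h, add_zero]

lemma rhoM_eq (l : Wt n) : rhoM l = rhoOf (mediumPos n) l := rfl
lemma rhoM_simpleRefl {i : Fin n} {l : Wt n} (hl : l ⬝ᵥ simpleRoot i ≠ 0) :
    rhoM (simpleRefl i l) = simpleRefl i (rhoM l) :=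
  rhoOf_simpleRefl Finset.subset_union_left (fun _ h => simpleRefl_medium h) hl

lemma rhoL_simpleRefl {i : Fin n} {l : Wt n} (hl : l ⬝ᵥ simpleRoot i ≠ 0) :
    rhoL (simpleRefl i l) = simpleRefl i (rhoL l) :=
  rhoOf_simpleRefl Finset.subset_union_right (fun _ h => simpleRefl_long h) hl

lemma sum_mediumPos {M : Type*} [AddCommMonoid M] (F : Wt n → M) :
    ∑ α ∈ mediumPos n, F α = ∑ j : Fin n, ∑ k : Fin n, if j < k then
      F (e (j : ℕ) - e (k : ℕ)) + F (e (j : ℕ) + e (k : ℕ)) else 0 := by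
  rw [mediumPos, Finset.sum_union, Finset.sum_image, Finset.sum_image, ← Finset.sum_add_distrib,
    Finset.sum_filter, Fintype.sum_prod_type]
  · rintro ⟨j, k⟩ h ⟨j', k'⟩ h' heq
    simp only [Finset.coe_filter, Finset.mem_univ, true_and, Set.mem_ofPred_eq] at h h' heq
    have h1 := congrFun heq j
    have h2 := congrFun heq k
    have h3 := congrFun heq j'
    simp only [Pi.add_apply, e_apply, Fin.val_inj] at h1 h2 h3
    rw [Prod.mk.injEq]
    have e1 : j = j' ∨ j = k' := by
      by_contra hc; push Not at hc
      simp [hc.1, hc.2, h.ne] at h1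
    have e2 : k = j' ∨ k = k' := by
      by_contra hc; push Not at hc
      simp [hc.1, hc.2, h.ne'] at h2
    rw [Fin.lt_def] at h h'
    simp only [Fin.ext_iff] at e1 e2 ⊢
    omega
  · rintro ⟨j, k⟩ h ⟨j', k'⟩ h' heq
    simp only [Finset.coe_filter, Finset.mem_univ, true_and, Set.mem_ofPred_eq] at h h' heq
    have h1 := congrFun heq j
    have h2 := congrFun heq k
    simp only [Pi.sub_apply, e_apply, Fin.val_inj] at h1 h2
    rw [Prod.mk.injEq]
    constructor
    · by_contra hc
      simp [hc, h.ne] at h1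
      split_ifs at h1
      omega
    · by_contra hc
      simp [hc, h.ne'] at h2
      split_ifs at h2
  · rw [Finset.disjoint_left]
    intro α h1 h2
    simp only [Finset.mem_image, Finset.mem_filter, Finset.mem_univ, true_and,
      Prod.exists] at h1 h2
    obtain ⟨j, k, hjk, rfl⟩ := h1
    obtain ⟨j', k', hjk', h⟩ := h2
    have h1 := congrFun h k
    simp only [Pi.sub_apply, Pi.add_apply, e_apply, Fin.val_inj, hjk.ne'] at h1
    simp at h1
    split_ifs at h1 <;> omega

lemma rhoM_apply (l : Wt n) (i : Fin n) : rhoM l i = ∑ k : Fin n,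
    if i < k then sgn (l i - l k) + sgn (l i + l k)
    else if k < i then - sgn (l k - l i) + sgn (l i + l k) else 0 := by
  have h : ∀ j k : Fin n, j < k →
      (sgn (l ⬝ᵥ (e (j : ℕ) - e (k : ℕ))) • coroot (e (j : ℕ) - e (k : ℕ) : Wt n) +
      sgn (l ⬝ᵥ (e (j : ℕ) + e (k : ℕ))) • coroot (e (j : ℕ) + e (k : ℕ) : Wt n)) i =
      (if j = i then sgn (l j - l k) + sgn (l j + l k) else 0) +
      (if k = i then - sgn (l j - l k) + sgn (l j + l k) else 0) := by
    intro j k hjk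
    rw [coroot_e_sub hjk.ne, coroot_e_add hjk.ne, dotProduct_sub, dotProduct_add, dot_e, dot_e]
    simp only [Pi.add_apply, Pi.smul_apply, Pi.sub_apply, e_apply, Fin.val_inj, smul_eq_mul,
      eq_comm (a := i)]
    split_ifs <;> ring
  rw [rhoM, sum_mediumPos]
  simp only [Finset.sum_apply]
  calc _ = ∑ j : Fin n, ∑ k : Fin n, ((if j = i then if j < k then
          sgn (l j - l k) + sgn (l j + l k) else 0 else 0) +
        (if k = i then if j < k then - sgn (l j - l k) + sgn (l j + l k) else 0 else 0)) := by
        refine Finset.sum_congr rfl fun j _ => Finset.sum_congr rfl fun k _ => ?_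
        by_cases hjk : j < k
        · rw [if_pos hjk, h j k hjk]; simp [hjk]
        · simp [hjk]
    _ = _ := by
        simp only [Finset.sum_add_distrib]
        have e1 : ∀ j : Fin n, ∑ k : Fin n, (if j = i then if j < k then
            sgn (l j - l k) + sgn (l j + l k) else 0 else 0) = if j = i then ∑ k : Fin n,
              if j < k then sgn (l j - l k) + sgn (l j + l k) else 0 else 0 := by
          intro j; split_ifs <;> simp
        simp_rw [e1]
        simp only [Finset.sum_ite_eq', Finset.mem_univ, if_true, ← Finset.sum_add_distrib]
        refine Finset.sum_congr rfl fun k _ => ?_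
        rcases lt_trichotomy i k with h | h | h
        · simp [h, h.not_gt]
        · simp [h]
        · simp [h, h.not_gt, add_comm (l i)]

lemma rhoL_apply (l : Wt n) (i : Fin n) : rhoL l i = sgn (l i) := by
  rw [rhoL, longPos, Finset.sum_image]
  · simp only [dotProduct_smul, dot_e, coroot_long, Finset.sum_apply, Pi.smul_apply, e_apply,
      Fin.val_inj, smul_eq_mul, mul_ite, mul_one, mul_zero, Finset.sum_ite_eq, Finset.mem_univ,
      if_true]
    rw [two_nsmul, ← two_mul, sgn_two_mul]
  · intro a _ b _ h
    have := congrFun h a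
    by_contra hc
    simp [e_apply, Fin.val_inj, hc] at this

/-- The coordinates of `ρ_m` at dominant weights. -/
def rhoDom (n : ℕ) : Wt n := fun i => 2 * (n - 1 - i)

lemma rhoM_of_dominant {l : Wt n} (hl : IsDominant l) : rhoM l = rhoDom n := by
  ext i
  rw [isDominant_iff] at hl
  have h : ∀ k : Fin n, (if i < k then sgn (l i - l k) + sgn (l i + l k)
      else if k < i then - sgn (l k - l i) + sgn (l i + l k) else 0) =
      if i < k then 2 else 0 := by
    intro k
    have h1 := sgn_of_nonneg (add_nonneg (hl.2 i) (hl.2 k))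
    split_ifs with hk hk'
    · rw [h1, sgn_of_nonneg (sub_nonneg.mpr (hl.1 hk.le))]; rfl
    · rw [h1, sgn_of_nonneg (sub_nonneg.mpr (hl.1 hk'.le))]; rfl
    · rfl
  rw [rhoM_apply, Finset.sum_congr rfl fun k _ => h k, ← Finset.sum_filter, Finset.sum_const,
    rhoDom]
  have : Finset.univ.filter (fun k => i < k) = Finset.Ioi i := by ext; simp
  rw [this, Fin.card_Ioi, nsmul_eq_mul]
  have := i.2
  push_cast [Nat.sub_sub, show 1 + (i : ℕ) ≤ n by omega]
  ring

lemma rhoL_of_dominant {l : Wt n} (hl : IsDominant l) : rhoL l = fun _ => 1 := by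
  ext i
  rw [rhoL_apply, sgn_of_nonneg ((isDominant_iff.mp hl).2 i)]

/-! ### The spectrum -/

variable {p : Params}

/-- The value of `x^m` at `γ_l`. -/
def gamU (p : Params) (l m : Wt n) : ℂˣ :=
  (p.t0 * p.tn) ^ (rhoL l ⬝ᵥ m) * p.t ^ (rhoM l ⬝ᵥ m) * p.q ^ (l ⬝ᵥ m)

lemma prod_zpow_eq (a : ℂˣ) (l m : Wt n) : ∏ i, (a ^ l i) ^ m i = a ^ (l ⬝ᵥ m) := by
  have : ∀ s : Finset (Fin n), ∏ i ∈ s, (a ^ l i) ^ m i = a ^ (∑ i ∈ s, l i * m i) := by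
    intro s
    induction s using Finset.cons_induction with
    | empty => simp
    | cons i s hi ih => rw [Finset.prod_cons, Finset.sum_cons, zpow_add, ih, zpow_mul]
  exact this _

lemma monoVal_gam (l m : Wt n) : monoVal (gam p l) m = gamU p l m := by
  have : (∏ i, gam p l i ^ m i) = gamU p l m := by
    simp only [gam, gamU, mul_zpow, Finset.prod_mul_distrib, prod_zpow_eq]
  rw [monoVal, this]

lemma gamU_e (l : Wt n) (i : Fin n) : gamU p l (e (i : ℕ)) = gam p l i := by
  simp only [gamU, dot_e, gam, mul_zpow]

lemma gamU_add (l m m' : Wt n) : gamU p l (m + m') = gamU p l m * gamU p l m' := by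
  simp only [gamU, dotProduct_add, zpow_add]
  generalize (p.t0 * p.tn) ^ (rhoL l ⬝ᵥ m) = a
  generalize (p.t0 * p.tn) ^ (rhoL l ⬝ᵥ m') = a'
  rw [mul_mul_mul_comm a, mul_mul_mul_comm (a * _)]

lemma gamU_neg (l m : Wt n) : gamU p l (-m) = (gamU p l m)⁻¹ := by
  simp only [gamU, dotProduct_neg, zpow_neg, mul_inv]

lemma gamU_sub (l m m' : Wt n) : gamU p l (m - m') = gamU p l m / gamU p l m' := by
  rw [sub_eq_add_neg, gamU_add, gamU_neg, div_eq_mul_inv]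

lemma gamU_simpleRefl {i : Fin n} {l : Wt n} (hl : l ⬝ᵥ simpleRoot i ≠ 0) (m : Wt n) :
    gamU p (simpleRefl i l) m = gamU p l (simpleRefl i m) := by
  simp only [gamU, rhoM_simpleRefl hl, rhoL_simpleRefl hl, simpleRefl_dot]

/-- A single w serves for all three vectors because an ascending step has nonzero pairing with a_i,
where both ρ commute with s_i. -/
lemma exists_weyl_rho (l : Wt n) : ∃ w ∈ weylGroup n, l = w (domPart l) ∧
    rhoL l = w (fun _ => 1) ∧ rhoM l = w (rhoDom n) := by
  induction l using weight_induction with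
  | dom l hl =>
    exact ⟨1, one_mem _, (domPart_of_dominant hl).symm, rhoL_of_dominant hl,
      rhoM_of_dominant hl⟩
  | step m i h ih =>
    obtain ⟨w, hw, h1, h2, h3⟩ := ih
    refine ⟨simpleRefl i * w, mul_mem (simpleRefl_mem i) hw, ?_, ?_, ?_⟩
    · rw [LinearEquiv.mul_apply, domPart_weyl (simpleRefl_mem i), ← h1]
    · rw [rhoL_simpleRefl h.ne', h2]; rfl
    · rw [rhoM_simpleRefl h.ne', h3]; rfl

/-- The value of the spectrum at a dominant weight: `t_0 t_n t^{2j} q^k`. -/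
def gVal (p : Params) (j k : ℤ) : ℂˣ := p.t0 * p.tn * p.t ^ (2 * j) * p.q ^ k

/-- `γ_l` is a signed permutation of `γ` at the dominant weight in the orbit of `l`. -/
lemma exists_gam_eq (p : Params) (l : Wt n) : ∃ (π : Equiv.Perm (Fin n)) (s : Fin n → ℤˣ),
    l = signedPerm π s (domPart l) ∧
    ∀ i, gam p l i = gVal p (n - 1 - (π⁻¹ i : Fin n)) (domPart l (π⁻¹ i)) ^ (s i : ℤ) := by
  obtain ⟨w, hw, h1, h2, h3⟩ := exists_weyl_rho l
  obtain ⟨π, s, rfl⟩ := exists_signedPerm hw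
  refine ⟨π, s, h1, fun i => ?_⟩
  have e1 : l i = s i * domPart l (π⁻¹ i) := by
    rw [← signedPerm_apply, ← h1]
  have e2 : rhoL l i = s i := by rw [h2, signedPerm_apply, mul_one]
  have e3 : rhoM l i = s i * (2 * (n - 1 - (π⁻¹ i : Fin n))) := by rw [h3]; rfl
  rw [gam, e1, e2, e3, gVal]
  simp only [mul_zpow, ← zpow_mul, mul_comm (s i : ℤ)]

/-- The quotient of two such values is an even power of t times a power of q. The exponent 2(j' - j)
has 0 ≤ j' - j ≤ n - 1, exactly the range covered by the conditions on t and q. -/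
lemma gVal_inj (hp : p.Generic n) {j j' : Fin n} {k k' : ℤ}
    (h : gVal p (n - 1 - j) k = gVal p (n - 1 - j') k') : j = j' ∧ k = k' := by
  wlog hjj : j ≤ j' generalizing j j' k k'
  · obtain ⟨h1, h2⟩ := this h.symm (le_of_not_ge hjj)
    exact ⟨h1.symm, h2.symm⟩
  have h1 : p.t ^ (2 * ((j' : ℤ) - j)) = p.q ^ (k' - k) := by
    have e1 : p.t ^ (2 * ((n : ℤ) - 1 - j)) * p.q ^ k =
        p.t ^ (2 * ((n : ℤ) - 1 - j')) * p.q ^ k' := by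
      simp only [gVal, mul_assoc] at h
      simpa using h
    rw [show 2 * ((j' : ℤ) - j) = 2 * ((n : ℤ) - 1 - j) - 2 * ((n : ℤ) - 1 - j') by ring,
      zpow_sub, zpow_sub, ← div_eq_mul_inv, ← div_eq_mul_inv, div_eq_div_iff_mul_eq_mul, e1,
      mul_comm]
  rcases eq_or_lt_of_le hjj with rfl | hlt
  · refine ⟨rfl, ?_⟩
    by_contra hk
    refine hp.q_pow_ne_one (k' - k) (by omega) ?_
    rw [← h1]; simp
  · exfalso
    have hlt' : (j : ℕ) < j' := hlt
    refine hp.t_pow_ne (j' - j) (by omega) (by have := j'.2; omega) (k' - k) ?_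
    rw [← h1, ← zpow_natCast]
    congr 1
    push_cast [hlt'.le]; ring

/-- The product is (t_0 t_n)² t^{2i} q^{k + k'} with 0 ≤ i ≤ 2n - 2. This excludes coincidences
between a coordinate of the spectrum and the inverse of a coordinate, including γ_i² = 1. -/
lemma gVal_mul_ne (hp : p.Generic n) (j j' : Fin n) (k k' : ℤ) :
    gVal p (n - 1 - j) k * gVal p (n - 1 - j') k' ≠ 1 := by
  intro h
  have hj := j.2
  have hj' := j'.2
  refine hp.t0_tn_pow_ne ((n - 1 - j) + (n - 1 - j')) (by omega) (-(k + k')) ?_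
  rw [zpow_neg, ← mul_eq_one_iff_eq_inv, ← h, ← zpow_natCast p.t]
  have : ((2 * ((n - 1 - j) + (n - 1 - j')) : ℕ) : ℤ) =
      2 * ((n : ℤ) - 1 - j) + 2 * ((n : ℤ) - 1 - j') := by omega
  rw [this, gVal, gVal, zpow_add, zpow_add, pow_two]
  ac_rfl

lemma gVal_zpow_inj (hp : p.Generic n) {j j' : Fin n} {k k' : ℤ} {s s' : ℤˣ}
    (h : gVal p (n - 1 - j) k ^ (s : ℤ) = gVal p (n - 1 - j') k' ^ (s' : ℤ)) :
    s = s' ∧ j = j' ∧ k = k' := by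
  rcases Int.units_eq_one_or s with rfl | rfl <;> rcases Int.units_eq_one_or s' with rfl | rfl
  · simp only [Units.val_one, zpow_one] at h
    exact ⟨rfl, gVal_inj hp h⟩
  · simp only [Units.val_one, zpow_one, Units.val_neg, zpow_neg] at h
    exact absurd (mul_eq_one_iff_eq_inv.mpr h) (gVal_mul_ne hp _ _ _ _)
  · simp only [Units.val_one, zpow_one, Units.val_neg, zpow_neg] at h
    exact absurd (mul_eq_one_iff_eq_inv.mpr h.symm) (gVal_mul_ne hp _ _ _ _)
  · simp only [Units.val_one, Units.val_neg, zpow_neg, zpow_one, inv_inj] at h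
    exact ⟨rfl, gVal_inj hp h⟩

/-- The spectrum separates weights. -/
lemma gam_injective (hp : p.Generic n) {l l' : Wt n} (h : gam p l = gam p l') : l = l' := by
  obtain ⟨π, s, h1, h2⟩ := exists_gam_eq p l
  obtain ⟨π', s', h1', h2'⟩ := exists_gam_eq p l'
  ext i
  have h3 := congrFun h i
  rw [h2, h2'] at h3
  obtain ⟨hs, -, hd⟩ := gVal_zpow_inj hp h3
  rw [h1, h1', signedPerm_apply, signedPerm_apply, hs, hd]

lemma gam_ne (hp : p.Generic n) (l : Wt n) {i j : Fin n} (hij : i ≠ j) :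
    gam p l i ≠ gam p l j := by
  obtain ⟨π, s, -, h2⟩ := exists_gam_eq p l
  rw [h2, h2]
  intro h
  exact hij (π⁻¹.injective (gVal_zpow_inj hp h).2.1)

lemma gam_sq_ne (hp : p.Generic n) (l : Wt n) (i : Fin n) : gam p l i ^ 2 ≠ 1 := by
  obtain ⟨π, s, -, h2⟩ := exists_gam_eq p l
  rw [h2]
  intro h
  refine gVal_mul_ne hp (π⁻¹ i) (π⁻¹ i) (domPart l (π⁻¹ i)) (domPart l (π⁻¹ i)) ?_
  rw [← pow_two]
  rcases Int.units_eq_one_or (s i) with hs | hs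
  · simpa [hs] using h
  · simpa [hs] using h

lemma gamU_simpleRoot_ne (hp : p.Generic n) (l : Wt n) (i : Fin n) :
    gamU p l (simpleRoot i) ≠ 1 := by
  by_cases h : (i : ℕ) + 1 < n
  · rw [simpleRoot_of_lt h, gamU_sub, gamU_e]
    have := gamU_e (p := p) l ⟨i + 1, h⟩
    rw [this, Ne, div_eq_one]
    exact gam_ne hp l (by simp [Fin.ext_iff])
  · rw [simpleRoot_of_last h, two_nsmul, gamU_add, gamU_e, ← pow_two]
    exact gam_sq_ne hp l i

/-- `γ_l` and `γ_{l'}` share all the values `y + y⁻¹` only if the weights share their orbit. -/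
lemma domPart_eq_of_gam (hp : p.Generic n) {l l' : Wt n}
    (h : ∀ i, ∃ j, gam p l' j = gam p l i ∨ gam p l' j = (gam p l i)⁻¹) :
    domPart l = domPart l' := by
  obtain ⟨π, s, h1, h2⟩ := exists_gam_eq p l
  obtain ⟨π', s', h1', h2'⟩ := exists_gam_eq p l'
  ext i
  obtain ⟨j, hj⟩ := h (π i)
  have hi : π⁻¹ (π i) = i := π.symm_apply_apply i
  rw [h2, h2', ← zpow_neg, ← Units.val_neg, hi] at hj
  rcases hj with hj | hj
  · obtain ⟨-, h3, h4⟩ := gVal_zpow_inj hp hj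
    rw [← h4, h3]
  · obtain ⟨-, h3, h4⟩ := gVal_zpow_inj hp hj
    rw [← h4, h3]

/-- At a weight fixed by `s_i`, the value of `x^{a_i}` is `t²` or `(t_0 t_n)²`. -/
lemma gam_of_orthogonal_of_lt {i : Fin n} (h : (i : ℕ) + 1 < n) {l : Wt n}
    (hl : l ⬝ᵥ simpleRoot i = 0) : gam p l i = p.t ^ 2 * gam p l ⟨i + 1, h⟩ := by
  have h1 : l i = l ⟨i + 1, h⟩ := by rw [dot_simple_of_lt h] at hl; omega
  have h2 := rhoOf_of_orthogonal (S := mediumPos n) Finset.subset_union_left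
    (fun _ h => simpleRefl_medium h) hl
  rw [if_pos (simpleRoot_medium h), ← rhoM_eq] at h2
  have h3 := congrFun h2 i
  rw [Pi.add_apply, simpleRefl_of_lt h, Equiv.swap_apply_left, coroot_simple_of_lt h] at h3
  have h4 : rhoM l i = rhoM l ⟨i + 1, h⟩ + 2 := by
    rw [h3]; simp [e_apply]
  rw [gam, gam, h4, h1, rhoL_apply, rhoL_apply, h1, zpow_add]
  generalize p.t ^ rhoM l ⟨i + 1, h⟩ = A
  generalize p.q ^ l ⟨i + 1, h⟩ = B
  norm_cast
  ac_rfl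

lemma gam_of_orthogonal_of_last {i : Fin n} (h : ¬ (i : ℕ) + 1 < n) {l : Wt n}
    (hl : l ⬝ᵥ simpleRoot i = 0) : gam p l i = p.t0 * p.tn := by
  have h1 : l i = 0 := by rw [dot_simple_of_last h] at hl; omega
  have h2 := rhoOf_of_orthogonal (S := mediumPos n) Finset.subset_union_left
    (fun _ h => simpleRefl_medium h) hl
  rw [if_neg (fun hc => medium_not_long hc (simpleRoot_long h)), ← rhoM_eq, add_zero] at h2
  have h3 := congrFun h2 i
  rw [simpleRefl_of_last h, if_pos rfl] at h3
  have h4 : rhoM l i = 0 := by omega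
  rw [gam, h4, h1, rhoL_apply, h1, sgn_of_nonneg le_rfl]
  simp

end
end Koornwinder

namespace Koornwinder
noncomputable section
open scoped Matrix

/-! ### Braid relations for operators of Demazure–Lusztig type -/

section DemazureLusztig

variable {K : Type*} [Field K]

/-- The operator `f ↦ t f + t⁻¹ v (s f - f)`. -/
def dl (t v : K) (s : K →+* K) (f : K) : K := t * f + t⁻¹ * (v * (s f - f))

lemma dl_eq {t : K} (ht : t ≠ 0) (v : K) (s : K →+* K) (f : K) :
    dl t v s f = t⁻¹ * ((t ^ 2 - v) * f + v * s f) := by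
  unfold dl; field_simp; ring

/-- The only input about v is its sum with its reflection; the precise shape of v plays no role. -/
lemma dl_quadratic {t v : K} (ht : t ≠ 0) {s : K →+* K} (hs : ∀ f, s (s f) = f) (hst : s t = t)
    (hv : s v = 1 + t ^ 2 - v) (f : K) :
    dl t v s (dl t v s f) = (t - t⁻¹) * dl t v s f + f := by
  simp only [dl, map_add, map_mul, map_sub, map_inv₀, hst, hv, hs]
  field_simp
  ring

lemma dl_comm {t v u w : K} {s r : K →+* K} (hsr : ∀ f, s (r f) = r (s f)) (hrt : r t = t)
    (hsu : s u = u) (hrv : r v = v) (hsw : s w = w) (f : K) :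
    dl t v s (dl u w r f) = dl u w r (dl t v s f) := by
  simp only [dl, map_add, map_mul, map_sub, map_inv₀, hsr, hrt, hsu, hrv, hsw]
  ring

/-- Here p, q, m stand for the values of v at the two simple roots and their sum. After expanding
both sides in the images of f under the group generated by s and r, the difference is a multiple of
the single relation `hR`. -/
lemma dl_braid_three {t p q m : K} (ht : t ≠ 0) {s r : K →+* K} (hs : ∀ f, s (s f) = f)
    (hr : ∀ f, r (r f) = f) (hb : ∀ f, s (r (s f)) = r (s (r f))) (hst : s t = t)
    (hrt : r t = t) (hsp : s p = 1 + t ^ 2 - p) (hrq : r q = 1 + t ^ 2 - q) (hsq : s q = m)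
    (hrp : r p = m) (hR : (t ^ 2 - m) * (p - 1) + (t ^ 2 - q) * (m - p) = 0) (f : K) :
    dl t p s (dl t q r (dl t p s f)) = dl t q r (dl t p s (dl t q r f)) := by
  have hsm : s m = q := by rw [← hsq, hs]
  have hrm : r m = p := by rw [← hrp, hr]
  simp only [dl_eq ht, map_add, map_mul, map_sub, map_inv₀, map_pow, hst, hrt, hsp, hrq,
    hsq, hrp, hsm, hrm, hs, hr, hb]
  linear_combination (t⁻¹ ^ 3 * (p * s f - q * r f + (q - p) * f)) * hR

/-- The analogue for a rank-two system of type C_2: p, p' belong to the two positive roots of one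
length, q, q' to those of the other length, and again one relation `hR` accounts for all
coefficients. -/
lemma dl_braid_four {t p p' u q q' : K} (ht : t ≠ 0) (hu : u ≠ 0) {s r : K →+* K}
    (hs : ∀ f, s (s f) = f) (hr : ∀ f, r (r f) = f)
    (hb : ∀ f, s (r (s (r f))) = r (s (r (s f)))) (hst : s t = t) (hrt : r t = t)
    (hsu : s u = u) (hru : r u = u) (hsp : s p = 1 + t ^ 2 - p) (hrp : r p = p')
    (hsp' : s p' = p') (hrq : r q = 1 + u ^ 2 - q) (hsq : s q = q') (hrq' : r q' = q')
    (hR : (t ^ 2 - p') * (q' - 1) + (u ^ 2 - q') * (p - 1) + (u ^ 2 - q) * (p' - p) = 0)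
    (f : K) :
    dl t p s (dl u q r (dl t p s (dl u q r f))) =
      dl u q r (dl t p s (dl u q r (dl t p s f))) := by
  have hsq' : s q' = q := by rw [← hsq, hs]
  have hrp' : r p' = p := by rw [← hrp, hr]
  simp only [dl_eq ht, dl_eq hu, map_add, map_mul, map_sub, map_inv₀, map_pow, map_one, hst, hrt,
    hsu, hru, hsp, hrq, hsq, hrp, hsp', hrq', hsq', hrp', hs, hr, hb]
  linear_combination (t⁻¹ ^ 2 * u⁻¹ ^ 2 * (p * q' * s (r f) - q * p' * r (s f) +
    p * (q - q') * s f + q * (p' - p) * r f)) * hR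

/-- The braid relation of length three for `v = (1 - t² z) / (1 - z)`. -/
lemma dl_braid_medium {t a b : K} (ht : t ≠ 0) {s r : K →+* K} (hs : ∀ f, s (s f) = f)
    (hr : ∀ f, r (r f) = f) (hb : ∀ f, s (r (s f)) = r (s (r f))) (hst : s t = t)
    (hrt : r t = t) (ha0 : a ≠ 0) (hb0 : b ≠ 0) (ha1 : a ≠ 1) (hb1 : b ≠ 1) (hab : a * b ≠ 1)
    (hsa : s a = a⁻¹) (hsb : s b = a * b) (hra : r a = a * b) (hrb : r b = b⁻¹) (f : K) :
    dl t ((1 - t ^ 2 * a) / (1 - a)) s (dl t ((1 - t ^ 2 * b) / (1 - b)) r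
        (dl t ((1 - t ^ 2 * a) / (1 - a)) s f)) =
      dl t ((1 - t ^ 2 * b) / (1 - b)) r (dl t ((1 - t ^ 2 * a) / (1 - a)) s
        (dl t ((1 - t ^ 2 * b) / (1 - b)) r f)) := by
  have h1 : 1 - a ≠ 0 := sub_ne_zero.mpr ha1.symm
  have h2 : 1 - b ≠ 0 := sub_ne_zero.mpr hb1.symm
  have h3 : 1 - a * b ≠ 0 := sub_ne_zero.mpr hab.symm
  have h4 : a - 1 ≠ 0 := sub_ne_zero.mpr ha1
  have h5 : b - 1 ≠ 0 := sub_ne_zero.mpr hb1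
  refine dl_braid_three (m := (1 - t ^ 2 * (a * b)) / (1 - a * b)) ht hs hr hb hst hrt
    ?_ ?_ ?_ ?_ ?_ f
  · simp only [map_div₀, map_sub, map_mul, map_pow, map_one, hst, hsa]
    field_simp; ring
  · simp only [map_div₀, map_sub, map_mul, map_pow, map_one, hrt, hrb]
    field_simp; ring
  · simp only [map_div₀, map_sub, map_mul, map_pow, map_one, hst, hsb]
  · simp only [map_div₀, map_sub, map_mul, map_pow, map_one, hrt, hra]
  · field_simp; ring

/-- The braid relation of length four for `v = (1 - t² x/y) / (1 - x/y)` and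
`w = (1 + c y - u² y²) / (1 - y²)`. -/
lemma dl_braid_long {t u c x y : K} (ht : t ≠ 0) (hu : u ≠ 0) {s r : K →+* K}
    (hs : ∀ f, s (s f) = f) (hr : ∀ f, r (r f) = f)
    (hb : ∀ f, s (r (s (r f))) = r (s (r (s f)))) (hst : s t = t) (hrt : r t = t)
    (hsu : s u = u) (hru : r u = u) (hsc : s c = c) (hrc : r c = c)
    (hx0 : x ≠ 0) (hy0 : y ≠ 0) (hxy : x ≠ y) (hxy' : x * y ≠ 1) (hx : x ^ 2 ≠ 1)
    (hy : y ^ 2 ≠ 1) (hsx : s x = y) (hrx : r x = x) (hry : r y = y⁻¹) (f : K) :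
    dl t ((1 - t ^ 2 * (x / y)) / (1 - x / y)) s
        (dl u ((1 + c * y - u ^ 2 * y ^ 2) / (1 - y ^ 2)) r
        (dl t ((1 - t ^ 2 * (x / y)) / (1 - x / y)) s
        (dl u ((1 + c * y - u ^ 2 * y ^ 2) / (1 - y ^ 2)) r f))) =
      dl u ((1 + c * y - u ^ 2 * y ^ 2) / (1 - y ^ 2)) r
        (dl t ((1 - t ^ 2 * (x / y)) / (1 - x / y)) s
        (dl u ((1 + c * y - u ^ 2 * y ^ 2) / (1 - y ^ 2)) r
        (dl t ((1 - t ^ 2 * (x / y)) / (1 - x / y)) s f))) := by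
  have hsy : s y = x := by rw [← hsx, hs]
  have h1 : y - x ≠ 0 := sub_ne_zero.mpr hxy.symm
  have h1' : x - y ≠ 0 := sub_ne_zero.mpr hxy
  have h2 : 1 - x * y ≠ 0 := sub_ne_zero.mpr hxy'.symm
  have h3 : 1 - x ^ 2 ≠ 0 := sub_ne_zero.mpr hx.symm
  have h4 : 1 - y ^ 2 ≠ 0 := sub_ne_zero.mpr hy.symm
  have h5 : y ^ 2 - 1 ≠ 0 := sub_ne_zero.mpr hy
  -- The auxiliary values are the images of the two functions under the other reflection, namely v
  -- with x/y replaced by x y and w with y replaced by x.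
  refine dl_braid_four (p' := (1 - t ^ 2 * (x * y)) / (1 - x * y))
    (q' := (1 + c * x - u ^ 2 * x ^ 2) / (1 - x ^ 2)) ht hu hs hr hb hst hrt hsu hru
    ?_ ?_ ?_ ?_ ?_ ?_ ?_ f
  · simp only [map_div₀, map_sub, map_mul, map_pow, map_one, hst, hsx, hsy]
    field_simp; ring
  · simp only [map_div₀, map_sub, map_mul, map_pow, map_one, hrt, hrx, hry]
    simp only [div_inv_eq_mul]
  · simp only [map_div₀, map_sub, map_mul, map_pow, map_one, hst, hsx, hsy, mul_comm y x]
  · simp only [map_div₀, map_sub, map_add, map_mul, map_pow, map_one, hru, hrc, hry]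
    field_simp; ring
  · simp only [map_div₀, map_sub, map_add, map_mul, map_pow, map_one, hsu, hsc, hsy]
  · simp only [map_div₀, map_sub, map_add, map_mul, map_pow, map_one, hru, hrc, hrx]
  · field_simp; ring

end DemazureLusztig

/-! ### Rational functions and the operators `T_i` -/

variable {n : ℕ} {p : Params}

lemma toRat_injective : Function.Injective (toRat : Laurent n → RatFn n) :=
  IsFractionRing.injective (Laurent n) (RatFn n)

lemma mono_injective : Function.Injective (mono : Wt n → Laurent n) := fun a b h => by
  by_contra hne
  have := congrArg (fun f : Laurent n => f.coeff a) h
  simp [mono, Ne.symm hne] at this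

lemma mono_add (a b : Wt n) : (mono (a + b) : Laurent n) = mono a * mono b := by
  simp [mono, AddMonoidAlgebra.single_mul_single]

lemma mono_zero : (mono 0 : Laurent n) = 1 := rfl

lemma monoR_add (a b : Wt n) : (monoR (a + b) : RatFn n) = monoR a * monoR b := by
  rw [monoR, mono_add, map_mul]; rfl

lemma monoR_zero : (monoR 0 : RatFn n) = 1 := by rw [monoR, mono_zero, map_one]

lemma monoR_ne_zero (a : Wt n) : (monoR a : RatFn n) ≠ 0 := fun h => by
  have := monoR_add a (-a)
  rw [h, add_neg_cancel, monoR_zero, zero_mul] at this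
  exact one_ne_zero this

lemma monoR_neg (a : Wt n) : (monoR (-a) : RatFn n) = (monoR a)⁻¹ := by
  refine eq_inv_of_mul_eq_one_left ?_
  rw [← monoR_add, neg_add_cancel, monoR_zero]

lemma monoR_sub (a b : Wt n) : (monoR (a - b) : RatFn n) = monoR a / monoR b := by
  rw [sub_eq_add_neg, monoR_add, monoR_neg, div_eq_mul_inv]

lemma monoR_nsmul (k : ℕ) (a : Wt n) : (monoR (k • a) : RatFn n) = monoR a ^ k := by
  induction k with
  | zero => simp [monoR_zero]
  | succ k ih => rw [succ_nsmul, monoR_add, ih, pow_succ]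

lemma monoR_injective : Function.Injective (monoR : Wt n → RatFn n) :=
  toRat_injective.comp mono_injective

/-- The constants. -/
def cst (c : ℂ) : RatFn n := algebraMap ℂ (RatFn n) c

lemma cst_mul_eq_smul (c : ℂ) (f : RatFn n) : cst c * f = c • f := (Algebra.smul_def c f).symm

lemma cst_unit_ne_zero (c : ℂˣ) : (cst (c : ℂ) : RatFn n) ≠ 0 := by
  simp [cst]

lemma toRat_smul_mono (c : ℂ) (a : Wt n) : toRat (c • mono a) = cst c * monoR a := by
  rw [map_smul, cst_mul_eq_smul]; rfl

lemma cst_mul_monoR_inj {c d : ℂ} (hc : c ≠ 0) {a b : Wt n}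
    (h : (cst c * monoR a : RatFn n) = cst d * monoR b) : a = b := by
  rw [← toRat_smul_mono, ← toRat_smul_mono] at h
  have h1 := congrArg (fun f : Laurent n => f.coeff a) (toRat_injective h)
  by_contra hne
  simp [mono, Ne.symm hne, hc] at h1

/-- The extension of an automorphism of `𝒜` to `ℂ(x)`. -/
def ext (σ : Laurent n ≃ₐ[ℂ] Laurent n) : RatFn n ≃ₐ[ℂ] RatFn n :=
  IsFractionRing.algEquivOfAlgEquiv (K := RatFn n) (L := RatFn n) σ

lemma extOp_apply (σ : Laurent n ≃ₐ[ℂ] Laurent n) (f : RatFn n) : extOp σ f = ext σ f := rfl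

lemma ext_toRat (σ : Laurent n ≃ₐ[ℂ] Laurent n) (f : Laurent n) :
    ext σ (toRat f) = toRat (σ f) :=
  IsFractionRing.algEquivOfAlgEquiv_algebraMap σ f

lemma ratFn_induction (f : RatFn n) : ∃ a b : Laurent n, f = toRat a / toRat b := by
  obtain ⟨a, b, -, h⟩ := IsFractionRing.div_surjective (A := Laurent n) f
  exact ⟨a, b, h.symm⟩

lemma ext_trans (σ τ : Laurent n ≃ₐ[ℂ] Laurent n) (f : RatFn n) :
    ext (σ.trans τ) f = ext τ (ext σ f) := by
  obtain ⟨a, b, rfl⟩ := ratFn_induction f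
  simp [map_div₀, ext_toRat]

lemma ext_refl (f : RatFn n) : ext AlgEquiv.refl f = f := by
  obtain ⟨a, b, rfl⟩ := ratFn_induction f
  simp [map_div₀, ext_toRat]

lemma ext_cst (σ : Laurent n ≃ₐ[ℂ] Laurent n) (c : ℂ) : ext σ (cst c) = cst c :=
  (ext σ).commutes c

lemma weylAct_mono (w : Wt n ≃ₗ[ℤ] Wt n) (a : Wt n) : weylAct w (mono a) = mono (w a) := by
  simp [weylAct, mono]

lemma ext_weyl_monoR (w : Wt n ≃ₗ[ℤ] Wt n) (a : Wt n) :
    ext (weylAct w) (monoR a) = monoR (w a) := by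
  rw [monoR, ext_toRat, weylAct_mono]; rfl

/-- Automorphisms of `𝒜` that agree on monomials are equal. -/
lemma laurent_aut_ext {σ τ : Laurent n ≃ₐ[ℂ] Laurent n}
    (h : ∀ a, σ (mono a) = τ (mono a)) : σ = τ := by
  have : (σ : Laurent n →ₐ[ℂ] Laurent n) = τ :=
    AddMonoidAlgebra.algHom_ext (fun a => h a) (by ext)
  exact AlgEquiv.coe_toAlgHom_injective this

lemma weylAct_mul (w w' : Wt n ≃ₗ[ℤ] Wt n) :
    weylAct (w * w') = (weylAct w').trans (weylAct w) :=
  laurent_aut_ext fun a => by simp [weylAct_mono]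

lemma weylAct_one : weylAct (1 : Wt n ≃ₗ[ℤ] Wt n) = AlgEquiv.refl :=
  laurent_aut_ext fun a => by simp [weylAct_mono]

lemma ext_weyl_mul (w w' : Wt n ≃ₗ[ℤ] Wt n) (f : RatFn n) :
    ext (weylAct (w * w')) f = ext (weylAct w) (ext (weylAct w') f) := by
  rw [weylAct_mul, ext_trans]

lemma shiftAct_mono (q : ℂˣ) (ν a : Wt n) :
    shiftAct q ν (mono a) = ((q ^ (ν ⬝ᵥ a) : ℂˣ) : ℂ) • mono a := by
  simp [shiftAct, shiftHom, mono]

lemma affineReflAct_mono (q : ℂˣ) (a : Wt n) : affineReflAct q (mono a) =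
    ((q ^ ((e 0 : Wt n) ⬝ᵥ a) : ℂˣ) : ℂ) • mono (signFlip 0 a) := by
  rw [affineReflAct, AlgEquiv.trans_apply, shiftAct_mono, map_smul, weylAct_mono]

lemma ext_affine_monoR (q : ℂˣ) (a : Wt n) : ext (affineReflAct q) (monoR a) =
    cst ((q ^ ((e 0 : Wt n) ⬝ᵥ a) : ℂˣ) : ℂ) * monoR (signFlip 0 a) := by
  rw [monoR, ext_toRat, affineReflAct_mono, toRat_smul_mono]

/-! ### The multiplicity function and the functions `v_β` -/

lemma neg_dot_neg' (a : Wt n) : (-a) ⬝ᵥ (-a) = a ⬝ᵥ a := by simp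

lemma dot_self_short {α : Wt n} (h : α ∈ shortPos n) : α ⬝ᵥ α = 1 := by
  obtain ⟨i, rfl⟩ := mem_shortPos.mp h
  simp [e_dot_e]

lemma dot_self_of_long {α : Wt n} (h : α ∈ longPos n ∨ -α ∈ longPos n) : α ⬝ᵥ α = 4 :=
  h.elim dot_self_long fun h => by rw [← neg_dot_neg', dot_self_long h]

lemma dot_self_of_medium {α : Wt n} (h : α ∈ mediumPos n ∨ -α ∈ mediumPos n) : α ⬝ᵥ α = 2 :=
  h.elim dot_self_medium fun h => by rw [← neg_dot_neg', dot_self_medium h]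

lemma mult_of_long {α : Wt n} (h : α ∈ longPos n ∨ -α ∈ longPos n) (m : ℤ) :
    p.mult α m = if 4 ∣ m then p.tn else if 2 ∣ m then p.t0 else 1 := if_pos h

lemma mult_of_medium {α : Wt n} (h : α ∈ mediumPos n ∨ -α ∈ mediumPos n) (m : ℤ) :
    p.mult α m = if 2 ∣ m then p.t else 1 := by
  have : ¬ (α ∈ longPos n ∨ -α ∈ longPos n) := fun h' => by
    have := dot_self_of_long h'; rw [dot_self_of_medium h] at this; norm_num at this
  rw [Params.mult, if_neg this, if_pos h]

lemma mult_of_short {α : Wt n} (h : α ∈ shortPos n ∨ -α ∈ shortPos n) (m : ℤ) :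
    p.mult α m = if 2 ∣ m then p.tnv else p.t0v := by
  have h1 : α ⬝ᵥ α = 1 := h.elim dot_self_short fun h => by rw [← neg_dot_neg', dot_self_short h]
  have h2 : ¬ (α ∈ longPos n ∨ -α ∈ longPos n) := fun h' => by
    have := dot_self_of_long h'; rw [h1] at this; norm_num at this
  have h3 : ¬ (α ∈ mediumPos n ∨ -α ∈ mediumPos n) := fun h' => by
    have := dot_self_of_medium h'; rw [h1] at this; norm_num at this
  rw [Params.mult, if_neg h2, if_neg h3, if_pos h]

lemma tSimple_of_lt {i : Fin n} (h : (i : ℕ) + 1 < n) : p.tSimple i = p.t := by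
  rw [Params.tSimple, mult_of_medium (Or.inl (simpleRoot_medium h))]; simp

lemma tSimple_of_last {i : Fin n} (h : ¬ (i : ℕ) + 1 < n) : p.tSimple i = p.tn := by
  rw [Params.tSimple, mult_of_long (Or.inl (simpleRoot_long h))]; simp

variable {F : Type*} [Field F] [Algebra ℂ F]

lemma not_even_medium {α : Wt n} (h : α ∈ mediumPos n ∨ -α ∈ mediumPos n) :
    ¬ ∀ i, Even (α i) := by
  have key : ∀ β ∈ mediumPos n, ¬ ∀ i, Even (β i) := by
    intro β hβ hc
    obtain ⟨i, j, hij, rfl | rfl⟩ := mem_mediumPos.mp hβ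
    · have := hc i
      simp [e_apply, Fin.val_inj, hij.ne] at this
    · have := hc i
      simp [e_apply, Fin.val_inj, hij.ne] at this
  rcases h with h | h
  · exact key α h
  · exact fun hc => key _ h fun i => (hc i).neg

lemma vFun_medium {α : Wt n} (h : α ∈ mediumPos n ∨ -α ∈ mediumPos n) (ev : Wt n → F) :
    vFun p α 0 ev = (1 - algebraMap ℂ F p.t ^ 2 * ev α) / (1 - ev α) := by
  rw [vFun, if_neg (not_even_medium h), mult_of_medium h]
  simp

/-- The numerator of `v_β`, expanded, for `β` a multiple of a long root. -/
lemma vFun_long {β : Wt n} (h : β ∈ shortPos n ∨ -β ∈ shortPos n) (ev : Wt n → F) :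
    vFun p (2 • β) 0 ev = (1 - algebraMap ℂ F p.tn * algebraMap ℂ F p.tnv * ev β) *
      (1 + algebraMap ℂ F p.tn * (algebraMap ℂ F p.tnv)⁻¹ * ev β) / (1 - ev (2 • β)) := by
  have h2 : ∀ i, Even ((2 • β) i) := fun i => by simp
  have h3 : (fun i => (2 • β) i / 2) = β := by
    ext i; change (2 • β i) / 2 = β i; rw [two_nsmul]; omega
  have h4 : (2 • β) ∈ longPos n ∨ -(2 • β) ∈ longPos n := by
    rcases h with h | h
    · obtain ⟨i, hi⟩ := mem_shortPos.mp h
      exact Or.inl (mem_longPos.mpr ⟨i, by rw [hi]⟩)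
    · obtain ⟨i, hi⟩ := mem_shortPos.mp h
      exact Or.inr (mem_longPos.mpr ⟨i, by rw [← hi, smul_neg]⟩)
  rw [vFun, if_pos h2]
  simp only [h3]
  rw [mult_of_long h4, mult_of_short h]
  simp

/-- For β = δ - 2ε_1 the multiplicities are looked up at the levels 2 and 1, not divisible by 4 and
by 2 respectively; this selects t_0 and t_0^∨ instead of t_n and t_n^∨. -/
lemma vFun_affine (hn : 0 < n) (ev : Wt n → F) :
    vFun p (-(2 • e 0) : Wt n) 1 ev =
      (1 - algebraMap ℂ F p.t0 * algebraMap ℂ F p.t0v * (algebraMap ℂ F p.qh * ev (-e 0))) *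
      (1 + algebraMap ℂ F p.t0 * (algebraMap ℂ F p.t0v)⁻¹ * (algebraMap ℂ F p.qh * ev (-e 0))) /
        (1 - algebraMap ℂ F p.q * ev (-(2 • e 0))) := by
  have h2 : ∀ i, Even ((-(2 • e 0) : Wt n) i) := fun i => by simp
  have h3 : (fun i => (-(2 • e 0) : Wt n) i / 2) = -e 0 := by
    ext i
    change (-(2 • (e 0 : Wt n) i)) / 2 = - (e 0 : Wt n) i
    rw [two_nsmul]; omega
  have h4 : (-(2 • e 0) : Wt n) ∈ longPos n ∨ -(-(2 • e 0) : Wt n) ∈ longPos n :=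
    Or.inr (mem_longPos.mpr ⟨⟨0, hn⟩, by simp⟩)
  have h5 : (-e 0 : Wt n) ∈ shortPos n ∨ -(-e 0 : Wt n) ∈ shortPos n :=
    Or.inr (mem_shortPos.mpr ⟨⟨0, hn⟩, by simp⟩)
  rw [vFun, if_pos h2]
  simp only [h3]
  rw [mult_of_long h4, mult_of_short h5]
  norm_num

end
end Koornwinder

/-! ### Explicit reflections on rational functions and explicit forms of the functions v. -/

namespace Koornwinder
noncomputable section
open scoped Matrix
variable {n : ℕ} {p : Params}

/-- The reflection `s_i` on rational functions. -/
def sR (i : Fin n) : RatFn n →+* RatFn n := (ext (weylAct (simpleRefl i)) : RatFn n →+* RatFn n)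

/-- The reflection `s_0` on rational functions. -/
def s0R (q : ℂˣ) : RatFn n →+* RatFn n := (ext (n := n) (affineReflAct q) : RatFn n →+* RatFn n)

lemma sR_apply (i : Fin n) (f : RatFn n) : sR i f = ext (weylAct (simpleRefl i)) f := rfl
lemma s0R_apply (q : ℂˣ) (f : RatFn n) : s0R q f = ext (affineReflAct q) f := rfl

lemma sR_monoR (i : Fin n) (a : Wt n) : sR i (monoR a) = monoR (simpleRefl i a) :=
  ext_weyl_monoR _ _

lemma s0R_monoR (q : ℂˣ) (a : Wt n) : s0R q (monoR a) =
    cst ((q ^ ((e 0 : Wt n) ⬝ᵥ a) : ℂˣ) : ℂ) * monoR (signFlip 0 a) := ext_affine_monoR q a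

lemma sR_cst (i : Fin n) (c : ℂ) : sR i (cst c : RatFn n) = cst c := ext_cst _ c
lemma s0R_cst (q : ℂˣ) (c : ℂ) : s0R q (cst c : RatFn n) = cst c := ext_cst _ c

/-- The function `v_{a_i}`. -/
def vS (p : Params) (i : Fin n) : RatFn n := vFun p (simpleRoot i) 0 monoR

/-- The function `v_{a_0}`. -/
def v0 (n : ℕ) (p : Params) : RatFn n := vFun p (-(2 • e 0)) 1 monoR

lemma cst_inv (c : ℂˣ) : (cst ((c⁻¹ : ℂˣ) : ℂ) : RatFn n) = (cst (c : ℂ))⁻¹ := by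
  simp [cst]

lemma T_apply (i : Fin n) (f : RatFn n) :
    T p i f = dl (cst (p.tSimple i : ℂ)) (vS p i) (sR i) f := by
  rw [dl, ← cst_inv, cst_mul_eq_smul, cst_mul_eq_smul]
  rfl

lemma T0_apply (f : RatFn n) : T0 n p f = dl (cst (p.t0 : ℂ)) (v0 n p) (s0R p.q) f := by
  rw [dl, ← cst_inv, cst_mul_eq_smul, cst_mul_eq_smul]
  rfl

lemma vS_of_lt {i : Fin n} (h : (i : ℕ) + 1 < n) :
    vS p i = (1 - cst (p.t : ℂ) ^ 2 * monoR (simpleRoot i)) / (1 - monoR (simpleRoot i)) :=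
  vFun_medium (Or.inl (simpleRoot_medium h)) _

/-- The coefficient of `x_n` in the numerator of `v_{a_n}`. -/
def cN (p : Params) : ℂ := p.tn * (((p.tnv : ℂ))⁻¹ - p.tnv)

/-- The coefficient of `q^{1/2} x_1⁻¹` in the numerator of `v_{a_0}`. -/
def c0 (p : Params) : ℂ := p.t0 * (((p.t0v : ℂ))⁻¹ - p.t0v)

lemma vS_of_last {i : Fin n} (h : ¬ (i : ℕ) + 1 < n) :
    vS p i = (1 + cst (cN p) * monoR (e (i : ℕ)) - cst (p.tn : ℂ) ^ 2 * monoR (e (i : ℕ)) ^ 2) /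
      (1 - monoR (e (i : ℕ)) ^ 2) := by
  rw [vS, simpleRoot_of_last h, vFun_long (Or.inl (mem_shortPos.mpr ⟨i, rfl⟩)), monoR_nsmul]
  congr 1
  have h1 : (algebraMap ℂ (RatFn n) p.tnv) ≠ 0 := cst_unit_ne_zero p.tnv
  simp only [cst, cN, map_mul, map_sub, map_inv₀]
  field_simp
  ring

/-- The function `q^{1/2} x_1⁻¹`. -/
def yR (n : ℕ) (p : Params) : RatFn n := cst (p.qh : ℂ) * monoR (-e 0)

lemma yR_sq : yR n p ^ 2 = cst (p.q : ℂ) * monoR (-(2 • e 0)) := by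
  rw [yR, mul_pow, ← monoR_nsmul, smul_neg]
  congr 1
  simp [cst, Params.q]

/-- In the variable q^{1/2} x_1⁻¹ this has the same shape as v_{a_n} in the variable x_n, so one
rank-two computation serves both ends of the affine diagram. -/
lemma v0_eq (hn : 0 < n) : v0 n p =
    (1 + cst (c0 p) * yR n p - cst (p.t0 : ℂ) ^ 2 * yR n p ^ 2) / (1 - yR n p ^ 2) := by
  rw [v0, vFun_affine hn, yR_sq]
  congr 1
  rw [← yR_sq, yR]
  have h1 : (algebraMap ℂ (RatFn n) p.t0v) ≠ 0 := cst_unit_ne_zero p.t0v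
  simp only [cst, c0, map_mul, map_sub, map_inv₀]
  field_simp
  ring

lemma monoR_ne_one {a : Wt n} (h : a ≠ 0) : (monoR a : RatFn n) ≠ 1 := fun h' =>
  h (monoR_injective (h'.trans monoR_zero.symm))

lemma monoR_e_sq_ne (i : Fin n) : (monoR (e (i : ℕ)) : RatFn n) ^ 2 ≠ 1 := by
  rw [← monoR_nsmul]
  refine monoR_ne_one fun h => ?_
  have := congrFun h i
  simp [e_apply] at this

lemma yR_ne_zero : yR n p ≠ 0 := mul_ne_zero (cst_unit_ne_zero _) (monoR_ne_zero _)

lemma yR_sq_ne (hn : 0 < n) : yR n p ^ 2 ≠ 1 := by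
  rw [yR_sq]
  intro h
  have h1 : (cst (p.q : ℂ) * monoR (-(2 • e 0)) : RatFn n) = cst 1 * monoR 0 := by
    rw [h, monoR_zero]; simp [cst]
  have := congrFun (cst_mul_monoR_inj (Units.ne_zero _) h1) ⟨0, hn⟩
  simp [e_apply] at this

/-! ### Relations between the reflections -/

lemma sR_sR (i : Fin n) (f : RatFn n) : sR i (sR i f) = f := by
  rw [sR_apply, sR_apply, ← ext_weyl_mul, simpleRefl_mul_self, weylAct_one, ext_refl]

lemma e0_dot (hn : 0 < n) (a : Wt n) : (e 0 : Wt n) ⬝ᵥ a = a ⟨0, hn⟩ := by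
  rw [dotProduct_comm]; exact dot_e a ⟨0, hn⟩

lemma s0R_s0R (hn : 0 < n) (q : ℂˣ) (f : RatFn n) : s0R q (s0R q f) = f := by
  rw [s0R_apply, s0R_apply, ← ext_trans]
  have : (affineReflAct q).trans (affineReflAct q) = (AlgEquiv.refl : Laurent n ≃ₐ[ℂ] _) := by
    refine laurent_aut_ext fun a => ?_
    rw [AlgEquiv.trans_apply, affineReflAct_mono, map_smul, affineReflAct_mono, smul_smul,
      ← Units.val_mul, ← zpow_add, e0_dot hn, e0_dot hn, signFlip_apply]
    have h1 : signFlip 0 (signFlip 0 a) = a := by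
      ext k; rw [signFlip_apply, signFlip_apply]; split_ifs <;> simp
    simp [h1]
  rw [this, ext_refl]

lemma simpleRefl_braid {i j : Fin n} (hij : (j : ℕ) = i + 1) (hj : (j : ℕ) + 1 < n) :
    simpleRefl i * simpleRefl j * simpleRefl i = simpleRefl j * simpleRefl i * simpleRefl j := by
  have hi : (i : ℕ) + 1 < n := by omega
  have hji : (⟨i + 1, hi⟩ : Fin n) = j := Fin.ext hij.symm
  have h1 : ∀ π π' : Equiv.Perm (Fin n), signedPerm π 1 * signedPerm π' 1 =
      signedPerm (π * π') 1 := fun π π' => by rw [signedPerm_mul]; simp [Pi.one_def]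
  rw [simpleRefl, simpleRefl, dif_pos hi, dif_pos hj, hji, h1, h1, h1, h1]
  congr 1
  have hne1 : i ≠ j := by rintro rfl; omega
  have hne2 : i ≠ ⟨j + 1, hj⟩ := by simp only [Ne, Fin.ext_iff]; omega
  have hne3 : j ≠ ⟨j + 1, hj⟩ := by simp only [Ne, Fin.ext_iff]; omega
  have h2 := Equiv.swap_mul_swap_mul_swap hne3.symm hne2.symm
  rw [Equiv.swap_comm j i, Equiv.swap_comm ⟨j + 1, hj⟩ j] at h2
  rw [h2, Equiv.swap_mul_swap_mul_swap hne1 hne2, Equiv.swap_comm]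

lemma simpleRefl_braid_last {i j : Fin n} (hij : (j : ℕ) = i + 1) (hj : ¬ (j : ℕ) + 1 < n) :
    simpleRefl i * simpleRefl j * simpleRefl i * simpleRefl j =
      simpleRefl j * simpleRefl i * simpleRefl j * simpleRefl i := by
  have hi : (i : ℕ) + 1 < n := by have := j.2; omega
  have hji : (⟨i + 1, hi⟩ : Fin n) = j := Fin.ext hij.symm
  have hne1 : i ≠ j := by rintro rfl; omega
  ext l k
  simp only [LinearEquiv.mul_apply, simpleRefl_of_lt hi, simpleRefl_of_last hj, hji]
  by_cases h1 : k = i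
  · subst h1; simp [hne1]
  · by_cases h2 : k = j
    · subst h2; simp [hne1]
    · simp [Equiv.swap_apply_of_ne_of_ne h1 h2, h2]

lemma simpleRefl_e_fix {i : Fin n} {k : ℕ} (h1 : k ≠ i) (h2 : k ≠ i + 1) :
    simpleRefl i (e k) = e k := by
  refine simpleRefl_eq_self ?_
  by_cases hi : (i : ℕ) + 1 < n
  · rw [dot_coroot_simple_of_lt hi, e_apply, e_apply, if_neg (Ne.symm h1), if_neg (Ne.symm h2)]
    rfl
  · rw [dot_coroot_simple_of_last hi, e_apply, if_neg (Ne.symm h1)]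

lemma simpleRefl_comm {i j : Fin n} (hij : (i : ℕ) + 2 ≤ j) :
    simpleRefl i * simpleRefl j = simpleRefl j * simpleRefl i := by
  have hi : (i : ℕ) + 1 < n := by have := j.2; omega
  ext l k
  simp only [LinearEquiv.mul_apply, simpleRefl_eq]
  have h1 : simpleRoot j ⬝ᵥ coroot (simpleRoot i) = 0 := by
    by_cases hj : (j : ℕ) + 1 < n
    · rw [dot_coroot_simple_of_lt hi, simpleRoot_of_lt hj]
      simp only [Pi.sub_apply, e_apply]
      split_ifs <;> omega
    · rw [dot_coroot_simple_of_lt hi, simpleRoot_of_last hj]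
      change 2 • (e (j : ℕ) : Wt n) i - 2 • (e (j : ℕ) : Wt n) ⟨i + 1, hi⟩ = 0
      simp only [e_apply]
      split_ifs <;> omega
  have h2 : simpleRoot i ⬝ᵥ coroot (simpleRoot j) = 0 := by
    by_cases hj : (j : ℕ) + 1 < n
    · rw [dot_coroot_simple_of_lt hj, simpleRoot_of_lt hi]
      simp only [Pi.sub_apply, e_apply]
      split_ifs <;> omega
    · rw [dot_coroot_simple_of_last hj, simpleRoot_of_lt hi]
      simp only [Pi.sub_apply, e_apply]
      split_ifs <;> omega
  simp only [sub_dotProduct, smul_dotProduct, h1, h2, smul_zero, sub_zero]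
  rw [sub_right_comm]

lemma sR_braid {i j : Fin n} (hij : (j : ℕ) = i + 1) (hj : (j : ℕ) + 1 < n) (f : RatFn n) :
    sR i (sR j (sR i f)) = sR j (sR i (sR j f)) := by
  simp only [sR_apply, ← ext_weyl_mul, ← mul_assoc]
  rw [simpleRefl_braid hij hj]

lemma sR_braid_last {i j : Fin n} (hij : (j : ℕ) = i + 1) (hj : ¬ (j : ℕ) + 1 < n)
    (f : RatFn n) : sR i (sR j (sR i (sR j f))) = sR j (sR i (sR j (sR i f))) := by
  simp only [sR_apply, ← ext_weyl_mul, ← mul_assoc]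
  rw [simpleRefl_braid_last hij hj]

lemma sR_comm {i j : Fin n} (hij : (i : ℕ) + 2 ≤ j) (f : RatFn n) :
    sR i (sR j f) = sR j (sR i f) := by
  simp only [sR_apply, ← ext_weyl_mul]
  rw [simpleRefl_comm hij]

lemma s0R_sR_comm {j : Fin n} (hj : 1 ≤ (j : ℕ)) (q : ℂˣ) (f : RatFn n) :
    s0R q (sR j f) = sR j (s0R q f) := by
  simp only [sR_apply, s0R_apply, ← ext_trans]
  congr 2
  refine laurent_aut_ext fun a => ?_
  rw [AlgEquiv.trans_apply, AlgEquiv.trans_apply, weylAct_mono, affineReflAct_mono,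
    affineReflAct_mono, map_smul, weylAct_mono]
  have h0 : simpleRefl j (e 0) = e 0 := simpleRefl_e_fix (by omega) (by omega)
  have h1 : (e 0 : Wt n) ⬝ᵥ simpleRefl j a = (e 0 : Wt n) ⬝ᵥ a := by
    rw [← simpleRefl_dot, h0]
  have h2 : signFlip 0 (simpleRefl j a) = simpleRefl j (signFlip 0 a) := by
    ext k
    by_cases h : (j : ℕ) + 1 < n
    · rw [signFlip_apply, simpleRefl_of_lt h, simpleRefl_of_lt h, signFlip_apply]
      congr 1
      simp only [Equiv.swap_apply_def, Fin.ext_iff]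
      split_ifs <;> simp_all <;> omega
    · rw [signFlip_apply, simpleRefl_of_last h, simpleRefl_of_last h, signFlip_apply]
      split_ifs <;> simp
  rw [h1, h2]

lemma s0R_braid {i : Fin n} (hi : (i : ℕ) = 0) (hn : 2 ≤ n) (q : ℂˣ) (f : RatFn n) :
    sR i (s0R q (sR i (s0R q f))) = s0R q (sR i (s0R q (sR i f))) := by
  simp only [sR_apply, s0R_apply, ← ext_trans]
  congr 2
  refine laurent_aut_ext fun a => ?_
  have h : (i : ℕ) + 1 < n := by omega
  have h0n : 0 < n := lt_of_lt_of_le Nat.zero_lt_two hn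
  have hi0 : i = ⟨0, h0n⟩ := Fin.ext hi
  have hi1 : (⟨i + 1, h⟩ : Fin n) = ⟨1, hn⟩ := Fin.ext (by simp [hi])
  simp only [AlgEquiv.trans_apply, weylAct_mono, affineReflAct_mono, map_smul, smul_smul,
    ← Units.val_mul, ← zpow_add, e0_dot (show 0 < n by omega), simpleRefl_of_lt h, signFlip_apply]
  have e1 : signFlip 0 (simpleRefl i (signFlip 0 (simpleRefl i a))) =
      simpleRefl i (signFlip 0 (simpleRefl i (signFlip 0 a))) := by
    ext k
    simp only [simpleRefl_of_lt h, signFlip_apply, hi1]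
    subst hi0
    by_cases h1 : k = ⟨0, h0n⟩
    · subst h1; simp
    · by_cases h2 : k = ⟨1, hn⟩
      · subst h2; simp
      · have : (k : ℕ) ≠ 0 := fun h => h1 (Fin.ext h)
        simp [Equiv.swap_apply_of_ne_of_ne h1 h2, this]
  rw [e1, hi1]
  subst hi0
  simp [add_comm]

/-! ### Relations between the operators `T_i` -/

lemma vS_reflect (i : Fin n) : sR i (vS p i) = 1 + cst (p.tSimple i : ℂ) ^ 2 - vS p i := by
  by_cases h : (i : ℕ) + 1 < n
  · have h1 : (monoR (simpleRoot i) : RatFn n) ≠ 1 :=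
      monoR_ne_one (posRoots_ne_zero (simpleRoot_mem i))
    have h2 : 1 - (monoR (simpleRoot i) : RatFn n) ≠ 0 := sub_ne_zero.mpr h1.symm
    have h3 : (monoR (simpleRoot i) : RatFn n) - 1 ≠ 0 := sub_ne_zero.mpr h1
    have h4 := monoR_ne_zero (simpleRoot i)
    rw [vS_of_lt h, tSimple_of_lt h]
    simp only [map_div₀, map_sub, map_mul, map_pow, map_one, sR_cst, sR_monoR,
      simpleRefl_simpleRoot, monoR_neg]
    field_simp; ring
  · have h1 : (monoR (e (i : ℕ)) : RatFn n) ^ 2 ≠ 1 := monoR_e_sq_ne i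
    have h2 : 1 - (monoR (e (i : ℕ)) : RatFn n) ^ 2 ≠ 0 := sub_ne_zero.mpr h1.symm
    have h3 : (monoR (e (i : ℕ)) : RatFn n) ^ 2 - 1 ≠ 0 := sub_ne_zero.mpr h1
    have h4 : (monoR (e (i : ℕ)) : RatFn n) ≠ 0 := monoR_ne_zero _
    rw [vS_of_last h, tSimple_of_last h]
    simp only [map_div₀, map_sub, map_add, map_mul, map_pow, map_one, sR_cst, sR_monoR,
      simpleRefl_e_of_last h, if_true, monoR_neg]
    field_simp; ring

lemma s0R_yR (hn : 0 < n) : s0R p.q (yR n p) = (yR n p)⁻¹ := by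
  have h1 : signFlip 0 (-e 0 : Wt n) = e 0 := by
    ext k; rw [signFlip_apply, Pi.neg_apply, e_apply]; split_ifs <;> simp
  rw [yR, map_mul, s0R_cst, s0R_monoR, e0_dot hn, h1, mul_inv, ← monoR_neg, neg_neg, ← mul_assoc,
    ← cst_inv]
  congr 1
  have : (-e 0 : Wt n) ⟨0, hn⟩ = -1 := by simp [e_apply]
  rw [this, cst, cst, cst, ← map_mul, ← Units.val_mul]
  congr 2
  rw [Params.q, zpow_neg_one, pow_two, mul_inv, mul_inv_cancel_left]

lemma v0_reflect (hn : 0 < n) : s0R p.q (v0 n p) = 1 + cst (p.t0 : ℂ) ^ 2 - v0 n p := by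
  have h1 : yR n p ^ 2 ≠ 1 := yR_sq_ne hn
  have h2 : 1 - yR n p ^ 2 ≠ 0 := sub_ne_zero.mpr h1.symm
  have h3 : yR n p ^ 2 - 1 ≠ 0 := sub_ne_zero.mpr h1
  have h4 : yR n p ≠ 0 := yR_ne_zero
  rw [v0_eq hn]
  simp only [map_div₀, map_sub, map_add, map_mul, map_pow, map_one, s0R_cst, s0R_yR hn]
  field_simp; ring

lemma T_quadratic (i : Fin n) (f : RatFn n) : T p i (T p i f) =
    ((p.tSimple i : ℂ) - (p.tSimple i : ℂ)⁻¹) • T p i f + f := by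
  rw [T_apply, T_apply, dl_quadratic (cst_unit_ne_zero _) (sR_sR i) (sR_cst _ _) (vS_reflect i),
    ← cst_mul_eq_smul]
  simp [cst]

lemma T0_quadratic (hn : 0 < n) (f : RatFn n) : T0 n p (T0 n p f) =
    ((p.t0 : ℂ) - (p.t0 : ℂ)⁻¹) • T0 n p f + f := by
  rw [T0_apply, T0_apply, dl_quadratic (cst_unit_ne_zero _) (s0R_s0R hn _) (s0R_cst _ _)
    (v0_reflect hn), ← cst_mul_eq_smul]
  simp [cst]

lemma T_braid {i j : Fin n} (hij : (j : ℕ) = i + 1) (hj : (j : ℕ) + 1 < n) :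
    T p i * T p j * T p i = T p j * T p i * T p j := by
  have hi : (i : ℕ) + 1 < n := by omega
  have hji : (⟨i + 1, hi⟩ : Fin n) = j := Fin.ext hij.symm
  have hsum : (simpleRoot i : Wt n) + simpleRoot j = e (i : ℕ) - e ((j : ℕ) + 1) := by
    rw [simpleRoot_of_lt hi, simpleRoot_of_lt hj, hij]; abel
  have h1 : simpleRefl i (simpleRoot j) = simpleRoot i + simpleRoot j := by
    rw [hsum, simpleRoot_of_lt hj, map_sub, simpleRefl_e_of_lt hi, hji, Equiv.swap_apply_right,
      simpleRefl_e_fix (by omega) (by omega)]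
  have h2 : simpleRefl j (simpleRoot i) = simpleRoot i + simpleRoot j := by
    rw [hsum, simpleRoot_of_lt hi, map_sub, simpleRefl_e_fix (by omega) (by omega), ← hij,
      simpleRefl_e_of_lt hj, Equiv.swap_apply_left]
  ext f
  simp only [Module.End.mul_apply, T_apply, vS_of_lt hi, vS_of_lt hj, tSimple_of_lt hi,
    tSimple_of_lt hj]
  refine dl_braid_medium (cst_unit_ne_zero _) (sR_sR i) (sR_sR j) (sR_braid hij hj) (sR_cst _ _)
    (sR_cst _ _) (monoR_ne_zero _) (monoR_ne_zero _)
    (monoR_ne_one (posRoots_ne_zero (simpleRoot_mem i)))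
    (monoR_ne_one (posRoots_ne_zero (simpleRoot_mem j))) ?_ ?_ ?_ ?_ ?_ f
  · rw [← monoR_add]
    refine monoR_ne_one fun h => ?_
    rw [hsum] at h
    have := congrFun h i
    simp [e_apply, show (i : ℕ) ≠ j + 1 by omega] at this
  · rw [sR_monoR, simpleRefl_simpleRoot, monoR_neg]
  · rw [sR_monoR, h1, monoR_add]
  · rw [sR_monoR, h2, monoR_add]
  · rw [sR_monoR, simpleRefl_simpleRoot, monoR_neg]

lemma T_braid_last {i j : Fin n} (hij : (j : ℕ) = i + 1) (hj : ¬ (j : ℕ) + 1 < n) :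
    T p i * T p j * T p i * T p j = T p j * T p i * T p j * T p i := by
  have hi : (i : ℕ) + 1 < n := by have := j.2; omega
  have hji : (⟨i + 1, hi⟩ : Fin n) = j := Fin.ext hij.symm
  have hne : (i : ℕ) ≠ j := by omega
  ext f
  simp only [Module.End.mul_apply, T_apply, vS_of_lt hi, vS_of_last hj, tSimple_of_lt hi,
    tSimple_of_last hj, simpleRoot_of_lt hi, monoR_sub, ← hij]
  refine dl_braid_long (cst_unit_ne_zero _) (cst_unit_ne_zero _) (sR_sR i) (sR_sR j)
    (sR_braid_last hij hj) (sR_cst _ _) (sR_cst _ _) (sR_cst _ _) (sR_cst _ _) (sR_cst _ _)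
    (sR_cst _ _) (monoR_ne_zero _) (monoR_ne_zero _) ?_ ?_ (monoR_e_sq_ne i) (monoR_e_sq_ne j)
    ?_ ?_ ?_ f
  · intro h
    have := congrFun (monoR_injective h) i
    simp [e_apply, hne] at this
  · rw [← monoR_add]
    refine monoR_ne_one fun h => ?_
    have := congrFun h i
    simp [e_apply, hne] at this
  · rw [sR_monoR, simpleRefl_e_of_lt hi, hji, Equiv.swap_apply_left]
  · rw [sR_monoR, simpleRefl_e_fix hne (by omega)]
  · rw [sR_monoR, simpleRefl_e_of_last hj, if_pos rfl, monoR_neg]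

lemma T0_braid {i : Fin n} (hi0 : (i : ℕ) = 0) (hn : 2 ≤ n) :
    T p i * T0 n p * T p i * T0 n p = T0 n p * T p i * T0 n p * T p i := by
  have hi : (i : ℕ) + 1 < n := by omega
  have hn0 : 0 < n := by omega
  -- With x = q^{1/2} x_2⁻¹ and y = q^{1/2} x_1⁻¹ one has x^{a_1} = x/y, s_1 exchanges x and y, and
  -- s_0 inverts y and fixes x: the same configuration as at the other end of the diagram.
  set x : RatFn n := cst (p.qh : ℂ) * monoR (-e 1) with hx
  have hsub : (monoR (simpleRoot i) : RatFn n) = x / yR n p := by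
    rw [simpleRoot_of_lt hi, hi0, hx, yR, mul_div_mul_left _ _ (cst_unit_ne_zero _), ← monoR_sub]
    congr 1; abel
  have hx0 : x ≠ 0 := mul_ne_zero (cst_unit_ne_zero _) (monoR_ne_zero _)
  have hmul : ∀ a b : Wt n, cst (p.qh : ℂ) * monoR a * (cst (p.qh : ℂ) * monoR b) =
      (cst ((p.qh * p.qh : ℂˣ) : ℂ) * monoR (a + b) : RatFn n) := fun a b => by
    rw [monoR_add, Units.val_mul, cst, cst, map_mul]; ring
  have hone : (1 : RatFn n) = cst 1 * monoR 0 := by rw [monoR_zero]; simp [cst]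
  ext f
  simp only [Module.End.mul_apply, T_apply, T0_apply, vS_of_lt hi, v0_eq hn0, tSimple_of_lt hi,
    hsub]
  refine dl_braid_long (cst_unit_ne_zero _) (cst_unit_ne_zero _) (sR_sR i) (s0R_s0R hn0 _)
    (s0R_braid hi0 hn _) (sR_cst _ _) (s0R_cst _ _) (sR_cst _ _) (s0R_cst _ _) (sR_cst _ _)
    (s0R_cst _ _) hx0 yR_ne_zero ?_ ?_ ?_ (yR_sq_ne hn0) ?_ ?_ (s0R_yR hn0) f
  · intro h
    have := congrFun (cst_mul_monoR_inj (Units.ne_zero _) h) ⟨0, hn0⟩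
    simp [e_apply] at this
  · intro h
    rw [hx, yR, hmul, hone] at h
    have := congrFun (cst_mul_monoR_inj (Units.ne_zero _) h) ⟨0, hn0⟩
    simp [e_apply] at this
  · intro h
    rw [pow_two, hx, hmul, hone] at h
    have := congrFun (cst_mul_monoR_inj (Units.ne_zero _) h) ⟨1, by omega⟩
    simp [e_apply] at this
  · have h1 := simpleRefl_e_of_lt hi ⟨i + 1, hi⟩
    simp only [Equiv.swap_apply_right, hi0, zero_add] at h1
    rw [hx, map_mul, sR_cst, sR_monoR, map_neg, h1, yR]
  · have h1 : signFlip 0 (-e 1 : Wt n) = -e 1 := by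
      ext k; rw [signFlip_apply, Pi.neg_apply, e_apply]; split_ifs <;> simp_all
    rw [hx, map_mul, s0R_cst, s0R_monoR, e0_dot hn0, h1]
    simp [e_apply, cst]

lemma sR_vS_fix {i j : Fin n} (h : (i : ℕ) + 2 ≤ j ∨ (j : ℕ) + 2 ≤ i) :
    sR i (vS p j) = vS p j := by
  have h1 : simpleRefl i (e (j : ℕ)) = e (j : ℕ) := simpleRefl_e_fix (by omega) (by omega)
  by_cases hj : (j : ℕ) + 1 < n
  · have h2 : simpleRefl i (e ((j : ℕ) + 1)) = e ((j : ℕ) + 1) :=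
      simpleRefl_e_fix (by omega) (by omega)
    simp only [vS_of_lt hj, simpleRoot_of_lt hj, map_div₀, map_sub, map_mul, map_pow, map_one,
      sR_cst, sR_monoR, h1, h2]
  · simp only [vS_of_last hj, map_div₀, map_sub, map_add, map_mul, map_pow, map_one,
      sR_cst, sR_monoR, h1]

lemma T_comm {i j : Fin n} (hij : (i : ℕ) + 2 ≤ j) : T p i * T p j = T p j * T p i := by
  ext f
  simp only [Module.End.mul_apply, T_apply]
  exact dl_comm (sR_comm hij) (sR_cst _ _) (sR_cst _ _) (sR_vS_fix (Or.inr hij))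
    (sR_vS_fix (Or.inl hij)) f

lemma T0_comm {j : Fin n} (hj : 1 ≤ (j : ℕ)) : T0 n p * T p j = T p j * T0 n p := by
  have hn0 : 0 < n := by have := j.2; omega
  have h1 : ∀ k, 1 ≤ k → s0R p.q (monoR (e k) : RatFn n) = monoR (e k) := fun k hk => by
    have h1 : signFlip 0 (e k : Wt n) = e k := by
      ext k'; rw [signFlip_apply, e_apply]; split_ifs <;> simp_all
    rw [s0R_monoR, h1, e0_dot hn0, e_apply]
    simp [cst, show 0 ≠ k by omega]
  ext f
  simp only [Module.End.mul_apply, T_apply, T0_apply]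
  refine dl_comm (s0R_sR_comm hj _) (sR_cst _ _) (s0R_cst _ _) ?_ ?_ f
  · have h0 : simpleRefl j (e 0) = e 0 := simpleRefl_e_fix (by omega) (by omega)
    simp only [v0_eq hn0, yR, map_div₀, map_sub, map_add, map_mul, map_pow, map_one,
      sR_cst, sR_monoR, map_neg, h0]
  · by_cases hj' : (j : ℕ) + 1 < n
    · simp only [vS_of_lt hj', simpleRoot_of_lt hj', monoR_sub, map_div₀, map_sub, map_mul,
        map_pow, map_one, s0R_cst, h1 j hj, h1 (j + 1) (by omega)]
    · simp only [vS_of_last hj', map_div₀, map_sub, map_add, map_mul, map_pow, map_one,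
        s0R_cst, h1 j hj]

end
end Koornwinder

namespace Koornwinder
noncomputable section
open scoped Matrix

/-! ### Commuting elements of the affine Hecke algebra -/

section Hecke

variable {G : Type*} [Group G]

/-- Braid relations of type `C̃_n` for `T 0, …, T (n - 1)` and the affine generator `A`. -/
structure BraidRel (n : ℕ) (T : ℕ → G) (A : G) : Prop where
  two_le : 2 ≤ n
  braid : ∀ k, k + 2 < n → T k * T (k + 1) * T k = T (k + 1) * T k * T (k + 1)
  last : ∀ k, k + 2 = n → T k * T (k + 1) * T k * T (k + 1) = T (k + 1) * T k * T (k + 1) * T k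
  comm : ∀ j k, j + 2 ≤ k → k < n → T j * T k = T k * T j
  affine : T 0 * A * T 0 * A = A * T 0 * A * T 0
  affine_comm : ∀ k, 1 ≤ k → k < n → A * T k = T k * A

/-- The palindromes `T_{n-1-d} ⋯ T_{n-1} ⋯ T_{n-1-d}`. -/
def palin (n : ℕ) (T : ℕ → G) : ℕ → G
  | 0 => T (n - 1)
  | d + 1 => T (n - 2 - d) * palin n T d * T (n - 2 - d)

/-- `Y_0 = T_0 ⋯ T_{n-1} ⋯ T_0 A` and `Y_{i+1} = T_i⁻¹ Y_i T_i⁻¹`. -/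
def yElt (n : ℕ) (T : ℕ → G) (A : G) : ℕ → G
  | 0 => palin n T (n - 1) * A
  | i + 1 => (T i)⁻¹ * yElt n T A i * (T i)⁻¹

variable {n : ℕ} {T : ℕ → G} {A : G}

lemma BraidRel.commute (h : BraidRel n T A) {j k : ℕ} (hjk : j + 2 ≤ k ∨ k + 2 ≤ j) (hk : k < n)
    (hj : j < n) : Commute (T j) (T k) := by
  rcases hjk with hjk | hjk
  · exact h.comm j k hjk hk
  · exact (h.comm k j hjk hj).symm

lemma BraidRel.commute_palin_low (h : BraidRel n T A) {d k : ℕ} (hk : k + 2 + d ≤ n - 1) :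
    Commute (T k) (palin n T d) := by
  induction d with
  | zero => exact h.commute (Or.inl (by omega)) (by omega) (by omega)
  | succ d ih =>
    have h1 : Commute (T k) (T (n - 2 - d)) :=
      h.commute (Or.inl (by omega)) (by omega) (by omega)
    exact (h1.mul_right (ih (by omega))).mul_right h1

/-- The generators strictly inside a palindrome commute with it. When the palindrome grows by T_k on
both sides, generators far from k are immediate. The neighbour T_{k+1} is carried through by the
relation of length four at the end of the diagram, and otherwise by two braid relations of length
three, one on each side. -/
lemma BraidRel.commute_palin (h : BraidRel n T A) {d j : ℕ} (hd : d ≤ n - 1)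
    (hj : n - 1 - d < j) (hjn : j < n) : Commute (T j) (palin n T d) := by
  induction d generalizing j with
  | zero => omega
  | succ d ih =>
    obtain ⟨k, hk⟩ : ∃ k, n = k + 2 + d := ⟨n - 2 - d, by omega⟩
    have hk' : n - 2 - d = k := by omega
    rw [palin, hk']
    rcases Nat.lt_or_ge (k + 1) j with hlt | hge
    · have h1 : Commute (T j) (T k) := h.commute (Or.inr (by omega)) (by omega) hjn
      exact (h1.mul_right (ih (by omega) (by omega) hjn)).mul_right h1
    · have hj1 : j = k + 1 := by omega
      subst hj1
      cases d with
      | zero =>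
        have h1 : n - 1 = k + 1 := by omega
        rw [palin, h1]
        have h2 := h.last k (by omega)
        change T (k + 1) * (T k * T (k + 1) * T k) = T k * T (k + 1) * T k * T (k + 1)
        rw [h2]; group
      | succ d =>
        have h1 : n - 2 - d = k + 1 := by omega
        have h2 : Commute (T k) (palin n T d) := h.commute_palin_low (by omega)
        have h3 := h.braid k (by omega)
        rw [palin, h1]
        set V := palin n T d
        change T (k + 1) * (T k * (T (k + 1) * V * T (k + 1)) * T k) =
          T k * (T (k + 1) * V * T (k + 1)) * T k * T (k + 1)
        calc _ = (T (k + 1) * T k * T (k + 1)) * V * T (k + 1) * T k := by group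
          _ = T k * T (k + 1) * (T k * V) * T (k + 1) * T k := by rw [← h3]; group
          _ = T k * T (k + 1) * V * (T k * T (k + 1) * T k) := by rw [h2.eq]; group
          _ = _ := by rw [h3]; group

lemma BraidRel.commute_yElt_high (h : BraidRel n T A) {i k : ℕ} (hik : i < k) (hk : k < n) :
    Commute (T k) (yElt n T A i) := by
  induction i with
  | zero =>
    exact (h.commute_palin le_rfl (by omega) hk).mul_right (h.affine_comm k hik hk).symm
  | succ i ih =>
    have h1 : Commute (T k) (T i)⁻¹ :=
      (h.commute (Or.inr (by omega)) (by omega) hk).inv_right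
    exact (h1.mul_right (ih (by omega))).mul_right h1

/-- Only the adjacent case needs work: conjugating T_k past the two inverse generators turns it into
T_{k+1}, which commutes with the earlier element Y_k, and the same braid relation turns it back on
the other side. -/
lemma BraidRel.commute_yElt_low (h : BraidRel n T A) {i k : ℕ} (hik : k + 2 ≤ i) (hi : i < n) :
    Commute (T k) (yElt n T A i) := by
  induction i with
  | zero => omega
  | succ i ih =>
    rcases Nat.lt_or_ge (k + 1) i with hlt | hge
    · have h1 : Commute (T k) (T i)⁻¹ :=
        (h.commute (Or.inl (by omega)) (by omega) (by omega)).inv_right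
      exact (h1.mul_right (ih (by omega) (by omega))).mul_right h1
    · have hj1 : i = k + 1 := by omega
      subst hj1
      have h2 : Commute (T (k + 1)) (yElt n T A k) := h.commute_yElt_high (by omega) (by omega)
      have h3 := h.braid k (by omega)
      rw [yElt, yElt]
      set V := yElt n T A k
      have h4 : T k * (T (k + 1))⁻¹ * (T k)⁻¹ = (T (k + 1))⁻¹ * (T k)⁻¹ * T (k + 1) := by
        rw [mul_inv_eq_iff_eq_mul, mul_inv_eq_iff_eq_mul]
        calc T k = (T (k + 1))⁻¹ * (T k)⁻¹ * (T k * T (k + 1) * T k) := by group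
          _ = _ := by rw [h3]; group
      have h5 : (T k)⁻¹ * (T (k + 1))⁻¹ * T k = T (k + 1) * (T k)⁻¹ * (T (k + 1))⁻¹ := by
        apply mul_right_cancel (b := T (k + 1) * T k)
        apply mul_left_cancel (a := T (k + 1) * T k)
        have e1 : T (k + 1) * T k * ((T k)⁻¹ * (T (k + 1))⁻¹ * T k * (T (k + 1) * T k)) =
          T k * T (k + 1) * T k := by group
        have e2 : T (k + 1) * T k * (T (k + 1) * (T k)⁻¹ * (T (k + 1))⁻¹ * (T (k + 1) * T k)) =
          T (k + 1) * T k * T (k + 1) := by group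
        rw [e1, e2, h3]
      change T k * ((T (k + 1))⁻¹ * ((T k)⁻¹ * V * (T k)⁻¹) * (T (k + 1))⁻¹) =
        (T (k + 1))⁻¹ * ((T k)⁻¹ * V * (T k)⁻¹) * (T (k + 1))⁻¹ * T k
      calc _ = (T k * (T (k + 1))⁻¹ * (T k)⁻¹) * V * (T k)⁻¹ * (T (k + 1))⁻¹ := by group
        _ = (T (k + 1))⁻¹ * (T k)⁻¹ * (T (k + 1) * V) * (T k)⁻¹ * (T (k + 1))⁻¹ := by
          rw [h4]; group
        _ = (T (k + 1))⁻¹ * (T k)⁻¹ * V * (T (k + 1) * (T k)⁻¹ * (T (k + 1))⁻¹) := by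
          rw [h2.eq]; group
        _ = _ := by rw [← h5]; group

/-- The only place where the relation of length four between A and its neighbour enters. The inner
palindrome V commutes both with A and with the outer palindrome T_0 V T_0, so the claim becomes a
rearrangement of T_0 A T_0 A. -/
lemma BraidRel.commute_yElt_zero_one (h : BraidRel n T A) :
    Commute (yElt n T A 0) (yElt n T A 1) := by
  obtain ⟨d, rfl⟩ : ∃ d, n = d + 2 := ⟨n - 2, by have := h.two_le; omega⟩
  have hU : palin (d + 2) T (d + 2 - 1) = T 0 * palin (d + 2) T d * T 0 := by
    change palin (d + 2) T (d + 1) = _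
    rw [palin]; simp
  set V := palin (d + 2) T d with hV
  have hVA : ∀ B : G, (∀ j, 1 ≤ j → j < d + 2 → Commute B (T j)) → ∀ d', d' ≤ d →
      Commute B (palin (d + 2) T d') := by
    intro B hB d' hd'
    induction d' with
    | zero => exact hB _ (by omega) (by omega)
    | succ d' ih =>
      have h1 := hB (d + 2 - 2 - d') (by omega) (by omega)
      exact (h1.mul_right (ih (by omega))).mul_right h1
  have h1 : Commute A V := hVA A (fun j hj hj' => h.affine_comm j hj hj') d le_rfl
  have h2 : Commute (T 0 * V * T 0) V := by
    rw [← hU]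
    exact hVA _ (fun j hj hj' => (h.commute_palin le_rfl (by omega) hj').symm) d le_rfl
  have h3 := h.affine
  rw [show yElt (d + 2) T A 1 = (T 0)⁻¹ * yElt (d + 2) T A 0 * (T 0)⁻¹ from rfl,
    show yElt (d + 2) T A 0 = palin (d + 2) T (d + 2 - 1) * A from rfl, hU]
  change T 0 * V * T 0 * A * ((T 0)⁻¹ * (T 0 * V * T 0 * A) * (T 0)⁻¹) =
    (T 0)⁻¹ * (T 0 * V * T 0 * A) * (T 0)⁻¹ * (T 0 * V * T 0 * A)
  calc _ = T 0 * V * T 0 * (A * V) * T 0 * A * (T 0)⁻¹ := by group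
    _ = ((T 0 * V * T 0) * V) * (A * T 0 * A * T 0) * (T 0)⁻¹ * (T 0)⁻¹ := by
      rw [h1.eq]; group
    _ = V * (T 0 * V * T 0) * (T 0 * A * T 0 * A) * (T 0)⁻¹ * (T 0)⁻¹ := by
      rw [h2.eq, h3]
    _ = V * T 0 * V * T 0 * (T 0 * A * T 0 * A) * (T 0)⁻¹ * (T 0)⁻¹ := by group
    _ = V * T 0 * V * T 0 * (A * T 0 * A * T 0) * (T 0)⁻¹ * (T 0)⁻¹ := by rw [h3]
    _ = V * T 0 * V * (T 0 * A * T 0 * A) * (T 0)⁻¹ := by group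
    _ = V * T 0 * V * (A * T 0 * A * T 0) * (T 0)⁻¹ := by rw [h3]
    _ = V * T 0 * (V * A) * T 0 * A := by group
    _ = V * T 0 * (A * V) * T 0 * A := by rw [h1.eq]
    _ = _ := by group

/-- The elements `Y_i` commute. -/
lemma BraidRel.commute_yElt (h : BraidRel n T A) {i j : ℕ} (hi : i < n) (hj : j < n) :
    Commute (yElt n T A i) (yElt n T A j) := by
  have h0 : ∀ j, j < n → Commute (yElt n T A 0) (yElt n T A j) := by
    intro j hj
    induction j with
    | zero => exact Commute.refl _
    | succ j ih =>
      rcases Nat.eq_zero_or_pos j with rfl | hpos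
      · exact h.commute_yElt_zero_one
      · have h1 : Commute (yElt n T A 0) (T j)⁻¹ :=
          (h.commute_yElt_high hpos (by omega)).symm.inv_right
        exact (h1.mul_right (ih (by omega))).mul_right h1
  have key : ∀ i, i < n → ∀ j, i ≤ j → j < n → Commute (yElt n T A i) (yElt n T A j) := by
    intro i
    induction i with
    | zero => exact fun _ j _ => h0 j
    | succ i ih =>
      intro hi j hij hj
      rcases Nat.eq_or_lt_of_le hij with rfl | hlt
      · exact Commute.refl _
      · have h1 : Commute (T i)⁻¹ (yElt n T A j) :=
          (h.commute_yElt_low (by omega) hj).inv_left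
        exact (h1.mul_left (ih (by omega) j (by omega) hj)).mul_left h1
  rcases Nat.le_total i j with hij | hij
  · exact key i hi j hij hj
  · exact (key j hj i hij hi).symm

end Hecke

end
end Koornwinder

namespace Koornwinder
noncomputable section
open scoped Matrix

/-! ### Products of consecutive operators -/

section Products

variable {M : Type*} [Monoid M]

/-- `T (b - d) ⋯ T (b - 1)`. -/
def ascProd (T : ℕ → M) (b : ℕ) : ℕ → M
  | 0 => 1
  | d + 1 => T (b - 1 - d) * ascProd T b d

/-- `T (a + d - 1) ⋯ T a`. -/
def descProd (T : ℕ → M) (a : ℕ) : ℕ → M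
  | 0 => 1
  | d + 1 => T (a + d) * descProd T a d

lemma ascProd_succ_right (T : ℕ → M) {b d : ℕ} (h : d ≤ b) :
    ascProd T (b + 1) (d + 1) = ascProd T b d * T b := by
  induction d with
  | zero => simp [ascProd]
  | succ d ih =>
    rw [ascProd, ih (by omega), ascProd, mul_assoc]
    congr 2; omega

lemma descProd_succ_right (T : ℕ → M) (a d : ℕ) :
    descProd T a (d + 1) = descProd T (a + 1) d * T a := by
  induction d with
  | zero => simp [descProd]
  | succ d ih =>
    rw [descProd, ih, descProd, mul_assoc]
    congr 2; omega

lemma map_ascProd {N : Type*} [Monoid N] (φ : M →* N) (T : ℕ → M) (b d : ℕ) :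
    φ (ascProd T b d) = ascProd (fun k => φ (T k)) b d := by
  induction d with
  | zero => simp [ascProd]
  | succ d ih => simp [ascProd, ih]

lemma map_descProd {N : Type*} [Monoid N] (φ : M →* N) (T : ℕ → M) (b d : ℕ) :
    φ (descProd T b d) = descProd (fun k => φ (T k)) b d := by
  induction d with
  | zero => simp [descProd]
  | succ d ih => simp [descProd, ih]

/-- Extension of a family indexed by `Fin n` to `ℕ`. -/
def natExt {n : ℕ} (f : Fin n → M) (k : ℕ) : M := if h : k < n then f ⟨k, h⟩ else 1

lemma natExt_fin {n : ℕ} (f : Fin n → M) (i : Fin n) : natExt f i = f i := by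
  simp [natExt]

lemma natExt_of_lt {n : ℕ} (f : Fin n → M) {k : ℕ} (h : k < n) : natExt f k = f ⟨k, h⟩ := by
  simp [natExt, h]

lemma prod_drop_finRange {n : ℕ} (f : Fin n → M) {d : ℕ} (hd : d ≤ n) :
    (((List.finRange n).drop (n - d)).map f).prod = ascProd (natExt f) n d := by
  induction d with
  | zero => simp [ascProd, List.drop_of_length_le]
  | succ d ih =>
    have h : n - (d + 1) < (List.finRange n).length := by simp; omega
    have h2 : n - 1 - d = n - (d + 1) := by omega
    rw [List.drop_eq_getElem_cons h, show n - (d + 1) + 1 = n - d by omega, List.map_cons,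
      List.prod_cons, ih (by omega), ascProd, h2, natExt_of_lt _ (by omega)]
    simp

lemma prod_take_finRange_reverse {n : ℕ} (f : Fin n → M) {d : ℕ} (hd : d ≤ n) :
    (((List.finRange n).take d).reverse.map f).prod = descProd (natExt f) 0 d := by
  induction d with
  | zero => simp [descProd]
  | succ d ih =>
    have h : d < (List.finRange n).length := by simp; omega
    rw [List.take_succ_eq_append_getElem h, List.reverse_append, List.map_append,
      List.prod_append, ih (by omega), descProd, natExt_of_lt _ (show 0 + d < n by omega)]
    simp

lemma prod_take_finRange {n : ℕ} (f : Fin n → M) {d : ℕ} (hd : d ≤ n) :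
    (((List.finRange n).take d).map f).prod = ascProd (natExt f) d d := by
  induction d with
  | zero => simp [ascProd]
  | succ d ih =>
    have h : d < (List.finRange n).length := by simp; omega
    rw [List.take_succ_eq_append_getElem h, List.map_append,
      List.prod_append, ih (by omega), ascProd_succ_right _ le_rfl, natExt_of_lt _ hd]
    simp

end Products

lemma palin_eq {G : Type*} [Group G] {n : ℕ} (T : ℕ → G) {d : ℕ} (hd : d < n) :
    palin n T d = ascProd T n (d + 1) * descProd T (n - 1 - d) d := by
  induction d with
  | zero => simp [palin, ascProd, descProd]
  | succ d ih =>
    rw [palin, ih (by omega), descProd_succ_right,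
      show ascProd T n (d + 1 + 1) = T (n - 1 - (d + 1)) * ascProd T n (d + 1) from rfl,
      show n - 2 - d = n - 1 - (d + 1) by omega, show n - 1 - (d + 1) + 1 = n - 1 - d by omega]
    simp only [mul_assoc]

/-- Each step of the recursion cancels the leftmost T_i and appends its inverse on the right. This
identifies the recursive elements, suited to proving commutation, with the products defining the
operators Y_i. -/
lemma yElt_eq {G : Type*} [Group G] {n : ℕ} (T : ℕ → G) (A : G) {i : ℕ} (hi : i < n) :
    yElt n T A i = ascProd T n (n - i) * descProd T 0 (n - 1) * A *
      ascProd (fun k => (T k)⁻¹) i i := by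
  induction i with
  | zero =>
    rw [yElt, palin_eq T (show n - 1 < n by omega), Nat.sub_self,
      show n - 1 + 1 = n - 0 by omega]
    simp [ascProd]
  | succ i ih =>
    have h1 : ascProd T n (n - i) = T i * ascProd T n (n - (i + 1)) := by
      rw [show n - i = n - (i + 1) + 1 by omega, ascProd]
      congr 2; omega
    rw [yElt, ih (by omega), ascProd_succ_right _ le_rfl, h1]
    group

variable {n : ℕ} {p : Params}

/-! ### The operators `T_i` as units, and the commutation of the `Y_i` -/

lemma unit_of_quadratic {A : Op n} {c : ℂ} (h : ∀ f, A (A f) = c • A f + f) :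
    A * (A - c • 1) = 1 ∧ (A - c • 1) * A = 1 := by
  constructor <;>
  · ext f
    simp [h f, sub_eq_add_neg, add_comm]

/-- `T_i` as an invertible operator. -/
def TU (p : Params) (i : Fin n) : (Op n)ˣ where
  val := T p i
  inv := T p i - ((p.tSimple i : ℂ) - (p.tSimple i : ℂ)⁻¹) • 1
  val_inv := (unit_of_quadratic (T_quadratic i)).1
  inv_val := (unit_of_quadratic (T_quadratic i)).2

/-- `T_0` as an invertible operator. -/
def T0U (hn : 0 < n) (p : Params) : (Op n)ˣ where
  val := T0 n p
  inv := T0 n p - ((p.t0 : ℂ) - (p.t0 : ℂ)⁻¹) • 1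
  val_inv := (unit_of_quadratic (T0_quadratic hn)).1
  inv_val := (unit_of_quadratic (T0_quadratic hn)).2

lemma inverse_T (i : Fin n) : Ring.inverse (T p i) =
    T p i - ((p.tSimple i : ℂ) - (p.tSimple i : ℂ)⁻¹) • 1 :=
  Ring.inverse_unit (TU p i)

lemma braidRel (hn : 2 ≤ n) : BraidRel n (natExt (TU (n := n) p)) (T0U (by omega) p) where
  two_le := hn
  braid k hk := by
    rw [natExt_of_lt _ (show k < n by omega), natExt_of_lt _ (show k + 1 < n by omega)]
    exact Units.ext (T_braid (i := ⟨k, by omega⟩) (j := ⟨k + 1, by omega⟩) rfl hk)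
  last k hk := by
    rw [natExt_of_lt _ (show k < n by omega), natExt_of_lt _ (show k + 1 < n by omega)]
    exact Units.ext (T_braid_last (i := ⟨k, by omega⟩) (j := ⟨k + 1, by omega⟩) rfl
      (by simp; omega))
  comm j k hjk hk := by
    rw [natExt_of_lt _ (show j < n by omega), natExt_of_lt _ hk]
    exact Units.ext (T_comm (i := ⟨j, by omega⟩) (j := ⟨k, by omega⟩) hjk)
  affine := by
    rw [natExt_of_lt _ (show 0 < n by omega)]
    exact Units.ext (T0_braid (i := ⟨0, by omega⟩) rfl hn)
  affine_comm k hk hkn := by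
    rw [natExt_of_lt _ hkn]
    exact Units.ext (T0_comm (j := ⟨k, hkn⟩) hk)

/-- `Y_i` as an invertible operator. -/
def YU (hn : 2 ≤ n) (p : Params) (i : Fin n) : (Op n)ˣ :=
  yElt n (natExt (TU p)) (T0U (by omega) p) i

lemma natExt_comp {M N : Type*} [Monoid M] [Monoid N] (φ : M →* N) (f : Fin n → M) :
    (fun k => φ (natExt f k)) = natExt (fun i => φ (f i)) := by
  ext k; unfold natExt; split_ifs <;> simp

lemma Y_eq_prod (p : Params) (i : Fin n) : Y p i =
    ascProd (natExt (T p)) n (n - i) * descProd (natExt (T p)) 0 (n - 1) * T0 n p *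
      ascProd (natExt fun j => Ring.inverse (T p j)) i i := by
  have hi := i.2
  rw [Y, ← prod_drop_finRange _ (show n - i ≤ n by omega),
    ← prod_take_finRange_reverse _ (show n - 1 ≤ n by omega), ← prod_take_finRange _ hi.le,
    show n - (n - (i : ℕ)) = i by omega, List.dropLast_eq_take, List.length_finRange]

lemma YU_val (hn : 2 ≤ n) (i : Fin n) : ((YU hn p i : (Op n)ˣ) : Op n) = Y p i := by
  have h1 := map_ascProd (Units.coeHom (Op n)) (natExt (TU p)) n (n - i)
  have h2 := map_descProd (Units.coeHom (Op n)) (natExt (TU p)) 0 (n - 1)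
  have h3 := map_ascProd (Units.coeHom (Op n)) (natExt fun i => (TU (n := n) p i)⁻¹) i i
  have h4 : (fun k => (natExt (TU (n := n) p) k)⁻¹) = natExt fun i => (TU p i)⁻¹ := by
    ext k; unfold natExt; split_ifs <;> simp
  rw [natExt_comp] at h1 h2 h3
  have h5 : ∀ j : Fin n, Ring.inverse (T p j) = ((TU p j)⁻¹ : (Op n)ˣ) :=
    fun j => Ring.inverse_unit (TU p j)
  rw [YU, yElt_eq _ _ i.2, Y_eq_prod, h4]
  simp_rw [h5]
  simp only [Units.val_mul]
  exact congrArg₂ _ (congrArg₂ _ (congrArg₂ _ h1 h2) rfl) h3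

lemma Y_commute (hn : 2 ≤ n) (i j : Fin n) : Y p i * Y p j = Y p j * Y p i := by
  rw [← YU_val hn, ← YU_val hn, ← Units.val_mul, ← Units.val_mul]
  exact congrArg _ ((braidRel hn).commute_yElt i.2 j.2).eq

/-- `Y_i = T_i Y_{i+1} T_i`. -/
lemma Y_eq_T_Y_T (hn : 2 ≤ n) {i : Fin n} (h : (i : ℕ) + 1 < n) :
    Y p i = T p i * Y p ⟨i + 1, h⟩ * T p i := by
  rw [← YU_val hn, ← YU_val hn]
  have : YU hn p i = TU p i * YU hn p ⟨i + 1, h⟩ * TU p i := by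
    simp only [YU, yElt, natExt_fin]
    group
  rw [this]
  rfl

lemma T_commute_Y (hn : 2 ≤ n) {i j : Fin n} (h1 : j ≠ i) (h2 : (j : ℕ) ≠ i + 1) :
    T p i * Y p j = Y p j * T p i := by
  rw [← YU_val hn]
  have h1' : (j : ℕ) ≠ i := fun h => h1 (Fin.ext h)
  have : TU p i * YU hn p j = YU hn p j * TU p i := by
    rw [YU, ← natExt_fin (TU p) i]
    rcases Nat.lt_or_ge (j : ℕ) i with h | h
    · exact ((braidRel hn).commute_yElt_high h i.2).eq
    · exact ((braidRel hn).commute_yElt_low (by omega) j.2).eq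
  exact congrArg (fun u : (Op n)ˣ => (u : Op n)) this

/-- `T_n⁻¹ Y_n` satisfies the quadratic relation of `T_0`. -/
lemma Y_last_quadratic (hn : 2 ≤ n) {i : Fin n} (h : ¬ (i : ℕ) + 1 < n) (f : RatFn n) :
    Ring.inverse (Y p i) (T p i f) =
      Ring.inverse (T p i) (Y p i f) - ((p.t0 : ℂ) - (p.t0 : ℂ)⁻¹) • f := by
  have hi : (i : ℕ) = n - 1 := by have := i.2; omega
  set A := T0U (show 0 < n by omega) p with hA
  set D := descProd (natExt (TU (n := n) p)) 0 (n - 1) with hD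
  have hC : ∀ d, ascProd (fun k => (natExt (TU (n := n) p) k)⁻¹) d d =
      (descProd (natExt (TU (n := n) p)) 0 d)⁻¹ := by
    intro d
    induction d with
    | zero => simp [ascProd, descProd]
    | succ d ih => rw [ascProd_succ_right _ le_rfl, ih, descProd, mul_inv_rev, zero_add]
  -- The last operator is T_n times the conjugate of T_0 by D = T_{n-1} ⋯ T_1; hence T_n⁻¹ Y_n
  -- inherits the quadratic relation of T_0.
  have h1 : YU hn p i = TU p i * (D * A * D⁻¹) := by
    rw [YU, yElt_eq _ _ i.2, hC, show n - (i : ℕ) = 0 + 1 by omega, hi]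
    simp only [ascProd, mul_one, Nat.sub_zero, ← hi]
    rw [natExt_fin]
    simp only [hi, ← hD, mul_assoc]
    rfl
  have h2 : (YU hn p i)⁻¹ * TU p i = D * A⁻¹ * D⁻¹ := by rw [h1]; group
  have h3 : (TU p i)⁻¹ * YU hn p i = D * A * D⁻¹ := by rw [h1]; group
  have hY : Ring.inverse (Y p i) = ((YU hn p i)⁻¹ : (Op n)ˣ) := by
    rw [← YU_val hn]; exact Ring.inverse_unit _
  have hT : Ring.inverse (T p i) = ((TU p i)⁻¹ : (Op n)ˣ) := Ring.inverse_unit (TU p i)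
  have e1 : Ring.inverse (Y p i) (T p i f) = (D * A⁻¹ * D⁻¹ : (Op n)ˣ).1 f := by
    rw [← h2, hY]; rfl
  have e2 : Ring.inverse (T p i) (Y p i f) = (D * A * D⁻¹ : (Op n)ˣ).1 f := by
    rw [← h3, hT, ← YU_val hn]; rfl
  have hDD : (D : Op n) ((D⁻¹ : (Op n)ˣ).1 f) = f := by
    rw [← Module.End.mul_apply, Units.mul_inv]; rfl
  have e3 : (D * A⁻¹ * D⁻¹ : (Op n)ˣ).1 f =
      (D : Op n) (A.1 ((D⁻¹ : (Op n)ˣ).1 f)) - ((p.t0 : ℂ) - (p.t0 : ℂ)⁻¹) • f := by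
    change (D : Op n) ((T0 n p - ((p.t0 : ℂ) - (p.t0 : ℂ)⁻¹) • 1 : Op n)
      ((D⁻¹ : (Op n)ˣ).1 f)) = _
    rw [LinearMap.sub_apply, map_sub, LinearMap.smul_apply, map_smul, Module.End.one_apply, hDD]
    rfl
  rw [e1, e2, e3]
  rfl

end
end Koornwinder

namespace Koornwinder
noncomputable section
open scoped Matrix

/-! ### The operators `T_i` on monomials, up to lower orbits -/

section Strings

variable {K : Type*} [Field K]

/-- The quotient of s f - f by 1 - z is a geometric sum along the string from f to s f. The term -t²
z in the numerator shifts the sum by one place, which cancels t f at the near end and leaves t⁻¹ s f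
at the far end; every other term is strictly inside. -/
lemma dl_string_pos {t c z X f : K} {s : K →+* K} (ht : t ≠ 0) (hz0 : z ≠ 0) (hz1 : z ≠ 1)
    (k : ℕ) (hs : s f = z⁻¹ ^ (k + 1) * f) :
    dl t ((1 + c * X - t ^ 2 * z) / (1 - z)) s f = t⁻¹ * s f +
      t⁻¹ * ((1 - t ^ 2) * ∑ j ∈ Finset.range k, z⁻¹ ^ (j + 1) * f +
        c * ∑ j ∈ Finset.range (k + 1), X * (z⁻¹ ^ (j + 1) * f)) := by
  have hz : (1 - z) ≠ 0 := sub_ne_zero.mpr hz1.symm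
  have hg : z⁻¹ * z = 1 := inv_mul_cancel₀ hz0
  set g := z⁻¹
  set S := ∑ j ∈ Finset.range k, g ^ (j + 1) with hS
  have h1 : ∑ j ∈ Finset.range (k + 1), g ^ (j + 1) = S + g ^ (k + 1) := Finset.sum_range_succ _ _
  have h2 : ∀ m, (∑ j ∈ Finset.range m, g ^ (j + 1)) * (1 - z) = g ^ m - 1 := by
    intro m
    induction m with
    | zero => simp
    | succ m ih => rw [Finset.sum_range_succ, add_mul, ih, pow_succ]; linear_combination (-g ^ m) * hg
  have h3 := h2 (k + 1)
  rw [h1] at h3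
  have h4 := h2 k
  rw [← hS] at h4
  rw [dl, ← Finset.sum_mul, ← Finset.mul_sum, ← Finset.sum_mul, h1, hs, ← hS]
  have h5 : (1 + c * X - t ^ 2 * z) / (1 - z) * (g ^ (k + 1) * f - f) =
      (1 + c * X - t ^ 2 * z) * (S + g ^ (k + 1)) * f := by
    rw [div_mul_eq_mul_div, div_eq_iff hz]
    linear_combination (-(1 + c * X - t ^ 2 * z) * f) * h3
  rw [h5]
  have h6 : z * (S + g ^ (k + 1)) = 1 + S := by
    linear_combination (-1 : K) * h3
  have h7 : t⁻¹ * t = 1 := inv_mul_cancel₀ ht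
  linear_combination (-t⁻¹ * t ^ 2 * f) * h6 - t * f * h7

/-- With the string running in the opposite direction neither end cancels: f survives with t - t⁻¹
and s f with t. -/
lemma dl_string_neg {t c z X f : K} {s : K →+* K} (ht : t ≠ 0) (hz1 : z ≠ 1)
    (k : ℕ) (hs : s f = z ^ (k + 1) * f) :
    dl t ((1 + c * X - t ^ 2 * z) / (1 - z)) s f = (t - t⁻¹) * f + t * s f -
      t⁻¹ * ((1 - t ^ 2) * ∑ j ∈ Finset.range k, z ^ (j + 1) * f +
        c * ∑ j ∈ Finset.range (k + 1), X * (z ^ j * f)) := by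
  have hz : (1 - z) ≠ 0 := sub_ne_zero.mpr hz1.symm
  set S := ∑ j ∈ Finset.range k, z ^ (j + 1) with hS
  have h1 : ∑ j ∈ Finset.range (k + 1), z ^ j = S + 1 := by
    rw [Finset.sum_range_succ', pow_zero]
  have h3 : (S + 1) * (1 - z) = 1 - z ^ (k + 1) := by
    rw [← h1, ← geom_sum_mul_neg]
  rw [dl, ← Finset.sum_mul, ← Finset.mul_sum, ← Finset.sum_mul, h1, hs, ← hS]
  have h5 : (1 + c * X - t ^ 2 * z) / (1 - z) * (z ^ (k + 1) * f - f) =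
      -(1 + c * X - t ^ 2 * z) * (S + 1) * f := by
    rw [div_mul_eq_mul_div, div_eq_iff hz]
    linear_combination ((1 + c * X - t ^ 2 * z) * f) * h3
  rw [h5]
  have h7 : t⁻¹ * t = 1 := inv_mul_cancel₀ ht
  have h8 : z * (S + 1) = S + z ^ (k + 1) := by linear_combination -h3
  linear_combination (t⁻¹ * t ^ 2 * f) * h8 + t * z ^ (k + 1) * f * h7

lemma dl_fixed {t v f : K} {s : K →+* K} (hs : s f = f) : dl t v s f = t * f := by
  simp [dl, hs]

end Strings

variable {n : ℕ} {p : Params}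

/-- The span of the monomials in lower orbits. -/
def LowS (l : Wt n) : Submodule ℂ (Laurent n) :=
  Submodule.span ℂ (mono '' {m | DomLT (domPart m) (domPart l)})

/-- The image of `LowS` in the rational functions. -/
def LowR (l : Wt n) : Submodule ℂ (RatFn n) := (LowS l).map toRat.toLinearMap

lemma cst_mul_mem {c : ℂ} {S : Submodule ℂ (RatFn n)} {f : RatFn n} (h : f ∈ S) :
    cst c * f ∈ S := by
  rw [cst_mul_eq_smul]; exact S.smul_mem _ h

lemma monoR_mem_lowR {l m : Wt n} (h : DomLT (domPart m) (domPart l)) : monoR m ∈ LowR l :=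
  ⟨mono m, Submodule.subset_span ⟨m, h, rfl⟩, rfl⟩

lemma cst_zpow (c : ℂˣ) (k : ℤ) : (cst ((c ^ k : ℂˣ) : ℂ) : RatFn n) = cst (c : ℂ) ^ k := by
  rw [Units.val_zpow_eq_zpow_val, cst, map_zpow₀]; rfl

lemma monoR_zsmul (k : ℤ) (a : Wt n) : (monoR (k • a) : RatFn n) = monoR a ^ k := by
  cases k with
  | ofNat k => rw [Int.ofNat_eq_natCast, natCast_zsmul, monoR_nsmul, zpow_natCast]
  | negSucc k => rw [negSucc_zsmul, monoR_neg, monoR_nsmul, zpow_negSucc]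

/-- A monomial `z^k x^l` with `z = c x^α`. -/
lemma zpow_mul_monoR (c : ℂˣ) (α l : Wt n) (k : ℤ) :
    (cst (c : ℂ) * monoR α : RatFn n) ^ k * monoR l =
      cst ((c ^ k : ℂˣ) : ℂ) * monoR (l + k • α) := by
  rw [mul_zpow, cst_zpow, monoR_add, monoR_zsmul]; ring

/-- The data of a root string: `z = c x^{r d}`, and either the middle coefficient `b` vanishes, or
`r = 2` and `X` is proportional to `x^d`. -/
structure StringData (d : Wt n) (r : ℤ) (z X : RatFn n) (b : ℂ) : Prop where
  signed : Signed d
  ne_zero : d ≠ 0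
  pos : 0 < r
  z_eq : ∃ c : ℂˣ, z = cst (c : ℂ) * monoR (r • d)
  z_ne : z ≠ 1
  X_eq : b = 0 ∨ (r = 2 ∧ ∃ c : ℂ, X = cst c * monoR d)

lemma StringData.z_ne_zero {d : Wt n} {r : ℤ} {z X : RatFn n} {b : ℂ}
    (h : StringData d r z X b) : z ≠ 0 := by
  obtain ⟨c, rfl⟩ := h.z_eq
  exact mul_ne_zero (cst_unit_ne_zero c) (monoR_ne_zero _)

lemma StringData.term_mem {d : Wt n} {r : ℤ} {z X : RatFn n} {b : ℂ}
    (h : StringData d r z X b) {l : Wt n} {j : ℤ}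
    (hj : DomLT (domPart (l + (r * j) • d)) (domPart l)) : z ^ j * monoR l ∈ LowR l := by
  obtain ⟨c, rfl⟩ := h.z_eq
  rw [zpow_mul_monoR, smul_smul, mul_comm j]
  exact cst_mul_mem (monoR_mem_lowR hj)

lemma StringData.mid_mem {d : Wt n} {r : ℤ} {z X : RatFn n} {b : ℂ}
    (h : StringData d r z X b) {l : Wt n} {j : ℤ} (hr : r = 2) {cX : ℂ}
    (hX : X = cst cX * monoR d)
    (hj : DomLT (domPart (l + (2 * j + 1) • d)) (domPart l)) :
    X * (z ^ j * monoR l) ∈ LowR l := by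
  obtain ⟨c, rfl⟩ := h.z_eq
  have : d + (l + j • (r • d)) = l + (2 * j + 1) • d := by rw [hr]; module
  rw [zpow_mul_monoR, hX, mul_mul_mul_comm, ← monoR_add, this, mul_assoc]
  exact cst_mul_mem (cst_mul_mem (monoR_mem_lowR hj))

lemma StringData.mem_pos {d : Wt n} {r : ℤ} {z X : RatFn n} {b : ℂ}
    (h : StringData d r z X b) {l : Wt n} {t : ℂˣ} {s : RatFn n →+* RatFn n} (k : ℕ)
    (hs : s (monoR l) = z⁻¹ ^ (k + 1) * monoR l)
    (hl : l - (r * (k + 1)) • d ∈ weylOrbit l) :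
    dl (cst (t : ℂ)) ((1 + cst b * X - cst (t : ℂ) ^ 2 * z) / (1 - z)) s (monoR l) -
      cst ((t⁻¹ : ℂˣ) : ℂ) * s (monoR l) ∈ LowR l := by
  have hpow : ∀ j : ℕ, z⁻¹ ^ (j + 1) = z ^ (-(j + 1 : ℤ)) := fun j => by
    rw [zpow_neg, inv_pow]; norm_cast
  rw [dl_string_pos (cst_unit_ne_zero t) h.z_ne_zero h.z_ne k hs, ← cst_inv, add_sub_cancel_left]
  refine cst_mul_mem (add_mem ?_ ?_)
  · have : (1 - cst (t : ℂ) ^ 2 : RatFn n) = cst (1 - (t : ℂ) ^ 2) := by simp [cst]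
    rw [this]
    refine cst_mul_mem (sum_mem fun j hj => ?_)
    rw [hpow]
    refine h.term_mem ?_
    have := domPart_lt_of_inside h.signed h.ne_zero (j := r * (j + 1)) (K := r * (k + 1))
      (mul_pos h.pos (by omega))
      (mul_lt_mul_of_pos_left (by simpa using Finset.mem_range.mp hj) h.pos) hl
    convert this using 2
    module
  · rcases h.X_eq with rfl | ⟨hr, cX, hX⟩
    · simp [cst]
    · refine cst_mul_mem (sum_mem fun j hj => ?_)
      rw [hpow]
      refine h.mid_mem hr hX ?_
      -- Multiplication by z moves two steps of d and multiplication by X one step, so the middle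
      -- terms sit at the odd positions, still strictly between the ends.
      have := domPart_lt_of_inside h.signed h.ne_zero (j := 2 * (j + 1) - 1) (K := r * (k + 1))
        (by omega) (by rw [hr]; have := Finset.mem_range.mp hj; omega) hl
      convert this using 2
      module

lemma StringData.mem_neg {d : Wt n} {r : ℤ} {z X : RatFn n} {b : ℂ}
    (h : StringData d r z X b) {l : Wt n} {t : ℂˣ} {s : RatFn n →+* RatFn n} (k : ℕ)
    (hs : s (monoR l) = z ^ (k + 1) * monoR l)
    (hl : l + (r * (k + 1)) • d ∈ weylOrbit l) :
    dl (cst (t : ℂ)) ((1 + cst b * X - cst (t : ℂ) ^ 2 * z) / (1 - z)) s (monoR l) -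
      (cst ((t : ℂ) - (t : ℂ)⁻¹) * monoR l + cst (t : ℂ) * s (monoR l)) ∈ LowR l := by
  -- The other end of the string is now l + r(k + 1) d, so convexity is applied in the direction -d.
  have hl' : l - (r * (k + 1)) • (-d) ∈ weylOrbit l := by rwa [smul_neg, sub_neg_eq_add]
  have h1 : (cst ((t : ℂ) - (t : ℂ)⁻¹) : RatFn n) = cst (t : ℂ) - (cst (t : ℂ))⁻¹ := by
    simp [cst]
  rw [dl_string_neg (cst_unit_ne_zero t) h.z_ne k hs, h1, sub_sub_cancel_left, ← cst_inv]
  refine neg_mem (cst_mul_mem (add_mem ?_ ?_))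
  · have : (1 - cst (t : ℂ) ^ 2 : RatFn n) = cst (1 - (t : ℂ) ^ 2) := by simp [cst]
    rw [this]
    refine cst_mul_mem (sum_mem fun j hj => ?_)
    rw [← zpow_natCast]
    refine h.term_mem ?_
    have := domPart_lt_of_inside (signed_neg h.signed) (neg_ne_zero.mpr h.ne_zero)
      (j := r * (j + 1)) (K := r * (k + 1)) (mul_pos h.pos (by omega))
      (mul_lt_mul_of_pos_left (by simpa using Finset.mem_range.mp hj) h.pos) hl'
    convert this using 2
    push_cast
    module
  · rcases h.X_eq with rfl | ⟨hr, cX, hX⟩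
    · simp [cst]
    · refine cst_mul_mem (sum_mem fun j hj => ?_)
      rw [← zpow_natCast]
      refine h.mid_mem hr hX ?_
      have := domPart_lt_of_inside (signed_neg h.signed) (neg_ne_zero.mpr h.ne_zero)
        (j := 2 * j + 1) (K := r * (k + 1))
        (by omega) (by rw [hr]; have := Finset.mem_range.mp hj; omega) hl'
      convert this using 2
      module

/-- The string data of the simple reflection `s_i`. -/
lemma stringData_simple (p : Params) (i : Fin n) : ∃ (d : Wt n) (r : ℤ) (z X : RatFn n) (b : ℂ),
    StringData d r z X b ∧ r • d = simpleRoot i ∧ z = monoR (simpleRoot i) ∧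
    vS p i = (1 + cst b * X - cst (p.tSimple i : ℂ) ^ 2 * z) / (1 - z) := by
  have hz := monoR_ne_one (posRoots_ne_zero (simpleRoot_mem i))
  by_cases h : (i : ℕ) + 1 < n
  · refine ⟨simpleRoot i, 1, monoR (simpleRoot i), 0, 0,
      ⟨signed_of_posRoots (simpleRoot_mem i), posRoots_ne_zero (simpleRoot_mem i), one_pos,
      ⟨1, by simp [cst]⟩, hz, Or.inl rfl⟩, one_smul _ _, rfl, ?_⟩
    rw [vS_of_lt h, tSimple_of_lt h]; simp
  · have h1 : (2 : ℤ) • e (i : ℕ) = simpleRoot i := by rw [simpleRoot_of_last h]; rfl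
    have h2 : (monoR (simpleRoot i) : RatFn n) = monoR (e (i : ℕ)) ^ 2 := by
      rw [simpleRoot_of_last h, monoR_nsmul]
    refine ⟨e (i : ℕ), 2, monoR (simpleRoot i), monoR (e (i : ℕ)), cN p,
      ⟨signed_e i, fun h => ?_, two_pos,
      ⟨1, by simp [cst, h1]⟩, hz, Or.inr ⟨rfl, 1, by simp [cst]⟩⟩, h1, rfl, ?_⟩
    · have := congrFun h i
      simp [e_apply] at this
    · rw [vS_of_last h, tSimple_of_last h, h2]

/-- The length of the string from l to s_i l is ⟨l, a_i^∨⟩, which the proof writes as k + 1. -/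
lemma T_monoR_pos {i : Fin n} {l : Wt n} (hl : 0 < l ⬝ᵥ simpleRoot i) :
    T p i (monoR l) - cst (((p.tSimple i)⁻¹ : ℂˣ) : ℂ) * monoR (simpleRefl i l) ∈ LowR l := by
  obtain ⟨d, r, z, X, b, h, hd, hz, hv⟩ := stringData_simple p i
  obtain ⟨k, hk⟩ := Int.eq_ofNat_of_zero_le (dot_simple_pos.mp hl).le
  obtain ⟨k, rfl⟩ : ∃ m, k = m + 1 := ⟨k - 1, by have := dot_simple_pos.mp hl; omega⟩
  have h1 : l - (r * (k + 1)) • d = simpleRefl i l := by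
    rw [simpleRefl_eq, hk, ← hd, smul_smul, mul_comm r]; push_cast; rfl
  have h2 : sR i (monoR l) = z⁻¹ ^ (k + 1) * monoR l := by
    rw [sR_monoR, simpleRefl_eq, hk, monoR_sub, monoR_zsmul, hz, zpow_natCast, inv_pow,
      div_eq_inv_mul]
  have h3 := h.mem_pos (t := p.tSimple i) k h2
    (by rw [h1]; exact weyl_mem_weylOrbit (simpleRefl_mem i) l)
  rwa [← hv, ← T_apply, sR_monoR] at h3

lemma T_monoR_neg {i : Fin n} {l : Wt n} (hl : l ⬝ᵥ simpleRoot i < 0) :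
    T p i (monoR l) - (cst ((p.tSimple i : ℂ) - (p.tSimple i : ℂ)⁻¹) * monoR l +
      cst (p.tSimple i : ℂ) * monoR (simpleRefl i l)) ∈ LowR l := by
  obtain ⟨d, r, z, X, b, h, hd, hz, hv⟩ := stringData_simple p i
  obtain ⟨k, hk⟩ := Int.eq_ofNat_of_zero_le (neg_nonneg.mpr (dot_simple_neg.mp hl).le)
  obtain ⟨k, rfl⟩ : ∃ m, k = m + 1 := ⟨k - 1, by have := dot_simple_neg.mp hl; omega⟩
  have hk' : l ⬝ᵥ coroot (simpleRoot i) = -((k + 1 : ℕ) : ℤ) := by omega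
  have h1 : l + (r * (k + 1)) • d = simpleRefl i l := by
    rw [simpleRefl_eq, hk', ← hd, smul_smul, mul_comm r, neg_mul, neg_smul, sub_neg_eq_add]
    push_cast; rfl
  have h2 : sR i (monoR l) = z ^ (k + 1) * monoR l := by
    rw [sR_monoR, simpleRefl_eq, hk', neg_smul, sub_neg_eq_add, monoR_add, monoR_zsmul, hz,
      zpow_natCast, mul_comm]
  have h3 := h.mem_neg (t := p.tSimple i) k h2
    (by rw [h1]; exact weyl_mem_weylOrbit (simpleRefl_mem i) l)
  rwa [← hv, ← T_apply, sR_monoR] at h3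

lemma T_monoR_zero {i : Fin n} {l : Wt n} (hl : l ⬝ᵥ simpleRoot i = 0) :
    T p i (monoR l) = cst (p.tSimple i : ℂ) * monoR l := by
  rw [T_apply, dl_fixed]
  rw [sR_monoR, simpleRefl_eq_self_iff.mpr hl]

lemma signFlip_zero_eq (hn : 0 < n) (l : Wt n) :
    signFlip 0 l = l - (2 * l ⟨0, hn⟩) • e 0 := by
  ext k
  simp only [signFlip_apply, Pi.sub_apply, Pi.smul_apply, e_apply, smul_eq_mul]
  split_ifs with h
  · have : k = ⟨0, hn⟩ := Fin.ext h
    subst this; ring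
  · ring

lemma signFlip_zero_mem (hn : 0 < n) : signFlip 0 ∈ weylGroup n := signFlip_mem ⟨0, hn⟩

lemma s0R_monoR_eq (hn : 0 < n) (l : Wt n) :
    s0R p.q (monoR l) = (yR n p ^ 2) ^ (l ⟨0, hn⟩) * monoR l := by
  rw [s0R_monoR, yR_sq, zpow_mul_monoR, e0_dot hn, signFlip_zero_eq hn]
  congr 2
  module

lemma stringData_affine (hn : 0 < n) :
    StringData (-e 0 : Wt n) 2 (yR n p ^ 2) (yR n p) (c0 p) where
  signed := signed_neg (signed_e ⟨0, hn⟩)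
  ne_zero h := by
    have := congrFun h ⟨0, hn⟩
    simp [e_apply] at this
  pos := two_pos
  z_eq := ⟨p.q, by rw [yR_sq, smul_neg]; rfl⟩
  z_ne := yR_sq_ne hn
  X_eq := Or.inr ⟨rfl, p.qh, rfl⟩

lemma T0_monoR_neg (hn : 0 < n) {l : Wt n} (hl : l ⟨0, hn⟩ < 0) :
    T0 n p (monoR l) - cst ((p.t0⁻¹ * p.q ^ l ⟨0, hn⟩ : ℂˣ) : ℂ) * monoR (signFlip 0 l) ∈
      LowR l := by
  have h := stringData_affine (p := p) hn
  obtain ⟨k, hk⟩ : ∃ k : ℕ, l ⟨0, hn⟩ = -((k + 1 : ℕ) : ℤ) :=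
    ⟨(-l ⟨0, hn⟩ - 1).toNat, by omega⟩
  have h1 : l - ((2 : ℤ) * (k + 1)) • (-e 0) = signFlip 0 l := by
    rw [signFlip_zero_eq hn, hk]; push_cast; module
  have h2 : s0R p.q (monoR l) = (yR n p ^ 2)⁻¹ ^ (k + 1) * monoR l := by
    rw [s0R_monoR_eq hn, hk, zpow_neg, zpow_natCast, inv_pow]
  have h3 := h.mem_pos (t := p.t0) k h2
    (by rw [h1]; exact weyl_mem_weylOrbit (signFlip_zero_mem hn) l)
  rw [← v0_eq hn, ← T0_apply, s0R_monoR, e0_dot hn, ← mul_assoc] at h3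
  convert h3 using 3
  rw [Units.val_mul, cst, map_mul]; rfl

lemma T0_monoR_pos (hn : 0 < n) {l : Wt n} (hl : 0 < l ⟨0, hn⟩) :
    T0 n p (monoR l) - (cst ((p.t0 : ℂ) - (p.t0 : ℂ)⁻¹) * monoR l +
      cst ((p.t0 * p.q ^ l ⟨0, hn⟩ : ℂˣ) : ℂ) * monoR (signFlip 0 l)) ∈ LowR l := by
  have h := stringData_affine (p := p) hn
  obtain ⟨k, hk⟩ : ∃ k : ℕ, l ⟨0, hn⟩ = ((k + 1 : ℕ) : ℤ) :=
    ⟨(l ⟨0, hn⟩ - 1).toNat, by omega⟩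
  have h1 : l + ((2 : ℤ) * (k + 1)) • (-e 0) = signFlip 0 l := by
    rw [signFlip_zero_eq hn, hk]; push_cast; module
  have h2 : s0R p.q (monoR l) = (yR n p ^ 2) ^ (k + 1) * monoR l := by
    rw [s0R_monoR_eq hn, hk, zpow_natCast]
  have h3 := h.mem_neg (t := p.t0) k h2
    (by rw [h1]; exact weyl_mem_weylOrbit (signFlip_zero_mem hn) l)
  rw [← v0_eq hn, ← T0_apply, s0R_monoR, e0_dot hn, ← mul_assoc (cst (p.t0 : ℂ))] at h3
  convert h3 using 4
  rw [Units.val_mul, cst, map_mul]; rfl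

lemma T0_monoR_zero (hn : 0 < n) {l : Wt n} (hl : l ⟨0, hn⟩ = 0) :
    T0 n p (monoR l) = cst (p.t0 : ℂ) * monoR l := by
  rw [T0_apply, dl_fixed]
  rw [s0R_monoR_eq hn, hl, zpow_zero, one_mul]

/-! ### The operators on Laurent polynomials -/

/-- `B` is the restriction of `A` to `𝒜`. -/
def Lifts (A : Op n) (B : Module.End ℂ (Laurent n)) : Prop :=
  ∀ f, A (toRat f) = toRat (B f)

lemma laurent_induction {motive : Laurent n → Prop} (f : Laurent n)
    (mono : ∀ l, motive (mono l)) (add : ∀ f g, motive f → motive g → motive (f + g))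
    (smul : ∀ (c : ℂ) f, motive f → motive (c • f)) : motive f := by
  refine AddMonoidAlgebra.induction_on f (fun a => mono a) add smul

lemma exists_lift_of_monoR {A : Op n} (h : ∀ l, ∃ g, A (monoR l) = toRat g) :
    ∃ B : Module.End ℂ (Laurent n), Lifts A B := by
  have h' : ∀ f, ∃ g, A (toRat f) = toRat g := fun f => by
    induction f using laurent_induction with
    | mono l => exact h l
    | add f g hf hg =>
      obtain ⟨a, ha⟩ := hf; obtain ⟨b, hb⟩ := hg
      exact ⟨a + b, by rw [map_add, map_add, map_add, ha, hb]⟩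
    | smul c f hf =>
      obtain ⟨a, ha⟩ := hf
      exact ⟨c • a, by rw [map_smul, map_smul, map_smul, ha]⟩
  choose B hB using h'
  exact ⟨{ toFun := B
           map_add' := fun f g => toRat_injective (by rw [← hB, map_add, map_add, map_add, hB, hB])
           map_smul' := fun c f => toRat_injective (by
            rw [← hB, map_smul, map_smul, RingHom.id_apply, map_smul, hB]) }, hB⟩

/-- Turns the leading-term formulas for T_i into the statement that T_i preserves Laurent
polynomials. -/
lemma lowR_lift {l : Wt n} {A g : RatFn n} (h : A - g ∈ LowR l) (hg : ∃ g', g = toRat g') :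
    ∃ g', A = toRat g' := by
  obtain ⟨r, -, hr⟩ := h
  obtain ⟨g', rfl⟩ := hg
  exact ⟨g' + r, by rw [map_add]; exact sub_eq_iff_eq_add'.mp hr.symm⟩

lemma exists_lift_T (p : Params) (i : Fin n) : ∃ B, Lifts (T p i) B := by
  refine exists_lift_of_monoR fun l => ?_
  rcases lt_trichotomy (l ⬝ᵥ simpleRoot i) 0 with h | h | h
  · refine lowR_lift (T_monoR_neg h)
      ⟨((p.tSimple i : ℂ) - (p.tSimple i : ℂ)⁻¹) • mono l +
        (p.tSimple i : ℂ) • mono (simpleRefl i l), ?_⟩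
    rw [map_add, toRat_smul_mono, toRat_smul_mono]
  · exact ⟨_ • mono _, by rw [T_monoR_zero h, toRat_smul_mono]⟩
  · exact lowR_lift (T_monoR_pos h) ⟨_ • mono _, by rw [toRat_smul_mono]⟩

lemma exists_lift_T0 (hn : 0 < n) (p : Params) : ∃ B, Lifts (T0 n p) B := by
  refine exists_lift_of_monoR fun l => ?_
  rcases lt_trichotomy (l ⟨0, hn⟩) 0 with h | h | h
  · exact lowR_lift (T0_monoR_neg hn h) ⟨_ • mono _, by rw [toRat_smul_mono]⟩
  · exact ⟨_ • mono _, by rw [T0_monoR_zero hn h, toRat_smul_mono]⟩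
  · refine lowR_lift (T0_monoR_pos hn h)
      ⟨((p.t0 : ℂ) - (p.t0 : ℂ)⁻¹) • mono l +
        ((p.t0 * p.q ^ l ⟨0, hn⟩ : ℂˣ) : ℂ) • mono (signFlip 0 l), ?_⟩
    rw [map_add, toRat_smul_mono, toRat_smul_mono]

/-- The restriction of `T_i` to `𝒜`. -/
def TL (p : Params) (i : Fin n) : Module.End ℂ (Laurent n) := (exists_lift_T p i).choose

/-- The restriction of `T_0` to `𝒜`. -/
def T0L (hn : 0 < n) (p : Params) : Module.End ℂ (Laurent n) := (exists_lift_T0 hn p).choose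

lemma lifts_T (i : Fin n) : Lifts (T p i) (TL p i) := (exists_lift_T p i).choose_spec

lemma lifts_T0 (hn : 0 < n) : Lifts (T0 n p) (T0L hn p) := (exists_lift_T0 hn p).choose_spec

lemma Lifts.mul {A A' : Op n} {B B' : Module.End ℂ (Laurent n)} (h : Lifts A B)
    (h' : Lifts A' B') : Lifts (A * A') (B * B') := fun f => by
  rw [Module.End.mul_apply, h', h]; rfl

lemma Lifts.one : Lifts (1 : Op n) 1 := fun _ => rfl

lemma Lifts.sub_smul_one {A : Op n} {B : Module.End ℂ (Laurent n)} (h : Lifts A B) (c : ℂ) :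
    Lifts (A - c • 1) (B - c • 1) := fun f => by
  simp [h f]

lemma Lifts.ascProd {A : ℕ → Op n} {B : ℕ → Module.End ℂ (Laurent n)}
    (h : ∀ k, Lifts (A k) (B k)) (b d : ℕ) : Lifts (ascProd A b d) (ascProd B b d) := by
  induction d with
  | zero => exact Lifts.one
  | succ d ih => exact (h _).mul ih

lemma Lifts.descProd {A : ℕ → Op n} {B : ℕ → Module.End ℂ (Laurent n)}
    (h : ∀ k, Lifts (A k) (B k)) (b d : ℕ) : Lifts (descProd A b d) (descProd B b d) := by
  induction d with
  | zero => exact Lifts.one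
  | succ d ih => exact (h _).mul ih

lemma Lifts.natExt {A : Fin n → Op n} {B : Fin n → Module.End ℂ (Laurent n)}
    (h : ∀ k, Lifts (A k) (B k)) (k : ℕ) : Lifts (natExt A k) (natExt B k) := by
  unfold Koornwinder.natExt
  split_ifs
  · exact h _
  · exact Lifts.one

/-- The restriction of `T_i⁻¹` to `𝒜`. -/
def TLinv (p : Params) (i : Fin n) : Module.End ℂ (Laurent n) :=
  TL p i - ((p.tSimple i : ℂ) - (p.tSimple i : ℂ)⁻¹) • 1

lemma lifts_Tinv (i : Fin n) : Lifts (Ring.inverse (T p i)) (TLinv p i) := by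
  rw [inverse_T]; exact (lifts_T i).sub_smul_one _

/-- The restriction of `Y_i` to `𝒜`. -/
def YL (p : Params) (i : Fin n) : Module.End ℂ (Laurent n) :=
  ascProd (natExt (TL p)) n (n - i) * descProd (natExt (TL p)) 0 (n - 1) *
    T0L (by have := i.2; omega) p * ascProd (natExt (TLinv p)) i i

lemma lifts_Y (i : Fin n) : Lifts (Y p i) (YL p i) := by
  rw [Y_eq_prod]
  exact (((Lifts.ascProd (Lifts.natExt lifts_T) _ _).mul
    (Lifts.descProd (Lifts.natExt lifts_T) _ _)).mul (lifts_T0 _)).mul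
    (Lifts.ascProd (Lifts.natExt lifts_Tinv) _ _)

end
end Koornwinder

namespace Koornwinder
noncomputable section
open scoped Matrix
variable {n : ℕ} {p : Params}

/-! ### Triangularity of the `Y`-operators -/

/-- The span of the monomials `x^m`, `m ≺ l`. -/
def LT (l : Wt n) : Submodule ℂ (Laurent n) :=
  Submodule.span ℂ (mono '' {m : Wt n | PrecLT m l})

lemma mono_mem_LT {l m : Wt n} (h : PrecLT m l) : mono m ∈ LT l := Submodule.subset_span ⟨m, h, rfl⟩

lemma LT_le {l m : Wt n} (h : PrecLT m l) : LT m ≤ LT l :=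
  Submodule.span_mono (Set.image_mono fun _ hk => PrecLT.trans hk h)

lemma LowS_le_LT (l : Wt n) : LowS l ≤ LT l :=
  Submodule.span_mono (Set.image_mono fun _ hk => precLT_iff.mpr (Or.inl hk))

/-- `w` acting on `𝒜`, as a linear map. -/
def WL (w : Wt n ≃ₗ[ℤ] Wt n) : Module.End ℂ (Laurent n) := (weylAct w).toLinearMap

lemma WL_mono (w : Wt n ≃ₗ[ℤ] Wt n) (l : Wt n) : WL w (mono l) = mono (w l) := weylAct_mono w l

lemma WL_mul (w w' : Wt n ≃ₗ[ℤ] Wt n) : WL (w * w') = WL w * WL w' := by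
  ext f; simp [WL, weylAct_mul]

lemma WL_one : WL (1 : Wt n ≃ₗ[ℤ] Wt n) = 1 := by
  ext f; simp [WL, weylAct_one]

lemma WL_LowS {w : Wt n ≃ₗ[ℤ] Wt n} (hw : w ∈ weylGroup n) {l m : Wt n}
    (h : domPart l = domPart m) {f : Laurent n} (hf : f ∈ LowS l) : WL w f ∈ LowS m := by
  have : LowS l ≤ (LowS m).comap (WL w) := by
    refine Submodule.span_le.mpr ?_
    rintro _ ⟨k, hk, rfl⟩
    rw [SetLike.mem_coe, Submodule.mem_comap, WL_mono]
    refine Submodule.subset_span ⟨_, ?_, rfl⟩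
    change DomLT (domPart (w k)) (domPart m)
    rw [domPart_weyl hw, ← h]
    exact hk
  exact this hf

lemma TL_mono_pos {i : Fin n} {l : Wt n} (hl : 0 < l ⬝ᵥ simpleRoot i) :
    TL p i (mono l) - (((p.tSimple i)⁻¹ : ℂˣ) : ℂ) • mono (simpleRefl i l) ∈ LowS l := by
  obtain ⟨r, hr, h⟩ := T_monoR_pos (p := p) hl
  have : r = TL p i (mono l) - (((p.tSimple i)⁻¹ : ℂˣ) : ℂ) • mono (simpleRefl i l) := by
    refine toRat_injective ?_
    rw [map_sub, ← lifts_T, toRat_smul_mono]; exact h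
  rwa [← this]

lemma TL_mono_neg {i : Fin n} {l : Wt n} (hl : l ⬝ᵥ simpleRoot i < 0) :
    TL p i (mono l) - (((p.tSimple i : ℂ) - (p.tSimple i : ℂ)⁻¹) • mono l +
      (p.tSimple i : ℂ) • mono (simpleRefl i l)) ∈ LowS l := by
  obtain ⟨r, hr, h⟩ := T_monoR_neg (p := p) hl
  have : r = TL p i (mono l) - (((p.tSimple i : ℂ) - (p.tSimple i : ℂ)⁻¹) • mono l +
      (p.tSimple i : ℂ) • mono (simpleRefl i l)) := by
    refine toRat_injective ?_
    rw [map_sub, ← lifts_T, map_add, toRat_smul_mono, toRat_smul_mono]; exact h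
  rwa [← this]

lemma TL_mono_zero {i : Fin n} {l : Wt n} (hl : l ⬝ᵥ simpleRoot i = 0) :
    TL p i (mono l) = (p.tSimple i : ℂ) • mono l := by
  refine toRat_injective ?_
  rw [← lifts_T, toRat_smul_mono]; exact T_monoR_zero hl

lemma T0L_mono_neg (hn : 0 < n) {l : Wt n} (hl : l ⟨0, hn⟩ < 0) :
    T0L hn p (mono l) - ((p.t0⁻¹ * p.q ^ l ⟨0, hn⟩ : ℂˣ) : ℂ) • mono (signFlip 0 l) ∈ LowS l := by
  obtain ⟨r, hr, h⟩ := T0_monoR_neg (p := p) hn hl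
  have : r = T0L hn p (mono l) -
      ((p.t0⁻¹ * p.q ^ l ⟨0, hn⟩ : ℂˣ) : ℂ) • mono (signFlip 0 l) := by
    refine toRat_injective ?_
    rw [map_sub, ← lifts_T0, toRat_smul_mono]; exact h
  rwa [← this]

lemma T0L_mono_pos (hn : 0 < n) {l : Wt n} (hl : 0 < l ⟨0, hn⟩) :
    T0L hn p (mono l) - (((p.t0 : ℂ) - (p.t0 : ℂ)⁻¹) • mono l +
      ((p.t0 * p.q ^ l ⟨0, hn⟩ : ℂˣ) : ℂ) • mono (signFlip 0 l)) ∈ LowS l := by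
  obtain ⟨r, hr, h⟩ := T0_monoR_pos (p := p) hn hl
  have : r = T0L hn p (mono l) - (((p.t0 : ℂ) - (p.t0 : ℂ)⁻¹) • mono l +
      ((p.t0 * p.q ^ l ⟨0, hn⟩ : ℂˣ) : ℂ) • mono (signFlip 0 l)) := by
    refine toRat_injective ?_
    rw [map_sub, ← lifts_T0, map_add, toRat_smul_mono, toRat_smul_mono]; exact h
  rwa [← this]

lemma T0L_mono_zero (hn : 0 < n) {l : Wt n} (hl : l ⟨0, hn⟩ = 0) :
    T0L hn p (mono l) = (p.t0 : ℂ) • mono l := by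
  refine toRat_injective ?_
  rw [← lifts_T0, toRat_smul_mono]; exact T0_monoR_zero hn hl

/-- `B` is triangular with diagonal coefficients `c`. -/
def UpperTri (B : Module.End ℂ (Laurent n)) (c : Wt n → ℂˣ) : Prop :=
  ∀ l, B (mono l) - (c l : ℂ) • mono l ∈ LT l

lemma UpperTri.map_LT {B : Module.End ℂ (Laurent n)} {c : Wt n → ℂˣ} (h : UpperTri B c)
    {l : Wt n} {f : Laurent n} (hf : f ∈ LT l) : B f ∈ LT l := by
  have : LT l ≤ (LT l).comap B := by
    refine Submodule.span_le.mpr ?_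
    rintro _ ⟨k, hk, rfl⟩
    rw [SetLike.mem_coe, Submodule.mem_comap, ← sub_add_cancel (B (mono k)) ((c k : ℂ) • mono k)]
    exact add_mem (LT_le hk (h k)) (Submodule.smul_mem _ _ (mono_mem_LT hk))
  exact this hf

lemma UpperTri.mul {B B' : Module.End ℂ (Laurent n)} {c c' : Wt n → ℂˣ} (h : UpperTri B c)
    (h' : UpperTri B' c') : UpperTri (B * B') (c * c') := fun l => by
  have h1 := h.map_LT (h' l)
  have h2 := Submodule.smul_mem _ (c' l : ℂ) (h l)
  have h3 := add_mem h1 h2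
  rw [map_sub, map_smul, smul_sub, smul_smul, sub_add_sub_cancel] at h3
  rw [Pi.mul_apply, Units.val_mul, mul_comm (c l : ℂ)]
  exact h3

lemma upperTri_one : UpperTri (1 : Module.End ℂ (Laurent n)) 1 := fun l => by
  simp

/-- `u⁻¹ B w` is triangular. -/
def TwistTri (u w : Wt n ≃ₗ[ℤ] Wt n) (B : Module.End ℂ (Laurent n)) (c : Wt n → ℂˣ) : Prop :=
  UpperTri (WL u⁻¹ * B * WL w) c

/-- A single T_i is not triangular, since it moves x^l to x^{s_i l}. Removing the reflection on the
left repairs this. In a product the intermediate Weyl elements cancel and the diagonal coefficients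
multiply, so each factor of Y_i can be treated separately. -/
lemma TwistTri.mul {u v w : Wt n ≃ₗ[ℤ] Wt n} {B B' : Module.End ℂ (Laurent n)}
    {c c' : Wt n → ℂˣ} (h : TwistTri u v B c) (h' : TwistTri v w B' c') :
    TwistTri u w (B * B') (c * c') := by
  have h1 := UpperTri.mul h h'
  have h2 : WL u⁻¹ * B * WL v * (WL v⁻¹ * B' * WL w) = WL u⁻¹ * (B * B') * WL w := by
    have : WL v * WL v⁻¹ = 1 := by rw [← WL_mul, mul_inv_cancel, WL_one]
    calc _ = WL u⁻¹ * B * (WL v * WL v⁻¹) * B' * WL w := by simp only [mul_assoc]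
      _ = _ := by rw [this]; simp only [mul_assoc, mul_one]
  rw [h2] at h1
  exact h1

lemma TwistTri.one (w : Wt n ≃ₗ[ℤ] Wt n) : TwistTri w w 1 1 := by
  have : WL w⁻¹ * 1 * WL w = 1 := by rw [mul_one, ← WL_mul, inv_mul_cancel, WL_one]
  rw [TwistTri, this]
  exact upperTri_one

lemma twistTri_iff {u w : Wt n ≃ₗ[ℤ] Wt n} {B : Module.End ℂ (Laurent n)} {c : Wt n → ℂˣ} :
    TwistTri u w B c ↔ ∀ l, WL u⁻¹ (B (mono (w l))) - (c l : ℂ) • mono l ∈ LT l := by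
  simp only [TwistTri, UpperTri, Module.End.mul_apply, WL_mono]

lemma weyl_inv_dot {w : Wt n ≃ₗ[ℤ] Wt n} (hw : w ∈ weylGroup n) (l m : Wt n) :
    w l ⬝ᵥ m = l ⬝ᵥ w⁻¹ m := by
  rw [← dot_weyl (inv_mem hw) (w l) m, ← LinearEquiv.mul_apply, inv_mul_cancel]
  rfl

/-- A reflection that lowers `l`, up to the Weyl group. -/
lemma precLT_of_sub_zsmul {l d : Wt n} {k : ℤ} (hk : 0 < k) (hd : ∀ j, 0 ≤ psum d j)
    (hne : l - k • d ≠ l) (ho : l - k • d ∈ weylOrbit l) : PrecLT (l - k • d) l := by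
  refine precLT_iff.mpr (Or.inr ⟨domPart_eq_of_mem ho, domLE_iff.mpr fun j => ?_, hne⟩)
  rw [psum_sub, psum_zsmul]
  have := mul_nonneg hk.le (hd j)
  linarith

lemma psum_simpleRoot_of_coroot {v : Wt n ≃ₗ[ℤ] Wt n} {i : Fin n} (c : ℤ)
    (h : ∀ k, 0 ≤ c * psum (v (coroot (simpleRoot i))) k) (k : Fin n) :
    0 ≤ c * psum (v (simpleRoot i)) k := by
  by_cases hi : (i : ℕ) + 1 < n
  · rw [← coroot_medium (simpleRoot_medium hi)]; exact h k
  · rw [← two_smul_coroot_long (simpleRoot_long hi), map_nsmul, psum_nsmul]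
    have := h k
    push_cast
    linarith

/-- The image of the monomial `x^{w l}` under `(s_i w)⁻¹` is lower than `l` if `⟨w l, a_i⟩` and
`w⁻¹ a_i` have the same sign. -/
lemma precLT_reflect {w : Wt n ≃ₗ[ℤ] Wt n} (hw : w ∈ weylGroup n) {i : Fin n} {l : Wt n} {c : ℤ}
    (h : ∀ k, 0 ≤ c * psum (w⁻¹ (coroot (simpleRoot i))) k)
    (hl : 0 < c * (w l ⬝ᵥ coroot (simpleRoot i))) :
    PrecLT ((simpleRefl i * w)⁻¹ (w l)) l := by
  have h0 : w⁻¹ (w l) = l := by rw [← LinearEquiv.mul_apply, inv_mul_cancel]; rfl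
  have h2 : (simpleRefl i * w)⁻¹ (w l) =
      l - (w l ⬝ᵥ coroot (simpleRoot i)) • w⁻¹ (simpleRoot i) := by
    rw [mul_inv_rev, simpleRefl_inv, LinearEquiv.mul_apply, simpleRefl_eq, map_sub, map_zsmul, h0]
  have hmem : (simpleRefl i * w)⁻¹ (w l) ∈ weylOrbit l :=
    mem_weylOrbit_trans (weyl_mem_weylOrbit hw l)
      (weyl_mem_weylOrbit (inv_mem (mul_mem (simpleRefl_mem i) hw)) _)
  refine precLT_iff.mpr (Or.inr ⟨domPart_eq_of_mem hmem, domLE_iff.mpr fun j => ?_, fun heq => ?_⟩)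
  · rw [h2, psum_sub, psum_zsmul, sub_le_self_iff]
    have h3 := psum_simpleRoot_of_coroot c h j
    have hc : c ≠ 0 := by rintro rfl; simp at hl
    have h4 := mul_nonneg hl.le h3
    have h5 : 0 < c * c := mul_self_pos.mpr hc
    by_contra hneg
    push Not at hneg
    nlinarith
  · rw [h2, sub_eq_self, smul_eq_zero] at heq
    rcases heq with heq | heq
    · rw [heq] at hl; simp at hl
    · have : simpleRoot i = 0 := by simpa using heq
      exact posRoots_ne_zero (simpleRoot_mem i) this

lemma sgn_of_neg {k : ℤ} (h : k < 0) : sgn k = -1 := if_neg (not_le.mpr h)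

/-- For ⟨l, β⟩ < 0 the reflected monomial carries t⁻¹. For ⟨l, β⟩ > 0 it carries t, and the leftover
multiple of x^{w l} becomes a lower monomial after the twist, because w⁻¹ a_i^∨ = -β is negative. At
0 the monomial is fixed up to t, which is where the sign of 0 is forced to be 1. -/
lemma twist_T {w : Wt n ≃ₗ[ℤ] Wt n} (hw : w ∈ weylGroup n) {i : Fin n}
    {β : Wt n} (hβ : w⁻¹ (coroot (simpleRoot i)) = -β) (hp : ∀ k, 0 ≤ psum β k) :
    TwistTri (simpleRefl i * w) w (TL p i) fun l => p.tSimple i ^ sgn (l ⬝ᵥ β) := by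
  have hu : (simpleRefl i * w)⁻¹ ∈ weylGroup n := inv_mem (mul_mem (simpleRefl_mem i) hw)
  have h1 : ∀ l, w l ⬝ᵥ coroot (simpleRoot i) = -(l ⬝ᵥ β) := fun l => by
    rw [weyl_inv_dot hw, hβ, dotProduct_neg]
  have h2 : ∀ l, (simpleRefl i * w)⁻¹ (simpleRefl i (w l)) = l := fun l => by
    rw [← LinearEquiv.mul_apply, ← LinearEquiv.mul_apply, mul_assoc, inv_mul_cancel]; rfl
  rw [twistTri_iff]
  intro l
  have hdom : domPart (w l) = domPart l := domPart_weyl hw l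
  rcases lt_trichotomy (l ⬝ᵥ β) 0 with h | h | h
  · have h3 : 0 < w l ⬝ᵥ simpleRoot i := dot_simple_pos.mpr (by rw [h1]; omega)
    have h4 := WL_LowS hu hdom (TL_mono_pos (p := p) h3)
    rw [map_sub, map_smul, WL_mono, h2] at h4
    rw [sgn_of_neg h, zpow_neg_one]
    exact LowS_le_LT _ h4
  · have h3 : w l ⬝ᵥ simpleRoot i = 0 := by rw [dot_simple_eq, h1, h]; simp
    have h5 : simpleRefl i (w l) = w l := simpleRefl_eq_self_iff.mpr h3
    have h6 := h2 l
    rw [h5] at h6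
    rw [TL_mono_zero h3, map_smul, WL_mono, h6, sgn_of_nonneg h.ge, zpow_one, sub_self]
    exact zero_mem _
  · have h3 : w l ⬝ᵥ simpleRoot i < 0 := dot_simple_neg.mpr (by rw [h1]; omega)
    have h4 := WL_LowS hu hdom (TL_mono_neg (p := p) h3)
    rw [map_sub, map_add, map_smul, map_smul, WL_mono, WL_mono, h2] at h4
    have h5 : PrecLT ((simpleRefl i * w)⁻¹ (w l)) l :=
      precLT_reflect hw (c := -1) (fun k => by rw [hβ, psum_neg]; have := hp k; omega)
        (by rw [h1]; omega)
    rw [sgn_of_nonneg h.le, zpow_one]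
    have h6 := add_mem (LowS_le_LT _ h4) (Submodule.smul_mem _
      ((p.tSimple i : ℂ) - (p.tSimple i : ℂ)⁻¹) (mono_mem_LT h5))
    convert h6 using 1
    abel

/-- Subtracting t - t⁻¹ from T_i moves the leftover monomial from the weights with negative pairing
to those with positive pairing. Hence the inverse requires w⁻¹ a_i^∨ to be positive instead of
negative. -/
lemma twist_Tinv {w : Wt n ≃ₗ[ℤ] Wt n} (hw : w ∈ weylGroup n) {i : Fin n}
    {β : Wt n} (hβ : w⁻¹ (coroot (simpleRoot i)) = β) (hp : ∀ k, 0 ≤ psum β k) :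
    TwistTri (simpleRefl i * w) w (TLinv p i) fun l => p.tSimple i ^ (-sgn (l ⬝ᵥ β)) := by
  have hu : (simpleRefl i * w)⁻¹ ∈ weylGroup n := inv_mem (mul_mem (simpleRefl_mem i) hw)
  have h1 : ∀ l, w l ⬝ᵥ coroot (simpleRoot i) = l ⬝ᵥ β := fun l => by
    rw [weyl_inv_dot hw, hβ]
  have h2 : ∀ l, (simpleRefl i * w)⁻¹ (simpleRefl i (w l)) = l := fun l => by
    rw [← LinearEquiv.mul_apply, ← LinearEquiv.mul_apply, mul_assoc, inv_mul_cancel]; rfl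
  rw [twistTri_iff]
  intro l
  have hdom : domPart (w l) = domPart l := domPart_weyl hw l
  have hT : TLinv p i (mono (w l)) = TL p i (mono (w l)) -
      ((p.tSimple i : ℂ) - (p.tSimple i : ℂ)⁻¹) • mono (w l) := rfl
  rcases lt_trichotomy (l ⬝ᵥ β) 0 with h | h | h
  · have h3 : w l ⬝ᵥ simpleRoot i < 0 := dot_simple_neg.mpr (by rw [h1]; omega)
    have h4 := WL_LowS hu hdom (TL_mono_neg (p := p) h3)
    rw [map_sub, map_add, map_smul, map_smul, WL_mono, WL_mono, h2] at h4
    rw [sgn_of_neg h, neg_neg, zpow_one, hT, map_sub, map_smul, WL_mono]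
    convert LowS_le_LT _ h4 using 1
    abel
  · have h3 : w l ⬝ᵥ simpleRoot i = 0 := by rw [dot_simple_eq, h1, h]; simp
    have h5 : simpleRefl i (w l) = w l := simpleRefl_eq_self_iff.mpr h3
    have h6 := h2 l
    rw [h5] at h6
    rw [hT, TL_mono_zero h3, map_sub, map_smul, map_smul, WL_mono, h6, sgn_of_nonneg h.ge,
      zpow_neg_one, Units.val_inv_eq_inv_val]
    convert zero_mem (LT l) using 1
    module
  · have h3 : 0 < w l ⬝ᵥ simpleRoot i := dot_simple_pos.mpr (by rw [h1]; omega)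
    have h4 := WL_LowS hu hdom (TL_mono_pos (p := p) h3)
    rw [map_sub, map_smul, WL_mono, h2] at h4
    have h5 : PrecLT ((simpleRefl i * w)⁻¹ (w l)) l :=
      precLT_reflect hw (c := 1) (fun k => by rw [hβ, one_mul]; exact hp k)
        (by rw [h1]; omega)
    rw [sgn_of_nonneg h.le, zpow_neg_one, hT, map_sub, map_smul, WL_mono]
    have h6 := sub_mem (LowS_le_LT _ h4) (Submodule.smul_mem _
      ((p.tSimple i : ℂ) - (p.tSimple i : ℂ)⁻¹) (mono_mem_LT h5))
    convert h6 using 1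
    abel

/-- The gradient of a_0 is -2ε_1, so the positive vector is w⁻¹ ε_1 itself rather than its negative.
The power of q is the factor by which s_0 multiplies the reflected monomial. -/
lemma twist_T0 (hn : 0 < n) {w : Wt n ≃ₗ[ℤ] Wt n} (hw : w ∈ weylGroup n)
    {β : Wt n} (hβ : w⁻¹ (e 0) = β) (hp : ∀ k, 0 ≤ psum β k) :
    TwistTri (signFlip 0 * w) w (T0L hn p)
      fun l => p.t0 ^ sgn (l ⬝ᵥ β) * p.q ^ (l ⬝ᵥ β) := by
  have hu : (signFlip 0 * w)⁻¹ ∈ weylGroup n := inv_mem (mul_mem (signFlip_zero_mem hn) hw)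
  have h1 : ∀ l, w l ⟨0, hn⟩ = l ⬝ᵥ β := fun l => by
    rw [← hβ, ← weyl_inv_dot hw]; exact (dot_e (w l) ⟨0, hn⟩).symm
  have h2 : ∀ l : Wt n, (signFlip 0 * w : Wt n ≃ₗ[ℤ] Wt n)⁻¹ (signFlip 0 (w l)) = l := fun l => by
    rw [← LinearEquiv.mul_apply, ← LinearEquiv.mul_apply, mul_assoc, inv_mul_cancel]; rfl
  rw [twistTri_iff]
  intro l
  have hdom : domPart (w l) = domPart l := domPart_weyl hw l
  rcases lt_trichotomy (l ⬝ᵥ β) 0 with h | h | h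
  · have h4 := WL_LowS hu hdom (T0L_mono_neg (p := p) hn (l := w l) (by rw [h1]; omega))
    rw [map_sub, map_smul, WL_mono, h2, h1] at h4
    rw [sgn_of_neg h, zpow_neg_one]
    exact LowS_le_LT _ h4
  · have h3 : w l ⟨0, hn⟩ = 0 := by rw [h1, h]
    have h5 : signFlip 0 (w l) = w l := by rw [signFlip_zero_eq hn, h3]; simp
    have h6 := h2 l
    rw [h5] at h6
    rw [T0L_mono_zero hn h3, map_smul, WL_mono, h6, sgn_of_nonneg h.ge, zpow_one, h, zpow_zero,
      mul_one, sub_self]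
    exact zero_mem _
  · have h3 : 0 < w l ⟨0, hn⟩ := by rw [h1]; omega
    have h4 := WL_LowS hu hdom (T0L_mono_pos (p := p) hn h3)
    rw [map_sub, map_add, map_smul, map_smul, WL_mono, WL_mono, h2, h1] at h4
    have h5 : PrecLT ((signFlip 0 * w : Wt n ≃ₗ[ℤ] Wt n)⁻¹ (w l)) l := by
      have h7 : signFlip 0 (signFlip 0 (w l)) = w l := by
        ext k; rw [signFlip_apply, signFlip_apply]; split_ifs <;> simp
      have h8 : (signFlip 0 * w : Wt n ≃ₗ[ℤ] Wt n)⁻¹ (w l) = l - (2 * (l ⬝ᵥ β)) • β := by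
        have e1 : w (l - (2 * (l ⬝ᵥ β)) • β) = signFlip 0 (w l) := by
          rw [signFlip_zero_eq hn, h1, map_sub, map_zsmul, ← hβ]
          congr 2
          rw [← LinearEquiv.mul_apply, mul_inv_cancel]; rfl
        rw [← h2 (l - (2 * (l ⬝ᵥ β)) • β), e1, h7]
      have hmem : (signFlip 0 * w : Wt n ≃ₗ[ℤ] Wt n)⁻¹ (w l) ∈ weylOrbit l :=
        mem_weylOrbit_trans (weyl_mem_weylOrbit hw l) (weyl_mem_weylOrbit hu _)
      rw [h8] at hmem ⊢
      refine precLT_of_sub_zsmul (by omega) hp ?_ hmem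
      rw [Ne, sub_eq_self, smul_eq_zero, not_or]
      refine ⟨by omega, ?_⟩
      rintro rfl
      simp at h
    rw [sgn_of_nonneg h.le, zpow_one]
    have h6 := add_mem (LowS_le_LT _ h4) (Submodule.smul_mem _
      ((p.t0 : ℂ) - (p.t0 : ℂ)⁻¹) (mono_mem_LT h5))
    convert h6 using 1
    abel

end
end Koornwinder

/-! ### Diagonal coefficients of Y_i: the walk of a basis vector along the word. -/

namespace Koornwinder
noncomputable section
open scoped Matrix
variable {n : ℕ} {p : Params}

/-- The `k`-th index different from `i`. -/
def skip (i k : ℕ) : ℕ := if k < i then k else k + 1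

lemma simpleRefl_e_left {j : ℕ} (h : j + 1 < n) :
    simpleRefl (⟨j, by omega⟩ : Fin n) (e j) = e (j + 1) := by
  have := simpleRefl_e_of_lt (i := (⟨j, by omega⟩ : Fin n)) h ⟨j, by omega⟩
  simpa using this

lemma simpleRefl_e_right {j : ℕ} (h : j + 1 < n) :
    simpleRefl (⟨j, by omega⟩ : Fin n) (e (j + 1)) = e j := by
  rw [← simpleRefl_e_left h, simpleRefl_simpleRefl]

/-- `w` lies in `W`, and `w⁻¹` sends `e b` to `c • e i` and the other basis vectors, in increasing
order, to the `e k` with `k ≠ i`, in increasing order. -/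
def Placed (i b : ℕ) (c : ℤ) (w : Wt n ≃ₗ[ℤ] Wt n) : Prop :=
  w ∈ weylGroup n ∧ ∀ k < n,
    w⁻¹ (e k) = if k < b then e (skip i k) else if k = b then c • e i else e (skip i (k - 1))

lemma inv_simpleRefl_mul (j : Fin n) (w : Wt n ≃ₗ[ℤ] Wt n) (v : Wt n) :
    (simpleRefl j * w)⁻¹ v = w⁻¹ (simpleRefl j v) := by
  rw [mul_inv_rev, simpleRefl_inv]; rfl

lemma Placed.left {i j : ℕ} {c : ℤ} {w : Wt n ≃ₗ[ℤ] Wt n} (h : Placed i (j + 1) c w)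
    (hj : j + 1 < n) : Placed i j c (simpleRefl ⟨j, by omega⟩ * w) := by
  refine ⟨mul_mem (simpleRefl_mem _) h.1, fun k hk => ?_⟩
  rw [inv_simpleRefl_mul]
  rcases eq_or_ne k j with rfl | h1
  · rw [simpleRefl_e_left hj, h.2 _ hj]; simp
  rcases eq_or_ne k (j + 1) with rfl | h2
  · rw [simpleRefl_e_right hj, h.2 _ (by omega)]; simp
  · rw [simpleRefl_e_fix h1 h2, h.2 _ hk]
    grind

lemma Placed.right {i j : ℕ} {c : ℤ} {w : Wt n ≃ₗ[ℤ] Wt n} (h : Placed i j c w)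
    (hj : j + 1 < n) : Placed i (j + 1) c (simpleRefl ⟨j, by omega⟩ * w) := by
  refine ⟨mul_mem (simpleRefl_mem _) h.1, fun k hk => ?_⟩
  rw [inv_simpleRefl_mul]
  rcases eq_or_ne k j with rfl | h1
  · rw [simpleRefl_e_left hj, h.2 _ hj]; simp
  rcases eq_or_ne k (j + 1) with rfl | h2
  · rw [simpleRefl_e_right hj, h.2 _ (by omega)]; simp
  · rw [simpleRefl_e_fix h1 h2, h.2 _ hk]
    grind

lemma Placed.flip_zero (hn : 0 < n) {i : ℕ} {c : ℤ} {w : Wt n ≃ₗ[ℤ] Wt n} (h : Placed i 0 c w) :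
    Placed i 0 (-c) (signFlip 0 * w) := by
  refine ⟨mul_mem (signFlip_zero_mem hn) h.1, fun k hk => ?_⟩
  have h0 : (signFlip 0 * w : Wt n ≃ₗ[ℤ] Wt n)⁻¹ (e k) = w⁻¹ (signFlip 0 (e k)) := by
    have h1 : (signFlip 0 * signFlip 0 : Wt n ≃ₗ[ℤ] Wt n) = 1 := by
      ext l k
      rw [LinearEquiv.mul_apply, signFlip_apply, signFlip_apply]
      split_ifs <;> simp
    rw [mul_inv_rev, inv_eq_of_mul_eq_one_left h1]; rfl
  rw [h0]
  rcases Nat.eq_zero_or_pos k with rfl | h1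
  · have h2 : signFlip 0 (e 0) = -(e 0 : Wt n) := by
      ext k
      rw [signFlip_apply, Pi.neg_apply, e_apply]
      split_ifs <;> simp
    rw [h2, map_neg, h.2 _ hk]
    simp
  · have h2 : signFlip 0 (e k) = (e k : Wt n) := by
      ext j
      rw [signFlip_apply, e_apply]
      split_ifs with h3 h4 <;> first | rfl | omega
    rw [h2, h.2 _ hk, if_neg (by omega), if_neg (by omega), if_neg (by omega), if_neg (by omega)]

lemma Placed.flip_last {i b : ℕ} {c : ℤ} {w : Wt n ≃ₗ[ℤ] Wt n} (h : Placed i b c w)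
    (hb : b + 1 = n) : Placed i b (-c) (simpleRefl ⟨b, by omega⟩ * w) := by
  refine ⟨mul_mem (simpleRefl_mem _) h.1, fun k hk => ?_⟩
  rw [inv_simpleRefl_mul, simpleRefl_e_of_last (i := ⟨b, by omega⟩) (by simp; omega) ⟨k, hk⟩]
  simp only [Fin.mk.injEq]
  split_ifs with h1 h2
  · omega
  · rw [map_neg, h.2 _ hk, if_neg h2, if_pos h1, neg_smul]
  · rw [h.2 _ hk, if_pos ‹_›]
  · omega

lemma Placed.one (i : ℕ) : Placed i i 1 (1 : Wt n ≃ₗ[ℤ] Wt n) := by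
  refine ⟨one_mem _, fun k _ => ?_⟩
  rw [inv_one]
  change e k = _
  unfold skip
  grind

lemma Placed.eq_one {i : ℕ} {w : Wt n ≃ₗ[ℤ] Wt n} (h : Placed i i 1 w) : w = 1 := by
  have h1 : ∀ k < n, w⁻¹ (e k) = e k := fun k hk => by
    rw [h.2 k hk, ← (Placed.one i).2 k hk, inv_one]; rfl
  ext l k
  change w l k = l k
  rw [← dot_e (w l) k, weyl_inv_dot h.1, h1 k k.2, dot_e]

lemma psum_e_nonneg (i : ℕ) (k : Fin n) : 0 ≤ psum (e i) k := by
  rw [psum_e_nat]; split_ifs <;> simp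

lemma psum_e_sub_nonneg {i j : ℕ} (h : i ≤ j) (k : Fin n) :
    0 ≤ psum (e i - e j) k := by
  rw [psum_sub, psum_e_nat, psum_e_nat]
  split_ifs <;> omega

lemma TwistTri.congr {u w : Wt n ≃ₗ[ℤ] Wt n} {B : Module.End ℂ (Laurent n)} {c c' : Wt n → ℂˣ}
    (h : TwistTri u w B c) (hc : ∀ l, c l = c' l) : TwistTri u w B c' := by
  rwa [← funext hc]

/-- Reading the inverse factors of Y_i from the right, the vector ε_i moves down from its own place
towards the first one. Passing ε_j contributes the exponent of the root ε_j - ε_i with a minus sign.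
-/
lemma twist_ascProd_Tinv {i d : ℕ} (hi : i < n) (hd : d ≤ i) :
    ∃ w : Wt n ≃ₗ[ℤ] Wt n, Placed i (i - d) 1 w ∧
      TwistTri w 1 (ascProd (natExt (TLinv p)) i d) fun l =>
        p.t ^ (-∑ j ∈ Finset.Ico (i - d) i, sgn (l ⬝ᵥ (e j - e i))) := by
  induction d with
  | zero => exact ⟨1, Placed.one i, (TwistTri.one 1).congr fun l => by simp⟩
  | succ d ih =>
    obtain ⟨w, hw, ht⟩ := ih (by omega)
    obtain ⟨j, hj⟩ : ∃ j, i = j + d + 1 := ⟨i - d - 1, by omega⟩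
    have e1 : i - d = j + 1 := by omega
    have e2 : i - (d + 1) = j := by omega
    have e3 : i - 1 - d = j := by omega
    rw [e1] at hw ht
    rw [e2]
    refine ⟨_, hw.left (by omega), ?_⟩
    rw [ascProd, e3, natExt_of_lt _ (show j < n by omega)]
    have h1 : w⁻¹ (coroot (simpleRoot ⟨j, by omega⟩)) = e j - e i := by
      rw [coroot_simple_of_lt (by simp; omega), map_sub, hw.2 _ (by omega), hw.2 _ (by simp; omega)]
      simp only [skip]
      rw [if_pos (by omega), if_pos (by omega), if_neg (by omega), if_pos trivial, one_smul]
    refine ((twist_Tinv hw.1 h1 (psum_e_sub_nonneg (by omega))).mul ht).congr fun l => ?_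
    rw [Pi.mul_apply, tSimple_of_lt (by simp; omega), ← zpow_add,
      Finset.sum_eq_sum_Ico_succ_bot (show j < i by omega)]
    congr 1
    ring

/-- After s_0 has changed its sign, the vector -ε_i climbs from the first place past the other basis
vectors, collecting the roots ε_i + ε_k, one for each k ≠ i that is passed. -/
lemma twist_descProd_T {i d : ℕ} (hd : d + 1 ≤ n) {w : Wt n ≃ₗ[ℤ] Wt n}
    (hw : Placed i 0 (-1) w) :
    ∃ w' : Wt n ≃ₗ[ℤ] Wt n, Placed i d (-1) w' ∧
      TwistTri w' w (descProd (natExt (TL p)) 0 d) fun l =>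
        p.t ^ (∑ j ∈ Finset.range d, sgn (l ⬝ᵥ (e i + e (skip i j)))) := by
  induction d with
  | zero => exact ⟨w, hw, (TwistTri.one w).congr fun l => by simp⟩
  | succ d ih =>
    obtain ⟨w', hw', ht⟩ := ih (by omega)
    refine ⟨_, hw'.right (by omega), ?_⟩
    rw [descProd, zero_add, natExt_of_lt _ (show d < n by omega)]
    have h1 : w'⁻¹ (coroot (simpleRoot ⟨d, by omega⟩)) = -(e i + e (skip i d)) := by
      rw [coroot_simple_of_lt (by simp; omega), map_sub, hw'.2 _ (by omega),
        hw'.2 _ (by simp; omega)]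
      simp
      abel
    refine ((twist_T hw'.1 h1 fun k => ?_).mul ht).congr fun l => ?_
    · rw [psum_add]; exact add_nonneg (psum_e_nonneg _ _) (psum_e_nonneg _ _)
    · rw [Pi.mul_apply, tSimple_of_lt (by simp; omega), ← zpow_add, Finset.sum_range_succ,
        add_comm]

/-- T_n restores the sign of ε_i at the last place and contributes t_n; on the way back down the
vector passes the ε_k with k > i and collects the roots ε_i - ε_k. -/
lemma twist_ascProd_T {i d : ℕ} (hi : i < n) (hd : d + 1 ≤ n - i) {w : Wt n ≃ₗ[ℤ] Wt n}
    (hw : Placed i (n - 1) (-1) w) :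
    ∃ w' : Wt n ≃ₗ[ℤ] Wt n, Placed i (n - 1 - d) 1 w' ∧
      TwistTri w' w (ascProd (natExt (TL p)) n (d + 1)) fun l =>
        p.tn ^ sgn (l ⬝ᵥ e i) *
        p.t ^ (∑ j ∈ Finset.Ico (n - 1 - d) (n - 1), sgn (l ⬝ᵥ (e i - e (j + 1)))) := by
  induction d with
  | zero =>
    refine ⟨_, hw.flip_last (by omega), ?_⟩
    rw [ascProd, ascProd, mul_one, Nat.sub_zero, natExt_of_lt _ (show n - 1 < n by omega)]
    have h1 : w⁻¹ (coroot (simpleRoot ⟨n - 1, by omega⟩)) = -e i := by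
      rw [coroot_simple_of_last (by simp; omega), hw.2 _ (by simp; omega)]
      simp
    refine (twist_T hw.1 h1 fun k => psum_e_nonneg _ _).congr fun l => ?_
    rw [tSimple_of_last (by simp; omega)]
    simp
  | succ d ih =>
    obtain ⟨w', hw', ht⟩ := ih (by omega)
    obtain ⟨j, hj⟩ : ∃ j, n = j + d + 2 := ⟨n - d - 2, by omega⟩
    have e1 : n - 1 - d = j + 1 := by omega
    have e2 : n - 1 - (d + 1) = j := by omega
    rw [e1] at hw' ht
    rw [e2]
    refine ⟨_, hw'.left (by omega), ?_⟩
    rw [ascProd, e2, natExt_of_lt _ (show j < n by omega)]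
    have h1 : w'⁻¹ (coroot (simpleRoot ⟨j, by omega⟩)) = -(e i - e (j + 1)) := by
      rw [coroot_simple_of_lt (by simp; omega), map_sub, hw'.2 _ (by omega),
        hw'.2 _ (by simp; omega)]
      simp only [skip]
      rw [if_pos (by omega), if_neg (by omega), if_neg (by omega), if_pos trivial, one_smul, neg_sub]
    refine ((twist_T hw'.1 h1 (psum_e_sub_nonneg (by omega))).mul ht).congr fun l => ?_
    rw [Pi.mul_apply, tSimple_of_lt (by simp; omega), mul_left_comm, ← zpow_add,
      Finset.sum_eq_sum_Ico_succ_bot (show j < n - 1 by omega)]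

/-- The exponents of t collected on the three legs of the walk add up to the coordinate of ρ_m. -/
lemma rhoM_sum {a : ℕ → ℤ} {i m : ℕ} (h : i ≤ m) :
    (∑ k ∈ Finset.range (m + 1), if i < k then sgn (a i - a k) + sgn (a i + a k)
      else if k < i then - sgn (a k - a i) + sgn (a i + a k) else 0) =
    -∑ j ∈ Finset.Ico 0 i, sgn (a j - a i) + ∑ j ∈ Finset.range m, sgn (a i + a (skip i j)) +
      ∑ j ∈ Finset.Ico i m, sgn (a i - a (j + 1)) := by
  induction m, h using Nat.le_induction with
  | base =>
    rw [Finset.sum_range_succ, if_neg (lt_irrefl i), if_neg (lt_irrefl i), add_zero, Finset.Ico_self,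
      Finset.sum_empty, add_zero, ← Finset.range_eq_Ico, ← Finset.sum_neg_distrib,
      ← Finset.sum_add_distrib]
    refine Finset.sum_congr rfl fun j hj => ?_
    have := Finset.mem_range.mp hj
    rw [if_neg (by omega), if_pos this, skip, if_pos this]
  | succ m hm ih =>
    rw [Finset.sum_range_succ, ih, Finset.sum_range_succ, Finset.sum_Ico_succ_top hm,
      if_pos (by omega), skip, if_neg (by omega)]
    ring

lemma rhoM_eq_sum (l : Wt n) (i : Fin n) : rhoM l i =
    -∑ j ∈ Finset.Ico 0 (i : ℕ), sgn (l ⬝ᵥ (e j - e i)) +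
      ∑ j ∈ Finset.range (n - 1), sgn (l ⬝ᵥ (e i + e (skip i j))) +
      ∑ j ∈ Finset.Ico (i : ℕ) (n - 1), sgn (l ⬝ᵥ (e i - e (j + 1))) := by
  have hi := i.2
  have h := rhoM_sum (a := fun k => l ⬝ᵥ e k) (i := i) (m := n - 1) (by omega)
  rw [show n - 1 + 1 = n by omega] at h
  simp only [dotProduct_sub, dotProduct_add]
  rw [← h, rhoM_apply, Finset.sum_range]
  simp only [dot_e, Fin.lt_def]

lemma upperTri_YL (p : Params) (i : Fin n) : UpperTri (YL p i) fun l => gam p l i := by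
  have hi := i.2
  obtain ⟨w1, hw1, h1⟩ := twist_ascProd_Tinv (p := p) i.2 le_rfl
  rw [Nat.sub_self] at hw1 h1
  have hb : w1⁻¹ (e 0) = e i := by rw [hw1.2 _ (by omega)]; simp
  have h2 := twist_T0 (p := p) (by omega) hw1.1 hb (psum_e_nonneg _)
  obtain ⟨w3, hw3, h3⟩ := twist_descProd_T (p := p) (d := n - 1) (by omega)
    (hw1.flip_zero (by omega))
  obtain ⟨w4, hw4, h4⟩ := twist_ascProd_T (p := p) (d := n - 1 - i) i.2 (by omega) hw3
  rw [show n - 1 - (n - 1 - (i : ℕ)) = i by omega] at hw4 h4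
  -- The walk returns ε_i to its place with its original sign, so the total Weyl element is trivial
  -- and no twist is left on Y_i.
  rw [hw4.eq_one, show n - 1 - (i : ℕ) + 1 = n - i by omega] at h4
  have h5 := ((h4.mul h3).mul h2).mul h1
  rw [TwistTri, inv_one, WL_one, one_mul, mul_one] at h5
  change UpperTri (YL p i) _ at h5
  convert h5 using 1
  funext l
  have key (a b c d f g : ℂˣ) : d * f * (a * b * c) * g = f * c * b * (d * g) * a := by ac_rfl
  simp only [Pi.mul_apply]
  rw [gam, rhoM_eq_sum, rhoL_apply, dot_e, zpow_add, zpow_add]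
  exact key _ _ _ _ _ _

end
end Koornwinder

namespace Koornwinder
noncomputable section
open scoped Matrix
variable {n : ℕ} {p : Params}

/-! ### Joint eigenvectors of the `Y`-operators -/

lemma coeff_eq_zero_of_mem_LT {l m : Wt n} {f : Laurent n} (hf : f ∈ LT l) (h : ¬ PrecLT m l) :
    f.coeff m = 0 := by
  induction hf using Submodule.span_induction with
  | mem f hf =>
    obtain ⟨k, hk, rfl⟩ := hf
    rw [mono, AddMonoidAlgebra.coeff_single, Finsupp.single_apply, if_neg]
    rintro rfl
    exact h hk
  | zero => rfl
  | add f g _ _ hf hg => rw [AddMonoidAlgebra.coeff_add, Finsupp.add_apply, hf, hg, add_zero]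
  | smul c f _ hf => rw [AddMonoidAlgebra.coeff_smul, Finsupp.smul_apply, hf, smul_zero]

lemma coeff_of_monic {l m : Wt n} {f : Laurent n} (hf : IsMonicTriangular l f)
    (h : ¬ PrecLT m l) : f.coeff m = if m = l then 1 else 0 := by
  have h1 := coeff_eq_zero_of_mem_LT hf h
  rw [AddMonoidAlgebra.coeff_sub, Finsupp.sub_apply, sub_eq_zero, mono,
    AddMonoidAlgebra.coeff_single, Finsupp.single_apply] at h1
  rw [h1]
  exact if_congr eq_comm rfl rfl

lemma coeff_self_of_monic {l : Wt n} {f : Laurent n} (hf : IsMonicTriangular l f) :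
    f.coeff l = 1 := by
  rw [coeff_of_monic hf (PrecLT.irrefl l), if_pos rfl]

lemma YL_commute (hn : 2 ≤ n) (i j : Fin n) : Commute (YL p i) (YL p j) := by
  refine LinearMap.ext fun f => toRat_injective ?_
  rw [Module.End.mul_apply, Module.End.mul_apply, ← lifts_Y, ← lifts_Y, ← lifts_Y, ← lifts_Y,
    ← Module.End.mul_apply, Y_commute hn]
  rfl

/-- `f` is a joint eigenvector of the operators `Y_i` with the eigenvalues `z_i`. -/
def IsEigen (p : Params) (z : Fin n → ℂˣ) (f : Laurent n) : Prop :=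
  ∀ i, YL p i f = (z i : ℂ) • f

lemma upperTri_LT {B : Module.End ℂ (Laurent n)} {c : Wt n → ℂˣ} (h : UpperTri B c) (l : Wt n) :
    ∀ f ∈ LT l, B f ∈ LT l := fun _ => h.map_LT

/-- D is a Lagrange projector: a product of factors (Y_i - (γ_m)_i) / ((γ_l)_i - (γ_m)_i), one for
each m in S, with i chosen so that the denominator is nonzero. Working modulo an arbitrary stable
subspace N allows two uses: N = `LT l` for constructing eigenvectors and N = 0 for their linear
independence. -/
lemma exists_separating (hn : 2 ≤ n) (hp : p.Generic n) (l : Wt n) (S : Finset (Wt n))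
    (hS : l ∉ S) : ∃ D : Module.End ℂ (Laurent n), (∀ i, Commute D (YL p i)) ∧
      (∀ N : Submodule ℂ (Laurent n), (∀ i, ∀ f ∈ N, YL p i f ∈ N) → (∀ f ∈ N, D f ∈ N) ∧
        ∀ g, (∀ i, YL p i g - (gam p l i : ℂ) • g ∈ N) → D g - g ∈ N) ∧
      ∀ g, ∀ m ∈ S, IsEigen p (gam p m) g → D g = 0 := by
  classical
  induction S using Finset.induction_on with
  | empty => exact ⟨1, fun i => Commute.one_left _, fun N _ => ⟨fun f hf => hf, by simp⟩, by simp⟩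
  | insert m S _ ih =>
    rw [Finset.mem_insert, not_or] at hS
    obtain ⟨D, h1, h2, h3⟩ := ih hS.2
    obtain ⟨i, hi⟩ : ∃ i, gam p m i ≠ gam p l i := by
      by_contra! h
      exact hS.1 (gam_injective hp (funext h)).symm
    have hi' : (gam p l i : ℂ) - gam p m i ≠ 0 :=
      sub_ne_zero.mpr fun h => hi (Units.ext h.symm)
    refine ⟨((gam p l i : ℂ) - gam p m i)⁻¹ • ((YL p i - (gam p m i : ℂ) • 1) * D),
      fun j => ?_, fun N hN => ⟨fun f hf => ?_, fun g hg => ?_⟩, fun g k hk hg => ?_⟩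
    · refine Commute.smul_left (Commute.mul_left (Commute.sub_left (YL_commute hn i j) ?_) (h1 j)) _
      exact Commute.smul_left (Commute.one_left _) _
    · have h4 := (h2 N hN).1 f hf
      exact Submodule.smul_mem _ _ (sub_mem (hN i _ h4) (Submodule.smul_mem _ _ h4))
    · have h4 := (h2 N hN).2 g hg
      have h5 := sub_mem (hN i _ h4) (Submodule.smul_mem _ (gam p m i : ℂ) h4)
      have h6 := Submodule.smul_mem _ ((gam p l i : ℂ) - gam p m i)⁻¹ (add_mem h5 (hg i))
      convert h6 using 1
      have h7 : g = ((gam p l i : ℂ) - gam p m i)⁻¹ • ((gam p l i : ℂ) - gam p m i) • g := by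
        rw [smul_smul, inv_mul_cancel₀ hi', one_smul]
      have h8 : (((gam p l i : ℂ) - gam p m i)⁻¹ • ((YL p i - (gam p m i : ℂ) • 1) * D)) g =
          ((gam p l i : ℂ) - gam p m i)⁻¹ • (YL p i (D g) - (gam p m i : ℂ) • D g) := rfl
      rw [h8]
      nth_rewrite 3 [h7]
      rw [← smul_sub, map_sub]
      congr 1
      module
    · rcases Finset.mem_insert.mp hk with rfl | hk
      · have h4 : (YL p i - (gam p k i : ℂ) • 1) (D g) = 0 := by
          have h5 := congrArg (fun A : Module.End ℂ (Laurent n) => A g) (h1 i).eq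
          simp only [Module.End.mul_apply] at h5
          simp [← h5, hg i]
        rw [LinearMap.smul_apply, Module.End.mul_apply, h4, smul_zero]
      · rw [LinearMap.smul_apply, Module.End.mul_apply, h3 g k hk hg, map_zero, smul_zero]

lemma monic_sub_mem {l : Wt n} {f g : Laurent n} (hf : IsMonicTriangular l f) (h : g - f ∈ LT l) :
    IsMonicTriangular l g := by
  have := add_mem h hf
  rwa [sub_add_sub_cancel] at this

/-- Inversion of a unitriangular change of basis, by well-founded induction. -/
lemma LT_le_span {P : Wt n → Laurent n} {l : Wt n}
    (h : ∀ m, PrecLT m l → IsMonicTriangular m (P m)) :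
    LT l ≤ Submodule.span ℂ (P '' {m | PrecLT m l}) := by
  have key : ∀ m, PrecLT m l → mono m ∈ Submodule.span ℂ (P '' {m | PrecLT m l}) := by
    intro m
    induction m using wellFounded_precLT.induction with
    | _ m ih =>
      intro hm
      have h1 : LT m ≤ Submodule.span ℂ (P '' {m | PrecLT m l}) := by
        refine Submodule.span_le.mpr ?_
        rintro _ ⟨k, hk, rfl⟩
        exact ih k hk (PrecLT.trans hk hm)
      have h2 := sub_mem (Submodule.subset_span (Set.mem_image_of_mem P hm)) (h1 (h m hm))
      rwa [sub_sub_cancel] at h2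
  refine Submodule.span_le.mpr ?_
  rintro _ ⟨k, hk, rfl⟩
  exact key k hk

/-- By induction the lower eigenvectors span the lower monomials, so the projector D kills `LT l`.
Since x^l is an eigenvector modulo `LT l`, its image D x^l is a genuine eigenvector, still with
leading term x^l. -/
lemma exists_eigen (hn : 2 ≤ n) (hp : p.Generic n) (l : Wt n) :
    ∃ f, IsMonicTriangular l f ∧ IsEigen p (gam p l) f := by
  induction l using wellFounded_precLT.induction with
  | _ l ih =>
    choose! P hP1 hP2 using ih
    obtain ⟨D, h1, h2, h3⟩ := exists_separating hn hp l (finite_precLT l).toFinset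
      (by simpa using PrecLT.irrefl l)
    have hLT : ∀ f ∈ LT l, D f = 0 := fun f hf => by
      have : Submodule.span ℂ (P '' {m | PrecLT m l}) ≤ LinearMap.ker D := by
        refine Submodule.span_le.mpr ?_
        rintro _ ⟨m, hm, rfl⟩
        exact h3 _ m (by simpa using hm) (hP2 m hm)
      exact this (LT_le_span hP1 hf)
    refine ⟨D (mono l), (h2 (LT l) fun i => upperTri_LT (upperTri_YL p i) l).2 _
      fun i => upperTri_YL p i l, fun i => ?_⟩
    have h4 := hLT _ (upperTri_YL p i l)
    rw [map_sub, map_smul, sub_eq_zero] at h4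
    rw [← h4, ← Module.End.mul_apply, ← (h1 i).eq]
    rfl

/-! ### The operators `f(Y)` on joint eigenvectors -/

lemma evalAt_mono (z : Fin n → ℂˣ) (l : Wt n) : evalAt z (mono l) = monoVal z l := by
  rw [evalAt, mono, AddMonoidAlgebra.coeff_single, Finsupp.sum_single_index (by simp), one_mul]

lemma evalY_mono (l : Wt n) : evalY p (mono l) = Ymono p l := by
  rw [evalY, mono, AddMonoidAlgebra.coeff_single, Finsupp.sum_single_index (by simp), one_smul]

lemma monoVal_e (z : Fin n → ℂˣ) (i : Fin n) : monoVal z (e (i : ℕ)) = z i := by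
  rw [monoVal, Finset.prod_eq_single i (fun j _ hj => ?_) (by simp), e_apply, if_pos rfl, zpow_one]
  rw [e_apply, if_neg (fun h => hj (Fin.ext h)), zpow_zero]

lemma Ymono_e (i : Fin n) : Ymono p (e (i : ℕ)) = Y p i := by
  have key : ∀ L : List (Fin n), L.Nodup →
      (L.map fun j => opZPow (Y p j) ((e (i : ℕ) : Wt n) j)).prod = if i ∈ L then Y p i else 1 := by
    intro L
    induction L with
    | nil => simp
    | cons j L ih =>
      intro h
      rw [List.nodup_cons] at h
      rw [List.map_cons, List.prod_cons, ih h.2, e_apply]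
      rcases eq_or_ne j i with rfl | hij
      · rw [if_pos rfl, if_neg h.1, if_pos (by simp)]
        simp [opZPow]
      · rw [if_neg (fun h => hij (Fin.ext h))]
        simp [opZPow, hij.symm]
  rw [Ymono, key _ (List.nodup_finRange n), if_pos (List.mem_finRange i)]

section Eigen

variable {z : Fin n → ℂˣ} {f : Laurent n}

lemma opZPow_eigen (hn : 2 ≤ n) (h : IsEigen p z f) (i : Fin n) (k : ℤ) :
    opZPow (Y p i) k (toRat f) = ((z i ^ k : ℂˣ) : ℂ) • toRat f := by
  have h1 : Y p i (toRat f) = (z i : ℂ) • toRat f := by rw [lifts_Y, h i, map_smul]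
  have h2 : Ring.inverse (Y p i) (toRat f) = ((z i)⁻¹ : ℂˣ) • toRat f := by
    have h3 := congrArg (Ring.inverse (Y p i) : Op n) h1
    rw [← Module.End.mul_apply, ← YU_val hn, Ring.inverse_mul_cancel _ (YU hn p i).isUnit,
      map_smul] at h3
    rw [← YU_val hn, eq_inv_smul_iff]
    exact h3.symm
  have pow : ∀ (A : Op n) (c : ℂˣ) (g : RatFn n), A g = c • g → ∀ m : ℕ, (A ^ m) g = c ^ m • g := by
    intro A c g hA m
    induction m with
    | zero => simp
    | succ m ih => rw [pow_succ', Module.End.mul_apply, ih, pow_succ, Units.smul_def, map_smul, hA,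
        mul_smul]; rfl
  unfold opZPow
  split_ifs with hk
  · obtain ⟨m, rfl⟩ := Int.eq_ofNat_of_zero_le hk
    rw [pow _ (z i) _ h1, Int.toNat_natCast, zpow_natCast]; rfl
  · obtain ⟨m, hm⟩ := Int.eq_ofNat_of_zero_le (show 0 ≤ -k by omega)
    obtain rfl : k = -(m : ℤ) := by omega
    rw [pow _ _ _ h2, neg_neg, Int.toNat_natCast, inv_pow, zpow_neg, zpow_natCast]; rfl

lemma Ymono_eigen (hn : 2 ≤ n) (h : IsEigen p z f) (l : Wt n) :
    Ymono p l (toRat f) = monoVal z l • toRat f := by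
  have key : ∀ L : List (Fin n), (L.map fun i => opZPow (Y p i) (l i)).prod (toRat f) =
      ((L.map fun i => z i ^ l i).prod : ℂˣ) • toRat f := by
    intro L
    induction L with
    | nil => simp
    | cons i L ih =>
      rw [List.map_cons, List.prod_cons, Module.End.mul_apply, ih, Units.smul_def, map_smul,
        opZPow_eigen hn h, smul_smul, List.map_cons, List.prod_cons, Units.smul_def, Units.val_mul,
        mul_comm]
  rw [Ymono, key, monoVal, Fin.prod_univ_def]
  rfl

lemma evalY_eigen (hn : 2 ≤ n) (h : IsEigen p z f) (g : Laurent n) :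
    evalY p g (toRat f) = evalAt z g • toRat f := by
  rw [evalY, evalAt, Finsupp.sum, Finsupp.sum, LinearMap.sum_apply, Finset.sum_smul]
  refine Finset.sum_congr rfl fun l _ => ?_
  rw [LinearMap.smul_apply, Ymono_eigen hn h, smul_smul]

lemma isEigen_of_evalY (h : ∀ g, evalY p g (toRat f) = evalAt z g • toRat f) : IsEigen p z f :=
  fun i => by
    apply toRat_injective
    rw [← lifts_Y, map_smul, ← Ymono_e, ← evalY_mono, h, evalAt_mono, monoVal_e]

end Eigen

/-! ### Non-symmetric Koornwinder polynomials -/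

lemma exists_nonsym (hn : 2 ≤ n) (hp : p.Generic n) :
    ∃ P : Wt n → Laurent n, IsNonsymKoornwinder p P := by
  classical
  choose P h1 h2 using exists_eigen hn hp
  have hne : ∀ l, P l ≠ 0 := fun l h0 => by
    have := coeff_self_of_monic (h1 l)
    rw [h0] at this
    simp at this
  refine ⟨P, linearIndependent_iff'.mpr fun S g hg l hl => ?_, ?_, h1,
    fun l f => evalY_eigen hn (h2 l) f⟩
  · obtain ⟨D, -, h4, h5⟩ := exists_separating hn hp l (S.erase l) (Finset.notMem_erase l S)
    -- With N = 0 the projector fixes P_l, while it annihilates the other terms of the linear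
    -- relation.
    have h6 := (h4 ⊥ (by simp)).2 (P l) fun i => by simp [h2 l i]
    rw [Submodule.mem_bot, sub_eq_zero] at h6
    have h7 := congrArg D hg
    rw [map_sum, Finset.sum_eq_single_of_mem l hl fun m hm hml => ?_, map_smul, h6, map_zero] at h7
    · exact (smul_eq_zero.mp h7).resolve_right (hne l)
    · rw [map_smul, h5 _ m (Finset.mem_erase.mpr ⟨hml, hm⟩) (h2 m), smul_zero]
  · rw [eq_top_iff]
    intro f _
    induction f using laurent_induction with
    | mono l =>
      have h3 : LT l ≤ Submodule.span ℂ (Set.range P) := (LT_le_span fun m _ => h1 m).trans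
        (Submodule.span_mono (Set.image_subset_range _ _))
      have h4 := sub_mem (Submodule.subset_span (Set.mem_range_self l)) (h3 (h1 l))
      rwa [sub_sub_cancel] at h4
    | add f g hf hg => exact add_mem (hf trivial) (hg trivial)
    | smul c f hf => exact Submodule.smul_mem _ _ (hf trivial)

namespace IsNonsymKoornwinder

variable {P : Wt n → Laurent n}

lemma isEigen (hP : IsNonsymKoornwinder p P) (l : Wt n) : IsEigen p (gam p l) (P l) :=
  isEigen_of_evalY (hP.eigen l)

/-- The basis `P_l` of `𝒜`. -/
def basis (hP : IsNonsymKoornwinder p P) : Module.Basis (Wt n) ℂ (Laurent n) :=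
  Module.Basis.mk hP.linearIndependent hP.span_eq_top.ge

lemma basis_apply (hP : IsNonsymKoornwinder p P) (l : Wt n) : hP.basis l = P l :=
  Module.Basis.mk_apply _ _ l

lemma repr_self (hP : IsNonsymKoornwinder p P) (l : Wt n) :
    hP.basis.repr (P l) = Finsupp.single l 1 := by
  rw [← hP.basis_apply, Module.Basis.repr_self]

lemma repr_YL (hP : IsNonsymKoornwinder p P) (i : Fin n) (f : Laurent n) (m : Wt n) :
    hP.basis.repr (YL p i f) m = gam p m i * hP.basis.repr f m := by
  have h : (Finsupp.lapply m ∘ₗ hP.basis.repr.toLinearMap) ∘ₗ YL p i =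
      (gam p m i : ℂ) • (Finsupp.lapply m ∘ₗ hP.basis.repr.toLinearMap) := by
    refine hP.basis.ext fun l => ?_
    simp only [LinearMap.comp_apply, LinearMap.smul_apply, LinearEquiv.coe_coe, hP.basis_apply,
      hP.isEigen l i, map_smul, hP.repr_self, Finsupp.lapply_apply, Finsupp.single_apply,
      smul_eq_mul]
    split_ifs with h
    · rw [h]
    · simp
  exact congrArg (fun A : Laurent n →ₗ[ℂ] ℂ => A f) h

/-- Simplicity of the joint spectrum, from injectivity of l ↦ γ_l. It is used both for uniqueness of
the P_l and for identifying the images of the intertwiners. -/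
lemma eq_smul_of_isEigen (hP : IsNonsymKoornwinder p P) (hp : p.Generic n) {l : Wt n}
    {f : Laurent n} (hf : IsEigen p (gam p l) f) : f = hP.basis.repr f l • P l := by
  refine hP.basis.repr.injective (Finsupp.ext fun m => ?_)
  rw [map_smul, hP.repr_self, Finsupp.smul_apply, Finsupp.single_apply, smul_eq_mul]
  split_ifs with h
  · rw [h, mul_one]
  · rw [mul_zero]
    by_contra h0
    refine h (gam_injective hp (funext fun i => Units.ext ?_))
    have h1 := hP.repr_YL i f m
    rw [hf i, map_smul, Finsupp.smul_apply, smul_eq_mul] at h1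
    exact mul_right_cancel₀ h0 h1

lemma exists_gam_of_isEigen (hP : IsNonsymKoornwinder p P) {z : Fin n → ℂˣ} {f : Laurent n}
    (hf : IsEigen p z f) (h0 : f ≠ 0) : ∃ l, z = gam p l := by
  obtain ⟨m, hm⟩ := Finsupp.ne_iff.mp ((map_ne_zero_iff _ hP.basis.repr.injective).mpr h0)
  refine ⟨m, funext fun i => Units.ext ?_⟩
  have h1 := hP.repr_YL i f m
  rw [hf i, map_smul, Finsupp.smul_apply, smul_eq_mul] at h1
  exact mul_right_cancel₀ hm h1

end IsNonsymKoornwinder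

lemma existsUnique_nonsym (hn : 2 ≤ n) (hp : p.Generic n) :
    ∃! P : Wt n → Laurent n, IsNonsymKoornwinder p P := by
  obtain ⟨P, hP⟩ := exists_nonsym hn hp
  refine ⟨P, hP, fun P' hP' => funext fun l => ?_⟩
  have h1 := hP.eq_smul_of_isEigen hp (hP'.isEigen l)
  have h2 := congrArg (fun f : Laurent n => f.coeff l) h1
  simp only [AddMonoidAlgebra.coeff_smul, Finsupp.smul_apply] at h2
  rw [coeff_self_of_monic (hP'.triangular l), coeff_self_of_monic (hP.triangular l), smul_eq_mul,
    mul_one] at h2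
  rw [h1, ← h2, one_smul]

lemma nonsymK_spec (hn : 2 ≤ n) (hp : p.Generic n) : IsNonsymKoornwinder p (nonsymK p : Wt n → _) :=
  Classical.epsilon_spec (exists_nonsym hn hp)

end
end Koornwinder

namespace Koornwinder
noncomputable section
open scoped Matrix
variable {n : ℕ} {p : Params}

/-! ### The action of `T_i` on the non-symmetric polynomials -/

lemma gam_apply_inj (hp : p.Generic n) {l m : Wt n} {i j : Fin n} (h : gam p l i = gam p m j) :
    l i = m j := by
  obtain ⟨π, s, h1, h2⟩ := exists_gam_eq p l
  obtain ⟨π', s', h1', h2'⟩ := exists_gam_eq p m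
  rw [h2, h2'] at h
  obtain ⟨hs, -, hd⟩ := gVal_zpow_inj hp h
  rw [h1, h1', signedPerm_apply, signedPerm_apply, hs, hd]

lemma gam_apply_inv_inj (hp : p.Generic n) {l m : Wt n} {i j : Fin n}
    (h : gam p l i = (gam p m j)⁻¹) : l i = - m j := by
  obtain ⟨π, s, h1, h2⟩ := exists_gam_eq p l
  obtain ⟨π', s', h1', h2'⟩ := exists_gam_eq p m
  rw [h2, h2', ← zpow_neg, ← Units.val_neg] at h
  obtain ⟨hs, -, hd⟩ := gVal_zpow_inj hp h
  rw [h1, h1', signedPerm_apply, signedPerm_apply, hs, hd]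
  simp

/-- The spectral point `s_i γ_l`. -/
def reflGam (p : Params) (i : Fin n) (l : Wt n) : Fin n → ℂˣ :=
  fun j => gamU p l (simpleRefl i (e (j : ℕ)))

lemma reflGam_of_ne {i : Fin n} {l : Wt n} (h : l ⬝ᵥ simpleRoot i ≠ 0) :
    reflGam p i l = gam p (simpleRefl i l) := by
  funext j
  rw [reflGam, ← gamU_simpleRefl h, gamU_e]

lemma reflGam_of_lt {i : Fin n} (h : (i : ℕ) + 1 < n) (l : Wt n) (j : Fin n) :
    reflGam p i l j = gam p l (Equiv.swap i ⟨i + 1, h⟩ j) := by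
  rw [reflGam, simpleRefl_e_of_lt h, gamU_e]

lemma reflGam_of_last {i : Fin n} (h : ¬ (i : ℕ) + 1 < n) (l : Wt n) (j : Fin n) :
    reflGam p i l j = if j = i then (gam p l j)⁻¹ else gam p l j := by
  rw [reflGam, simpleRefl_e_of_last h]
  split_ifs
  · rw [gamU_neg, gamU_e]
  · rw [gamU_e]

/-- Comparing powers of q would force m = s_i l = l. But γ_l is not fixed by s_i: two of its
coordinates would coincide, or one would have square 1. -/
lemma reflGam_ne_gam (hp : p.Generic n) {i : Fin n} {l : Wt n} (h : l ⬝ᵥ simpleRoot i = 0)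
    (m : Wt n) : reflGam p i l ≠ gam p m := by
  intro hm
  have hl : simpleRefl i l = l := simpleRefl_eq_self_iff.mpr h
  by_cases hi : (i : ℕ) + 1 < n
  · have h1 : m = l := by
      ext j
      have h2 := congrFun hm j
      rw [reflGam_of_lt hi] at h2
      rw [← gam_apply_inj hp h2]
      conv_rhs => rw [← hl, simpleRefl_of_lt hi]
    have h2 := congrFun hm i
    rw [reflGam_of_lt hi, Equiv.swap_apply_left, h1] at h2
    exact gam_ne hp l (by simp [Fin.ext_iff]) h2
  · have h1 : m = l := by
      ext j
      have h2 := congrFun hm j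
      rw [reflGam_of_last hi] at h2
      conv_rhs => rw [← hl, simpleRefl_of_last hi]
      split_ifs at h2 ⊢
      · exact gam_apply_inv_inj hp h2.symm
      · exact (gam_apply_inj hp h2).symm
    have h2 := congrFun hm i
    rw [reflGam_of_last hi, if_pos rfl, h1, inv_eq_iff_mul_eq_one, ← pow_two] at h2
    exact gam_sq_ne hp l i h2

lemma TL_quadratic (i : Fin n) (f : Laurent n) : TL p i (TL p i f) =
    ((p.tSimple i : ℂ) - (p.tSimple i : ℂ)⁻¹) • TL p i f + f := by
  apply toRat_injective
  rw [map_add, map_smul, ← lifts_T, ← lifts_T, T_quadratic]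

/-- The scalar `c` for which `T_i P_l - c P_l` is a joint eigenvector. -/
def cT (p : Params) (i : Fin n) (l : Wt n) : ℂ :=
  if (i : ℕ) + 1 < n then
    ((p.tSimple i : ℂ) - (p.tSimple i : ℂ)⁻¹) / (1 - (gamU p l (-simpleRoot i) : ℂ))
  else
    ((p.tSimple i : ℂ) - (p.tSimple i : ℂ)⁻¹ +
      ((p.t0 : ℂ) - (p.t0 : ℂ)⁻¹) * (gamU p l (-e (i : ℕ)) : ℂ)) /
      (1 - (gamU p l (-simpleRoot i) : ℂ))

lemma cT_of_lt {i : Fin n} (h : (i : ℕ) + 1 < n) (hp : p.Generic n) (l : Wt n) :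
    cT p i l * ((gam p l i : ℂ) - gam p l ⟨i + 1, h⟩) =
      ((p.tSimple i : ℂ) - (p.tSimple i : ℂ)⁻¹) * gam p l i := by
  have h1 : (gam p l i : ℂ) - gam p l ⟨i + 1, h⟩ ≠ 0 :=
    sub_ne_zero.mpr fun hc => gam_ne hp l (by simp [Fin.ext_iff]) (Units.ext hc)
  have h2 : (gamU p l (-simpleRoot i) : ℂ) = (gam p l ⟨i + 1, h⟩ : ℂ) / gam p l i := by
    rw [simpleRoot_of_lt h, neg_sub, gamU_sub, gamU_e, ← gamU_e l ⟨i + 1, h⟩, Units.val_div_eq_div_val]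
  have h3 : (gam p l i : ℂ) ≠ 0 := Units.ne_zero _
  rw [cT, if_pos h, h2]
  field_simp

lemma cT_of_last {i : Fin n} (h : ¬ (i : ℕ) + 1 < n) (hp : p.Generic n) (l : Wt n) :
    cT p i l * ((gam p l i : ℂ) - (gam p l i : ℂ)⁻¹) =
      ((p.tSimple i : ℂ) - (p.tSimple i : ℂ)⁻¹) * gam p l i + ((p.t0 : ℂ) - (p.t0 : ℂ)⁻¹) := by
  have h1 : (gam p l i : ℂ) ^ 2 - 1 ≠ 0 :=
    sub_ne_zero.mpr fun hc => gam_sq_ne hp l i (Units.ext (by simpa using hc))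
  have h2 : (gamU p l (-simpleRoot i) : ℂ) = ((gam p l i : ℂ) ^ 2)⁻¹ := by
    rw [simpleRoot_of_last h, gamU_neg, two_nsmul, gamU_add, gamU_e, ← pow_two]; simp
  have h3 : (gam p l i : ℂ) ≠ 0 := Units.ne_zero _
  have h4 : (gamU p l (-e (i : ℕ)) : ℂ) = (gam p l i : ℂ)⁻¹ := by rw [gamU_neg, gamU_e]; simp
  rw [cT, if_neg h, h2, h4]
  field_simp

/-- The intertwiner attached to s_i. The relations between T_i and the Y_j show that each Y_j maps
T_i g to a multiple of T_i g plus a multiple of g, and the scalar in `cT` is chosen so that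
subtracting it removes the second term for all j at once. -/
lemma isEigen_TL_sub (hn : 2 ≤ n) (hp : p.Generic n) (i : Fin n) {l : Wt n} {g : Laurent n}
    (hg : IsEigen p (gam p l) g) : IsEigen p (reflGam p i l) (TL p i g - cT p i l • g) := by
  intro j
  apply toRat_injective
  rw [← lifts_Y, map_smul, map_sub, map_smul, ← lifts_T]
  have hG : ∀ j, Y p j (toRat g) = (gam p l j : ℂ) • toRat g := fun j => by
    rw [lifts_Y, hg j, map_smul]
  generalize toRat g = G at hG
  by_cases hi : (i : ℕ) + 1 < n
  · have hc := cT_of_lt hi hp l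
    have h1 := Y_eq_T_Y_T (p := p) hn hi
    have hYT : ∀ f, Y p i f = T p i (Y p ⟨i + 1, hi⟩ (T p i f)) := fun f => by rw [h1]; rfl
    rw [reflGam_of_lt hi]
    rcases eq_or_ne j i with rfl | hji
    · have h2 : Y p j (T p j G) = (gam p l ⟨j + 1, hi⟩ : ℂ) • T p j G +
          (((p.tSimple j : ℂ) - (p.tSimple j : ℂ)⁻¹) * gam p l j) • G := by
        rw [hYT, T_quadratic, map_add, map_add, map_smul, map_smul, ← hYT, hG, hG, map_smul,
          smul_smul, add_comm]
      rw [Equiv.swap_apply_left, map_sub, map_smul, hG, h2, ← hc]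
      module
    rcases eq_or_ne j ⟨i + 1, hi⟩ with rfl | hji'
    · have h2 : Y p ⟨i + 1, hi⟩ (T p i G) = (gam p l i : ℂ) • T p i G -
          (((p.tSimple i : ℂ) - (p.tSimple i : ℂ)⁻¹) * gam p l i) • G := by
        have h3 : T p i (Y p ⟨i + 1, hi⟩ (T p i G)) = (gam p l i : ℂ) • G := by rw [← hYT, hG]
        have h4 := congrArg (T p i) h3
        rw [T_quadratic, h3, map_smul, smul_smul] at h4
        rw [eq_sub_iff_add_eq, add_comm]
        exact h4
      rw [Equiv.swap_apply_right, map_sub, map_smul, hG, h2, ← hc]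
      module
    · have h2 : Y p j (T p i G) = (gam p l j : ℂ) • T p i G := by
        have h3 := congrArg (fun A : Op n => A G) (T_commute_Y (p := p) hn hji
          (fun h => hji' (Fin.ext h)))
        simp only [Module.End.mul_apply] at h3
        rw [← h3, hG, map_smul]
      rw [Equiv.swap_apply_of_ne_of_ne hji hji', map_sub, map_smul, hG, h2]
      module
  · have hc := cT_of_last hi hp l
    rw [reflGam_of_last hi]
    rcases eq_or_ne j i with rfl | hji
    · have h2 := Y_last_quadratic (p := p) hn hi G
      have hY : ∀ f, Y p j (Ring.inverse (Y p j) f) = f := fun f => by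
        rw [← Module.End.mul_apply, ← YU_val hn, Ring.mul_inverse_cancel _ (YU hn p j).isUnit]
        rfl
      have h3 := congrArg (Y p j) h2
      have h5 : (gam p l j : ℂ) ≠ 0 := Units.ne_zero _
      rw [hY, hG, inverse_T, LinearMap.sub_apply, LinearMap.smul_apply, Module.End.one_apply,
        map_smul] at h3
      simp only [map_sub, map_smul, hG] at h3
      have h4 : Y p j (T p j G) = (gam p l j : ℂ)⁻¹ • T p j G +
          (((p.tSimple j : ℂ) - (p.tSimple j : ℂ)⁻¹) * gam p l j +
            ((p.t0 : ℂ) - (p.t0 : ℂ)⁻¹)) • G := by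
        -- The relation between Y_n⁻¹ T_n and T_n⁻¹ Y_n, applied to G and multiplied by Y_n, is
        -- linear in Y_n T_n G and can be solved for it.
        have h6 : T p j G = (gam p l j : ℂ) • Y p j (T p j G) - ((gam p l j : ℂ) *
          (((p.tSimple j : ℂ) - (p.tSimple j : ℂ)⁻¹) * gam p l j +
            ((p.t0 : ℂ) - (p.t0 : ℂ)⁻¹))) • G := by
          nth_rewrite 1 [h3]; module
        have h7 := congrArg (fun f => (gam p l j : ℂ)⁻¹ • f) h6
        simp only [smul_sub, smul_smul, inv_mul_cancel_left₀ h5, inv_mul_cancel₀ h5, one_smul] at h7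
        rw [h7]; module
      rw [if_pos rfl, map_sub, map_smul, hG, h4, ← hc, Units.val_inv_eq_inv_val]
      module
    · have h2 : Y p j (T p i G) = (gam p l j : ℂ) • T p i G := by
        have h3 := congrArg (fun A : Op n => A G) (T_commute_Y (p := p) hn hji
          (fun h => hi (h ▸ j.2)))
        simp only [Module.End.mul_apply] at h3
        rw [← h3, hG, map_smul]
      rw [if_neg hji, map_sub, map_smul, hG, h2]
      module

/-! ### The dual parameters -/

lemma tSimple_dual (i : Fin n) : p.dual.tSimple i = p.tSimple i := by
  by_cases hi : (i : ℕ) + 1 < n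
  · rw [tSimple_of_lt hi, tSimple_of_lt hi]; rfl
  · rw [tSimple_of_last hi, tSimple_of_last hi]; rfl

/-- The value `\tilde v_{εα}(γ_l)`. -/
def vDual (p : Params) (ε : ℤˣ) (α l : Wt n) : ℂ :=
  vFun p.dual ((ε : ℤ) • α) 0 (monoVal (gam p l))

lemma vDual_medium {α : Wt n} (h : α ∈ mediumPos n) (ε : ℤˣ) (l : Wt n) :
    vDual p ε α l = (1 - (p.t : ℂ) ^ 2 * ((gamU p l α ^ (ε : ℤ) : ℂˣ) : ℂ)) /
      (1 - ((gamU p l α ^ (ε : ℤ) : ℂˣ) : ℂ)) := by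
  rcases Int.units_eq_one_or ε with rfl | rfl
  · rw [vDual, vFun_medium (by simp [h]), monoVal_gam]
    simp [Params.dual]
  · rw [vDual, vFun_medium (by simp [h]), monoVal_gam]
    simp [Params.dual, gamU_neg]

lemma vDual_long {β : Wt n} (h : β ∈ shortPos n) (ε : ℤˣ) (l : Wt n) :
    vDual p ε (2 • β) l = (1 - (p.tn : ℂ) * p.t0 * ((gamU p l β ^ (ε : ℤ) : ℂˣ) : ℂ)) *
      (1 + (p.tn : ℂ) * (p.t0 : ℂ)⁻¹ * ((gamU p l β ^ (ε : ℤ) : ℂˣ) : ℂ)) /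
      (1 - ((gamU p l β ^ (ε : ℤ) : ℂˣ) : ℂ) ^ 2) := by
  have h1 : (ε : ℤ) • (2 • β) = 2 • ((ε : ℤ) • β) := smul_comm _ _ _
  rcases Int.units_eq_one_or ε with rfl | rfl
  · rw [vDual, h1, vFun_long (by simp [h]), monoVal_gam, monoVal_gam, two_nsmul, gamU_add]
    simp [Params.dual, pow_two]
  · rw [vDual, h1, vFun_long (by simp [h]), monoVal_gam, monoVal_gam, two_nsmul, gamU_add]
    simp [Params.dual, gamU_neg, pow_two]

/-- The eigenvalue `ε t_i^ε`. -/
def signVal (p : Params) (ε : ℤˣ) (i : Fin n) : ℂ :=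
  ((ε : ℤ) : ℂ) * ((p.tSimple i ^ (ε : ℤ) : ℂˣ) : ℂ)

/-- This identity is where the functions with dual parameters enter: the distance of the
intertwiner's scalar from an eigenvalue of T_i is a value of the dual v at the spectral point. Later
coefficients are rewritten through it. -/
lemma signVal_sub_cT (hp : p.Generic n) (ε : ℤˣ) (i : Fin n) (l : Wt n) :
    signVal p ε i - cT p i l =
      ((ε : ℤ) : ℂ) * (p.tSimple i : ℂ)⁻¹ * vDual p (-ε) (simpleRoot i) l := by
  have ht : (p.tSimple i : ℂ) ≠ 0 := Units.ne_zero _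
  by_cases hi : (i : ℕ) + 1 < n
  · have hx : (gamU p l (simpleRoot i) : ℂ) ≠ 0 := Units.ne_zero _
    have hx1 : (gamU p l (simpleRoot i) : ℂ) - 1 ≠ 0 :=
      sub_ne_zero.mpr fun h => gamU_simpleRoot_ne hp l i (Units.ext h)
    have hx2 : 1 - (gamU p l (simpleRoot i) : ℂ) ≠ 0 := by rw [← neg_sub]; exact neg_ne_zero.mpr hx1
    rw [vDual_medium (simpleRoot_medium hi), cT, if_pos hi, gamU_neg, ← tSimple_of_lt hi, signVal]
    generalize (gamU p l (simpleRoot i)) = x at *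
    generalize p.tSimple i = t at *
    rcases Int.units_eq_one_or ε with rfl | rfl
    · simp
      field_simp
      ring
    · simp
      field_simp
      ring
  · have hx : (gamU p l (e (i : ℕ)) : ℂ) ≠ 0 := Units.ne_zero _
    have hx1 : (gamU p l (e (i : ℕ)) : ℂ) ^ 2 - 1 ≠ 0 :=
      sub_ne_zero.mpr fun h => gam_sq_ne hp l i (Units.ext (by rw [← gamU_e]; simpa using h))
    have hx2 : 1 - (gamU p l (e (i : ℕ)) : ℂ) ^ 2 ≠ 0 := by
      rw [← neg_sub]; exact neg_ne_zero.mpr hx1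
    rw [cT, if_neg hi, gamU_neg, gamU_neg, simpleRoot_of_last hi,
      vDual_long (mem_shortPos.mpr ⟨i, rfl⟩), ← tSimple_of_last hi, signVal, two_nsmul, gamU_add]
    have h0 : (p.t0 : ℂ) ≠ 0 := Units.ne_zero _
    generalize (gamU p l (e (i : ℕ))) = x at *
    generalize p.tSimple i = t at *
    rcases Int.units_eq_one_or ε with rfl | rfl
    · simp
      field_simp
      ring
    · simp
      field_simp
      ring

/-- At a weight fixed by s_i the monomial x^{a_i} takes the value t² at γ_l, or x_n takes the value
t_0 t_n, and this is a zero of the numerator of the dual v at -a_i. -/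
lemma cT_of_orthogonal (hp : p.Generic n) {i : Fin n} {l : Wt n} (h : l ⬝ᵥ simpleRoot i = 0) :
    cT p i l = p.tSimple i := by
  have h1 := signVal_sub_cT hp 1 i l
  have h2 : vDual p (-1) (simpleRoot i) l = 0 := by
    by_cases hi : (i : ℕ) + 1 < n
    · rw [vDual_medium (simpleRoot_medium hi), div_eq_zero_iff]
      left
      have h3 : gamU p l (simpleRoot i) = p.t ^ 2 := by
        have h4 := gamU_e (p := p) l ⟨i + 1, hi⟩
        rw [simpleRoot_of_lt hi, gamU_sub, gamU_e, h4, gam_of_orthogonal_of_lt hi h,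
          mul_div_cancel_right]
      rw [h3]
      simp
    · rw [simpleRoot_of_last hi, vDual_long (mem_shortPos.mpr ⟨i, rfl⟩), gamU_e,
        gam_of_orthogonal_of_last hi h]
      have h0 : (p.t0 : ℂ) ≠ 0 := Units.ne_zero _
      have h0' : (p.tn : ℂ) ≠ 0 := Units.ne_zero _
      rw [div_eq_zero_iff, mul_eq_zero]
      left; left
      simp
      field_simp
      ring
  rw [h2, mul_zero, sub_eq_zero] at h1
  rw [← h1, signVal]
  simp

end
end Koornwinder

/-! ### The matrix of T_i in the basis of non-symmetric polynomials. -/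

namespace Koornwinder
noncomputable section
open scoped Matrix
variable {n : ℕ} {p : Params}

lemma coeff_mono (l m : Wt n) : (mono l : Laurent n).coeff m = if l = m then 1 else 0 := by
  rw [mono, AddMonoidAlgebra.coeff_single, Finsupp.single_apply]

lemma coeff_eq_zero_of_mem_LowS {l m : Wt n} {f : Laurent n} (hf : f ∈ LowS l)
    (h : ¬ DomLT (domPart m) (domPart l)) : f.coeff m = 0 := by
  induction hf using Submodule.span_induction with
  | mem f hf =>
    obtain ⟨k, hk, rfl⟩ := hf
    rw [coeff_mono, if_neg]
    rintro rfl
    exact h hk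
  | zero => rfl
  | add f g _ _ hf hg => rw [AddMonoidAlgebra.coeff_add, Finsupp.add_apply, hf, hg, add_zero]
  | smul c f _ hf => rw [AddMonoidAlgebra.coeff_smul, Finsupp.smul_apply, hf, smul_zero]

lemma coeff_TL_mono {i : Fin n} {m k : Wt n} (h : ¬ DomLT (domPart m) (domPart k))
    (h1 : k ≠ m) (h2 : simpleRefl i k ≠ m) : (TL p i (mono k)).coeff m = 0 := by
  rcases lt_trichotomy (k ⬝ᵥ simpleRoot i) 0 with h3 | h3 | h3
  · have h4 := coeff_eq_zero_of_mem_LowS (TL_mono_neg (p := p) h3) h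
    simpa [AddMonoidAlgebra.coeff_sub, AddMonoidAlgebra.coeff_add, AddMonoidAlgebra.coeff_smul,
      coeff_mono, h1, h2] using h4
  · simp [TL_mono_zero h3, AddMonoidAlgebra.coeff_smul, coeff_mono, h1]
  · have h4 := coeff_eq_zero_of_mem_LowS (TL_mono_pos (p := p) h3) h
    simpa [AddMonoidAlgebra.coeff_sub, AddMonoidAlgebra.coeff_smul, coeff_mono, h2] using h4

lemma DomLE.not_domLT {l m : Wt n} (h : DomLE l m) : ¬ DomLT m l := fun h' =>
  h'.2 (DomLE.antisymm h'.1 h)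

/-- T_i can produce x^l only from x^l, from x^{s_i l}, or from a monomial in a strictly higher
orbit, and none of these is below s_i l, which itself is below l. -/
lemma coeff_TL_of_mem_LT {i : Fin n} {l : Wt n} (hl : 0 < l ⬝ᵥ simpleRoot i) {f : Laurent n}
    (hf : f ∈ LT (simpleRefl i l)) : (TL p i f).coeff l = 0 := by
  induction hf using Submodule.span_induction with
  | mem f hf =>
    obtain ⟨k, hk, rfl⟩ := hf
    have h1 : PrecLT k l := PrecLT.trans hk (simpleRefl_precLT hl)
    refine coeff_TL_mono (DomLE.not_domLT (PrecLT.domPart_le h1)) h1.2 fun h => ?_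
    rw [← h, simpleRefl_simpleRefl] at hk
    exact hk.2 rfl
  | zero => simp
  | add f g _ _ hf hg =>
    rw [map_add, AddMonoidAlgebra.coeff_add, Finsupp.add_apply, hf, hg, add_zero]
  | smul c f _ hf => rw [map_smul, AddMonoidAlgebra.coeff_smul, Finsupp.smul_apply, hf, smul_zero]

lemma coeff_TL_of_monic {i : Fin n} {l : Wt n} (hl : 0 < l ⬝ᵥ simpleRoot i) {f : Laurent n}
    (hf : IsMonicTriangular (simpleRefl i l) f) : (TL p i f).coeff l = p.tSimple i := by
  have h1 := coeff_TL_of_mem_LT (p := p) hl hf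
  have hne : simpleRefl i l ≠ l := (simpleRefl_precLT hl).2
  have h2 : (TL p i (mono (simpleRefl i l))).coeff l = p.tSimple i := by
    have h3 : simpleRefl i l ⬝ᵥ simpleRoot i < 0 := by rw [simpleRefl_dot_simple]; omega
    have h4 := coeff_eq_zero_of_mem_LowS (m := l) (TL_mono_neg (p := p) h3)
      (DomLE.not_domLT (PrecLT.domPart_le (simpleRefl_precLT hl)))
    simp only [AddMonoidAlgebra.coeff_sub, AddMonoidAlgebra.coeff_add, AddMonoidAlgebra.coeff_smul,
      coeff_mono, simpleRefl_simpleRefl, Finsupp.sub_apply, Finsupp.add_apply, Finsupp.smul_apply,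
      hne, if_false, if_true, smul_eq_mul, mul_zero, mul_one, zero_add] at h4
    exact sub_eq_zero.mp h4
  rw [map_sub, AddMonoidAlgebra.coeff_sub, Finsupp.sub_apply, h2, sub_eq_zero] at h1
  exact h1

/-- The diagonal coefficient of `T_i` in the basis `P_l`. -/
def diagT (p : Params) (i : Fin n) (l : Wt n) : ℂ :=
  if 0 < l ⬝ᵥ simpleRoot i then
    (p.tSimple i : ℂ) - (p.tSimple i : ℂ)⁻¹ - cT p i (simpleRefl i l)
  else cT p i l

/-- The off-diagonal coefficient of `T_i` in the basis `P_l`. -/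
def offT (p : Params) (i : Fin n) (l : Wt n) : ℂ :=
  if 0 < l ⬝ᵥ simpleRoot i then
    (p.tSimple i : ℂ)⁻¹ * (((p.tSimple i : ℂ) - cT p i (simpleRefl i l)) *
      (cT p i (simpleRefl i l) + (p.tSimple i : ℂ)⁻¹))
  else if l ⬝ᵥ simpleRoot i = 0 then 0
  else p.tSimple i

namespace IsNonsymKoornwinder

variable {P : Wt n → Laurent n}

/-- The image of the intertwiner is a multiple of P_l by simplicity of the spectrum. The multiple is
read off at x^l, which does not occur in P_{s_i l} and occurs in T_i P_{s_i l} with coefficient t_i.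
-/
lemma TL_apply_of_neg (hP : IsNonsymKoornwinder p P) (hn : 2 ≤ n) (hp : p.Generic n) {i : Fin n}
    {l : Wt n} (hl : 0 < l ⬝ᵥ simpleRoot i) : TL p i (P (simpleRefl i l)) =
      cT p i (simpleRefl i l) • P (simpleRefl i l) + (p.tSimple i : ℂ) • P l := by
  have h1 := isEigen_TL_sub hn hp i (hP.isEigen (simpleRefl i l))
  rw [reflGam_of_ne (by rw [simpleRefl_dot_simple]; omega), simpleRefl_simpleRefl] at h1
  have h2 := hP.eq_smul_of_isEigen hp h1
  generalize hP.basis.repr _ l = x at h2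
  have h3 := congrArg (fun f : Laurent n => f.coeff l) h2
  have h4 : (P (simpleRefl i l)).coeff l = 0 := by
    rw [coeff_of_monic (hP.triangular _) fun h =>
      PrecLT.irrefl _ (PrecLT.trans h (simpleRefl_precLT hl)), if_neg (simpleRefl_precLT hl).2.symm]
  simp only [AddMonoidAlgebra.coeff_sub, AddMonoidAlgebra.coeff_smul, Finsupp.sub_apply,
    Finsupp.smul_apply, h4, coeff_TL_of_monic hl (hP.triangular _),
    coeff_self_of_monic (hP.triangular l), smul_eq_mul, mul_zero, sub_zero, mul_one] at h3
  rw [h3, ← h2]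
  abel

/-- The three signs of ⟨l, a_i⟩ differ. For a negative pairing the previous lemma applies; for zero
the intertwiner's image has a spectral point outside the spectrum and vanishes; for a positive one
P_l is expressed through P_{s_i l} and T_i P_{s_i l}, and the quadratic relation finishes. -/
lemma TL_apply (hP : IsNonsymKoornwinder p P) (hn : 2 ≤ n) (hp : p.Generic n) (i : Fin n)
    (l : Wt n) : TL p i (P l) = diagT p i l • P l + offT p i l • P (simpleRefl i l) := by
  have ht : (p.tSimple i : ℂ) ≠ 0 := Units.ne_zero _
  rcases lt_trichotomy (l ⬝ᵥ simpleRoot i) 0 with h | h | h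
  · have h1 := hP.TL_apply_of_neg hn hp (l := simpleRefl i l) (i := i)
      (by rw [simpleRefl_dot_simple]; omega)
    rw [simpleRefl_simpleRefl] at h1
    rw [h1, diagT, offT, if_neg (by omega), if_neg (by omega), if_neg h.ne]
  · have h1 := isEigen_TL_sub hn hp i (hP.isEigen l)
    have h2 : TL p i (P l) - cT p i l • P l = 0 := by
      by_contra h0
      obtain ⟨m, hm⟩ := hP.exists_gam_of_isEigen h1 h0
      exact reflGam_ne_gam hp h m hm
    rw [diagT, offT, if_neg (by omega), if_neg (by omega), if_pos h, zero_smul, add_zero]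
    exact sub_eq_zero.mp h2
  · have h1 := hP.TL_apply_of_neg hn hp h
    have h2 := TL_quadratic (p := p) i (P (simpleRefl i l))
    have h3 : P l = (p.tSimple i : ℂ)⁻¹ • (TL p i (P (simpleRefl i l)) -
        cT p i (simpleRefl i l) • P (simpleRefl i l)) := by
      rw [h1, add_sub_cancel_left, smul_smul, inv_mul_cancel₀ ht, one_smul]
    rw [diagT, offT, if_pos h, if_pos h]
    nth_rewrite 1 [h3]
    rw [map_smul, map_sub, map_smul, h2, h1]
    generalize P l = A
    generalize P (simpleRefl i l) = B
    generalize cT p i (simpleRefl i l) = c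
    match_scalars
    · field_simp
      ring
    · field_simp

lemma repr_TL (hP : IsNonsymKoornwinder p P) (hn : 2 ≤ n) (hp : p.Generic n) (i : Fin n)
    (f : Laurent n) (m : Wt n) : hP.basis.repr (TL p i f) m =
      diagT p i m * hP.basis.repr f m +
        offT p i (simpleRefl i m) * hP.basis.repr f (simpleRefl i m) := by
  have h : (Finsupp.lapply m ∘ₗ hP.basis.repr.toLinearMap) ∘ₗ TL p i =
      diagT p i m • (Finsupp.lapply m ∘ₗ hP.basis.repr.toLinearMap) +
      offT p i (simpleRefl i m) • (Finsupp.lapply (simpleRefl i m) ∘ₗ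
        hP.basis.repr.toLinearMap) := by
    refine hP.basis.ext fun l => ?_
    simp only [LinearMap.comp_apply, LinearMap.smul_apply, LinearMap.add_apply, LinearEquiv.coe_coe,
      hP.basis_apply, hP.TL_apply hn hp, map_smul, map_add, hP.repr_self, Finsupp.lapply_apply,
      Finsupp.single_apply, smul_eq_mul]
    have h1 : simpleRefl i l = m ↔ l = simpleRefl i m :=
      ⟨fun h => by rw [← h, simpleRefl_simpleRefl], fun h => by rw [h, simpleRefl_simpleRefl]⟩
    rw [if_congr h1 rfl rfl]
    congr 1
    · split_ifs with h2
      · rw [h2]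
      · simp
    · split_ifs with h2
      · rw [h2]
      · simp
  exact congrArg (fun A : Laurent n →ₗ[ℂ] ℂ => A f) h

/-- T_i preserves the span of each pair P_m, P_{s_i m}, and on it the two coordinate equations are
equivalent, so each pair yields one linear condition. At a weight fixed by s_i, T_i is
multiplication by t_i: the equation is empty for ε = 1, and for ε = -1 it forces the coefficient to
vanish. -/
lemma TL_eq_signVal_iff (hP : IsNonsymKoornwinder p P) (hn : 2 ≤ n) (hp : p.Generic n)
    (ε : ℤˣ) (i : Fin n) (f : Laurent n) : TL p i f = signVal p ε i • f ↔
      (∀ m, 0 < m ⬝ᵥ simpleRoot i → hP.basis.repr f (simpleRefl i m) =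
        ((ε : ℤ) : ℂ) * ((p.tSimple i : ℂ) ^ 2)⁻¹ * vDual p ε (simpleRoot i) (simpleRefl i m) *
          hP.basis.repr f m) ∧
      (ε = -1 → ∀ m, m ⬝ᵥ simpleRoot i = 0 → hP.basis.repr f m = 0) := by
  have ht : (p.tSimple i : ℂ) ≠ 0 := Units.ne_zero _
  -- The eigenvalues t_i and -t_i⁻¹ are distinct; this gives the vanishing at fixed weights in the
  -- case ε = -1.
  have ht2 : (p.tSimple i : ℂ) ^ 2 + 1 ≠ 0 := fun h => by
    have h1 : (p.tSimple i) ^ 2 = -1 := Units.ext (by simpa using eq_neg_of_add_eq_zero_left h)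
    by_cases hi : (i : ℕ) + 1 < n
    · rw [tSimple_of_lt hi] at h1; exact hp.t_sq_ne h1
    · rw [tSimple_of_last hi] at h1; exact hp.tn_sq_ne h1
  have key : ∀ m, hP.basis.repr (TL p i f) m = signVal p ε i * hP.basis.repr f m ↔
      diagT p i m * hP.basis.repr f m +
        offT p i (simpleRefl i m) * hP.basis.repr f (simpleRefl i m) =
        signVal p ε i * hP.basis.repr f m := fun m => by rw [hP.repr_TL hn hp]
  have hiff : TL p i f = signVal p ε i • f ↔ ∀ m, diagT p i m * hP.basis.repr f m +
        offT p i (simpleRefl i m) * hP.basis.repr f (simpleRefl i m) =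
        signVal p ε i * hP.basis.repr f m := by
    rw [← hP.basis.repr.injective.eq_iff, DFunLike.ext_iff, map_smul]
    exact forall_congr' key
  generalize hP.basis.repr f = F at *
  have hsv : ∀ l, vDual p ε (simpleRoot i) l = -((ε : ℤ) : ℂ) * p.tSimple i *
      (signVal p (-ε) i - cT p i l) := fun l => by
    rw [signVal_sub_cT hp, neg_neg]
    rcases Int.units_eq_one_or ε with rfl | rfl
    · simp [ht]
    · simp [ht]
  rw [hiff]
  have hpos : ∀ m, 0 < m ⬝ᵥ simpleRoot i → (diagT p i m * F m +
      offT p i (simpleRefl i m) * F (simpleRefl i m) = signVal p ε i * F m ↔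
      F (simpleRefl i m) = ((ε : ℤ) : ℂ) * ((p.tSimple i : ℂ) ^ 2)⁻¹ *
        vDual p ε (simpleRoot i) (simpleRefl i m) * F m) := fun m hm => by
    have h1 : simpleRefl i m ⬝ᵥ simpleRoot i < 0 := by rw [simpleRefl_dot_simple]; omega
    rw [diagT, offT, if_pos hm, if_neg (by omega), if_neg h1.ne, hsv, signVal, signVal]
    generalize cT p i (simpleRefl i m) = c
    generalize F (simpleRefl i m) = b
    generalize F m = a
    generalize (p.tSimple i) = t at *
    rcases Int.units_eq_one_or ε with rfl | rfl
    · simp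
      field_simp
      constructor <;> intro h <;> linear_combination h
    · simp
      field_simp
      exact ⟨fun h => mul_left_cancel₀ ht (by linear_combination h),
        fun h => by linear_combination (t : ℂ) * h⟩
  constructor
  · intro h
    refine ⟨fun m hm => (hpos m hm).mp (h m), fun hε m hm => ?_⟩
    subst hε
    have h1 := h m
    have h2 : simpleRefl i m = m := simpleRefl_eq_self_iff.mpr hm
    rw [h2, diagT, offT, if_neg (by omega), if_neg (by omega), if_pos hm, cT_of_orthogonal hp hm,
      signVal, zero_mul, add_zero] at h1
    simp at h1
    field_simp at h1
    have h3 : ((p.tSimple i : ℂ) ^ 2 + 1) * F m = 0 := by linear_combination h1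
    exact (mul_eq_zero.mp h3).resolve_left ht2
  · rintro ⟨h1, h2⟩ m
    rcases lt_trichotomy (m ⬝ᵥ simpleRoot i) 0 with h | h | h
    · have h3 : 0 < simpleRefl i m ⬝ᵥ simpleRoot i := by rw [simpleRefl_dot_simple]; omega
      have h4 := h1 _ h3
      rw [simpleRefl_simpleRefl, hsv, signVal] at h4
      rw [diagT, offT, if_neg (by omega), if_pos h3, simpleRefl_simpleRefl, signVal, h4]
      generalize cT p i m = c
      generalize F (simpleRefl i m) = a
      generalize (p.tSimple i) = t at *
      rcases Int.units_eq_one_or ε with rfl | rfl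
      · simp
        field_simp
        ring
      · simp
        field_simp
        ring
    · have h3 : simpleRefl i m = m := simpleRefl_eq_self_iff.mpr h
      rw [h3, diagT, offT, if_neg (by omega), if_neg (by omega), if_pos h, cT_of_orthogonal hp h,
        signVal, zero_mul, add_zero]
      rcases Int.units_eq_one_or ε with rfl | rfl
      · simp
      · rw [h2 rfl m h, mul_zero, mul_zero]
    · exact (hpos m h).mpr (h1 m h)

end IsNonsymKoornwinder

end
end Koornwinder

namespace Koornwinder
noncomputable section
open scoped Matrix
variable {n : ℕ} {p : Params}

/-! ### Regular weights -/

lemma sum_fundWt_apply (k : Fin n) : (∑ i : Fin n, fundWt i) k = (n : ℤ) - k := by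
  have h : ∀ i : Fin n, (fundWt i : Wt n) k = if k ≤ i then 1 else 0 := fun i => by
    simp [fundWt, Finset.sum_apply, e_apply, Fin.val_inj]
  rw [Finset.sum_apply]
  simp_rw [h]
  rw [← Finset.sum_filter, Finset.sum_const, nsmul_one,
    show Finset.univ.filter (fun i => k ≤ i) = Finset.Ici k by ext; simp, Fin.card_Ici]
  have := k.2
  omega

lemma sum_fundWt_dot_pos {α : Wt n} (h : α ∈ posRoots n) : 0 < (∑ i : Fin n, fundWt i) ⬝ᵥ α := by
  rcases Finset.mem_union.mp h with h | h
  · obtain ⟨i, j, hij, rfl | rfl⟩ := mem_mediumPos.mp h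
    · rw [dotProduct_sub, dot_e, dot_e, sum_fundWt_apply, sum_fundWt_apply]
      have : (i : ℕ) < j := hij
      omega
    · rw [dotProduct_add, dot_e, dot_e, sum_fundWt_apply, sum_fundWt_apply]
      have := i.2; have := j.2
      omega
  · obtain ⟨i, rfl⟩ := mem_longPos.mp h
    rw [dotProduct_smul, dot_e, sum_fundWt_apply]
    have := i.2
    simp

lemma sum_fundWt_dot_coroot (i : Fin n) :
    (∑ i : Fin n, fundWt i) ⬝ᵥ coroot (simpleRoot i) = 1 := by
  have := i.2
  by_cases hi : (i : ℕ) + 1 < n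
  · have h := dot_e (∑ i : Fin n, fundWt i) ⟨i + 1, hi⟩
    rw [coroot_simple_of_lt hi, dotProduct_sub, dot_e, h, sum_fundWt_apply, sum_fundWt_apply]
    push_cast
    ring
  · rw [coroot_simple_of_last hi, dot_e, sum_fundWt_apply]
    omega

lemma dot_pos_of_regular {l α : Wt n} (hl : IsRegularDominant l) (h : α ∈ posRoots n) :
    0 < l ⬝ᵥ α := by
  have h1 := dot_nonneg_of_dominant hl h
  have h2 := sum_fundWt_dot_pos h
  rw [sub_dotProduct] at h1
  omega

/-- The pairing of w l with a_i is that of l with w⁻¹ a_i, which is a root up to sign. Hence the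
vanishing condition for ε = -1 is void on a regular orbit. -/
lemma dot_ne_zero_of_regular {l m : Wt n} (hl : IsRegularDominant l) (hm : m ∈ weylOrbit l)
    (i : Fin n) : m ⬝ᵥ simpleRoot i ≠ 0 := by
  obtain ⟨w, hw, rfl⟩ := mem_weylOrbit.mp hm
  rw [weyl_inv_dot hw]
  rcases isRoot_weyl (inv_mem hw) (simpleRoot_mem i) with h | h
  · exact (dot_pos_of_regular hl h).ne'
  · have := dot_pos_of_regular hl h
    rw [dotProduct_neg] at this
    omega

/-- Since κ pairs to 1 with every simple co-root, a dominant weight fails to be regular only if one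
of its pairings is zero. -/
lemma exists_dot_eq_zero {l : Wt n} (hl : IsDominant l) (h : ¬ IsRegularDominant l) :
    ∃ i : Fin n, l ⬝ᵥ simpleRoot i = 0 := by
  by_contra! hc
  refine h fun i => ?_
  have h1 := hl i
  have h2 := hc i
  rw [sub_dotProduct, sum_fundWt_dot_coroot]
  have h3 : l ⬝ᵥ coroot (simpleRoot i) ≠ 0 := fun h3 => h2 (by rw [dot_simple_eq, h3]; simp)
  omega

/-! ### The expansion coefficients -/

/-- The contribution of the root `α` to the coefficient at `m`. -/
def rootFactor (p : Params) (ε : ℤˣ) (α m : Wt n) : ℂ :=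
  ((ε : ℤ) : ℂ) * ((p.dual.mult α 0 : ℂ) ^ 2)⁻¹ * vDual p ε α m

/-- The expansion coefficient of the (anti)symmetric polynomial at `m`. -/
def expCoeff (p : Params) (ε : ℤˣ) (m : Wt n) : ℂ := ∏ α ∈ negRoots m, rootFactor p ε α m

/-- The spectral point moves together with the root, γ_{s_i m} = s_i γ_m, and s_i preserves the root
length on which the multiplicity depends. -/
lemma rootFactor_simpleRefl {i : Fin n} {m α : Wt n} (h : 0 < m ⬝ᵥ simpleRoot i)
    (hα : α ∈ negRoots m) (ε : ℤˣ) :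
    rootFactor p ε (simpleRefl i α) (simpleRefl i m) = rootFactor p ε α m := by
  obtain ⟨h1, h2⟩ := Finset.mem_filter.mp hα
  have hne : α ≠ simpleRoot i := by rintro rfl; omega
  have hg : ∀ β : Wt n, gamU p (simpleRefl i m) (simpleRefl i β) = gamU p m β := fun β => by
    rw [gamU_simpleRefl h.ne', simpleRefl_simpleRefl]
  rcases Finset.mem_union.mp h1 with hm | hm
  · have hm' := simpleRefl_medium hm hne
    rw [rootFactor, rootFactor, vDual_medium hm, vDual_medium hm', hg, mult_of_medium (Or.inl hm),
      mult_of_medium (Or.inl hm')]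
  · have hm' := simpleRefl_long hm hne
    have hmul : p.dual.mult (simpleRefl i α) 0 = p.dual.mult α 0 := by
      rw [mult_of_long (Or.inl hm), mult_of_long (Or.inl hm')]
    rw [rootFactor, rootFactor, hmul]
    obtain ⟨j, rfl⟩ := mem_longPos.mp hm
    obtain ⟨k, hk⟩ := mem_longPos.mp hm'
    have hjk : simpleRefl i (e (j : ℕ)) = e (k : ℕ) := by
      rw [map_nsmul] at hk
      exact (smul_right_injective (Wt n) two_ne_zero hk : _)
    rw [hk, vDual_long (mem_shortPos.mpr ⟨j, rfl⟩), vDual_long (mem_shortPos.mpr ⟨k, rfl⟩),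
      ← hjk, hg]

/-- The new root a_i contributes exactly the factor of the recursion for eigenvectors of T_i, and
all the old factors are carried along unchanged. -/
lemma expCoeff_simpleRefl {i : Fin n} {m : Wt n} (h : 0 < m ⬝ᵥ simpleRoot i) (ε : ℤˣ) :
    expCoeff p ε (simpleRefl i m) =
      ((ε : ℤ) : ℂ) * ((p.tSimple i : ℂ) ^ 2)⁻¹ * vDual p ε (simpleRoot i) (simpleRefl i m) *
        expCoeff p ε m := by
  rw [expCoeff, prod_negRoots_simpleRefl h, ← tSimple_dual]
  exact congrArg _ (Finset.prod_congr rfl fun α hα => rootFactor_simpleRefl h hα ε)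

lemma expCoeff_of_dominant {l : Wt n} (hl : IsDominant l) (ε : ℤˣ) : expCoeff p ε l = 1 := by
  rw [expCoeff, negRoots_of_dominant hl, Finset.prod_empty]

/-! ### The spaces `𝒜_±(λ)` -/

/-- The (anti)symmetric combination of the `P_m`, `m ∈ Wl`. -/
def signPoly (p : Params) (ε : ℤˣ) (l : Wt n) : Laurent n :=
  ∑ m ∈ weylOrbit l, expCoeff p ε m • nonsymK p m

lemma mem_signPart_iff {ε : ℤˣ} {l : Wt n} {f : Laurent n} : f ∈ signPart p ε l ↔
    f ∈ orbitSpace p l ∧ ∀ i, TL p i f = signVal p ε i • f := by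
  refine and_congr_right fun _ => forall_congr' fun i => ?_
  rw [lifts_T, ← map_smul, toRat_injective.eq_iff]
  rfl

section Generic

variable (hn : 2 ≤ n) (hp : p.Generic n)
include hn hp

lemma mem_orbitSpace_iff {l : Wt n} {f : Laurent n} : f ∈ orbitSpace p l ↔
    ∀ m ∉ weylOrbit l, (nonsymK_spec hn hp).basis.repr f m = 0 := by
  have h : nonsymK p '' (weylOrbit l : Set (Wt n)) =
      (nonsymK_spec hn hp).basis '' (weylOrbit l : Set (Wt n)) :=
    Set.image_congr fun m _ => ((nonsymK_spec hn hp).basis_apply m).symm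
  rw [orbitSpace, h, Module.Basis.mem_span_image]
  constructor
  · intro h1 m hm
    by_contra h0
    exact hm (h1 (Finsupp.mem_support_iff.mpr h0))
  · intro h1 m hm
    by_contra h0
    exact Finsupp.mem_support_iff.mp hm (h1 m h0)

lemma repr_signPoly (ε : ℤˣ) (l m : Wt n) :
    (nonsymK_spec hn hp).basis.repr (signPoly p ε l) m =
      if m ∈ weylOrbit l then expCoeff p ε m else 0 := by
  classical
  rw [signPoly, map_sum, Finsupp.finsetSum_apply]
  simp [IsNonsymKoornwinder.repr_self, Finsupp.single_apply]

lemma signPoly_mem {ε : ℤˣ} {l : Wt n}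
    (h : ε = -1 → ∀ m ∈ weylOrbit l, ∀ i, m ⬝ᵥ simpleRoot i ≠ 0) :
    signPoly p ε l ∈ signPart p ε l := by
  refine mem_signPart_iff.mpr ⟨(mem_orbitSpace_iff hn hp).mpr fun m hm => ?_, fun i => ?_⟩
  · rw [repr_signPoly hn hp, if_neg hm]
  · refine ((nonsymK_spec hn hp).TL_eq_signVal_iff hn hp ε i _).mpr
      ⟨fun m hm => ?_, fun hε m hm => ?_⟩
    · rw [repr_signPoly hn hp, repr_signPoly hn hp, if_congr simpleRefl_mem_weylOrbit rfl rfl]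
      split_ifs
      · exact expCoeff_simpleRefl hm ε
      · rw [mul_zero]
    · rw [repr_signPoly hn hp, if_neg fun hc => h hε m hc i hm]

/-- Every weight of the orbit is reached from l by ascending reflections, so the recursion
determines all coefficients from the one at l. -/
lemma eq_smul_signPoly {ε : ℤˣ} {l : Wt n} (hl : IsDominant l) {f : Laurent n}
    (hf : f ∈ signPart p ε l) :
    f = (nonsymK_spec hn hp).basis.repr f l • signPoly p ε l := by
  obtain ⟨h1, h2⟩ := mem_signPart_iff.mp hf
  rw [mem_orbitSpace_iff hn hp] at h1
  refine (nonsymK_spec hn hp).basis.repr.injective (Finsupp.ext fun m => ?_)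
  rw [map_smul, Finsupp.smul_apply, repr_signPoly hn hp, smul_eq_mul]
  split_ifs with hm
  · induction m using weight_induction with
    | dom m hd =>
      have : m = l := by
        rw [eq_domPart hl (mem_weylOrbit_symm hm), domPart_of_dominant hd]
      rw [this, expCoeff_of_dominant hl, mul_one]
    | step m i h ih =>
      rw [(((nonsymK_spec hn hp).TL_eq_signVal_iff hn hp ε i f).mp (h2 i)).1 m h,
        expCoeff_simpleRefl h, ih (simpleRefl_mem_weylOrbit.mp hm)]
      ring
  · rw [mul_zero, h1 m hm]

lemma signPart_eq_span {ε : ℤˣ} {l : Wt n} (hl : IsDominant l)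
    (h : ε = -1 → ∀ m ∈ weylOrbit l, ∀ i, m ⬝ᵥ simpleRoot i ≠ 0) :
    signPart p ε l = Submodule.span ℂ {signPoly p ε l} := by
  refine le_antisymm (fun f hf => ?_) ?_
  · rw [Submodule.mem_span_singleton]
    exact ⟨_, (eq_smul_signPoly hn hp hl hf).symm⟩
  · rw [Submodule.span_singleton_le_iff_mem]
    exact signPoly_mem hn hp h

/-- The dominant weight is itself fixed by some s_i, so the coefficient from which all the others
are computed is zero. -/
lemma signPart_neg_eq_bot {l : Wt n} (hl : IsDominant l) (h : ¬ IsRegularDominant l) :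
    signPart p (-1) l = ⊥ := by
  obtain ⟨i, hi⟩ := exists_dot_eq_zero hl h
  refine (Submodule.eq_bot_iff _).mpr fun f hf => ?_
  have h1 := (((nonsymK_spec hn hp).TL_eq_signVal_iff hn hp (-1) i f).mp
    ((mem_signPart_iff.mp hf).2 i)).2 rfl l hi
  rw [eq_smul_signPoly hn hp hl hf, h1, zero_smul]

/-- The dominant weight is the highest of its orbit, and its coefficient is an empty product. -/
lemma signPoly_monic {ε : ℤˣ} {l : Wt n} (hl : IsDominant l) :
    IsMonicTriangular l (signPoly p ε l) := by
  have h1 : signPoly p ε l - nonsymK p l ∈ LT l := by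
    rw [signPoly, ← Finset.add_sum_erase _ _ (mem_weylOrbit_self l), expCoeff_of_dominant hl,
      one_smul, add_sub_cancel_left]
    refine sum_mem fun m hm => Submodule.smul_mem _ _ ?_
    obtain ⟨hne, hm⟩ := Finset.mem_erase.mp hm
    have h2 : PrecLT m l :=
      precLT_iff.mpr (Or.inr ⟨domPart_eq_of_mem hm, mem_orbit_domLE hl hm, hne⟩)
    have h3 := add_mem (LT_le h2 ((nonsymK_spec hn hp).triangular m)) (mono_mem_LT h2)
    rwa [sub_add_cancel] at h3
  exact monic_sub_mem ((nonsymK_spec hn hp).triangular l) h1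

lemma signPoly_ne_zero {ε : ℤˣ} {l : Wt n} (hl : IsDominant l) : signPoly p ε l ≠ 0 := fun h => by
  have h1 := coeff_self_of_monic (signPoly_monic (ε := ε) hn hp hl)
  rw [h] at h1
  simp at h1

lemma eq_signPoly {ε : ℤˣ} {l : Wt n} (hl : IsDominant l) {f : Laurent n}
    (hf : f ∈ signPart p ε l) (h1 : f.coeff l = 1) : f = signPoly p ε l := by
  have h2 := eq_smul_signPoly hn hp hl hf
  have h3 := congrArg (fun f : Laurent n => f.coeff l) h2
  simp only [AddMonoidAlgebra.coeff_smul, Finsupp.smul_apply, h1,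
    coeff_self_of_monic (signPoly_monic hn hp hl), smul_eq_mul, mul_one] at h3
  rw [h2, ← h3, one_smul]

end Generic

end
end Koornwinder

namespace Koornwinder
noncomputable section
open scoped Matrix
variable {n : ℕ} {p : Params}

/-! ### Minimal representatives -/

lemma reducedWord_spec (w : weylGroup n) : IsReducedWord w (reducedWord w) := by
  refine Classical.epsilon_spec (p := IsReducedWord w) ?_
  classical
  have h : ∃ k, ∃ L : List (Fin n), (L.map simpleRefl).prod = (w : Wt n ≃ₗ[ℤ] Wt n) ∧
      L.length = k := by
    obtain ⟨L, hL⟩ := exists_word w.2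
    exact ⟨_, L, hL, rfl⟩
  obtain ⟨L, h1, h2⟩ := Nat.find_spec h
  exact ⟨L, h1, fun L' h' => h2 ▸ Nat.find_min' h ⟨L', h', rfl⟩⟩

lemma card_negRoots_of_not_pos {i : Fin n} {m : Wt n} (h : ¬ 0 < m ⬝ᵥ simpleRoot i) :
    (negRoots (simpleRefl i m)).card ≤ (negRoots m).card := by
  rcases (not_lt.mp h).lt_or_eq with h1 | h1
  · have h2 := card_negRoots_simpleRefl (i := i) (m := simpleRefl i m)
      (by rw [simpleRefl_dot_simple]; omega)
    rw [simpleRefl_simpleRefl] at h2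
    omega
  · rw [simpleRefl_eq_self_iff.mpr h1]

lemma word_cons (i : Fin n) (L : List (Fin n)) (l : Wt n) :
    ((i :: L).map simpleRefl).prod l = simpleRefl i ((L.map simpleRefl).prod l) := by
  rw [List.map_cons, List.prod_cons]; rfl

/-- One letter adds at most one negative root, which bounds the length of any word from l to a given
weight from below. -/
lemma card_negRoots_word_le {l : Wt n} (hl : IsDominant l) (L : List (Fin n)) :
    (negRoots ((L.map simpleRefl).prod l)).card ≤ L.length := by
  induction L with
  | nil => simp [negRoots_of_dominant hl]
  | cons i L ih =>
    rw [word_cons, List.length_cons]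
    by_cases h : 0 < (L.map simpleRefl).prod l ⬝ᵥ simpleRoot i
    · rw [card_negRoots_simpleRefl h]; omega
    · exact (card_negRoots_of_not_pos h).trans (by omega)

/-- A word of minimal length ascends at every step. -/
lemma word_induction {l : Wt n} (hl : IsDominant l) {motive : List (Fin n) → Prop}
    (nil : motive [])
    (cons : ∀ i L, 0 < (L.map simpleRefl).prod l ⬝ᵥ simpleRoot i → motive L → motive (i :: L))
    (L : List (Fin n)) (h : L.length ≤ (negRoots ((L.map simpleRefl).prod l)).card) :
    motive L := by
  induction L with
  | nil => exact nil
  | cons i L ih =>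
    rw [word_cons, List.length_cons] at h
    have h1 := card_negRoots_word_le hl L
    have h2 : 0 < (L.map simpleRefl).prod l ⬝ᵥ simpleRoot i := by
      by_contra hc
      have := card_negRoots_of_not_pos hc
      omega
    rw [card_negRoots_simpleRefl h2] at h
    exact cons i L h2 (ih (by omega))

lemma mult_simpleRefl {i : Fin n} {m α : Wt n} (h : 0 < m ⬝ᵥ simpleRoot i)
    (hα : α ∈ negRoots m) : p.mult (simpleRefl i α) 0 = p.mult α 0 := by
  obtain ⟨h1, h2⟩ := Finset.mem_filter.mp hα
  have hne : α ≠ simpleRoot i := by rintro rfl; omega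
  rcases Finset.mem_union.mp h1 with hm | hm
  · rw [mult_of_medium (Or.inl hm), mult_of_medium (Or.inl (simpleRefl_medium hm hne))]
  · rw [mult_of_long (Or.inl hm), mult_of_long (Or.inl (simpleRefl_long hm hne))]

lemma prod_tSimple_word {l : Wt n} (hl : IsDominant l) (L : List (Fin n))
    (h : L.length ≤ (negRoots ((L.map simpleRefl).prod l)).card) :
    (L.map p.tSimple).prod = ∏ α ∈ negRoots ((L.map simpleRefl).prod l), p.mult α 0 := by
  refine word_induction hl (motive := fun L => (L.map p.tSimple).prod =
    ∏ α ∈ negRoots ((L.map simpleRefl).prod l), p.mult α 0) ?_ (fun i L h ih => ?_) L h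
  · simp [negRoots_of_dominant hl]
  · rw [word_cons, prod_negRoots_simpleRefl h, List.map_cons, List.prod_cons, ih]
    exact congrArg _ (Finset.prod_congr rfl fun α hα => (mult_simpleRefl h hα).symm)

/-- Reflections act on the spectrum as on the weights when the pairing is nonzero, and along a
minimal word every step ascends. -/
lemma gamU_word {l : Wt n} (hl : IsDominant l) (L : List (Fin n))
    (h : L.length ≤ (negRoots ((L.map simpleRefl).prod l)).card) (m : Wt n) :
    gamU p ((L.map simpleRefl).prod l) ((L.map simpleRefl).prod m) = gamU p l m := by
  refine word_induction hl (motive := fun L => gamU p ((L.map simpleRefl).prod l)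
    ((L.map simpleRefl).prod m) = gamU p l m) ?_ (fun i L h ih => ?_) L h
  · simp
  · rw [word_cons, word_cons, gamU_simpleRefl h.ne', simpleRefl_simpleRefl, ih]

/-- The positive roots made negative by `w`. -/
def inversions (w : Wt n ≃ₗ[ℤ] Wt n) : Finset (Wt n) :=
  (posRoots n).filter fun α => -(w α) ∈ posRoots n

/-- Adding the letter i on the left creates at most one new inversion, namely w⁻¹ a_i. -/
lemma card_inversions_word_le (L : List (Fin n)) :
    (inversions (L.map simpleRefl).prod).card ≤ L.length := by
  classical
  induction L with
  | nil =>
    simp only [List.map_nil, List.prod_nil, List.length_nil, Nat.le_zero, Finset.card_eq_zero]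
    exact Finset.filter_eq_empty_iff.mpr fun α hα => neg_notMem_posRoots hα
  | cons i L ih =>
    have hw := word_mem L
    set w := (L.map simpleRefl).prod with hw_def
    have hsub : inversions ((i :: L).map simpleRefl).prod ⊆
        insert (w⁻¹ (simpleRoot i)) (inversions w) := by
      intro α hα
      obtain ⟨h1, h2⟩ := Finset.mem_filter.mp hα
      rw [word_cons, ← hw_def] at h2
      rw [Finset.mem_insert]
      rcases isRoot_weyl hw h1 with h3 | h3
      · by_cases h4 : w α = simpleRoot i
        · left
          rw [← h4, ← LinearEquiv.mul_apply, inv_mul_cancel]; rfl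
        · exact absurd h2 (neg_notMem_posRoots (simpleRefl_posRoots h3 h4))
      · exact Or.inr (Finset.mem_filter.mpr ⟨h1, h3⟩)
    refine (Finset.card_le_card hsub).trans ((Finset.card_insert_le _ _).trans ?_)
    rw [List.length_cons]
    omega

section Minimal

variable {l m : Wt n} {w : weylGroup n}

lemma IsMinimalTo.apply (h : IsMinimalTo l m w) : (w : Wt n ≃ₗ[ℤ] Wt n) l = m := h.1

lemma IsMinimalTo.weylLength_eq (hl : IsDominant l) (h : IsMinimalTo l m w) :
    weylLength w = (negRoots m).card := by
  refine le_antisymm ?_ ?_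
  · obtain ⟨L, l', h1, h2, h3⟩ := exists_dominant_word m
    have h4 : l' = l := by
      have h5 : m ∈ weylOrbit l := mem_weylOrbit.mpr ⟨w, w.2, h.apply⟩
      have h6 : m ∈ weylOrbit l' := mem_weylOrbit.mpr ⟨_, word_mem L, h2⟩
      rw [eq_domPart hl (mem_weylOrbit_symm h5), eq_domPart h1 (mem_weylOrbit_symm h6)]
    rw [← h3]
    refine (h.2 ⟨_, word_mem L⟩ (by rw [← h4]; exact h2)).trans ?_
    exact (reducedWord_spec _).2 L rfl
  · have h1 := card_negRoots_word_le hl (reducedWord w)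
    rwa [(reducedWord_spec w).1, h.apply] at h1

/-- This is the hypothesis under which a reduced expression ascends at every letter. -/
lemma IsMinimalTo.length_le (hl : IsDominant l) (h : IsMinimalTo l m w) :
    (reducedWord w).length ≤ (negRoots (((reducedWord w).map simpleRefl).prod l)).card := by
  rw [(reducedWord_spec w).1, h.apply]
  exact (h.weylLength_eq hl).le

lemma IsMinimalTo.tWeyl_eq (hl : IsDominant l) (h : IsMinimalTo l m w) :
    p.tWeyl w = ∏ α ∈ negRoots m, p.mult α 0 := by
  have h1 := prod_tSimple_word (p := p) hl (reducedWord w) (h.length_le hl)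
  rwa [(reducedWord_spec w).1, h.apply] at h1

lemma IsMinimalTo.gamU_eq (hl : IsDominant l) (h : IsMinimalTo l m w) (k : Wt n) :
    gamU p m ((w : Wt n ≃ₗ[ℤ] Wt n) k) = gamU p l k := by
  have h1 := gamU_word (p := p) hl (reducedWord w) (h.length_le hl) k
  rwa [(reducedWord_spec w).1, h.apply] at h1

/-- If β is positive and negative on μ = w l, then w⁻¹ β is negative on the dominant weight l, so it
is a negative root and -w⁻¹ β is an inversion. Equality follows by counting: there are at most as
many inversions as letters, and the length is the number of roots negative on μ. -/
lemma IsMinimalTo.image_inversions (hl : IsDominant l) (h : IsMinimalTo l m w) :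
    (inversions (w : Wt n ≃ₗ[ℤ] Wt n)).image (fun α => -((w : Wt n ≃ₗ[ℤ] Wt n) α)) =
      negRoots m := by
  classical
  have hsub : negRoots m ⊆
      (inversions (w : Wt n ≃ₗ[ℤ] Wt n)).image (fun α => -((w : Wt n ≃ₗ[ℤ] Wt n) α)) := by
    intro β hβ
    obtain ⟨h1, h2⟩ := Finset.mem_filter.mp hβ
    have h3 : (w : Wt n ≃ₗ[ℤ] Wt n) (-((w : Wt n ≃ₗ[ℤ] Wt n)⁻¹ β)) = -β := by
      rw [map_neg, ← LinearEquiv.mul_apply, mul_inv_cancel]; rfl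
    refine Finset.mem_image.mpr ⟨-((w : Wt n ≃ₗ[ℤ] Wt n)⁻¹ β),
      Finset.mem_filter.mpr ⟨?_, by rwa [h3, neg_neg]⟩, by rw [h3, neg_neg]⟩
    refine (isRoot_weyl (inv_mem w.2) h1).resolve_left fun hc => ?_
    have h4 := dot_nonneg_of_dominant hl hc
    rw [← h.apply, weyl_inv_dot w.2] at h2
    omega
  refine (Finset.eq_of_subset_of_card_le hsub (Finset.card_image_le.trans ?_)).symm
  have h1 := card_inversions_word_le (reducedWord w)
  rw [(reducedWord_spec w).1] at h1
  exact h1.trans (h.weylLength_eq hl).le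

end Minimal

/-! ### Agreement of the two product formulas. -/

lemma vFun_comp_equiv {F : Type*} [Field F] [Algebra ℂ F] {u : Wt n ≃ₗ[ℤ] Wt n}
    (hu : ∀ l m, u l ⬝ᵥ u m = l ⬝ᵥ m) {α : Wt n} (h : α ∈ posRoots n) (h' : u α ∈ posRoots n)
    (ε : ℤˣ) (ev : Wt n → F) :
    vFun p ((ε : ℤ) • α) 0 (fun k => ev (u k)) = vFun p ((ε : ℤ) • u α) 0 ev := by
  have hmed : ∀ {β : Wt n}, β ∈ mediumPos n →
      (ε : ℤ) • β ∈ mediumPos n ∨ -((ε : ℤ) • β) ∈ mediumPos n := fun hβ => by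
    rcases Int.units_eq_one_or ε with rfl | rfl <;> simp [hβ]
  have hsh : ∀ {β : Wt n}, β ∈ shortPos n →
      (ε : ℤ) • β ∈ shortPos n ∨ -((ε : ℤ) • β) ∈ shortPos n := fun hβ => by
    rcases Int.units_eq_one_or ε with rfl | rfl <;> simp [hβ]
  rcases Finset.mem_union.mp h with hm | hm
  · have hm' : u α ∈ mediumPos n := (Finset.mem_union.mp h').resolve_right fun hc => by
      have h1 := hu α α
      rw [dot_self_long hc, dot_self_medium hm] at h1
      omega
    rw [vFun_medium (hmed hm), vFun_medium (hmed hm'), map_zsmul]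
  · have hm' : u α ∈ longPos n := (Finset.mem_union.mp h').resolve_left fun hc => by
      have h1 := hu α α
      rw [dot_self_medium hc, dot_self_long hm] at h1
      omega
    obtain ⟨j, rfl⟩ := mem_longPos.mp hm
    obtain ⟨k, hk⟩ := mem_longPos.mp hm'
    have hjk : u (e (j : ℕ)) = e (k : ℕ) := by
      rw [map_nsmul] at hk
      exact (smul_right_injective (Wt n) two_ne_zero hk : _)
    rw [hk, smul_comm (ε : ℤ) 2, smul_comm (ε : ℤ) 2, vFun_long (hsh (mem_shortPos.mpr ⟨j, rfl⟩)),
      vFun_long (hsh (mem_shortPos.mpr ⟨k, rfl⟩))]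
    simp only [map_nsmul, map_zsmul, hjk]

lemma prefactor_eq {l m : Wt n} {w : weylGroup n} (hl : IsDominant l) (h : IsMinimalTo l m w)
    (ε : ℤˣ) : ((ε : ℤ) : ℂ) ^ weylLength w * ((p.dual.tWeyl w : ℂˣ) : ℂ) ^ (-2 : ℤ) =
      ∏ α ∈ negRoots m, (((ε : ℤ) : ℂ) * ((p.dual.mult α 0 : ℂ) ^ 2)⁻¹) := by
  rw [Finset.prod_mul_distrib, Finset.prod_const, h.weylLength_eq hl, h.tWeyl_eq hl,
    Finset.prod_inv_distrib, Finset.prod_pow, zpow_neg]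
  congr 2
  push_cast
  norm_cast

lemma coeffA_eq {l m : Wt n} {w : weylGroup n} (hl : IsDominant l) (h : IsMinimalTo l m w)
    (ε : ℤˣ) : coeffA p ε w m = expCoeff p ε m := by
  rw [coeffA, prefactor_eq hl h]
  exact Finset.prod_mul_distrib.symm

lemma coeffB_eq {l m : Wt n} {w : weylGroup n} (hl : IsDominant l) (h : IsMinimalTo l m w)
    (ε : ℤˣ) : coeffB p ε w l = expCoeff p ε m := by
  classical
  rw [← coeffA_eq hl h, coeffA, coeffB]
  congr 1
  change ∏ α ∈ inversions (w : Wt n ≃ₗ[ℤ] Wt n), _ = ∏ α ∈ negRoots m, _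
  rw [← h.image_inversions hl, Finset.prod_image fun a _ b _ hab => by simpa using hab]
  refine Finset.prod_congr rfl fun α hα => ?_
  obtain ⟨h1, h2⟩ := Finset.mem_filter.mp hα
  -- The substitution -w matches both changes at once: it sends an inversion α to the root -w α
  -- negative on μ, and it turns evaluation at γ_μ into evaluation at γ_λ⁻¹.
  have h3 := vFun_comp_equiv (p := p.dual)
    (u := (w : Wt n ≃ₗ[ℤ] Wt n).trans (LinearEquiv.neg ℤ))
    (fun a b => by simp [dot_weyl w.2]) h1 h2 ε (monoVal (gam p m))
  have h4 : (fun k => monoVal (gam p m)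
      (((w : Wt n ≃ₗ[ℤ] Wt n).trans (LinearEquiv.neg ℤ)) k)) = monoVal (gam p l)⁻¹ := by
    funext k
    change monoVal (gam p m) (-((w : Wt n ≃ₗ[ℤ] Wt n) k)) = _
    rw [monoVal_gam, gamU_neg, h.gamU_eq hl, Units.val_inv_eq_inv_val, ← monoVal_gam, monoVal,
      monoVal]
    simp
  rw [h4] at h3
  exact h3

lemma hasExpansion_signPoly {l : Wt n} (hl : IsDominant l) (ε : ℤˣ) :
    HasExpansion p ε l (signPoly p ε l) :=
  ⟨expCoeff p ε, rfl, fun _ _ _ hw => ⟨(coeffA_eq hl hw ε).symm, (coeffB_eq hl hw ε).symm⟩⟩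

end
end Koornwinder

namespace Koornwinder
noncomputable section
open scoped Matrix
variable {n : ℕ} {p : Params}

/-! ### The algebra of difference-reflection operators -/

lemma extOp_mul_mulOp (σ : Laurent n ≃ₐ[ℂ] Laurent n) (g : RatFn n) :
    extOp σ * mulOp g = mulOp (ext σ g) * extOp σ :=
  LinearMap.ext fun f => map_mul (ext σ) g f

lemma mulOp_mul (g h : RatFn n) : mulOp g * mulOp h = mulOp (g * h) :=
  LinearMap.ext fun f => (mul_assoc g h f).symm

lemma extOp_trans (σ τ : Laurent n ≃ₐ[ℂ] Laurent n) :
    extOp (σ.trans τ) = extOp τ * extOp σ :=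
  LinearMap.ext fun f => ext_trans σ τ f

lemma extOp_refl : extOp (AlgEquiv.refl : Laurent n ≃ₐ[ℂ] Laurent n) = 1 :=
  LinearMap.ext fun f => ext_refl f

lemma mulOp_one : mulOp (1 : RatFn n) = 1 := LinearMap.ext fun f => one_mul f

lemma shiftAct_add (q : ℂˣ) (μ ν : Wt n) :
    shiftAct q (μ + ν) = (shiftAct q ν).trans (shiftAct q μ) :=
  laurent_aut_ext fun a => by
    rw [AlgEquiv.trans_apply, shiftAct_mono, shiftAct_mono, map_smul, shiftAct_mono, smul_smul,
      ← Units.val_mul, ← zpow_add, add_dotProduct, add_comm]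

lemma shiftAct_zero (q : ℂˣ) : shiftAct q (0 : Wt n) = AlgEquiv.refl :=
  laurent_aut_ext fun a => by
    rw [shiftAct_mono, zero_dotProduct, zpow_zero, Units.val_one, one_smul]; rfl

lemma weylAct_shiftAct {w : Wt n ≃ₗ[ℤ] Wt n} (hw : w ∈ weylGroup n) (q : ℂˣ) (ν : Wt n) :
    (shiftAct q ν).trans (weylAct w) = (weylAct w).trans (shiftAct q (w ν)) :=
  laurent_aut_ext fun a => by
    rw [AlgEquiv.trans_apply, AlgEquiv.trans_apply, shiftAct_mono, map_smul, weylAct_mono,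
      shiftAct_mono, dot_weyl hw]

/-- The operators `g(x) τ(ν) w`. -/
def basicOps (n : ℕ) (q : ℂˣ) : Set (Op n) :=
  {A | ∃ (g : RatFn n) (ν : Wt n) (w : weylGroup n),
    A = mulOp g * extOp (shiftAct q ν) * extOp (weylAct (w : Wt n ≃ₗ[ℤ] Wt n))}

/-- Reflections and translations can be moved to the right past multiplication operators, and W
normalizes the translations; hence g(x) τ(ν) w is a normal form closed under products. -/
lemma mul_mem_basicOps {q : ℂˣ} {A B : Op n} (hA : A ∈ basicOps n q) (hB : B ∈ basicOps n q) :
    A * B ∈ basicOps n q := by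
  obtain ⟨g, ν, w, rfl⟩ := hA
  obtain ⟨g', ν', w', rfl⟩ := hB
  refine ⟨g * ext (shiftAct q ν) (ext (weylAct (w : Wt n ≃ₗ[ℤ] Wt n)) g'),
    ν + (w : Wt n ≃ₗ[ℤ] Wt n) ν', w * w', ?_⟩
  have h1 := extOp_mul_mulOp (weylAct (w : Wt n ≃ₗ[ℤ] Wt n)) g'
  have h2 := extOp_mul_mulOp (shiftAct q ν) (ext (weylAct (w : Wt n ≃ₗ[ℤ] Wt n)) g')
  have h3 := congrArg extOp (weylAct_shiftAct w.2 q ν')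
  rw [extOp_trans, extOp_trans] at h3
  rw [Subgroup.coe_mul, weylAct_mul, extOp_trans, shiftAct_add, extOp_trans, ← mulOp_mul]
  set W := extOp (weylAct (w : Wt n ≃ₗ[ℤ] Wt n))
  set W' := extOp (weylAct (w' : Wt n ≃ₗ[ℤ] Wt n))
  set S := extOp (shiftAct q ν)
  set S' := extOp (shiftAct q ν')
  calc mulOp g * S * W * (mulOp g' * S' * W')
      = mulOp g * S * (W * mulOp g') * S' * W' := by simp only [mul_assoc]
    _ = mulOp g * (S * mulOp (ext (weylAct (w : Wt n ≃ₗ[ℤ] Wt n)) g')) * (W * S') * W' := by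
        rw [h1]; simp only [mul_assoc]
    _ = _ := by rw [h2, h3]; simp only [mul_assoc]

lemma one_mem_basicOps (n : ℕ) (q : ℂˣ) : (1 : Op n) ∈ basicOps n q :=
  ⟨1, 0, 1, by rw [mulOp_one, shiftAct_zero, Subgroup.coe_one, weylAct_one, extOp_refl]; rfl⟩

/-- The algebra of difference-reflection operators. -/
def opAlgebra (n : ℕ) (q : ℂˣ) : Subalgebra ℂ (Op n) :=
  (Submodule.span ℂ (basicOps n q)).toSubalgebra (Submodule.subset_span (one_mem_basicOps n q))
    fun x y hx hy => by
      have h := Submodule.mul_mem_mul hx hy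
      rw [Submodule.span_mul_span] at h
      refine Submodule.span_mono ?_ h
      rintro _ ⟨a, ha, b, hb, rfl⟩
      exact mul_mem_basicOps ha hb

lemma mem_opAlgebra {q : ℂˣ} {A : Op n} :
    A ∈ opAlgebra n q ↔ A ∈ Submodule.span ℂ (basicOps n q) := Iff.rfl

lemma mulOp_mem (q : ℂˣ) (g : RatFn n) : mulOp g ∈ opAlgebra n q :=
  Submodule.subset_span ⟨g, 0, 1, by
    rw [shiftAct_zero, Subgroup.coe_one, weylAct_one, extOp_refl]; rfl⟩

lemma extOp_weyl_mem (q : ℂˣ) {w : Wt n ≃ₗ[ℤ] Wt n} (hw : w ∈ weylGroup n) :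
    extOp (weylAct w) ∈ opAlgebra n q :=
  Submodule.subset_span ⟨1, 0, ⟨w, hw⟩, by
    rw [shiftAct_zero, extOp_refl, mulOp_one, one_mul, one_mul]⟩

lemma extOp_shift_mem (q : ℂˣ) (ν : Wt n) : extOp (shiftAct q ν) ∈ opAlgebra n q :=
  Submodule.subset_span ⟨1, ν, 1, by
    rw [Subgroup.coe_one, weylAct_one, extOp_refl, mulOp_one]; rfl⟩

lemma T_mem (i : Fin n) : T p i ∈ opAlgebra n p.q :=
  add_mem (Subalgebra.smul_mem _ (one_mem _) _) (Subalgebra.smul_mem _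
    (mul_mem (mulOp_mem _ _) (sub_mem (extOp_weyl_mem _ (simpleRefl_mem i)) (one_mem _))) _)

lemma T0_mem (hn : 0 < n) : T0 n p ∈ opAlgebra n p.q := by
  have h : extOp (affineReflAct (n := n) p.q) ∈ opAlgebra n p.q := by
    rw [affineReflAct, extOp_trans]
    exact mul_mem (extOp_weyl_mem _ (signFlip_zero_mem hn)) (extOp_shift_mem _ _)
  exact add_mem (Subalgebra.smul_mem _ (one_mem _) _) (Subalgebra.smul_mem _
    (mul_mem (mulOp_mem _ _) (sub_mem h (one_mem _))) _)

/-- The units of the algebra of difference-reflection operators. -/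
def opUnits (n : ℕ) (q : ℂˣ) : Subgroup (Op n)ˣ := (opAlgebra n q).toSubmonoid.units

lemma mem_opUnits {q : ℂˣ} {u : (Op n)ˣ} :
    u ∈ opUnits n q ↔ (u : Op n) ∈ opAlgebra n q ∧ ((u⁻¹ : (Op n)ˣ) : Op n) ∈ opAlgebra n q :=
  Submonoid.mem_units_iff _ _

lemma TU_mem (i : Fin n) : TU p i ∈ opUnits n p.q :=
  mem_opUnits.mpr ⟨T_mem i, sub_mem (T_mem i) (Subalgebra.smul_mem _ (one_mem _) _)⟩

lemma T0U_mem (hn : 0 < n) : T0U hn p ∈ opUnits n p.q :=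
  mem_opUnits.mpr ⟨T0_mem hn, sub_mem (T0_mem hn) (Subalgebra.smul_mem _ (one_mem _) _)⟩

lemma yElt_mem {G : Type*} [Group G] {H : Subgroup G} {n : ℕ} {T : ℕ → G} {A : G}
    (hT : ∀ k, T k ∈ H) (hA : A ∈ H) (i : ℕ) : yElt n T A i ∈ H := by
  have h : ∀ d, palin n T d ∈ H := fun d => by
    induction d with
    | zero => exact hT _
    | succ d ih => exact mul_mem (mul_mem (hT _) ih) (hT _)
  induction i with
  | zero => exact mul_mem (h _) hA
  | succ i ih => exact mul_mem (mul_mem (inv_mem (hT _)) ih) (inv_mem (hT _))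

lemma YU_mem (hn : 2 ≤ n) (i : Fin n) : YU hn p i ∈ opUnits n p.q := by
  refine yElt_mem (fun k => ?_) (T0U_mem _) _
  unfold natExt
  split_ifs
  · exact TU_mem _
  · exact one_mem _

/-- Membership in the algebra of difference-reflection operators is what makes f(Y)_sym exist. The
inverses cause no trouble, as the generators and their inverses both lie in the algebra. -/
lemma evalY_mem (hn : 2 ≤ n) (f : Laurent n) : evalY p f ∈ opAlgebra n p.q := by
  refine sum_mem fun l _ => Subalgebra.smul_mem _ (list_prod_mem fun A hA => ?_) _
  obtain ⟨i, -, rfl⟩ := List.mem_map.mp hA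
  have h := mem_opUnits.mp (YU_mem (p := p) hn i)
  have h1 : Ring.inverse (Y p i) = ((YU hn p i)⁻¹ : (Op n)ˣ) := by
    rw [← YU_val hn, Ring.inverse_unit]
  rw [YU_val] at h
  unfold opZPow
  split_ifs
  · exact pow_mem h.1 _
  · rw [h1]; exact pow_mem h.2 _

/-! ### The operators `D_sym` -/

lemma IsSymOf.add {D D' E E' : Op n} (h : IsSymOf p D E) (h' : IsSymOf p D' E') :
    IsSymOf p (D + D') (E + E') := by
  classical
  obtain ⟨d, h1, rfl, rfl⟩ := h
  obtain ⟨d', h1', rfl, rfl⟩ := h'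
  refine ⟨d + d', fun w => add_mem (h1 w) (h1' w), ?_, ?_⟩
  · rw [Finsupp.sum_add_index' (fun w => zero_mul _) (fun w A B => add_mul _ _ _)]
  · rw [Finsupp.sum_add_index' (fun w => rfl) (fun w A B => rfl)]

lemma IsSymOf.smul {D E : Op n} (h : IsSymOf p D E) (c : ℂ) : IsSymOf p (c • D) (c • E) := by
  obtain ⟨d, h1, rfl, rfl⟩ := h
  refine ⟨c • d, fun w => Submodule.smul_mem _ c (h1 w), ?_, ?_⟩
  · rw [Finsupp.sum_smul_index' (fun w => zero_mul _), Finsupp.smul_sum]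
    exact Finsupp.sum_congr fun w _ => (smul_mul_assoc _ _ _).symm
  · rw [Finsupp.sum_smul_index' (fun w => rfl), Finsupp.smul_sum]

lemma exists_isSymOf {D : Op n} (hD : D ∈ opAlgebra n p.q) : ∃ E, IsSymOf p D E := by
  rw [mem_opAlgebra] at hD
  induction hD using Submodule.span_induction with
  | mem A hA =>
    obtain ⟨g, ν, w, rfl⟩ := hA
    refine ⟨mulOp g * extOp (shiftAct p.q ν),
      Finsupp.single w (mulOp g * extOp (shiftAct p.q ν)), fun w' => ?_, ?_, ?_⟩
    · classical
      rw [Finsupp.single_apply]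
      split_ifs
      · exact Submodule.subset_span ⟨g, ν, rfl⟩
      · exact zero_mem _
    · rw [Finsupp.sum_single_index (zero_mul _)]
    · rw [Finsupp.sum_single_index rfl]
  | zero => exact ⟨0, 0, fun w => zero_mem _, by simp, by simp⟩
  | add A B _ _ hA hB =>
    obtain ⟨E, hE⟩ := hA
    obtain ⟨E', hE'⟩ := hB
    exact ⟨_, hE.add hE'⟩
  | smul c A _ hA =>
    obtain ⟨E, hE⟩ := hA
    exact ⟨_, hE.smul c⟩

/-- Elements of W act trivially on f. Thus every admissible choice of D_sym acts on invariants as D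
does, and uniqueness of the decomposition of D is not needed. -/
lemma IsSymOf.apply_eq {D E : Op n} (h : IsSymOf p D E) {f : Laurent n} (hf : f ∈ invariants n) :
    E (toRat f) = D (toRat f) := by
  obtain ⟨d, -, rfl, rfl⟩ := h
  rw [Finsupp.sum, Finsupp.sum, LinearMap.sum_apply, LinearMap.sum_apply]
  refine Finset.sum_congr rfl fun w _ => ?_
  rw [Module.End.mul_apply, extOp_apply, ext_toRat, hf w w.2]

end
end Koornwinder

namespace Koornwinder
noncomputable section
open scoped Matrix
variable {n : ℕ} {p : Params}

/-! ### Invariant Laurent polynomials -/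

lemma mem_invariants_iff {f : Laurent n} :
    f ∈ invariants n ↔ ∀ i, weylAct (simpleRefl i) f = f := by
  refine ⟨fun h i => h _ (simpleRefl_mem i), fun h w hw => ?_⟩
  induction hw using Subgroup.closure_induction with
  | mem w hw => obtain ⟨i, rfl⟩ := hw; exact h i
  | one => rw [weylAct_one]; rfl
  | mul x y _ _ hx hy => rw [weylAct_mul, AlgEquiv.trans_apply, hy, hx]
  | inv x _ hx =>
    conv_lhs => rw [← hx]
    rw [← AlgEquiv.trans_apply, ← weylAct_mul, inv_mul_cancel, weylAct_one]
    rfl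

/-- Since v and its reflection add up to 1 + t_i², the vanishing of v would force t_i² = -1. -/
lemma vS_ne_zero (hp : p.Generic n) (i : Fin n) : vS p i ≠ 0 := fun h => by
  have h1 := vS_reflect (p := p) i
  rw [h, map_zero, sub_zero] at h1
  have h2 : (1 : ℂ) + (p.tSimple i : ℂ) ^ 2 = 0 := by
    refine (algebraMap ℂ (RatFn n)).injective ?_
    rw [map_add, map_one, map_pow, map_zero]
    exact h1.symm
  have h3 : (p.tSimple i) ^ 2 = -1 :=
    Units.ext (by simpa using eq_neg_of_add_eq_zero_right h2)
  by_cases hi : (i : ℕ) + 1 < n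
  · rw [tSimple_of_lt hi] at h3; exact hp.t_sq_ne h3
  · rw [tSimple_of_last hi] at h3; exact hp.tn_sq_ne h3

lemma signVal_one (i : Fin n) : signVal p 1 i = p.tSimple i := by simp [signVal]

/-- The difference T_i f - t_i f equals t_i⁻¹ v (s_i f - f), and neither prefactor vanishes. This
identifies the plus eigenspaces with invariants. -/
lemma mem_invariants_iff_TL (hp : p.Generic n) {f : Laurent n} :
    f ∈ invariants n ↔ ∀ i, TL p i f = signVal p 1 i • f := by
  refine mem_invariants_iff.trans (forall_congr' fun i => ?_)
  rw [← toRat_injective.eq_iff, ← toRat_injective.eq_iff (a := TL p i f), ← lifts_T, T_apply, dl,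
    map_smul, signVal_one, ← cst_mul_eq_smul, add_eq_left, mul_eq_zero, mul_eq_zero, sub_eq_zero,
    sR_apply, ext_toRat]
  simp [vS_ne_zero hp, cst_unit_ne_zero]

lemma coeff_weylAct (w : Wt n ≃ₗ[ℤ] Wt n) (f : Laurent n) (l : Wt n) :
    (weylAct w f).coeff (w l) = f.coeff l := by
  induction f using laurent_induction with
  | mono m => rw [weylAct_mono, coeff_mono, coeff_mono, if_congr w.injective.eq_iff rfl rfl]
  | add f g hf hg =>
    rw [map_add, AddMonoidAlgebra.coeff_add, AddMonoidAlgebra.coeff_add, Finsupp.add_apply,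
      Finsupp.add_apply, hf, hg]
  | smul c f hf =>
    rw [map_smul, AddMonoidAlgebra.coeff_smul, AddMonoidAlgebra.coeff_smul, Finsupp.smul_apply,
      Finsupp.smul_apply, hf]

lemma coeff_eq_of_mem_orbit {f : Laurent n} (hf : f ∈ invariants n) {l m : Wt n}
    (h : m ∈ weylOrbit l) : f.coeff m = f.coeff l := by
  obtain ⟨w, hw, rfl⟩ := mem_weylOrbit.mp h
  conv_lhs => rw [← hf w hw]
  exact coeff_weylAct w f l

lemma coeff_orbitSum (l m : Wt n) : (orbitSum l).coeff m = if m ∈ weylOrbit l then 1 else 0 := by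
  classical
  rw [orbitSum, AddMonoidAlgebra.coeff_sum, Finsupp.finsetSum_apply]
  simp [coeff_mono]

lemma orbitSum_mem (l : Wt n) : orbitSum l ∈ invariants n := by
  classical
  refine mem_invariants_iff.mpr fun i => ?_
  rw [orbitSum, map_sum]
  refine Finset.sum_nbij' (simpleRefl i) (simpleRefl i)
    (fun m hm => simpleRefl_mem_weylOrbit.mpr hm) (fun m hm => simpleRefl_mem_weylOrbit.mpr hm)
    (fun m _ => simpleRefl_simpleRefl i m) (fun m _ => simpleRefl_simpleRefl i m)
    fun m _ => weylAct_mono _ m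

lemma mem_weylOrbit_iff_of_dominant {l m : Wt n} (hl : IsDominant l) :
    m ∈ weylOrbit l ↔ l = domPart m :=
  ⟨fun h => eq_domPart hl (mem_weylOrbit_symm h), fun h => h ▸ mem_weylOrbit_symm (domPart_mem m)⟩

lemma mem_span_orbitSum {f : Laurent n} (hf : f ∈ invariants n) :
    f ∈ Submodule.span ℂ (orbitSum '' {m : Wt n | IsDominant m ∧ f.coeff m ≠ 0}) := by
  classical
  have h : f = ∑ m ∈ f.coeff.support.filter IsDominant, f.coeff m • orbitSum m := by
    refine AddMonoidAlgebra.ext (Finsupp.ext fun k => ?_)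
    rw [AddMonoidAlgebra.coeff_sum, Finsupp.finsetSum_apply]
    simp only [AddMonoidAlgebra.coeff_smul, Finsupp.smul_apply, coeff_orbitSum, smul_eq_mul,
      mul_ite, mul_one, mul_zero]
    rw [Finset.sum_congr rfl fun m hm => if_congr
      (mem_weylOrbit_iff_of_dominant (Finset.mem_filter.mp hm).2) rfl rfl, Finset.sum_ite_eq']
    have h1 : f.coeff (domPart k) = f.coeff k := coeff_eq_of_mem_orbit hf (domPart_mem k)
    split_ifs with h2
    · exact h1.symm
    · rw [← h1]
      by_contra h3
      exact h2 (Finset.mem_filter.mpr ⟨Finsupp.mem_support_iff.mpr h3, domPart_dominant k⟩)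
  rw [h]
  refine sum_mem fun m hm => Submodule.smul_mem _ _ (Submodule.subset_span ?_)
  obtain ⟨h1, h2⟩ := Finset.mem_filter.mp hm
  rw [← h]
  exact ⟨m, ⟨h2, Finsupp.mem_support_iff.mp h1⟩, rfl⟩

/-! ### Evaluation -/

/-- Evaluation at `y` as a homomorphism of algebras. -/
def evalHom (y : Fin n → ℂˣ) : Laurent n →ₐ[ℂ] ℂ :=
  AddMonoidAlgebra.lift ℂ ℂ (Wt n)
    { toFun := fun m => monoVal y m.toAdd
      map_one' := by simp [monoVal]
      map_mul' := fun a b => by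
        simp [monoVal, zpow_add, Finset.prod_mul_distrib] }

lemma evalAt_eq (y : Fin n → ℂˣ) (f : Laurent n) : evalAt y f = evalHom y f := by
  rw [evalHom, AddMonoidAlgebra.lift_apply]
  rfl

lemma evalHom_mono (y : Fin n → ℂˣ) (m : Wt n) : evalHom y (mono m) = monoVal y m := by
  rw [← evalAt_eq, evalAt_mono]

lemma evalHom_gam_simpleRefl {i : Fin n} {m : Wt n} (h : 0 < m ⬝ᵥ simpleRoot i) (f : Laurent n) :
    evalHom (gam p (simpleRefl i m)) (weylAct (simpleRefl i) f) = evalHom (gam p m) f := by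
  induction f using laurent_induction with
  | mono k =>
    rw [weylAct_mono, evalHom_mono, evalHom_mono, monoVal_gam, monoVal_gam, gamU_simpleRefl h.ne',
      simpleRefl_simpleRefl]
  | add f g hf hg => rw [map_add, map_add, map_add, hf, hg]
  | smul c f hf => rw [map_smul, map_smul, map_smul, hf]

/-- Ascending from the dominant weight, each step replaces γ_m by s_i γ_m, which an invariant does
not notice. So f(Y) acts on the orbit space of a dominant weight by a scalar. -/
lemma evalAt_gam_orbit {f : Laurent n} (hf : f ∈ invariants n) (m : Wt n) :
    evalAt (gam p m) f = evalAt (gam p (domPart m)) f := by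
  induction m using weight_induction with
  | dom l hl => rw [domPart_of_dominant hl]
  | step m i h ih =>
    rw [domPart_weyl (simpleRefl_mem i), ← ih, evalAt_eq, evalAt_eq, ← evalHom_gam_simpleRefl h,
      hf _ (simpleRefl_mem i)]

/-- The invariant `∏ (z - x_i - x_i⁻¹)`. -/
def sepPoly (n : ℕ) (z : ℂ) : Laurent n :=
  ∏ i : Fin n, (algebraMap ℂ (Laurent n) z - (mono (e (i : ℕ)) + mono (-e (i : ℕ))))

lemma sepPoly_mem (z : ℂ) : sepPoly n z ∈ invariants n := by
  refine mem_invariants_iff.mpr fun i => ?_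
  rw [sepPoly, map_prod]
  simp only [map_sub, map_add, weylAct_mono, AlgEquiv.commutes, map_neg]
  by_cases hi : (i : ℕ) + 1 < n
  · simp only [simpleRefl_e_of_lt hi]
    exact Equiv.prod_comp (Equiv.swap i ⟨i + 1, hi⟩)
      fun j : Fin n => algebraMap ℂ (Laurent n) z - (mono (e (j : ℕ)) + mono (-e (j : ℕ)))
  · refine Finset.prod_congr rfl fun j _ => ?_
    rw [simpleRefl_e_of_last hi]
    split_ifs
    · rw [neg_neg, add_comm]
    · rfl

lemma evalAt_sepPoly (y : Fin n → ℂˣ) (z : ℂ) :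
    evalAt y (sepPoly n z) = ∏ i, (z - ((y i : ℂ) + (y i : ℂ)⁻¹)) := by
  rw [evalAt_eq, sepPoly, map_prod]
  refine Finset.prod_congr rfl fun i _ => ?_
  have h : monoVal y (-e (i : ℕ)) = (y i : ℂ)⁻¹ := by
    rw [← monoVal_e y i, monoVal, monoVal]
    simp
  rw [map_sub, map_add, evalHom_mono, evalHom_mono, monoVal_e, h, AlgHom.commutes]
  rfl

/-- The invariant ∏ (z - x_j - x_j⁻¹) with z = y + y⁻¹, where y is a coordinate of γ_m, vanishes at
γ_m, hence at γ_l. So y or y⁻¹ is a coordinate of γ_l; doing this for every coordinate of γ_m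
identifies the orbits. -/
lemma domPart_eq_of_evalAt (hp : p.Generic n) {l m : Wt n}
    (h : ∀ f ∈ invariants n, evalAt (gam p m) f = evalAt (gam p l) f) :
    domPart m = domPart l := by
  refine domPart_eq_of_gam hp fun i => ?_
  have h1 := h _ (sepPoly_mem ((gam p m i : ℂ) + (gam p m i : ℂ)⁻¹))
  rw [evalAt_sepPoly, evalAt_sepPoly, Finset.prod_eq_zero (Finset.mem_univ i) (sub_self _), eq_comm,
    Finset.prod_eq_zero_iff] at h1
  obtain ⟨j, -, hj⟩ := h1
  refine ⟨j, ?_⟩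
  have hx : (gam p m i : ℂ) ≠ 0 := Units.ne_zero _
  have hy : (gam p l j : ℂ) ≠ 0 := Units.ne_zero _
  rw [Units.ext_iff, Units.ext_iff, Units.val_inv_eq_inv_val]
  have h2 : ((gam p l j : ℂ) - gam p m i) * ((gam p l j : ℂ) * gam p m i - 1) = 0 := by
    field_simp at hj
    linear_combination -hj
  rcases mul_eq_zero.mp h2 with h3 | h3
  · exact Or.inl (sub_eq_zero.mp h3)
  · exact Or.inr (eq_inv_of_mul_eq_one_left (sub_eq_zero.mp h3))

/-! ### Symmetric Koornwinder polynomials -/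

section Generic

variable (hn : 2 ≤ n) (hp : p.Generic n)
include hn hp

lemma exists_evalY_repr (f q : Laurent n) : ∃ q', evalY p f (toRat q) = toRat q' ∧
    ∀ m, (nonsymK_spec hn hp).basis.repr q' m =
      evalAt (gam p m) f * (nonsymK_spec hn hp).basis.repr q m := by
  classical
  have hq : q ∈ Submodule.span ℂ (Set.range (nonsymK p)) := by
    rw [(nonsymK_spec hn hp).span_eq_top]; trivial
  induction hq using Submodule.span_induction with
  | mem q hq =>
    obtain ⟨l, rfl⟩ := hq
    refine ⟨evalAt (gam p l) f • nonsymK p l, ?_, fun m => ?_⟩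
    · rw [(nonsymK_spec hn hp).eigen, map_smul]
    · rw [map_smul, (nonsymK_spec hn hp).repr_self, Finsupp.smul_apply, Finsupp.single_apply,
        smul_eq_mul]
      split_ifs with h
      · rw [h]
      · rw [mul_zero, mul_zero]
  | zero => exact ⟨0, by simp, by simp⟩
  | add q r _ _ hq hr =>
    obtain ⟨q', h1, h2⟩ := hq
    obtain ⟨r', h3, h4⟩ := hr
    refine ⟨q' + r', by rw [map_add, map_add, map_add, h1, h3], fun m => ?_⟩
    rw [map_add, map_add, Finsupp.add_apply, Finsupp.add_apply, h2, h4, mul_add]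
  | smul c q _ hq =>
    obtain ⟨q', h1, h2⟩ := hq
    refine ⟨c • q', by rw [map_smul, map_smul, map_smul, h1], fun m => ?_⟩
    rw [map_smul, map_smul, Finsupp.smul_apply, Finsupp.smul_apply, h2, smul_eq_mul, smul_eq_mul]
    ring

lemma signPoly_mem_invariants (l : Wt n) : signPoly p 1 l ∈ invariants n := by
  have h : signPoly p 1 l ∈ signPart p 1 l :=
    signPoly_mem hn hp fun h => absurd h (by decide)
  exact (mem_invariants_iff_TL hp).mpr (mem_signPart_iff.mp h).2

lemma repr_of_invariant {f : Laurent n} (hf : f ∈ invariants n) (m : Wt n) :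
    (nonsymK_spec hn hp).basis.repr f m =
      (nonsymK_spec hn hp).basis.repr f (domPart m) * expCoeff p 1 m := by
  rw [mem_invariants_iff_TL hp] at hf
  induction m using weight_induction with
  | dom l hl => rw [domPart_of_dominant hl, expCoeff_of_dominant hl, mul_one]
  | step m i h ih =>
    rw [(((nonsymK_spec hn hp).TL_eq_signVal_iff hn hp 1 i f).mp (hf i)).1 m h,
      expCoeff_simpleRefl h, ih, domPart_weyl (simpleRefl_mem i)]
    ring

lemma repr_signPoly_dominant {l m : Wt n} (hl : IsDominant l) (hm : IsDominant m) :
    (nonsymK_spec hn hp).basis.repr (signPoly p 1 l) m = if l = m then 1 else 0 := by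
  rw [repr_signPoly hn hp, if_congr (mem_weylOrbit_iff_of_dominant hl) rfl rfl,
    domPart_of_dominant hm, expCoeff_of_dominant hm]

/-- An invariant is determined by its coefficients at the dominant P_m, since the recursion
propagates them through each orbit; it is therefore the corresponding combination of the symmetric
sums. -/
lemma span_signPoly :
    Submodule.span ℂ (Set.range fun l : DomWt n => signPoly p 1 l.1) = invariants n := by
  classical
  refine le_antisymm (Submodule.span_le.mpr ?_) fun f hf => ?_
  · rintro _ ⟨l, rfl⟩
    exact signPoly_mem_invariants hn hp _
  · set F := (nonsymK_spec hn hp).basis.repr f with hF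
    have h : f = ∑ m ∈ F.support.filter IsDominant, F m • signPoly p 1 m := by
      refine (nonsymK_spec hn hp).basis.repr.injective (Finsupp.ext fun k => ?_)
      rw [map_sum, Finsupp.finsetSum_apply]
      simp only [map_smul, Finsupp.smul_apply, repr_signPoly hn hp, smul_eq_mul, mul_ite, mul_zero]
      rw [Finset.sum_congr rfl fun m hm => if_congr
        (mem_weylOrbit_iff_of_dominant (Finset.mem_filter.mp hm).2) rfl rfl, Finset.sum_ite_eq']
      rw [repr_of_invariant hn hp hf k, ← hF]
      split_ifs with h2
      · rfl
      · rw [mul_eq_zero]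
        left
        by_contra h3
        exact h2 (Finset.mem_filter.mpr ⟨Finsupp.mem_support_iff.mpr h3, domPart_dominant k⟩)
    rw [h]
    exact sum_mem fun m hm => Submodule.smul_mem _ _
      (Submodule.subset_span ⟨⟨m, (Finset.mem_filter.mp hm).2⟩, rfl⟩)

lemma isSymKoornwinder_signPoly :
    IsSymKoornwinder p fun l : DomWt n => signPoly p 1 l.1 where
  linearIndependent := by
    classical
    refine linearIndependent_iff'.mpr fun S g hg l hl => ?_
    have h := congrArg (fun f => (nonsymK_spec hn hp).basis.repr f l.1) hg
    simp only [map_sum, map_smul, Finsupp.finsetSum_apply, Finsupp.smul_apply, map_zero,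
      Finsupp.coe_zero, Pi.zero_apply] at h
    rw [Finset.sum_eq_single_of_mem l hl fun m _ hm => by
      rw [repr_signPoly_dominant hn hp m.2 l.2, if_neg fun h => hm (Subtype.ext h), smul_zero],
      repr_signPoly_dominant hn hp l.2 l.2, if_pos rfl, smul_eq_mul, mul_one] at h
    exact h
  span_eq := span_signPoly hn hp
  triangular l := by
    have hm := signPoly_monic (ε := 1) hn hp l.2
    have h1 := mem_span_orbitSum (sub_mem (signPoly_mem_invariants hn hp l.1) (orbitSum_mem l.1))
    refine Submodule.span_mono (Set.image_mono ?_) h1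
    rintro m ⟨hd, h3⟩
    refine ⟨hd, ?_⟩
    rw [AddMonoidAlgebra.coeff_sub, Finsupp.sub_apply, coeff_orbitSum,
      if_congr (mem_weylOrbit_iff_of_dominant l.2) rfl rfl, domPart_of_dominant hd] at h3
    have hne : m ≠ l.1 := by
      rintro rfl
      rw [if_pos rfl, coeff_self_of_monic hm, sub_self] at h3
      exact h3 rfl
    rw [if_neg hne.symm, sub_zero] at h3
    have h4 : PrecLT m l.1 := by
      by_contra hc
      rw [coeff_of_monic hm hc, if_neg hne] at h3
      exact h3 rfl
    have h5 := PrecLT.domPart_le h4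
    rw [domPart_of_dominant hd, domPart_of_dominant l.2] at h5
    exact ⟨h5, hne⟩
  eigen l f hf := by
    obtain ⟨E, hE⟩ := exists_isSymOf (p := p) (evalY_mem hn f)
    refine ⟨E, hE, ?_⟩
    rw [hE.apply_eq (signPoly_mem_invariants hn hp l.1), signPoly, map_sum, map_sum,
      Finset.smul_sum]
    refine Finset.sum_congr rfl fun m hm => ?_
    rw [map_smul, map_smul, (nonsymK_spec hn hp).eigen, smul_comm, evalAt_gam_orbit hf,
      ← (mem_weylOrbit_iff_of_dominant l.2).mp hm]

/-- The eigenvalues of the invariants in Y separate orbits, which confines Q_l to the orbit space of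
l. As an invariant it then lies in the line of symmetric combinations, and its coefficient 1 at x^l
fixes the multiple. -/
lemma IsSymKoornwinder.eq_signPoly {Q : DomWt n → Laurent n} (hQ : IsSymKoornwinder p Q)
    (l : DomWt n) : Q l = signPoly p 1 l.1 := by
  have hinv : Q l ∈ invariants n := by
    rw [← hQ.span_eq]; exact Submodule.subset_span (Set.mem_range_self l)
  refine Koornwinder.eq_signPoly hn hp l.2 (mem_signPart_iff.mpr
    ⟨(mem_orbitSpace_iff hn hp).mpr fun m hm => ?_, (mem_invariants_iff_TL hp).mp hinv⟩) ?_
  · by_contra h0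
    refine hm ((mem_weylOrbit_iff_of_dominant l.2).mpr ?_)
    rw [← domPart_of_dominant l.2]
    refine (domPart_eq_of_evalAt hp fun f hf => ?_).symm
    obtain ⟨E, hE, h1⟩ := hQ.eigen l f hf
    obtain ⟨q', h2, h3⟩ := exists_evalY_repr hn hp f (Q l)
    rw [hE.apply_eq hinv, h2, ← map_smul, toRat_injective.eq_iff] at h1
    have h4 := h3 m
    rw [h1, map_smul, Finsupp.smul_apply, smul_eq_mul] at h4
    exact (mul_right_cancel₀ h0 h4).symm
  · have h1 : ∀ g ∈ Submodule.span ℂ (orbitSum '' {m : Wt n | IsDominant m ∧ DomLT m l.1}),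
        g.coeff l.1 = 0 := fun g hg => by
      induction hg using Submodule.span_induction with
      | mem g hg =>
        obtain ⟨m, ⟨h1, h2⟩, rfl⟩ := hg
        rw [coeff_orbitSum, if_neg]
        rw [mem_weylOrbit_iff_of_dominant h1, domPart_of_dominant l.2]
        exact h2.2
      | zero => rfl
      | add f g _ _ hf hg =>
        rw [AddMonoidAlgebra.coeff_add, Finsupp.add_apply, hf, hg, add_zero]
      | smul c f _ hf =>
        rw [AddMonoidAlgebra.coeff_smul, Finsupp.smul_apply, hf, smul_zero]
    have h2 := h1 _ (hQ.triangular l)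
    rw [AddMonoidAlgebra.coeff_sub, Finsupp.sub_apply, coeff_orbitSum,
      if_pos (mem_weylOrbit_self _), sub_eq_zero] at h2
    exact h2

lemma symK_eq (l : DomWt n) : symK p l = signPoly p 1 l.1 :=
  IsSymKoornwinder.eq_signPoly hn hp
    (Classical.epsilon_spec (p := IsSymKoornwinder p) ⟨_, isSymKoornwinder_signPoly hn hp⟩) l

end Generic

end
end Koornwinder

open Koornwinder

theorem mainTheorem6 (n : ℕ) (hn : 2 ≤ n) (p : Params) (hp : p.Generic n) :
    (∃! P : Wt n → Laurent n, IsNonsymKoornwinder p P) ∧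
    (∃! Q : DomWt n → Laurent n, IsSymKoornwinder p Q) ∧
    ∀ l : DomWt n,
      signPart p 1 l.1 = Submodule.span ℂ {symK p l} ∧
      (IsRegularDominant l.1 → Module.finrank ℂ (signPart p (-1) l.1) = 1) ∧
      (¬ IsRegularDominant l.1 → signPart p (-1) l.1 = ⊥) ∧
      HasExpansion p 1 l.1 (symK p l) ∧
      (IsRegularDominant l.1 →
        ∃ R : Laurent n,
          (R ∈ signPart p (-1) l.1 ∧ IsMonicTriangular l.1 R) ∧
          (∀ R' : Laurent n,
            R' ∈ signPart p (-1) l.1 → IsMonicTriangular l.1 R' → R' = R) ∧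
          HasExpansion p (-1) l.1 R) := by
  refine ⟨existsUnique_nonsym hn hp, ⟨_, isSymKoornwinder_signPoly hn hp, fun Q hQ =>
    funext fun l => IsSymKoornwinder.eq_signPoly hn hp hQ l⟩, fun l => ?_⟩
  rw [symK_eq hn hp]
  refine ⟨signPart_eq_span hn hp l.2 fun h => absurd h (by decide), fun h => ?_,
    signPart_neg_eq_bot hn hp l.2, hasExpansion_signPoly l.2 1, fun h =>
    ⟨signPoly p (-1) l.1, ⟨signPoly_mem hn hp fun _ m hm => dot_ne_zero_of_regular h hm,
      signPoly_monic hn hp l.2⟩, fun R hR hm => eq_signPoly hn hp l.2 hR (coeff_self_of_monic hm),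
      hasExpansion_signPoly l.2 (-1)⟩⟩
  rw [signPart_eq_span hn hp l.2 fun _ m hm => dot_ne_zero_of_regular h hm,
    finrank_span_singleton (signPoly_ne_zero hn hp l.2)]
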